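/- \textbf{Proposition A (Normal forms).} Let $K=\{(x,y): x^2+y^2\le 1,\ y\ge 0\}$ be the closed half-disc and let $F$ be the outer billiard map about $K$: for $z\notin K$, $F(z)$ is the point such that the line through $z$ and $F(z)$ supports $K$ and touches it in exactly one point, this contact point is the midpoint of $z$ and $F(z)$, and $K$ lies on the right of the line directed from $z$ to $F(z)$ ($F$ is defined at $z$ when such a point exists; orbits are required to stay in its domain). Let $\ell_1=\{x\ge 1,\ y=0\}$, let $F^2\ell_1$ be its image under the extension of $F^2$ to $\ell_1$ from above (so the first step is the reflection in $(1,0)$), and for $x_0$ large let $\mathcal D=\mathcal D(x_0)$ be the unbounded region between $\ell_1$ and $F^2\ell_1$ to the right of $\{x=x_0\}$. Let $\mathcal F$ be the first return map of $F^2$ to $\mathcal D$. Write $P(a,b,c,d)$ for the closed parallelogram with vertices $a,b,c,d$ and set $$\mathbf R=P\Big(\big(0,\tfrac{3}{512}\big),\big(\tfrac{3}{256},-\tfrac{3}{512}\big),\big(0,-\tfrac{3}{512}\big),\big(-\tfrac{3}{256},\tfrac{3}{512}\big)\Big),\qquad \mathbf R_n=\big(3n-\tfrac34,1\big)+\mathbf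 R,$$ $$\mathcal E=P\Big(\big(\tfrac1{1024},0\big),\big(-\tfrac1{1024},\tfrac{\sqrt2}{512}\big),\big(-\tfrac1{1024},0\big),\big(\tfrac1{1024},-\tfrac{\sqrt2}{512}\big)\Big).$$ For maps $f_n$, $f_n=\mathcal O(n^{-k})$ means that the $C^5$ norm of $f_n$ (the supremum over its domain of all partial derivatives of order at most $5$) is at most $M/n^k$ with $M$ independent of $n$; $f_n=\mathcal O_4(n^{-k})$ means that, moreover, all partial derivatives of $f_n$ of order at most $4$ vanish at the origin. For every sufficiently large $x_0$ there are $N$ and, for $n\ge N$, elliptic periodic points $(x_n,y_n)$ of $F$ (the derivative of $F^q$ at the point, $q$ its period, has non-real eigenvalues of modulus $1$) with $$x_n=3n-\tfrac34+\mathcal O\big(\tfrac1n\big),\qquad y_n=1+\mathcal O\big(\tfrac1n\big),$$ such that $\mathbf R_n$ is a neighbourhood of $(x_n,y_n)$, and $C^\infty$ diffeomorphisms $C=C_n:(x,y)\mapsto(\xi,\eta)$ from an open set $U_n\supseteq\mathbf R_n$ onto an open subset of $\mathbb R^2$ such that $C(x_n,y_n)=(0,0)$, $\mathcal E\subset C(\mathbf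 R_n)$ and, on $U_n$, $$\xi=\frac y4-\frac14+\mathcal O(n^{-1}),\qquad \eta=\frac{\sqrt2\,x}4-\frac{3\sqrt2\,n}4+\frac{3\sqrt2}{16}+\mathcal O(n^{-1}).$$ Moreover, $\mathcal F$ is defined on $C^{-1}(\mathcal E)$ and maps it into $U_n$, and $C\circ\mathcal F\circ C^{-1}:\mathcal E\to\mathbb R^2$, $(\xi,\eta)\mapsto(\xi',\eta')$, has the form $$\xi'=\xi\cos w-\eta\sin w+\mathcal O_4(n^{-3}),\qquad \eta'=\xi\sin w+\eta\cos w+\mathcal O_4(n^{-3}),\qquad w=\alpha(n)+\alpha_2(n)(\xi^2+\eta^2),$$ where $$\alpha(n)=-\arccos\big(-\tfrac79\big)+\mathcal O\big(\tfrac1n\big),\qquad |\alpha_2(n)|\ge\frac c{n^2}$$ with a constant $c>0$ independent of $n$. In particular the twist coefficient $\alpha_2(n)$ is nonzero. -/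

import Mathlib

open Real Set Topology
open scoped ContDiff

/-! ### Outer billiards -/

/-- The planar cross product; `crossProd u v ≤ 0` says that `v` does not point to the left of `u`. -/
def crossProd (u v : ℝ × ℝ) : ℝ := u.1 * v.2 - u.2 * v.1

/-- `w` is the image of `z` under the outer billiard map about `K`: the line through `z` and `w`
supports `K`, it touches `K` in exactly one point, this contact point bisects the segment from `z`
to `w`, and `K` lies on the right of the line directed from `z` to `w`. -/
structure IsOuterImage (K : Set (ℝ × ℝ)) (z w : ℝ × ℝ) : Prop where
  notMem : z ∉ K
  contact : K ∩ (affineSpan ℝ {z, w} : Set (ℝ × ℝ)) = {midpoint ℝ z w}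
  right : ∀ k ∈ K, crossProd (w - z) (k - z) ≤ 0

/-- The set of points at which the outer billiard map is defined. -/
def outerDomain (K : Set (ℝ × ℝ)) : Set (ℝ × ℝ) := {z | ∃ w, IsOuterImage K z w}

/-- The image of a point is unique. -/
theorem IsOuterImage.unique {K : Set (ℝ × ℝ)} {z w w' : ℝ × ℝ}
    (h : IsOuterImage K z w) (h' : IsOuterImage K z w') : w = w' := by
  have m : midpoint ℝ z w ∈ K ∩ (affineSpan ℝ {z, w} : Set (ℝ × ℝ)) := by
    rw [h.contact]; rfl
  have m' : midpoint ℝ z w' ∈ K ∩ (affineSpan ℝ {z, w'} : Set (ℝ × ℝ)) := by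
    rw [h'.contact]; rfl
  have hne : w ≠ z := by
    rintro rfl
    exact h.notMem (by simpa using m.1)
  have e : ∀ v : ℝ × ℝ, midpoint ℝ z v = ((z.1 + v.1) / 2, (z.2 + v.2) / 2) := by
    intro v
    rw [midpoint_eq_smul_add]
    ext <;> simp <;> ring
  have a := h.right _ m'.1
  have b := h'.right _ m.1
  rw [e] at a b
  simp only [crossProd, Prod.fst_sub, Prod.snd_sub] at a b
  have hc : (w.1 - z.1) * (w'.2 - z.2) = (w.2 - z.2) * (w'.1 - z.1) := by linarith
  have hl : w' ∈ (affineSpan ℝ {z, w} : Set (ℝ × ℝ)) := by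
    by_cases h1 : w.1 - z.1 = 0
    · have h2 : w.2 - z.2 ≠ 0 := by
        intro h2
        exact hne (Prod.ext (by linarith) (by linarith))
      have h3 : w'.1 - z.1 = 0 := by
        rw [h1, zero_mul] at hc
        exact (mul_eq_zero.mp hc.symm).resolve_left h2
      have : w' = AffineMap.lineMap z w ((w'.2 - z.2) / (w.2 - z.2)) := by
        ext
        · simp [AffineMap.lineMap_apply, h1]; linarith
        · simp [AffineMap.lineMap_apply]; field_simp; ring
      rw [this]
      exact AffineMap.lineMap_mem_affineSpan_pair _ _ _
    · have : w' = AffineMap.lineMap z w ((w'.1 - z.1) / (w.1 - z.1)) := by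
        ext
        · simp [AffineMap.lineMap_apply]; field_simp; ring
        · simp [AffineMap.lineMap_apply]; field_simp; linarith
      rw [this]
      exact AffineMap.lineMap_mem_affineSpan_pair _ _ _
  have hm : midpoint ℝ z w' ∈ K ∩ (affineSpan ℝ {z, w} : Set (ℝ × ℝ)) :=
    ⟨m'.1, AffineMap.lineMap_mem (2⁻¹ : ℝ) (left_mem_affineSpan_pair ℝ z w) hl |> fun h => by
      simpa [midpoint] using h⟩
  rw [h.contact, mem_singleton_iff, e, e, Prod.mk.injEq] at hm
  exact Prod.ext (by linarith [hm.1]) (by linarith [hm.2])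

open Classical in
/-- The outer billiard map about `K`, with the placeholder value `z` where it is not defined. -/
noncomputable def outerBilliard (K : Set (ℝ × ℝ)) (z : ℝ × ℝ) : ℝ × ℝ :=
  if h : ∃ w, IsOuterImage K z w then h.choose else z

/-- The closed upper unit half-disc. -/
def semiDisc : Set (ℝ × ℝ) := {p | p.1 ^ 2 + p.2 ^ 2 ≤ 1 ∧ 0 ≤ p.2}

/-! ### Elliptic periodic points -/

/-- `z` is an elliptic periodic point of the map `T`, defined on `dom`: its orbit stays in `dom`, it
is periodic, and the derivative of `T ^ q` at `z`, with `q` the period of `z`, has its two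
eigenvalues on the unit circle and not real. -/
structure IsEllipticPeriodicPoint (dom : Set (ℝ × ℝ)) (T : ℝ × ℝ → ℝ × ℝ) (z : ℝ × ℝ) : Prop where
  regular : ∀ i : ℕ, T^[i] z ∈ dom
  periodic : z ∈ Function.periodicPts T
  differentiableAt : DifferentiableAt ℝ (T^[Function.minimalPeriod T z]) z
  elliptic : ∀ μ : ℂ,
    Polynomial.aeval μ
      (fderiv ℝ (T^[Function.minimalPeriod T z]) z : (ℝ × ℝ) →ₗ[ℝ] (ℝ × ℝ)).charpoly = 0 →
    ‖μ‖ = 1 ∧ μ.im ≠ 0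

/-! ### The first return map -/

/-- The half-line that extends the flat side of the half-disc to the right. -/
def ellOne : Set (ℝ × ℝ) := {p | 1 ≤ p.1 ∧ p.2 = 0}

/-- The image of `ellOne` under the square of the outer billiard map. On `ellOne` the first step is
the one-sided extension from the upper half-plane, that is, the point reflection in `(1, 0)`. -/
def ellOneImage : Set (ℝ × ℝ) :=
  {w | ∃ p ∈ ellOne, IsOuterImage semiDisc (2 - p.1, -p.2) w}

/-- The unbounded region between `ellOne` and `ellOneImage`, to the right of `{x = x₀}`. -/
def sectionRegion (x₀ : ℝ) : Set (ℝ × ℝ) :=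
  {p | x₀ < p.1 ∧ 0 < p.2 ∧ ∃ y, p.2 < y ∧ (p.1, y) ∈ ellOneImage}

/-- `m` is the number of steps of the squared outer billiard map after which the point `z` returns
to the section for the first time; all points of the orbit met on the way are regular. -/
structure IsFirstReturnTime (x₀ : ℝ) (z : ℝ × ℝ) (m : ℕ) : Prop where
  pos : 0 < m
  regular : ∀ i < 2 * m, (outerBilliard semiDisc)^[i] z ∈ outerDomain semiDisc
  mem : (outerBilliard semiDisc)^[2 * m] z ∈ sectionRegion x₀
  first : ∀ j, 0 < j → j < m → (outerBilliard semiDisc)^[2 * j] z ∉ sectionRegion x₀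

/-- The set of points of the section that return to it. -/
def returnDomain (x₀ : ℝ) : Set (ℝ × ℝ) :=
  {z | z ∈ sectionRegion x₀ ∧ ∃ m, IsFirstReturnTime x₀ z m}

open Classical in
/-- The first return map of the squared outer billiard map to the section, with the placeholder
value `z` where it is not defined. -/
noncomputable def firstReturn (x₀ : ℝ) (z : ℝ × ℝ) : ℝ × ℝ :=
  if h : ∃ m, IsFirstReturnTime x₀ z m then (outerBilliard semiDisc)^[2 * h.choose] z else z

/-! ### Domains, norms, normal form -/

/-- The parallelogram `𝐑`. -/
def parR : Set (ℝ × ℝ) :=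
  convexHull ℝ {(0, 3 / 512), (3 / 256, -3 / 512), (0, -3 / 512), (-3 / 256, 3 / 512)}

/-- The translate `𝐑ₙ` of `𝐑`. -/
def parRn (n : ℕ) : Set (ℝ × ℝ) := (fun z => ((3 * n - 3 / 4, 1) : ℝ × ℝ) + z) '' parR

/-- The parallelogram `𝓔`. -/
noncomputable def parE : Set (ℝ × ℝ) :=
  convexHull ℝ {(1 / 1024, 0), (-1 / 1024, √2 / 512), (-1 / 1024, 0), (1 / 1024, -√2 / 512)}

/-- `f` is of class `C⁵` on `S` and its derivatives of order at most `5` are bounded by `B` there.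
(The operator norm of the `k`-th derivative and the maximum of the partial derivatives of order `k`
differ at most by a factor that depends on `k` only.) -/
def C5BoundOn (f : ℝ × ℝ → ℝ × ℝ) (S : Set (ℝ × ℝ)) (B : ℝ) : Prop :=
  ContDiffOn ℝ 5 f S ∧ ∀ k ≤ 5, ∀ z ∈ S, ‖iteratedFDerivWithin ℝ k f S z‖ ≤ B

/-- All partial derivatives of `f`, as a map on `S`, of order at most `l` vanish at the origin. -/
def JetVanishesOn (f : ℝ × ℝ → ℝ × ℝ) (S : Set (ℝ × ℝ)) (l : ℕ) : Prop :=
  ∀ k ≤ l, iteratedFDerivWithin ℝ k f S 0 = 0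

/-- The affine part of the conjugacy. -/
noncomputable def affinePart (n : ℕ) (z : ℝ × ℝ) : ℝ × ℝ :=
  (z.2 / 4 - 1 / 4, √2 * z.1 / 4 - 3 * √2 * n / 4 + 3 * √2 / 16)

/-- The twist map: rotation of `(ξ, η)` by the angle `w = a + b (ξ² + η²)`. -/
noncomputable def twistMap (a b : ℝ) (q : ℝ × ℝ) : ℝ × ℝ :=
  (q.1 * cos (a + b * (q.1 ^ 2 + q.2 ^ 2)) - q.2 * sin (a + b * (q.1 ^ 2 + q.2 ^ 2)),
    q.1 * sin (a + b * (q.1 ^ 2 + q.2 ^ 2)) + q.2 * cos (a + b * (q.1 ^ 2 + q.2 ^ 2)))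

/-! ### The outer billiard about the half-disc -/

/-! Far from the half-disc the squared map moves points by a bounded amount. An orbit at distance
about 3n, with lengths divided by n, is therefore a slow orbit with step h = 1/n, and it can be
averaged. A revolution splits into four legs. On each of them one of the two steps of the squared
map is the reflection in a corner (1, 0) or (-1, 0), and the other is the billiard map of the whole
disc. Up to sign and a translation by (2, 0), all legs iterate one map: the disc map followed by the
reflection in (h, 0). In tangent coordinates (u, s), where u parametrises the contact point and s is
the tangent length, a step is the pair of algebraic relations `StepRel`. The quantities J = 2s/(1 +
u²) (`actionVar`) and T = -(J/4)(u + u³/3) (`phaseVar`) satisfy J' = J + O(h³) and T' = T + h +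
O(h³) (`NearOrbit.action_step`, `NearOrbit.phase_step`). After about 1/h steps they are known up to
O(h²) (`orbit_estimate`, `LegData.eventually_estimate`). All this holds for complex points, so
Cauchy's estimate turns uniform bounds into bounds on derivatives.

One return consists of legs with n - 1, n - 1, n and n steps of the squared map and one further step
between the first two legs, 4n - 1 in all (`segment_return`, `eventually_return`). To leading order
it is an affine map near (3n, 0), which fixes (3n - 3/4, 1) and has linear part conjugate to the
rotation by -arccos(-7/9).

At h = 0 the return is the square of a half return. The level curves of J are parabolas with focus
at the origin. In the parabolic coordinates |Z| + Z₂ and |Z| - Z₂, normalised to x and y, the half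
return reads y' = x, x' = -y - (2/3)x + cubic terms + O(4), without quadratic terms
(`vanishesTo_recurrence`). Its multiplier is (-1 + 2√2 i)/3. No power of exponent 1 to 5 of the
square of this multiplier is 1, and the resonant cubic coefficient gives the twist coefficient
-4√2/9 of the limit (`twistDefect_limitCoord`).

For finite n the scaled return is 1/n-close to the limit, with all derivatives
(`closeTo_coordReturn`, `CloseTo.fderiv`). A quantitative surjectivity argument gives a fixed point
within O(1/n) of (3n - 3/4, 1) (`exists_fixedPoint`). Area preservation makes its linear part a
rotation in suitable coordinates (`exists_linearisation`). The homological equations of degrees 2, 3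
and 4 have divisors bounded away from zero, except at the resonant monomial, so the normalising
coordinates and the twist coefficient converge with n (`ConjugatePair.exists_normalForm`). The twist
coefficient so obtained could be complex. A nonzero imaginary part would make the map or its inverse
contract a neighbourhood of the fixed point, which area preservation forbids (`not_contracting`,
`im_twist_eq_zero`).

Finally the scaling is undone. Writing w = y/n turns the twist β|w|² into (β/n²)|y|², and a
remainder vanishing to order 5 becomes n · n⁻⁵ together with its derivatives (`CloseTo.scaledMap`),
which is better than the required n⁻³. -/

theorem crossProd_eq_zero_of_mem_line {z w k : ℝ × ℝ}
    (h : k ∈ (affineSpan ℝ {z, w} : Set (ℝ × ℝ))) : crossProd (w - z) (k - z) = 0 := by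
  obtain ⟨r, rfl⟩ := mem_affineSpan_pair_iff_exists_lineMap_eq.1 h
  simp only [crossProd, AffineMap.lineMap_apply, Prod.fst_sub, Prod.snd_sub, vsub_eq_sub,
    vadd_eq_add, Prod.fst_add, Prod.snd_add, Prod.smul_fst, Prod.smul_snd, smul_eq_mul]
  ring

theorem midpoint_prod (z v : ℝ × ℝ) :
    midpoint ℝ z v = ((z.1 + v.1) / 2, (z.2 + v.2) / 2) := by
  rw [midpoint_eq_smul_add]
  ext <;> simp <;> ring

/-- If the linear functional that cuts out the line from `z` to `w` is nonpositive on `K` and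
vanishes there only at `m`, then both the side condition and the uniqueness of the contact point
follow. -/
theorem IsOuterImage.of_support {K : Set (ℝ × ℝ)} {z w m : ℝ × ℝ} (hz : z ∉ K)
    (hm : ((z.1 + w.1) / 2, (z.2 + w.2) / 2) = m) (hmK : m ∈ K)
    (h : ∀ k ∈ K, crossProd (w - z) (k - z) ≤ 0 ∧ (crossProd (w - z) (k - z) = 0 → k = m)) :
    IsOuterImage K z w := by
  have hm' : midpoint ℝ z w = m := by rw [midpoint_prod, hm]
  refine ⟨hz, ?_, fun k hk => (h k hk).1⟩
  ext k
  constructor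
  · rintro ⟨hk, hl⟩
    rw [mem_singleton_iff, hm']
    exact (h k hk).2 (crossProd_eq_zero_of_mem_line hl)
  · rintro rfl
    refine ⟨hm' ▸ hmK, ?_⟩
    exact AffineMap.lineMap_mem_affineSpan_pair _ _ _

/-- The supporting functional is -2((z.1 - 1)b + z.2(1 - a)). Both products are nonnegative on the
half-disc, and they vanish together only at the corner (1, 0). -/
theorem isOuterImage_right {z : ℝ × ℝ} (h1 : 1 < z.1) (h2 : 0 < z.2) :
    IsOuterImage semiDisc z (2 - z.1, -z.2) := by
  refine IsOuterImage.of_support (m := (1, 0)) ?_ ?_ ?_ ?_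
  · rintro ⟨h, -⟩
    nlinarith [sq_nonneg z.2]
  · ext <;> simp
  · simp [semiDisc]
  · rintro ⟨a, b⟩ ⟨h, hb⟩
    simp only [crossProd, Prod.fst_sub, Prod.snd_sub] at h hb ⊢
    have ha : a ≤ 1 := by nlinarith [sq_nonneg b]
    have key : (2 - z.1 - z.1) * (b - z.2) - (-z.2 - z.2) * (a - z.1)
        = -2 * ((z.1 - 1) * b + z.2 * (1 - a)) := by ring
    rw [key]
    have p1 : 0 ≤ (z.1 - 1) * b := mul_nonneg (by linarith) hb
    have p2 : 0 ≤ z.2 * (1 - a) := mul_nonneg h2.le (by linarith)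
    refine ⟨by linarith, fun h0 => ?_⟩
    have q1 : (z.1 - 1) * b = 0 := by linarith
    have q2 : z.2 * (1 - a) = 0 := by linarith
    have r1 := (mul_eq_zero.1 q1).resolve_left (by linarith)
    have r2 := (mul_eq_zero.1 q2).resolve_left h2.ne'
    ext <;> simp <;> linarith

theorem isOuterImage_left {z : ℝ × ℝ} (h1 : -1 < z.1) (h2 : z.2 < 0) :
    IsOuterImage semiDisc z (-2 - z.1, -z.2) := by
  refine IsOuterImage.of_support (m := (-1, 0)) ?_ ?_ ?_ ?_
  · rintro ⟨-, h⟩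
    linarith
  · ext <;> simp
  · simp [semiDisc]
  · rintro ⟨a, b⟩ ⟨h, hb⟩
    simp only [crossProd, Prod.fst_sub, Prod.snd_sub] at h hb ⊢
    have ha : -1 ≤ a := by nlinarith [sq_nonneg b]
    have key : (-2 - z.1 - z.1) * (b - z.2) - (-z.2 - z.2) * (a - z.1)
        = -2 * ((z.1 + 1) * b + (-z.2) * (a + 1)) := by ring
    rw [key]
    have p1 : 0 ≤ (z.1 + 1) * b := mul_nonneg (by linarith) hb
    have p2 : 0 ≤ (-z.2) * (a + 1) := mul_nonneg (by linarith) (by linarith)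
    refine ⟨by linarith, fun h0 => ?_⟩
    have q1 : (z.1 + 1) * b = 0 := by linarith
    have q2 : (-z.2) * (a + 1) = 0 := by linarith
    have r1 := (mul_eq_zero.1 q1).resolve_left (by linarith)
    have r2 := (mul_eq_zero.1 q2).resolve_left (by linarith)
    ext <;> simp <;> linarith

/-- The supporting functional is s(2⟨t, k⟩ - 2) = s(|k|² - 1 - |k - t|²), so strict convexity of the
disc gives the single contact point. Positivity of `t.2` places that point on the half-disc. -/
theorem isOuterImage_tangent {t : ℝ × ℝ} {s : ℝ} (ht : t.1 ^ 2 + t.2 ^ 2 = 1) (ht2 : 0 < t.2)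
    (hs : 0 < s) :
    IsOuterImage semiDisc (t.1 - s * t.2, t.2 + s * t.1) (t.1 + s * t.2, t.2 - s * t.1) := by
  refine IsOuterImage.of_support (m := t) ?_ ?_ ?_ ?_
  · rintro ⟨h, -⟩
    simp only at h
    have : (t.1 - s * t.2) ^ 2 + (t.2 + s * t.1) ^ 2
      = (1 + s ^ 2) * (t.1 ^ 2 + t.2 ^ 2) := by ring
    rw [this, ht] at h
    nlinarith
  · ext <;> simp
  · exact ⟨ht.le, ht2.le⟩
  · rintro ⟨a, b⟩ ⟨h, hb⟩
    simp only [crossProd, Prod.fst_sub, Prod.snd_sub] at h hb ⊢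
    have key : (t.1 + s * t.2 - (t.1 - s * t.2)) * (b - (t.2 + s * t.1))
        - (t.2 - s * t.1 - (t.2 + s * t.1)) * (a - (t.1 - s * t.2))
        = s * (2 * (t.1 * a + t.2 * b) - 2 * (t.1 ^ 2 + t.2 ^ 2)) := by ring
    rw [key, ht]
    have e : 2 * (t.1 * a + t.2 * b) - 2
      = -((a - t.1) ^ 2 + (b - t.2) ^ 2) + (a ^ 2 + b ^ 2 - 1) := by linear_combination ht
    have le : 2 * (t.1 * a + t.2 * b) - 2 ≤ 0 := by
      rw [e]; nlinarith [sq_nonneg (a - t.1), sq_nonneg (b - t.2)]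
    refine ⟨by rw [mul_one]; exact mul_nonpos_of_nonneg_of_nonpos hs.le le, fun h0 => ?_⟩
    rw [mul_one] at h0
    have h1 := (mul_eq_zero.1 h0).resolve_left hs.ne'
    rw [e] at h1
    have q1 : (a - t.1) ^ 2 = 0 := by nlinarith [sq_nonneg (a - t.1), sq_nonneg (b - t.2)]
    have q2 : (b - t.2) ^ 2 = 0 := by nlinarith [sq_nonneg (a - t.1), sq_nonneg (b - t.2)]
    have r1 := pow_eq_zero_iff (two_ne_zero) |>.1 q1
    have r2 := pow_eq_zero_iff (two_ne_zero) |>.1 q2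
    ext <;> simp <;> linarith

/-- The outer billiard map about the unit disc. -/
noncomputable def arcMap (w : ℝ × ℝ) : ℝ × ℝ :=
  ((2 / (w.1 ^ 2 + w.2 ^ 2) - 1) * w.1
      + 2 * √(w.1 ^ 2 + w.2 ^ 2 - 1) / (w.1 ^ 2 + w.2 ^ 2) * w.2,
    -(2 * √(w.1 ^ 2 + w.2 ^ 2 - 1) / (w.1 ^ 2 + w.2 ^ 2)) * w.1
      + (2 / (w.1 ^ 2 + w.2 ^ 2) - 1) * w.2)

/-- The points whose tangent line to the disc touches it in the upper half-plane. -/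
def arcSet : Set (ℝ × ℝ) :=
  {w | 1 < w.1 ^ 2 + w.2 ^ 2 ∧ √(w.1 ^ 2 + w.2 ^ 2 - 1) * w.1 < w.2}

theorem isOpen_arcSet : IsOpen arcSet := by
  have c1 : Continuous fun w : ℝ × ℝ => w.1 ^ 2 + w.2 ^ 2 := by fun_prop
  have c2 : Continuous fun w : ℝ × ℝ => √(w.1 ^ 2 + w.2 ^ 2 - 1) * w.1 := by fun_prop
  exact (isOpen_lt continuous_const c1).inter (isOpen_lt c2 continuous_snd)

theorem isOuterImage_arc {w : ℝ × ℝ} (h : w ∈ arcSet) :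
    IsOuterImage semiDisc w (arcMap w) := by
  obtain ⟨h1, h2⟩ := h
  set ρ := w.1 ^ 2 + w.2 ^ 2 with hρ
  set s := √(ρ - 1) with hs
  have s2 : s ^ 2 = ρ - 1 := Real.sq_sqrt (by linarith)
  have sp : 0 < s := Real.sqrt_pos.2 (by linarith)
  have ρ0 : ρ ≠ 0 := by linarith
  -- With tangent length s = √(ρ - 1) the contact point is (w₁ + s w₂, w₂ - s w₁)/ρ. The second
  -- condition in `arcSet` says that its ordinate is positive.
  have := isOuterImage_tangent (t := ((w.1 + s * w.2) / ρ, (w.2 - s * w.1) / ρ)) (s := s)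
    (by
      field_simp
      linear_combination (1 + s ^ 2) * (-hρ.symm + hρ.symm) + ρ * s2 + (1 + s ^ 2) * hρ.symm)
    (by simp only; apply div_pos <;> linarith) sp
  convert this using 1
  · ext
    · simp only; field_simp; linear_combination (-w.1) * s2
    · simp only; field_simp; linear_combination (-w.2) * s2
  · ext
    · simp only [arcMap, ← hρ, ← hs]; field_simp; linear_combination (w.1) * s2
    · simp only [arcMap, ← hρ, ← hs]; field_simp; linear_combination (w.2) * s2

theorem outerBilliard_eq {K : Set (ℝ × ℝ)} {z w : ℝ × ℝ} (h : IsOuterImage K z w) :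
    outerBilliard K z = w := by
  have hex : ∃ w, IsOuterImage K z w := ⟨w, h⟩
  rw [outerBilliard, dif_pos hex]
  exact hex.choose_spec.unique h

/-! ### Area preservation of the billiard map -/

theorem clm_det_prod (A : (ℝ × ℝ) →L[ℝ] (ℝ × ℝ)) :
    A.det = (A (1, 0)).1 * (A (0, 1)).2 - (A (0, 1)).1 * (A (1, 0)).2 := by
  have : A.det = LinearMap.det (A : (ℝ × ℝ) →ₗ[ℝ] (ℝ × ℝ)) := rfl
  rw [this, ← LinearMap.det_toMatrix (Module.Basis.finTwoProd ℝ), Matrix.det_fin_two]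
  simp [LinearMap.toMatrix_apply]

/-- The map `f` is differentiable at `z`, with derivative of determinant one. -/
def AreaPreservingAt (f : ℝ × ℝ → ℝ × ℝ) (z : ℝ × ℝ) : Prop :=
  ∃ A : (ℝ × ℝ) →L[ℝ] (ℝ × ℝ), HasFDerivAt f A z ∧ A.det = 1

theorem AreaPreservingAt.comp {f g : ℝ × ℝ → ℝ × ℝ} {z : ℝ × ℝ}
    (hg : AreaPreservingAt g (f z)) (hf : AreaPreservingAt f z) :
    AreaPreservingAt (g ∘ f) z := by
  obtain ⟨A, hA, dA⟩ := hf
  obtain ⟨B, hB, dB⟩ := hg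
  refine ⟨B.comp A, hB.comp z hA, ?_⟩
  have : (B.comp A).det = B.det * A.det := LinearMap.det_comp _ _
  rw [this, dA, dB, one_mul]

theorem AreaPreservingAt.iterate {f : ℝ × ℝ → ℝ × ℝ} {z : ℝ × ℝ} :
    ∀ {k : ℕ}, (∀ i < k, AreaPreservingAt f (f^[i] z)) → AreaPreservingAt (f^[k]) z
  | 0, _ => ⟨ContinuousLinearMap.id ℝ _, hasFDerivAt_id z, by
      exact LinearMap.det_id⟩
  | k + 1, h => by
      rw [Function.iterate_succ']
      exact (h k (Nat.lt_succ_self k)).comp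
        (AreaPreservingAt.iterate fun i hi => h i (hi.trans (Nat.lt_succ_self k)))

/-- A rotation whose angle depends only on the radius preserves area: the Jacobian is p² + q² plus a
multiple of p p' + q q', half the derivative of the constant p² + q². -/
theorem areaPreservingAt_radial {p q : ℝ → ℝ} {p' q' : ℝ} {w : ℝ × ℝ}
    (hp : HasDerivAt p p' (w.1 ^ 2 + w.2 ^ 2)) (hq : HasDerivAt q q' (w.1 ^ 2 + w.2 ^ 2))
    (h1 : p (w.1 ^ 2 + w.2 ^ 2) ^ 2 + q (w.1 ^ 2 + w.2 ^ 2) ^ 2 = 1)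
    (h2 : p (w.1 ^ 2 + w.2 ^ 2) * p' + q (w.1 ^ 2 + w.2 ^ 2) * q' = 0) :
    AreaPreservingAt (fun w => (p (w.1 ^ 2 + w.2 ^ 2) * w.1 + q (w.1 ^ 2 + w.2 ^ 2) * w.2,
      -q (w.1 ^ 2 + w.2 ^ 2) * w.1 + p (w.1 ^ 2 + w.2 ^ 2) * w.2)) w := by
  have f1 : HasFDerivAt (fun w : ℝ × ℝ => w.1) (ContinuousLinearMap.fst ℝ ℝ ℝ) w :=
    hasFDerivAt_fst
  have f2 : HasFDerivAt (fun w : ℝ × ℝ => w.2) (ContinuousLinearMap.snd ℝ ℝ ℝ) w :=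
    hasFDerivAt_snd
  have hρ := (f1.pow 2).add (f2.pow 2)
  have hP := hp.comp_hasFDerivAt (f := fun w : ℝ × ℝ => w.1 ^ 2 + w.2 ^ 2) w hρ
  have hQ := hq.comp_hasFDerivAt (f := fun w : ℝ × ℝ => w.1 ^ 2 + w.2 ^ 2) w hρ
  refine ⟨_, ((hP.mul f1).add (hQ.mul f2)).prodMk ((hQ.neg.mul f1).add (hP.mul f2)), ?_⟩
  rw [clm_det_prod]
  simp
  linear_combination h1 + 2 * (w.1 ^ 2 + w.2 ^ 2) * h2

/-- The disc map rotates each circle of squared radius ρ by an angle with cosine 2/ρ - 1 and sine of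
absolute value 2√(ρ - 1)/ρ. -/
theorem areaPreservingAt_arcMap {w : ℝ × ℝ} (h : 1 < w.1 ^ 2 + w.2 ^ 2) :
    AreaPreservingAt arcMap w := by
  set ρ := w.1 ^ 2 + w.2 ^ 2 with hρ
  have s2 : √(ρ - 1) ^ 2 = ρ - 1 := Real.sq_sqrt (by linarith)
  have sp : 0 < √(ρ - 1) := Real.sqrt_pos.2 (by linarith)
  have ρ0 : ρ ≠ 0 := by linarith
  have hp : HasDerivAt (fun r : ℝ => 2 / r - 1) (-2 / ρ ^ 2) ρ := by
    simpa using ((hasDerivAt_const ρ (2 : ℝ)).div (hasDerivAt_id ρ) ρ0).sub_const 1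
  have hq : HasDerivAt (fun r : ℝ => 2 * √(r - 1) / r)
      ((2 * (1 / (2 * √(ρ - 1))) * ρ - 2 * √(ρ - 1) * 1) / ρ ^ 2) ρ := by
    have h0 : HasDerivAt (fun r : ℝ => r - 1) 1 ρ := (hasDerivAt_id ρ).sub_const 1
    exact ((h0.sqrt (by linarith)).const_mul 2).div (hasDerivAt_id ρ) ρ0
  refine areaPreservingAt_radial hp hq ?_ ?_
  · rw [← hρ]
    field_simp
    linear_combination 4 * s2
  · rw [← hρ]
    set s := √(ρ - 1)
    field_simp
    linear_combination -4 * s2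

/-- The outer billiard map about the half-disc is defined and locally area preserving. -/
def IsRegularPoint (z : ℝ × ℝ) : Prop :=
  z ∈ outerDomain semiDisc ∧ AreaPreservingAt (outerBilliard semiDisc) z

theorem AreaPreservingAt.congr {f g : ℝ × ℝ → ℝ × ℝ} {z : ℝ × ℝ}
    (hf : AreaPreservingAt f z) (h : g =ᶠ[𝓝 z] f) : AreaPreservingAt g z := by
  obtain ⟨A, hA, d⟩ := hf
  exact ⟨A, hA.congr_of_eventuallyEq h, d⟩

theorem isRegularPoint_arc {w : ℝ × ℝ} (h : w ∈ arcSet) : IsRegularPoint w := by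
  refine ⟨⟨_, isOuterImage_arc h⟩, (areaPreservingAt_arcMap h.1).congr ?_⟩
  filter_upwards [isOpen_arcSet.mem_nhds h] with v hv
  exact outerBilliard_eq (isOuterImage_arc hv)

theorem areaPreservingAt_reflection (c : ℝ) (z : ℝ × ℝ) :
    AreaPreservingAt (fun z => (c - z.1, -z.2)) z := by
  have f1 : HasFDerivAt (fun w : ℝ × ℝ => w.1) (ContinuousLinearMap.fst ℝ ℝ ℝ) z :=
    hasFDerivAt_fst
  have f2 : HasFDerivAt (fun w : ℝ × ℝ => w.2) (ContinuousLinearMap.snd ℝ ℝ ℝ) z :=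
    hasFDerivAt_snd
  refine ⟨_, (f1.const_sub c).prodMk f2.neg, ?_⟩
  rw [clm_det_prod]
  simp

theorem isRegularPoint_right {z : ℝ × ℝ} (h1 : 1 < z.1) (h2 : 0 < z.2) : IsRegularPoint z := by
  refine ⟨⟨_, isOuterImage_right h1 h2⟩, (areaPreservingAt_reflection 2 z).congr ?_⟩
  have : IsOpen {z : ℝ × ℝ | 1 < z.1 ∧ 0 < z.2} :=
    (isOpen_lt continuous_const continuous_fst).inter (isOpen_lt continuous_const continuous_snd)
  filter_upwards [this.mem_nhds ⟨h1, h2⟩] with v hv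
  exact outerBilliard_eq (isOuterImage_right hv.1 hv.2)

theorem isRegularPoint_left {z : ℝ × ℝ} (h1 : -1 < z.1) (h2 : z.2 < 0) : IsRegularPoint z := by
  refine ⟨⟨_, isOuterImage_left h1 h2⟩, (areaPreservingAt_reflection (-2) z).congr ?_⟩
  have : IsOpen {z : ℝ × ℝ | -1 < z.1 ∧ z.2 < 0} :=
    (isOpen_lt continuous_const continuous_fst).inter (isOpen_lt continuous_snd continuous_const)
  filter_upwards [this.mem_nhds ⟨h1, h2⟩] with v hv
  exact outerBilliard_eq (isOuterImage_left hv.1 hv.2)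

/-! ### The section -/

/-- A point of `ellOneImage` and its preimage on the axis have their midpoint in the half-disc, so
the ordinate of the image is at most 2. Orbits above height 2 therefore miss the section. -/
theorem lt_two_of_mem_sectionRegion {x₀ : ℝ} {p : ℝ × ℝ} (h : p ∈ sectionRegion x₀) :
    x₀ < p.1 ∧ 0 < p.2 ∧ p.2 < 2 := by
  obtain ⟨h1, h2, y, hy, q, ⟨hq1, hq2⟩, hw⟩ := h
  refine ⟨h1, h2, hy.trans_le ?_⟩
  have hm : midpoint ℝ (2 - q.1, -q.2) (p.1, y) ∈ semiDisc := by
    have : midpoint ℝ (2 - q.1, -q.2) (p.1, y) ∈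
        semiDisc ∩ (affineSpan ℝ {(2 - q.1, -q.2), (p.1, y)} : Set (ℝ × ℝ)) := by
      rw [hw.contact]; rfl
    exact this.1
  rw [midpoint_prod] at hm
  have := hm.1
  simp only [hq2] at this
  nlinarith [sq_nonneg ((2 - q.1 + p.1) / 2)]

theorem mem_sectionRegion {x₀ : ℝ} {p : ℝ × ℝ} (h : x₀ < p.1) (h2 : 2 ≤ p.1) (h3 : 0 < p.2)
    (h4 : p.2 ≤ 3 / 2) : p ∈ sectionRegion x₀ := by
  -- The boundary point over `p.1` is the image of (-q, 0) under the disc map, with abscissa q -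
  -- 2/q. Hence q is the positive root of q² - p.1 q - 2. Its height 2√(q² - 1)/q exceeds 3/2
  -- because q > 2.
  set q := (p.1 + √(p.1 ^ 2 + 8)) / 2 with hq
  have hs : √(p.1 ^ 2 + 8) ^ 2 = p.1 ^ 2 + 8 := Real.sq_sqrt (by positivity)
  have hs3 : 3 ≤ √(p.1 ^ 2 + 8) := Real.le_sqrt_of_sq_le (by nlinarith)
  have hq2 : q ^ 2 - p.1 * q - 2 = 0 := by rw [hq]; linear_combination hs / 4
  have q2 : 2 < q := by rw [hq]; linarith
  have hw : ((-q, 0) : ℝ × ℝ) ∈ arcSet := by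
    constructor
    · simp only; nlinarith
    · simp only
      have : 0 < √((-q) ^ 2 + 0 ^ 2 - 1) := Real.sqrt_pos.2 (by nlinarith)
      nlinarith
  have e := isOuterImage_arc hw
  clear_value q
  set r := √((-q) ^ 2 + 0 ^ 2 - 1) with hr
  have hr2 : r ^ 2 = q ^ 2 - 1 := by rw [hr, Real.sq_sqrt (by nlinarith)]; ring
  have hrp : 0 ≤ r := Real.sqrt_nonneg _
  have hA : arcMap (-q, 0) = (p.1, 2 * r / q) := by
    simp only [arcMap, ← hr]
    have : q ≠ 0 := by linarith
    ext
    · simp only; field_simp; linear_combination q * hq2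
    · simp only; field_simp; ring
  refine ⟨h, h3, 2 * r / q, ?_, (2 + q, 0), ⟨by simp only; linarith, rfl⟩, ?_⟩
  · refine h4.trans_lt ?_
    rw [lt_div_iff₀ (by linarith)]
    nlinarith
  · rw [hA] at e
    convert e using 2
    · ring
    · simp

/-! ### Tangent coordinates -/

/-- The point on the tangent line at `((u² - 1) / (u² + 1), 2u / (u² + 1))` of the unit circle, at
signed distance `s` from the contact point; all lengths are multiplied by `h`, except `s`. -/
def chart {K : Type*} [Field K] (h : K) (v : K × K) : K × K :=
  ((h * (v.1 ^ 2 - 1) - 2 * v.1 * v.2) / (1 + v.1 ^ 2),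
    (2 * h * v.1 + v.2 * (v.1 ^ 2 - 1)) / (1 + v.1 ^ 2))

/-- Two consecutive points, in tangent coordinates, of the composition of the outer billiard map
about the disc with the reflection in `(h, 0)`. -/
structure StepRel {K : Type*} [Field K] (h : K) (v v' : K × K) : Prop where
  sum : (v.2 + v'.2) * (v.1 - v'.1) = 4 * h
  diff : (v'.2 - v.2) * (1 + v.1 * v'.1) = -2 * h * (v.1 + v'.1)

/-- Replacing s by -s in `chart` reflects the point in its contact point. With `StepRel.chart_snd`,
this identifies the relations of `StepRel` with the disc map followed by the reflection in (h, 0).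
-/
theorem StepRel.chart_fst {K : Type*} [Field K] {h : K} {v v' : K × K} (r : StepRel h v v')
    (h1 : 1 + v.1 ^ 2 ≠ 0) (h2 : 1 + v'.1 ^ 2 ≠ 0) :
    (chart h v').1 = 2 * h - (h * (v.1 ^ 2 - 1) + 2 * v.1 * v.2) / (1 + v.1 ^ 2) := by
  obtain ⟨a, b⟩ := r
  simp only [chart]
  field_simp
  linear_combination (1 - v.1 * v'.1) * a - (v.1 + v'.1) * b

theorem StepRel.chart_snd {K : Type*} [Field K] {h : K} {v v' : K × K} (r : StepRel h v v')
    (h1 : 1 + v.1 ^ 2 ≠ 0) (h2 : 1 + v'.1 ^ 2 ≠ 0) :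
    (chart h v').2 = -((2 * h * v.1 - v.2 * (v.1 ^ 2 - 1)) / (1 + v.1 ^ 2)) := by
  obtain ⟨a, b⟩ := r
  simp only [chart]
  field_simp
  linear_combination (v.1 * v'.1 - 1) * b - (v.1 + v'.1) * a

theorem one_add_sq_ne (x : ℝ) : 1 + x ^ 2 ≠ 0 := by positivity

theorem StepRel.fst_lt {v v' : ℝ × ℝ} (r : StepRel 1 v v') (h : 0 < v.2) (h' : 0 < v'.2) :
    v'.1 < v.1 := by
  have := r.sum
  by_contra hc
  push Not at hc
  nlinarith [mul_nonneg (add_pos h h').le (sub_nonneg.2 hc)]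

/-- Two successive point reflections, in the contact point t and in (1, 0), compose to the
translation by 2((1, 0) - t). Its components are 4/(1 + u²) and -4u/(1 + u²), which gives the
monotonicity of both coordinates along a run. -/
theorem StepRel.chart_fst_lt {v v' : ℝ × ℝ} (r : StepRel 1 v v') :
    (chart 1 v).1 < (chart 1 v').1 := by
  rw [r.chart_fst (one_add_sq_ne _) (one_add_sq_ne _), ← sub_pos]
  have : 2 * 1 - (1 * (v.1 ^ 2 - 1) + 2 * v.1 * v.2) / (1 + v.1 ^ 2) - (chart 1 v).1
      = 4 / (1 + v.1 ^ 2) := by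
    have := one_add_sq_ne v.1
    simp only [chart]
    field_simp
    ring
  rw [this]
  positivity

theorem StepRel.chart_snd_eq {v v' : ℝ × ℝ} (r : StepRel 1 v v') :
    (chart 1 v').2 = (chart 1 v).2 - 4 * v.1 / (1 + v.1 ^ 2) := by
  have := one_add_sq_ne v.1
  rw [r.chart_snd (one_add_sq_ne _) (one_add_sq_ne _)]
  simp only [chart]
  field_simp
  ring

theorem tangent_mem_arcSet {t : ℝ × ℝ} {s : ℝ} (ht : t.1 ^ 2 + t.2 ^ 2 = 1) (ht2 : 0 < t.2)
    (hs : 0 < s) : (t.1 - s * t.2, t.2 + s * t.1) ∈ arcSet := by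
  have e : (t.1 - s * t.2) ^ 2 + (t.2 + s * t.1) ^ 2 = 1 + s ^ 2 := by
    linear_combination (1 + s ^ 2) * ht
  refine ⟨?_, ?_⟩
  · simp only [e]; nlinarith
  · simp only [e, add_sub_cancel_left, Real.sqrt_sq hs.le]
    nlinarith [mul_pos (mul_pos hs hs) ht2]

section

local notation "F" => outerBilliard semiDisc

theorem arc_step_pos {v v' : ℝ × ℝ} (r : StepRel 1 v v') (hu : 0 < v.1) (hs : 0 < v.2) :
    IsRegularPoint (chart 1 v) ∧ F (chart 1 v) = (2 - (chart 1 v').1, -(chart 1 v').2) := by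
  have n1 := one_add_sq_ne v.1
  have ht : ((v.1 ^ 2 - 1) / (1 + v.1 ^ 2)) ^ 2 + (2 * v.1 / (1 + v.1 ^ 2)) ^ 2 = 1 := by
    field_simp; ring
  have ht2 : 0 < 2 * v.1 / (1 + v.1 ^ 2) := by positivity
  have e := isOuterImage_tangent (t := ((v.1 ^ 2 - 1) / (1 + v.1 ^ 2), 2 * v.1 / (1 + v.1 ^ 2)))
    ht ht2 hs
  have m := tangent_mem_arcSet (t := ((v.1 ^ 2 - 1) / (1 + v.1 ^ 2), 2 * v.1 / (1 + v.1 ^ 2)))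
    ht ht2 hs
  have ew : chart 1 v = ((v.1 ^ 2 - 1) / (1 + v.1 ^ 2) - v.2 * (2 * v.1 / (1 + v.1 ^ 2)),
      2 * v.1 / (1 + v.1 ^ 2) + v.2 * ((v.1 ^ 2 - 1) / (1 + v.1 ^ 2))) := by
    ext <;> simp only [chart] <;> field_simp
  refine ⟨by rw [ew]; exact isRegularPoint_arc m, ?_⟩
  rw [r.chart_fst n1 (one_add_sq_ne _), r.chart_snd n1 (one_add_sq_ne _), ew, outerBilliard_eq e]
  ext <;> simp only <;> field_simp <;> ring

/-- For u < 0 the contact point of the chart lies on the lower half-circle. Central symmetry brings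
it to the arc, and the corner (-1, 0) takes over the role of (1, 0). -/
theorem arc_step_neg {v v' : ℝ × ℝ} (r : StepRel 1 v v') (hu : v.1 < 0) (hs : 0 < v.2) :
    IsRegularPoint (-(chart 1 v)) ∧ F (-(chart 1 v)) = ((chart 1 v').1 - 2, (chart 1 v').2) := by
  have n1 := one_add_sq_ne v.1
  have ht : ((1 - v.1 ^ 2) / (1 + v.1 ^ 2)) ^ 2 + (2 * (-v.1) / (1 + v.1 ^ 2)) ^ 2 = 1 := by
    field_simp; ring
  have ht2 : 0 < 2 * (-v.1) / (1 + v.1 ^ 2) := by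
    have : 0 < -v.1 := by linarith
    positivity
  have e := isOuterImage_tangent
    (t := ((1 - v.1 ^ 2) / (1 + v.1 ^ 2), 2 * (-v.1) / (1 + v.1 ^ 2))) ht ht2 hs
  have m := tangent_mem_arcSet
    (t := ((1 - v.1 ^ 2) / (1 + v.1 ^ 2), 2 * (-v.1) / (1 + v.1 ^ 2))) ht ht2 hs
  have ew : -(chart 1 v) = ((1 - v.1 ^ 2) / (1 + v.1 ^ 2) - v.2 * (2 * (-v.1) / (1 + v.1 ^ 2)),
      2 * (-v.1) / (1 + v.1 ^ 2) + v.2 * ((1 - v.1 ^ 2) / (1 + v.1 ^ 2))) := by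
    ext <;> simp only [chart, Prod.fst_neg, Prod.snd_neg] <;> field_simp <;> ring
  refine ⟨by rw [ew]; exact isRegularPoint_arc m, ?_⟩
  rw [r.chart_fst n1 (one_add_sq_ne _), r.chart_snd n1 (one_add_sq_ne _), ew, outerBilliard_eq e]
  ext <;> simp only <;> field_simp <;> ring

/-! ### Orbit segments -/

/-- `z'` is reached from `z` in `k` steps of the squared outer billiard map, through regular points,
and without visiting the section in between. -/
structure Segment (x₀ : ℝ) (z : ℝ × ℝ) (k : ℕ) (z' : ℝ × ℝ) : Prop where
  map : F^[2 * k] z = z'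
  regular : ∀ i < 2 * k, IsRegularPoint (F^[i] z)
  notMem : ∀ j, 0 < j → j < k → F^[2 * j] z ∉ sectionRegion x₀

theorem Segment.refl (x₀ : ℝ) (z : ℝ × ℝ) : Segment x₀ z 0 z :=
  ⟨rfl, fun i hi => by omega, fun j _ hj => by omega⟩

theorem Segment.trans {x₀ : ℝ} {z z' z'' : ℝ × ℝ} {k l : ℕ} (h : Segment x₀ z k z')
    (h' : Segment x₀ z' l z'') (hz : z' ∉ sectionRegion x₀) : Segment x₀ z (k + l) z'' := by
  have shift : ∀ i, 2 * k ≤ i → F^[i] z = F^[i - 2 * k] z' := by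
    intro i hi
    rw [← h.map, ← Function.iterate_add_apply, Nat.sub_add_cancel hi]
  refine ⟨?_, fun i hi => ?_, fun j h0 hj => ?_⟩
  · rw [shift _ (by omega), show 2 * (k + l) - 2 * k = 2 * l by omega, h'.map]
  · by_cases hk : i < 2 * k
    · exact h.regular i hk
    · rw [shift i (by omega)]
      exact h'.regular _ (by omega)
  · rcases lt_trichotomy j k with hk | rfl | hk
    · exact h.notMem j h0 hk
    · rwa [h.map]
    · rw [shift _ (by omega), show 2 * j - 2 * k = 2 * (j - k) by omega]
      exact h'.notMem _ (by omega) (by omega)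

theorem Segment.single {x₀ : ℝ} {z y z' : ℝ × ℝ} (h1 : IsRegularPoint z) (h2 : F z = y)
    (h3 : IsRegularPoint y) (h4 : F y = z') : Segment x₀ z 1 z' := by
  refine ⟨by simp [h2, h4], fun i hi => ?_, fun j _ hj => by omega⟩
  interval_cases i
  · exact h1
  · simpa [h2] using h3

theorem Segment.chain {x₀ : ℝ} {z : ℕ → ℝ × ℝ} : ∀ {m : ℕ},
    (∀ j < m, Segment x₀ (z j) 1 (z (j + 1))) →
    (∀ j, 0 < j → j < m → z j ∉ sectionRegion x₀) → Segment x₀ (z 0) m (z m)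
  | 0, _, _ => Segment.refl _ _
  | 1, h, _ => h 0 one_pos
  | m + 2, h, h' => (Segment.chain (fun j hj => h j (by omega)) fun j h0 hj =>
      h' j h0 (by omega)).trans (k := m + 1) (l := 1) (h (m + 1) (by omega)) (h' (m + 1) (by omega) (by omega))

/-- Here the corner reflection in (1, 0) comes before the arc step, so the orbit of the squared map
is the reflection in (1, 0) of the chart orbit. -/
theorem segment_first {x₀ : ℝ} {v v' : ℝ × ℝ} (r : StepRel 1 v v') (hu : 0 < v.1) (hs : 0 < v.2)
    (ha : (chart 1 v).1 < 1) (hb : (chart 1 v).2 < 0) :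
    Segment x₀ (2 - (chart 1 v).1, -(chart 1 v).2) 1 (2 - (chart 1 v').1, -(chart 1 v').2) := by
  have A := arc_step_pos r hu hs
  have h1 : 1 < ((2 - (chart 1 v).1, -(chart 1 v).2) : ℝ × ℝ).1 := by simp only; linarith
  have h2 : 0 < ((2 - (chart 1 v).1, -(chart 1 v).2) : ℝ × ℝ).2 := by simp only; linarith
  refine Segment.single (isRegularPoint_right h1 h2) (y := chart 1 v) ?_ A.1 A.2
  rw [outerBilliard_eq (isOuterImage_right h1 h2)]
  ext <;> simp

/-- The arc step comes first and the reflection in (-1, 0) second, so the orbit is minus the chart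
orbit. -/
theorem segment_second {x₀ : ℝ} {v v' : ℝ × ℝ} (r : StepRel 1 v v') (hu : v.1 < 0) (hs : 0 < v.2)
    (ha : 1 < (chart 1 v').1) (hb : (chart 1 v').2 < 0) :
    Segment x₀ (-chart 1 v) 1 (-chart 1 v') := by
  have A := arc_step_neg r hu hs
  have h1 : -1 < (((chart 1 v').1 - 2, (chart 1 v').2) : ℝ × ℝ).1 := by simp only; linarith
  refine Segment.single A.1 A.2 (isRegularPoint_left h1 hb) ?_
  rw [outerBilliard_eq (isOuterImage_left h1 hb)]
  ext
  · simp only [Prod.fst_neg]; ring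
  · rfl

/-- The same relation as on the first leg, with the arc step first: now the chart points themselves
form the orbit. -/
theorem segment_third {x₀ : ℝ} {v v' : ℝ × ℝ} (r : StepRel 1 v v') (hu : 0 < v.1) (hs : 0 < v.2)
    (ha : (chart 1 v').1 < 1) (hb : (chart 1 v').2 < 0) :
    Segment x₀ (chart 1 v) 1 (chart 1 v') := by
  have A := arc_step_pos r hu hs
  have h1 : 1 < ((2 - (chart 1 v').1, -(chart 1 v').2) : ℝ × ℝ).1 := by simp only; linarith
  have h2 : 0 < ((2 - (chart 1 v').1, -(chart 1 v').2) : ℝ × ℝ).2 := by simp only; linarith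
  refine Segment.single A.1 A.2 (isRegularPoint_right h1 h2) ?_
  rw [outerBilliard_eq (isOuterImage_right h1 h2)]
  ext <;> simp

theorem segment_fourth {x₀ : ℝ} {v v' : ℝ × ℝ} (r : StepRel 1 v v') (hu : v.1 < 0) (hs : 0 < v.2)
    (ha : 1 < (chart 1 v).1) (hb : (chart 1 v).2 < 0) :
    Segment x₀ ((chart 1 v).1 - 2, (chart 1 v).2) 1 ((chart 1 v').1 - 2, (chart 1 v').2) := by
  have A := arc_step_neg r hu hs
  have h1 : -1 < (((chart 1 v).1 - 2, (chart 1 v).2) : ℝ × ℝ).1 := by simp only; linarith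
  refine Segment.single (isRegularPoint_left h1 hb) (y := -chart 1 v) ?_ A.1 A.2
  rw [outerBilliard_eq (isOuterImage_left h1 hb)]
  ext
  · simp only [Prod.fst_neg]; ring
  · rfl

/-- Neither step touches the arc: the reflections in (1, 0) and then (-1, 0) compose to the
translation by (-4, 0). This is the one step that joins the first leg to the second. -/
theorem segment_switch {x₀ : ℝ} {w : ℝ × ℝ} (h1 : -1 < w.1) (h2 : w.1 < 1) (h3 : w.2 < 0) :
    Segment x₀ (2 - w.1, -w.2) 1 (-(w + (2, 0))) := by
  have a1 : 1 < ((2 - w.1, -w.2) : ℝ × ℝ).1 := by simp only; linarith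
  have a2 : 0 < ((2 - w.1, -w.2) : ℝ × ℝ).2 := by simp only; linarith
  refine Segment.single (isRegularPoint_right a1 a2) (y := w) ?_ (isRegularPoint_left h1 h3) ?_
  · rw [outerBilliard_eq (isOuterImage_right a1 a2)]
    ext <;> simp
  · rw [outerBilliard_eq (isOuterImage_left h1 h3)]
    ext <;> simp; ring

/-! ### Runs in tangent coordinates and the itinerary of a return -/

/-- A run of `m` steps in tangent coordinates. -/
structure Run (v : ℕ → ℝ × ℝ) (m : ℕ) : Prop where
  rel : ∀ j < m, StepRel 1 (v j) (v (j + 1))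
  pos : ∀ j ≤ m, 0 < (v j).2

theorem Run.fst_anti {v : ℕ → ℝ × ℝ} {m : ℕ} (r : Run v m) {i j : ℕ} (hij : i ≤ j) (hj : j ≤ m) :
    (v j).1 ≤ (v i).1 := by
  induction j, hij using Nat.le_induction with
  | base => rfl
  | succ j _ ih =>
    exact ((r.rel j (by omega)).fst_lt (r.pos _ (by omega)) (r.pos _ hj)).le.trans (ih (by omega))

theorem Run.chart_mono {v : ℕ → ℝ × ℝ} {m : ℕ} (r : Run v m) {i j : ℕ} (hij : i ≤ j)
    (hj : j ≤ m) : (chart 1 (v i)).1 ≤ (chart 1 (v j)).1 := by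
  induction j, hij using Nat.le_induction with
  | base => rfl
  | succ j _ ih => exact (ih (by omega)).trans (r.rel j (by omega)).chart_fst_lt.le

theorem Run.chart_snd_anti {v : ℕ → ℝ × ℝ} {m : ℕ} (r : Run v m) {i j : ℕ} (hij : i ≤ j)
    (hj : j ≤ m) (h : ∀ l < j, 0 < (v l).1) : (chart 1 (v j)).2 ≤ (chart 1 (v i)).2 := by
  induction j, hij using Nat.le_induction with
  | base => rfl
  | succ j _ ih =>
    refine le_trans ?_ (ih (by omega) fun l hl => h l (by omega))
    rw [(r.rel j (by omega)).chart_snd_eq]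
    have := h j (by omega)
    have : 0 < 4 * (v j).1 / (1 + (v j).1 ^ 2) := by positivity
    linarith

theorem Run.chart_snd_mono {v : ℕ → ℝ × ℝ} {m : ℕ} (r : Run v m) {i j : ℕ} (hij : i ≤ j)
    (hj : j ≤ m) (h : (v 0).1 < 0) : (chart 1 (v i)).2 ≤ (chart 1 (v j)).2 := by
  induction j, hij using Nat.le_induction with
  | base => rfl
  | succ j _ ih =>
    refine le_trans (ih (by omega)) ?_
    rw [(r.rel j (by omega)).chart_snd_eq]
    have := r.fst_anti (Nat.zero_le j) (by omega)
    have : 4 * (v j).1 / (1 + (v j).1 ^ 2) ≤ 0 :=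
      div_nonpos_of_nonpos_of_nonneg (by linarith) (by positivity)
    linarith

theorem notMem_section_of_fst {x₀ : ℝ} {z : ℝ × ℝ} (h : z.1 ≤ x₀) : z ∉ sectionRegion x₀ :=
  fun hz => not_lt.2 h (lt_two_of_mem_sectionRegion hz).1

theorem notMem_section_of_neg {x₀ : ℝ} {z : ℝ × ℝ} (h : z.2 ≤ 0) : z ∉ sectionRegion x₀ :=
  fun hz => not_lt.2 h (lt_two_of_mem_sectionRegion hz).2.1

theorem notMem_section_of_two_le {x₀ : ℝ} {z : ℝ × ℝ} (h : 2 ≤ z.2) : z ∉ sectionRegion x₀ :=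
  fun hz => not_lt.2 h (lt_two_of_mem_sectionRegion hz).2.2

/-- The itinerary of the points near the fixed point of the first return map. -/
theorem segment_return {x₀ : ℝ} (hx : 1 ≤ x₀) {v₁ v₂ v₃ v₄ : ℕ → ℝ × ℝ} {m k : ℕ} (hm : 1 ≤ m)
    (hk : 1 ≤ k) (r₁ : Run v₁ m) (r₂ : Run v₂ m) (r₃ : Run v₃ k) (r₄ : Run v₄ k)
    (s₂ : chart 1 (v₂ 0) = chart 1 (v₁ m) + (2, 0)) (s₃ : chart 1 (v₃ 0) = -chart 1 (v₂ m))
    (s₄ : chart 1 (v₄ 0) = chart 1 (v₃ k) + (2, 0))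
    (u₁ : 0 < (v₁ (m - 1)).1) (a₁ : -1 < (chart 1 (v₁ m)).1) (a₁' : (chart 1 (v₁ m)).1 < 1)
    (b₁ : (chart 1 (v₁ 0)).2 < 0) (b₁' : (chart 1 (v₁ 1)).2 ≤ -2)
    (u₂ : (v₂ 0).1 < 0) (b₂ : (chart 1 (v₂ m)).2 < 0)
    (u₃ : 0 < (v₃ (k - 1)).1) (a₃ : -1 < (chart 1 (v₃ k)).1) (a₃' : (chart 1 (v₃ k)).1 < 1)
    (b₃ : (chart 1 (v₃ 1)).2 < 0)
    (u₄ : (v₄ 0).1 < 0) (b₄ : (chart 1 (v₄ (k - 1))).2 < 0) :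
    Segment x₀ (2 - (chart 1 (v₁ 0)).1, -(chart 1 (v₁ 0)).2) (m + 1 + m + k + k)
      ((chart 1 (v₄ k)).1 - 2, (chart 1 (v₄ k)).2) := by
  have p₁ : ∀ l < m, 0 < (v₁ l).1 := fun l hl =>
    u₁.trans_le (r₁.fst_anti (by omega) (by omega))
  have p₃ : ∀ l < k, 0 < (v₃ l).1 := fun l hl =>
    u₃.trans_le (r₃.fst_anti (by omega) (by omega))
  have n₂ : ∀ l ≤ m, (v₂ l).1 < 0 := fun l hl => (r₂.fst_anti (Nat.zero_le l) hl).trans_lt u₂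
  have n₄ : ∀ l ≤ k, (v₄ l).1 < 0 := fun l hl => (r₄.fst_anti (Nat.zero_le l) hl).trans_lt u₄
  have y₁ : ∀ j, 1 ≤ j → j ≤ m → (chart 1 (v₁ j)).2 ≤ -2 := fun j h1 hj =>
    (r₁.chart_snd_anti h1 hj fun l hl => p₁ l (by omega)).trans b₁'
  have y₃ : ∀ j, 1 ≤ j → j ≤ k → (chart 1 (v₃ j)).2 < 0 := fun j h1 hj =>
    (r₃.chart_snd_anti h1 hj fun l hl => p₃ l (by omega)).trans_lt b₃
  have x₁ : ∀ j ≤ m, (chart 1 (v₁ j)).1 < 1 := fun j hj => (r₁.chart_mono hj le_rfl).trans_lt a₁'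
  have x₃ : ∀ j ≤ k, (chart 1 (v₃ j)).1 < 1 := fun j hj => (r₃.chart_mono hj le_rfl).trans_lt a₃'
  have x₂ : ∀ j ≤ m, 1 < (chart 1 (v₂ j)).1 := fun j hj => by
    refine lt_of_lt_of_le ?_ (r₂.chart_mono (Nat.zero_le j) hj)
    rw [s₂]; simp only [Prod.fst_add]; linarith
  have x₄ : ∀ j ≤ k, 1 < (chart 1 (v₄ j)).1 := fun j hj => by
    refine lt_of_lt_of_le ?_ (r₄.chart_mono (Nat.zero_le j) hj)
    rw [s₄]; simp only [Prod.fst_add]; linarith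
  -- Each leg avoids the section for its own reason: ordinate at least 2 on the first, abscissa
  -- below -1 on the second, abscissa below 1 on the third, negative ordinate on the fourth.
  have S₁ : Segment x₀ _ m _ :=
    Segment.chain (x₀ := x₀) (z := fun j => (2 - (chart 1 (v₁ j)).1, -(chart 1 (v₁ j)).2))
    (m := m)
    (fun j hj => segment_first (r₁.rel j hj) (p₁ j hj) (r₁.pos j hj.le) (x₁ j hj.le) (by
      rcases Nat.eq_zero_or_pos j with rfl | h
      · exact b₁
      · linarith [y₁ j h hj.le]))
    (fun j h0 hj => notMem_section_of_two_le (by simp only; linarith [y₁ j h0 hj.le]))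
  have S₂ : Segment x₀ _ m _ := Segment.chain (x₀ := x₀) (z := fun j => -chart 1 (v₂ j)) (m := m)
    (fun j hj => segment_second (r₂.rel j hj) (n₂ j hj.le) (r₂.pos j hj.le) (x₂ _ hj)
      ((r₂.chart_snd_mono (Nat.succ_le_of_lt hj) le_rfl u₂).trans_lt b₂))
    (fun j h0 hj => notMem_section_of_fst (by
      simp only [Prod.fst_neg]; linarith [x₂ j hj.le]))
  have S₃ : Segment x₀ _ k _ := Segment.chain (x₀ := x₀) (z := fun j => chart 1 (v₃ j)) (m := k)
    (fun j hj => segment_third (r₃.rel j hj) (p₃ j hj) (r₃.pos j hj.le) (x₃ _ hj)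
      (y₃ _ (by omega) hj))
    (fun j h0 hj => notMem_section_of_fst (by linarith [x₃ j hj.le]))
  have S₄ : Segment x₀ _ k _ :=
    Segment.chain (x₀ := x₀) (z := fun j => ((chart 1 (v₄ j)).1 - 2, (chart 1 (v₄ j)).2)) (m := k)
    (fun j hj => segment_fourth (r₄.rel j hj) (n₄ j hj.le) (r₄.pos j hj.le) (x₄ _ hj.le)
      ((r₄.chart_snd_mono (by omega) (by omega) u₄).trans_lt b₄))
    (fun j h0 hj => notMem_section_of_neg
      ((r₄.chart_snd_mono (j := k - 1) (by omega) (by omega) u₄).trans b₄.le))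
  have S₁₂ : Segment x₀ (2 - (chart 1 (v₁ m)).1, -(chart 1 (v₁ m)).2) 1 (-chart 1 (v₂ 0)) := by
    rw [s₂]
    exact segment_switch a₁ a₁' (by linarith [y₁ m hm le_rfl])
  simp only [s₃, s₄] at S₃ S₄
  -- No step separates the last two legs: the end of the third and the start of the fourth are the
  -- same point, written in two ways.
  have S₄' : Segment x₀ (chart 1 (v₃ k)) k ((chart 1 (v₄ k)).1 - 2, (chart 1 (v₄ k)).2) := by
    convert S₄ using 1
    ext <;> simp
  refine ((((S₁.trans S₁₂ ?_).trans S₂ ?_).trans S₃ ?_).trans S₄' ?_)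
  · exact notMem_section_of_two_le (by simp only; linarith [y₁ m hm le_rfl])
  · exact notMem_section_of_fst (by simp only [Prod.fst_neg]; linarith [x₂ 0 (Nat.zero_le _)])
  · exact notMem_section_of_fst (by simp only [Prod.fst_neg]; linarith [x₂ m le_rfl])
  · exact notMem_section_of_fst (by linarith [x₃ k le_rfl])

theorem Segment.isFirstReturnTime {x₀ : ℝ} {z z' : ℝ × ℝ} {k : ℕ} (h : Segment x₀ z k z')
    (hk : 0 < k) (hz : z' ∈ sectionRegion x₀) : IsFirstReturnTime x₀ z k :=
  ⟨hk, fun i hi => (h.regular i hi).1, h.map.symm ▸ hz, h.notMem⟩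

theorem Segment.firstReturn_eq {x₀ : ℝ} {z z' : ℝ × ℝ} {k : ℕ} (h : Segment x₀ z k z')
    (hk : 0 < k) (hz : z' ∈ sectionRegion x₀) : firstReturn x₀ z = z' := by
  have hr := h.isFirstReturnTime hk hz
  have hex : ∃ m, IsFirstReturnTime x₀ z m := ⟨k, hr⟩
  have hc := hex.choose_spec
  rw [firstReturn, dif_pos hex, ← h.map]
  congr 2
  rcases lt_trichotomy hex.choose k with hlt | heq | hgt
  · exact absurd hc.mem (hr.first _ hc.pos hlt)
  · rw [heq]
  · exact absurd hr.mem (hc.first _ hr.pos hgt)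

end

/-! ### The complexified map in tangent coordinates -/

/-- The second tangent coordinate after one step. -/
noncomputable def nextLength (h : ℂ) (v : ℂ × ℂ) : ℂ :=
  Complex.sqrt (v.2 ^ 2 + 8 * h * (h - v.2 * v.1) / (1 + v.1 ^ 2))

/-- One step in tangent coordinates. -/
noncomputable def tangentStep (h : ℂ) (v : ℂ × ℂ) : ℂ × ℂ :=
  (v.1 - 4 * h / (v.2 + nextLength h v), nextLength h v)

/-- The adiabatic invariant. -/
noncomputable def actionVar (v : ℂ × ℂ) : ℂ := 2 * v.2 / (1 + v.1 ^ 2)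

/-- The phase that advances by one step size in each step, up to small errors. -/
noncomputable def phaseVar (v : ℂ × ℂ) : ℂ := -(actionVar v / 4) * (v.1 + v.1 ^ 3 / 3)

theorem Complex.sqrt_sq' (z : ℂ) : Complex.sqrt z ^ 2 = z := by
  simp [Complex.sqrt]

theorem Complex.sqrt_re_nonneg (z : ℂ) : 0 ≤ (Complex.sqrt z).re := by
  rw [Complex.sqrt, Complex.cpow_inv_two_re]
  exact Real.sqrt_nonneg _

theorem Complex.analyticAt_sqrt {z : ℂ} (hz : z ∈ Complex.slitPlane) :
    AnalyticAt ℂ Complex.sqrt z := by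
  unfold Complex.sqrt
  exact analyticAt_id.cpow analyticAt_const hz

/-! ### Estimates for one step near the leading order orbit -/

/-- The point `v` is close to the point with first coordinate `a` on the leading order orbit. -/
structure NearOrbit (a : ℝ) (v : ℂ × ℂ) : Prop where
  lower : -1 ≤ a
  upper : a ≤ 1
  fst : ‖v.1 - a‖ ≤ 1 / 20
  action : ‖actionVar v - 3‖ ≤ 1 / 10

namespace NearOrbit

variable {a : ℝ} {v : ℂ × ℂ}

theorem abs_fst_le (p : NearOrbit a v) : |a| ≤ 1 := _root_.abs_le.2 ⟨p.lower, p.upper⟩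

theorem fst_norm (p : NearOrbit a v) : ‖v.1‖ ≤ 21 / 20 := by
  have h1 : ‖(a : ℂ)‖ ≤ 1 := by rw [Complex.norm_real]; exact p.abs_fst_le
  have := norm_add_le (v.1 - a) (a : ℂ)
  rw [sub_add_cancel] at this
  linarith [p.fst]

theorem sq_sub_le (p : NearOrbit a v) : ‖v.1 ^ 2 - (a : ℂ) ^ 2‖ ≤ |a| / 10 + 1 / 400 := by
  have e : v.1 ^ 2 - (a : ℂ) ^ 2 = 2 * a * (v.1 - a) + (v.1 - a) ^ 2 := by ring
  rw [e]
  refine (norm_add_le _ _).trans ?_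
  rw [norm_mul, norm_mul, norm_pow, Complex.norm_real, Real.norm_eq_abs, Complex.norm_two]
  have := p.fst
  have h0 := norm_nonneg (v.1 - a)
  have := abs_nonneg a
  nlinarith [mul_le_mul_of_nonneg_left p.fst (abs_nonneg a)]

theorem one_add_sq_lower (p : NearOrbit a v) : 99 / 100 ≤ ‖1 + v.1 ^ 2‖ := by
  have e : (1 + v.1 ^ 2 : ℂ) = ((1 + a ^ 2 : ℝ) : ℂ) + (v.1 ^ 2 - (a : ℂ) ^ 2) := by
    push_cast; ring
  rw [e]
  have h1 := norm_sub_le_norm_add ((1 + a ^ 2 : ℝ) : ℂ) (v.1 ^ 2 - (a : ℂ) ^ 2)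
  rw [Complex.norm_real, Real.norm_eq_abs, abs_of_nonneg (by positivity)] at h1
  have := p.sq_sub_le
  nlinarith [sq_abs a, sq_nonneg (|a| - 1 / 20)]

theorem one_add_sq_upper (p : NearOrbit a v) : ‖1 + v.1 ^ 2‖ ≤ 22 / 10 := by
  have h1 := norm_add_le (1 : ℂ) (v.1 ^ 2)
  rw [norm_one, norm_pow] at h1
  nlinarith [p.fst_norm, norm_nonneg v.1]

theorem one_add_sq_ne_zero (p : NearOrbit a v) : 1 + v.1 ^ 2 ≠ 0 := by
  intro h
  have := p.one_add_sq_lower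
  rw [h, norm_zero] at this
  norm_num at this

theorem snd_eq (p : NearOrbit a v) : v.2 = actionVar v * (1 + v.1 ^ 2) / 2 := by
  have := p.one_add_sq_ne_zero
  simp only [actionVar]
  field_simp

theorem snd_near (p : NearOrbit a v) : ‖v.2 - ((3 / 2 * (1 + a ^ 2) : ℝ) : ℂ)‖ ≤ 3 / 10 := by
  have e : v.2 - ((3 / 2 * (1 + a ^ 2) : ℝ) : ℂ)
      = (actionVar v - 3) * (1 + v.1 ^ 2) / 2 + 3 / 2 * (v.1 ^ 2 - (a : ℂ) ^ 2) := by
    rw [p.snd_eq]; push_cast; ring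
  rw [e]
  refine (norm_add_le _ _).trans ?_
  rw [norm_div, norm_mul, norm_mul, Complex.norm_two]
  have h3 : ‖(3 / 2 : ℂ)‖ = 3 / 2 := by norm_num
  rw [h3]
  have := p.sq_sub_le
  have := p.abs_fst_le
  have := mul_le_mul p.action p.one_add_sq_upper (norm_nonneg _) (by norm_num)
  linarith

theorem snd_re (p : NearOrbit a v) : 12 / 10 ≤ v.2.re := by
  have h1 := (abs_le'.1 ((Complex.abs_re_le_norm _).trans p.snd_near)).2
  rw [Complex.sub_re, Complex.ofReal_re] at h1
  nlinarith [sq_nonneg a]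

theorem snd_norm (p : NearOrbit a v) : ‖v.2‖ ≤ 33 / 10 := by
  have h1 := norm_add_le (v.2 - ((3 / 2 * (1 + a ^ 2) : ℝ) : ℂ)) ((3 / 2 * (1 + a ^ 2) : ℝ) : ℂ)
  rw [sub_add_cancel, Complex.norm_real, Real.norm_eq_abs, abs_of_nonneg (by positivity)] at h1
  have := p.snd_near
  have := p.abs_fst_le
  nlinarith [sq_abs a, abs_nonneg a]

theorem snd_sq_re (p : NearOrbit a v) : 12 / 10 ≤ (v.2 ^ 2).re := by
  set s := 3 / 2 * (1 + a ^ 2) with hs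
  have hs1 : 3 / 2 ≤ s := by nlinarith [sq_nonneg a]
  have e : v.2 ^ 2 = ((s ^ 2 : ℝ) : ℂ) + (2 * s * (v.2 - (s : ℝ)) + (v.2 - (s : ℝ)) ^ 2) := by
    push_cast; ring
  have h2 : ‖2 * (s : ℂ) * (v.2 - (s : ℝ)) + (v.2 - (s : ℝ)) ^ 2‖ ≤ 6 / 10 * s + 9 / 100 := by
    refine (norm_add_le _ _).trans ?_
    rw [norm_mul, norm_mul, norm_pow, Complex.norm_real, Real.norm_eq_abs, Complex.norm_two,
      abs_of_nonneg (by linarith)]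
    have := p.snd_near
    have h0 := norm_nonneg (v.2 - (s : ℂ))
    nlinarith [mul_le_mul_of_nonneg_left this (show 0 ≤ s by linarith)]
  rw [e, Complex.add_re, Complex.ofReal_re]
  have h3 := (_root_.abs_le.1 ((Complex.abs_re_le_norm _).trans h2)).1
  nlinarith

theorem increment_le (p : NearOrbit a v) {h : ℝ} (h0 : 0 < h) (h1 : h ≤ 1 / 1000) :
    ‖8 * (h : ℂ) * (h - v.2 * v.1) / (1 + v.1 ^ 2)‖ ≤ 30 * h := by
  rw [norm_div, norm_mul, norm_mul, Complex.norm_real, Real.norm_eq_abs, abs_of_pos h0,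
    div_le_iff₀ (by linarith [p.one_add_sq_lower])]
  have h8 : ‖(8 : ℂ)‖ = 8 := by norm_num
  rw [h8]
  have h2 : ‖(h : ℂ) - v.2 * v.1‖ ≤ 1 / 1000 + 33 / 10 * (21 / 20) := by
    refine (norm_sub_le _ _).trans ?_
    rw [norm_mul, Complex.norm_real, Real.norm_eq_abs, abs_of_pos h0]
    exact add_le_add h1 (mul_le_mul p.snd_norm p.fst_norm (norm_nonneg _) (by norm_num))
  nlinarith [p.one_add_sq_lower, mul_le_mul_of_nonneg_left h2 h0.le,
    mul_le_mul_of_nonneg_left p.one_add_sq_lower h0.le]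

/-- This keeps the radicand in the right half-plane, where the principal square root is analytic. -/
theorem radicand_re (p : NearOrbit a v) {h : ℝ} (h0 : 0 < h) (h1 : h ≤ 1 / 1000) :
    1 ≤ (v.2 ^ 2 + 8 * (h : ℂ) * (h - v.2 * v.1) / (1 + v.1 ^ 2)).re := by
  rw [Complex.add_re]
  have := (_root_.abs_le.1 ((Complex.abs_re_le_norm _).trans (p.increment_le h0 h1))).1
  linarith [p.snd_sq_re]

/-- The principal root has nonnegative real part and s has real part at least 1.2, so the
denominator s + s' cannot be small. -/
theorem sum_ge (p : NearOrbit a v) (h : ℂ) : 12 / 10 ≤ ‖v.2 + nextLength h v‖ := by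
  refine le_trans ?_ (Complex.re_le_norm _)
  rw [Complex.add_re]
  have := Complex.sqrt_re_nonneg (v.2 ^ 2 + 8 * h * (h - v.2 * v.1) / (1 + v.1 ^ 2))
  have := p.snd_re
  unfold nextLength
  linarith

theorem sum_ne_zero (p : NearOrbit a v) (h : ℂ) : v.2 + nextLength h v ≠ 0 := by
  intro h'
  have := p.sum_ge h
  rw [h', norm_zero] at this
  norm_num at this

/-- Eliminating u' from the two relations leaves s'²(1 + u²) = s²(1 + u²) + 8h(h - su), whose
principal root is `nextLength`. The relation `sum` then gives u'. -/
theorem stepRel (p : NearOrbit a v) (h : ℂ) : StepRel h v (tangentStep h v) := by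
  have n1 := p.one_add_sq_ne_zero
  have n2 := p.sum_ne_zero h
  have e := Complex.sqrt_sq' (v.2 ^ 2 + 8 * h * (h - v.2 * v.1) / (1 + v.1 ^ 2))
  change nextLength h v ^ 2 = _ at e
  constructor
  · simp only [tangentStep]
    field_simp
    ring
  · simp only [tangentStep]
    generalize nextLength h v = s at *
    field_simp at e ⊢
    linear_combination e

theorem analyticAt_tangentStep (p : NearOrbit a v) {h : ℝ} (h0 : 0 < h) (h1 : h ≤ 1 / 1000) :
    AnalyticAt ℂ (tangentStep h) v := by
  have n1 := p.one_add_sq_ne_zero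
  have f1 : AnalyticAt ℂ (fun v : ℂ × ℂ => v.1) v := analyticAt_fst
  have f2 : AnalyticAt ℂ (fun v : ℂ × ℂ => v.2) v := analyticAt_snd
  have hr : AnalyticAt ℂ (fun v : ℂ × ℂ =>
      v.2 ^ 2 + 8 * (h : ℂ) * (h - v.2 * v.1) / (1 + v.1 ^ 2)) v :=
    (f2.pow 2).add ((analyticAt_const.mul (analyticAt_const.sub (f2.mul f1))).div
      (analyticAt_const.add (f1.pow 2)) n1)
  have hs : AnalyticAt ℂ (nextLength (h : ℂ)) v :=
    AnalyticAt.comp (g := Complex.sqrt) (Complex.analyticAt_sqrt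
      (Or.inl (zero_lt_one.trans_le (p.radicand_re h0 h1)))) hr
  exact (f1.sub (analyticAt_const.div (f2.add hs) (p.sum_ne_zero h))).prod hs

theorem step_fst (p : NearOrbit a v) {h : ℝ} (h0 : 0 < h) :
    ‖v.1 - (tangentStep h v).1‖ ≤ 10 / 3 * h := by
  have e : v.1 - (tangentStep h v).1 = 4 * h / (v.2 + nextLength h v) := by
    simp [tangentStep]
  have h4 : ‖(4 : ℂ)‖ = 4 := by norm_num
  rw [e, norm_div, norm_mul, Complex.norm_real, Real.norm_eq_abs, abs_of_pos h0, h4,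
    div_le_iff₀ (by linarith [p.sum_ge h])]
  nlinarith [p.sum_ge h]

theorem step_bounds (p : NearOrbit a v) {h : ℝ} (h0 : 0 < h) (h1 : h ≤ 1 / 1000) :
    ‖(tangentStep h v).1‖ ≤ 11 / 10 ∧ 9 / 10 ≤ ‖1 + v.1 * (tangentStep h v).1‖ ∧
      9 / 10 ≤ ‖1 + (tangentStep h v).1 ^ 2‖ := by
  have hd := p.step_fst h0
  set u := v.1
  set u' := (tangentStep h v).1
  have hu := p.fst_norm
  have hl := p.one_add_sq_lower
  have hu' : ‖u'‖ ≤ 11 / 10 := by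
    have := norm_sub_le u (u - u')
    rw [sub_sub_cancel] at this
    linarith
  refine ⟨hu', ?_, ?_⟩
  · have e : 1 + u * u' = (1 + u ^ 2) - u * (u - u') := by ring
    have := norm_sub_norm_le (1 + u ^ 2) (u * (u - u'))
    rw [← e, norm_mul] at this
    nlinarith [norm_nonneg (u - u'), norm_nonneg u]
  · have e : 1 + u' ^ 2 = (1 + u ^ 2) - (u + u') * (u - u') := by ring
    have := norm_sub_norm_le (1 + u ^ 2) ((u + u') * (u - u'))
    rw [← e, norm_mul] at this
    have h2 := norm_add_le u u'
    nlinarith [norm_nonneg (u - u'), norm_nonneg (u + u')]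

theorem step_ne_zero (p : NearOrbit a v) {h : ℝ} (h0 : 0 < h) (h1 : h ≤ 1 / 1000) :
    1 + v.1 * (tangentStep h v).1 ≠ 0 ∧ 1 + (tangentStep h v).1 ^ 2 ≠ 0 := by
  obtain ⟨-, b, c⟩ := p.step_bounds h0 h1
  constructor
  · intro h; rw [h, norm_zero] at b; norm_num at b
  · intro h; rw [h, norm_zero] at c; norm_num at c

/-- The change of J has the closed form -2h(u + u')(u - u')²/((1 + uu')(1 + u²)(1 + u'²)). Since u -
u' is itself O(h), the change is cubic in h. -/
theorem action_step (p : NearOrbit a v) {h : ℝ} (h0 : 0 < h) (h1 : h ≤ 1 / 1000) :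
    ‖actionVar (tangentStep h v) - actionVar v‖ ≤ 100 * h ^ 3 := by
  obtain ⟨b1, b2, b3⟩ := p.step_bounds h0 h1
  obtain ⟨n2, n3⟩ := p.step_ne_zero h0 h1
  have n1 := p.one_add_sq_ne_zero
  obtain ⟨r1, r2⟩ := p.stepRel h
  have hd := p.step_fst h0
  have hu := p.fst_norm
  have hl := p.one_add_sq_lower
  set u := v.1
  set w := tangentStep h v
  set u' := w.1
  have e : actionVar w - actionVar v
      = -2 * h * (u + u') * (u - u') ^ 2 / ((1 + u * u') * (1 + u ^ 2) * (1 + u' ^ 2)) := by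
    simp only [actionVar]
    change 2 * w.2 / (1 + u' ^ 2) - 2 * v.2 / (1 + u ^ 2) = _
    rw [div_sub_div _ _ n3 n1, div_eq_div_iff (mul_ne_zero n3 n1)
      (mul_ne_zero (mul_ne_zero n2 n1) n3)]
    linear_combination ((1 + u ^ 2) * (1 + u' ^ 2)) *
      ((u + u') * (1 + u * u') * r1 + (2 + u ^ 2 + u' ^ 2) * r2)
  rw [e, norm_div]
  have hden : (9 / 10 : ℝ) * (99 / 100) * (9 / 10) ≤ ‖(1 + u * u') * (1 + u ^ 2) * (1 + u' ^ 2)‖ := by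
    rw [norm_mul, norm_mul]
    gcongr
  rw [div_le_iff₀ (lt_of_lt_of_le (by norm_num) hden)]
  have hsum : ‖u + u'‖ ≤ 22 / 10 := (norm_add_le _ _).trans (by linarith)
  have hnum : ‖-2 * (h : ℂ) * (u + u') * (u - u') ^ 2‖ ≤ 2 * h * (22 / 10) * (10 / 3 * h) ^ 2 := by
    rw [norm_mul, norm_mul, norm_mul, norm_pow, Complex.norm_real, Real.norm_eq_abs, abs_of_pos h0]
    have h2 : ‖(-2 : ℂ)‖ = 2 := by norm_num
    rw [h2]
    gcongr
  refine hnum.trans ?_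
  have h3 : 0 < h ^ 3 := by positivity
  nlinarith [mul_le_mul_of_nonneg_left hden h3.le]

theorem action_norm (p : NearOrbit a v) : ‖actionVar v‖ ≤ 31 / 10 := by
  have h1 := norm_add_le (actionVar v - 3) 3
  have h3 : ‖(3 : ℂ)‖ = 3 := by norm_num
  rw [sub_add_cancel, h3] at h1
  linarith [p.action]

/-- At fixed J one has dT = -(s/2) du. The relation (s + s')(u - u') = 4h is the trapezoidal rule
for this integral, whose error is cubic in u - u'. The change of J adds a further O(h³). -/
theorem phase_step (p : NearOrbit a v) {h : ℝ} (h0 : 0 < h) (h1 : h ≤ 1 / 1000) :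
    ‖phaseVar (tangentStep h v) - phaseVar v - h‖ ≤ 100 * h ^ 3 := by
  obtain ⟨b1, -, -⟩ := p.step_bounds h0 h1
  obtain ⟨n2, n3⟩ := p.step_ne_zero h0 h1
  have n1 := p.one_add_sq_ne_zero
  obtain ⟨r1, -⟩ := p.stepRel h
  have hd := p.step_fst h0
  have hJ := p.action_step h0 h1
  have hs := p.snd_eq
  have hu := p.fst_norm
  have hs' : (tangentStep h v).2
      = actionVar (tangentStep h v) * (1 + (tangentStep h v).1 ^ 2) / 2 := by
    simp only [actionVar]; field_simp
  have hJn := p.action_norm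
  set J := actionVar v with hJd
  set w := tangentStep h v
  set J' := actionVar w with hJd'
  set u := v.1
  set u' := w.1
  have e : phaseVar w - phaseVar v - h = -(J' - J) * (u' + u' ^ 3 / 3) / 4
      - (u - u') * (J * (u - u') ^ 2 / 6 + (J' - J) * (1 + u' ^ 2) / 2) / 4 := by
    simp only [phaseVar, ← hJd, ← hJd']
    change -(J' / 4) * (u' + u' ^ 3 / 3) - -(J / 4) * (u + u ^ 3 / 3) - h = _
    rw [hs, hs'] at r1
    linear_combination (1 / 4 : ℂ) * r1
  rw [e]
  have g1 : ‖u' + u' ^ 3 / 3‖ ≤ 2 := by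
    refine (norm_add_le _ _).trans ?_
    rw [norm_div, norm_pow]
    have h3 : ‖(3 : ℂ)‖ = 3 := by norm_num
    rw [h3]
    have : ‖u'‖ ^ 3 ≤ (11 / 10) ^ 3 := by gcongr
    linarith
  have g2 : ‖1 + u' ^ 2‖ ≤ 3 := by
    refine (norm_add_le _ _).trans ?_
    rw [norm_one, norm_pow]
    have : ‖u'‖ ^ 2 ≤ (11 / 10) ^ 2 := by gcongr
    linarith
  have t1 : ‖-(J' - J) * (u' + u' ^ 3 / 3) / 4‖ ≤ 100 * h ^ 3 * 2 / 4 := by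
    rw [norm_div, norm_mul, norm_neg]
    have h4 : ‖(4 : ℂ)‖ = 4 := by norm_num
    rw [h4]
    gcongr
  have t2 : ‖(u - u') * (J * (u - u') ^ 2 / 6 + (J' - J) * (1 + u' ^ 2) / 2) / 4‖
      ≤ (10 / 3 * h) * (31 / 10 * (10 / 3 * h) ^ 2 / 6 + 100 * h ^ 3 * 3 / 2) / 4 := by
    have h4 : ‖(4 : ℂ)‖ = 4 := by norm_num
    have h6 : ‖(6 : ℂ)‖ = 6 := by norm_num
    rw [norm_div, norm_mul, h4]
    gcongr
    refine (norm_add_le _ _).trans ?_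
    rw [norm_div, norm_mul, norm_pow, norm_div, norm_mul, h6, Complex.norm_two]
    gcongr
  refine (norm_sub_le _ _).trans ((add_le_add t1 t2).trans ?_)
  have h3 : 0 < h ^ 3 := by positivity
  nlinarith

end NearOrbit

/-- On the disc of radius 1/4 about `a` the difference quotient of the cubic stays within |a|/4 +
1/48 of 1 + a², hence is at least 10/11 in modulus. This recovers the slope from the phase. -/
theorem norm_sub_le_of_cubic {u : ℂ} {a : ℝ} (h : ‖u - a‖ ≤ 1 / 4) :
    ‖u - a‖ ≤ 11 / 10 * ‖(u + u ^ 3 / 3) - (a + (a : ℂ) ^ 3 / 3)‖ := by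
  have e : (u + u ^ 3 / 3) - (a + (a : ℂ) ^ 3 / 3)
      = (u - a) * (((1 + a ^ 2 : ℝ) : ℂ) + (a * (u - a) + (u - a) ^ 2 / 3)) := by
    push_cast; ring
  rw [e, norm_mul]
  have h1 := norm_sub_le_norm_add ((1 + a ^ 2 : ℝ) : ℂ) (a * (u - a) + (u - a) ^ 2 / 3)
  rw [Complex.norm_real, Real.norm_eq_abs, abs_of_nonneg (by positivity)] at h1
  have h2 : ‖(a : ℂ) * (u - a) + (u - a) ^ 2 / 3‖ ≤ |a| / 4 + 1 / 48 := by
    refine (norm_add_le _ _).trans ?_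
    rw [norm_mul, norm_div, norm_pow, Complex.norm_real, Real.norm_eq_abs]
    have h3 : ‖(3 : ℂ)‖ = 3 := by norm_num
    rw [h3]
    have := norm_nonneg (u - a)
    nlinarith [mul_le_mul_of_nonneg_left h (abs_nonneg a)]
  have h5 : 10 / 11 ≤ ‖((1 + a ^ 2 : ℝ) : ℂ) + (a * (u - a) + (u - a) ^ 2 / 3)‖ := by
    nlinarith [sq_abs a, sq_nonneg (|a| - 1 / 8)]
  nlinarith [norm_nonneg (u - a)]

theorem exists_cubic_root {t : ℝ} (h1 : -1 ≤ t) (h2 : t ≤ 1) :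
    ∃ a : ℝ, -1 ≤ a ∧ a ≤ 1 ∧ a + a ^ 3 / 3 = -(4 / 3) * t := by
  have hc : ContinuousOn (fun a : ℝ => a + a ^ 3 / 3) (Icc (-1) 1) := by fun_prop
  have := intermediate_value_Icc (show (-1 : ℝ) ≤ 1 by norm_num) hc
  obtain ⟨a, ha, hv⟩ := this (show -(4 / 3) * t ∈ _ by constructor <;> norm_num <;> linarith)
  exact ⟨a, ha.1, ha.2, hv⟩

/-- The bootstrap of the induction: a rough bound 1/4 on the slope, together with accurate action
and phase, improves to the bound 1/20 required by `NearOrbit`. -/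
theorem nearOrbit_of_phase {v : ℂ × ℂ} {a t : ℝ} (h1 : -1 ≤ a) (h2 : a ≤ 1)
    (ht : |t| ≤ 1) (ha : a + a ^ 3 / 3 = -(4 / 3) * t) (hu : ‖v.1 - a‖ ≤ 1 / 4)
    (hJ : ‖actionVar v - 3‖ ≤ 1 / 90) (hT : ‖phaseVar v - t‖ ≤ 1 / 90) :
    NearOrbit a v := by
  refine ⟨h1, h2, ?_, by linarith⟩
  refine (norm_sub_le_of_cubic hu).trans ?_
  have hJ0 : 289 / 100 ≤ ‖actionVar v‖ := by
    have := norm_sub_norm_le (3 : ℂ) (3 - actionVar v)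
    have h3 : ‖(3 : ℂ)‖ = 3 := by norm_num
    rw [sub_sub_cancel, h3, norm_sub_rev] at this
    linarith
  have hJn : actionVar v ≠ 0 := by
    intro h; rw [h, norm_zero] at hJ0; norm_num at hJ0
  have e : (v.1 + v.1 ^ 3 / 3) - (a + (a : ℂ) ^ 3 / 3)
      = 4 / 3 * (t * (actionVar v - 3) - 3 * (phaseVar v - t)) / actionVar v := by
    have ha' : (a : ℂ) + (a : ℂ) ^ 3 / 3 = -(4 / 3) * t := by
      have := congrArg ((↑) : ℝ → ℂ) ha
      push_cast at this
      exact this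
    rw [ha']
    simp only [phaseVar]
    generalize actionVar v = J at *
    field_simp
    ring
  have h43 : ‖(4 / 3 : ℂ)‖ = 4 / 3 := by norm_num
  have h3 : ‖(3 : ℂ)‖ = 3 := by norm_num
  have hn : ‖t * (actionVar v - 3) - 3 * (phaseVar v - t)‖ ≤ 1 * (1 / 90) + 3 * (1 / 90) := by
    refine (norm_sub_le _ _).trans ?_
    rw [norm_mul, norm_mul, h3, Complex.norm_real, Real.norm_eq_abs]
    gcongr
  have : ‖(v.1 + v.1 ^ 3 / 3) - (a + (a : ℂ) ^ 3 / 3)‖ ≤ 1 / 22 := by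
    rw [e, norm_div, norm_mul, h43, div_le_iff₀ (by linarith)]
    nlinarith
  linarith

/-- Along the orbit the action is almost constant and the phase advances uniformly. -/
theorem orbit_estimate {h : ℝ} (h0 : 0 < h) (h1 : h ≤ 1 / 2000) {t₀ a₀ : ℝ} (ht : -1 ≤ t₀)
    (ht' : t₀ ≤ 0) (ha₁ : -1 ≤ a₀) (ha₂ : a₀ ≤ 1) (ha : a₀ + a₀ ^ 3 / 3 = -(4 / 3) * t₀)
    {v : ℂ × ℂ} (hu : ‖v.1 - a₀‖ ≤ 1 / 4)
    (hJ : ‖actionVar v - 3‖ ≤ 1 / 100) (hT : ‖phaseVar v - t₀‖ ≤ 1 / 100) :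
    ∀ j : ℕ, j * h ≤ 1 → (∃ a : ℝ, a + a ^ 3 / 3 = -(4 / 3) * (t₀ + j * h) ∧
      NearOrbit a ((tangentStep h)^[j] v)) ∧
      ‖actionVar ((tangentStep h)^[j] v) - actionVar v‖ ≤ 100 * j * h ^ 3 ∧
      ‖phaseVar ((tangentStep h)^[j] v) - phaseVar v - j * h‖ ≤ 100 * j * h ^ 3 := by
  intro j
  induction j with
  | zero =>
    intro _
    refine ⟨⟨a₀, by simpa using ha, nearOrbit_of_phase ha₁ ha₂ ?_ ha hu ?_ ?_⟩, ?_, ?_⟩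
    · exact abs_le.2 ⟨ht, by linarith⟩
    · simp only [Function.iterate_zero, id]; linarith
    · simp only [Function.iterate_zero, id]; linarith
    · simp
    · simp
  | succ j ih =>
    intro hj
    push_cast at hj
    obtain ⟨⟨a, ha', p⟩, iJ, iT⟩ := ih (by linarith)
    rw [Function.iterate_succ_apply']
    set w := (tangentStep h)^[j] v
    have sJ := p.action_step h0 (by linarith)
    have sT := p.phase_step h0 (by linarith)
    have su := p.step_fst h0
    have J1 : ‖actionVar (tangentStep h w) - actionVar v‖ ≤ 100 * (j + 1 : ℕ) * h ^ 3 := by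
      have := norm_sub_le_norm_sub_add_norm_sub (actionVar (tangentStep h w)) (actionVar w)
        (actionVar v)
      push_cast
      linarith
    have T1 : ‖phaseVar (tangentStep h w) - phaseVar v - (j + 1 : ℕ) * h‖
        ≤ 100 * (j + 1 : ℕ) * h ^ 3 := by
      have e : phaseVar (tangentStep h w) - phaseVar v - (j + 1 : ℕ) * h
        = (phaseVar (tangentStep h w) - phaseVar w - h) + (phaseVar w - phaseVar v - j * h) := by
        push_cast; ring
      rw [e]
      refine (norm_add_le _ _).trans ?_
      push_cast
      linarith
    refine ⟨?_, J1, T1⟩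
    -- Since (j + 1)h ≤ 1, the accumulated error is at most 100h². It fits into the gap between the
    -- bounds 1/100 and 1/90.
    have small : 100 * (j + 1 : ℕ) * h ^ 3 ≤ 1 / 1000 := by
      push_cast
      have : ((j : ℝ) + 1) * h * (100 * h ^ 2) ≤ 1 * (100 * h ^ 2) := by
        gcongr
      nlinarith
    obtain ⟨a', l', r', hv'⟩ := exists_cubic_root (t := t₀ + (j + 1 : ℕ) * h)
      (by have : (0 : ℝ) ≤ (j + 1 : ℕ) * h := by positivity
          linarith) (by push_cast; linarith)
    refine ⟨a', hv', nearOrbit_of_phase l' r' ?_ hv' ?_ ?_ ?_⟩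
    · refine abs_le.2 ⟨?_, by push_cast; linarith⟩
      have : (0 : ℝ) ≤ (j + 1 : ℕ) * h := by positivity
      linarith
    -- The cubic a + a³/3 has difference quotients at least 1, so the slope of the leading order
    -- orbit moves by at most 4h/3 per step.
    · have hdiff : |a - a'| ≤ 4 / 3 * h := by
        have e : (a - a') * (1 + (a ^ 2 + a * a' + a' ^ 2) / 3) = 4 / 3 * h := by
          push_cast at hv'
          linear_combination ha' - hv'
        have q : 0 ≤ a ^ 2 + a * a' + a' ^ 2 := by nlinarith [sq_nonneg (a + a'), sq_nonneg (a - a')]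
        have pos : 0 ≤ a - a' := by
          by_contra hneg
          push Not at hneg
          nlinarith
        rw [abs_of_nonneg pos]
        nlinarith
      have e : (tangentStep h w).1 - a' = (w.1 - a) - (w.1 - (tangentStep h w).1)
          + ((a - a' : ℝ) : ℂ) := by
        push_cast; ring
      rw [e]
      refine (norm_add_le _ _).trans ?_
      have := norm_sub_le (w.1 - (a : ℂ)) (w.1 - (tangentStep h w).1)
      rw [Complex.norm_real, Real.norm_eq_abs]
      have := p.fst
      linarith
    · have := norm_sub_le_norm_sub_add_norm_sub (actionVar (tangentStep h w)) (actionVar v) 3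
      linarith
    · have e : phaseVar (tangentStep h w) - ((t₀ + (j + 1 : ℕ) * h : ℝ) : ℂ)
        = (phaseVar (tangentStep h w) - phaseVar v - (j + 1 : ℕ) * h) + (phaseVar v - t₀) := by
        push_cast; ring
      rw [e]
      exact (norm_add_le _ _).trans (by linarith)

/-! ### Passing to tangent coordinates -/

/-- The tangent coordinates of a point of the plane. -/
noncomputable def tangentCoord (h : ℂ) (w : ℂ × ℂ) : ℂ × ℂ :=
  ((h * w.2 - Complex.sqrt (w.1 ^ 2 + w.2 ^ 2 - h ^ 2) * w.1) /
      (w.1 ^ 2 + w.2 ^ 2 - h * w.1 - Complex.sqrt (w.1 ^ 2 + w.2 ^ 2 - h ^ 2) * w.2),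
    Complex.sqrt (w.1 ^ 2 + w.2 ^ 2 - h ^ 2))

theorem Complex.sqrt_sq_of_re_pos {z : ℂ} (hz : 0 < z.re) : Complex.sqrt (z ^ 2) = z :=
  Complex.sq_cpow_two_inv hz

theorem chart_tangentCoord {h : ℂ} {w : ℂ × ℂ} (h1 : w.1 ^ 2 + w.2 ^ 2 ≠ 0)
    (h2 : w.1 ^ 2 + w.2 ^ 2 - h * w.1 - Complex.sqrt (w.1 ^ 2 + w.2 ^ 2 - h ^ 2) * w.2 ≠ 0) :
    chart h (tangentCoord h w) = w ∧ 1 + (tangentCoord h w).1 ^ 2 ≠ 0 := by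
  have hs := Complex.sqrt_sq' (w.1 ^ 2 + w.2 ^ 2 - h ^ 2)
  obtain ⟨x, y⟩ := w
  simp only [tangentCoord, chart] at *
  generalize Complex.sqrt (x ^ 2 + y ^ 2 - h ^ 2) = S at *
  set D := x ^ 2 + y ^ 2 - h * x - S * y with hD
  set N := h * y - S * x with hN
  -- N/D is u = sin θ/(1 - cos θ) for the contact point at angle θ. The identity is the half-angle
  -- formula, and it needs only S² = x² + y² - h².
  have key : D ^ 2 + N ^ 2 = 2 * (x ^ 2 + y ^ 2) * D := by
    rw [hD, hN]; linear_combination (x ^ 2 + y ^ 2) * hs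
  have k1 : 1 + (N / D) ^ 2 = 2 * (x ^ 2 + y ^ 2) / D := by
    field_simp; linear_combination key
  have k0 : (2 : ℂ) * (x ^ 2 + y ^ 2) / D ≠ 0 := div_ne_zero (mul_ne_zero two_ne_zero h1) h2
  have k2 : (N / D) ^ 2 - 1 = 2 * (x ^ 2 + y ^ 2) / D - 2 := by linear_combination k1
  refine ⟨?_, by rw [k1]; exact k0⟩
  ext
  · simp only
    rw [k1, k2, div_eq_iff k0]
    field_simp
    rw [hD, hN]
    linear_combination x * hs
  · simp only
    rw [k1, k2, div_eq_iff k0]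
    field_simp
    rw [hD, hN]
    linear_combination y * hs

theorem chart_sq_add_sq {h : ℂ} {v : ℂ × ℂ} (h1 : 1 + v.1 ^ 2 ≠ 0) :
    (chart h v).1 ^ 2 + (chart h v).2 ^ 2 = v.2 ^ 2 + h ^ 2 := by
  simp only [chart]
  field_simp
  ring

theorem tangentCoord_chart {h : ℂ} {v : ℂ × ℂ} (h1 : 1 + v.1 ^ 2 ≠ 0)
    (h2 : v.2 ^ 2 + h ^ 2 ≠ 0) (h3 : 0 < v.2.re) : tangentCoord h (chart h v) = v := by
  have hs : Complex.sqrt ((chart h v).1 ^ 2 + (chart h v).2 ^ 2 - h ^ 2) = v.2 := by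
    rw [chart_sq_add_sq h1, add_sub_cancel_right, Complex.sqrt_sq_of_re_pos h3]
  have hD : (chart h v).1 ^ 2 + (chart h v).2 ^ 2 - h * (chart h v).1 - v.2 * (chart h v).2
      = (v.2 ^ 2 + h ^ 2) * 2 / (1 + v.1 ^ 2) := by
    rw [chart_sq_add_sq h1]
    simp only [chart]
    field_simp
    ring
  ext
  · simp only [tangentCoord]
    rw [hs, hD, div_eq_iff (div_ne_zero (mul_ne_zero h2 two_ne_zero) h1)]
    simp only [chart]
    field_simp
    ring
  · simp only [tangentCoord]
    rw [hs]

theorem analyticAt_tangentCoord {h : ℂ} {w : ℂ × ℂ}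
    (h1 : w.1 ^ 2 + w.2 ^ 2 - h ^ 2 ∈ Complex.slitPlane)
    (h2 : w.1 ^ 2 + w.2 ^ 2 - h * w.1 - Complex.sqrt (w.1 ^ 2 + w.2 ^ 2 - h ^ 2) * w.2 ≠ 0) :
    AnalyticAt ℂ (fun p : ℂ × ℂ × ℂ => tangentCoord p.1 p.2) (h, w) := by
  have f1 : AnalyticAt ℂ (fun p : ℂ × ℂ × ℂ => p.1) (h, w) := analyticAt_fst
  have f2 : AnalyticAt ℂ (fun p : ℂ × ℂ × ℂ => p.2.1) (h, w) :=
    AnalyticAt.comp (g := Prod.fst) analyticAt_fst analyticAt_snd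
  have f3 : AnalyticAt ℂ (fun p : ℂ × ℂ × ℂ => p.2.2) (h, w) :=
    AnalyticAt.comp (g := Prod.snd) analyticAt_snd analyticAt_snd
  have hs : AnalyticAt ℂ (fun p : ℂ × ℂ × ℂ =>
      Complex.sqrt (p.2.1 ^ 2 + p.2.2 ^ 2 - p.1 ^ 2)) (h, w) :=
    AnalyticAt.comp (g := Complex.sqrt) (Complex.analyticAt_sqrt h1)
      (((f2.pow 2).add (f3.pow 2)).sub (f1.pow 2))
  exact (((f1.mul f3).sub (hs.mul f2)).div
    ((((f2.pow 2).add (f3.pow 2)).sub (f1.mul f2)).sub (hs.mul f3)) h2).prod hs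

theorem analyticAt_chart {h : ℂ} {v : ℂ × ℂ} (h1 : 1 + v.1 ^ 2 ≠ 0) :
    AnalyticAt ℂ (fun p : ℂ × ℂ × ℂ => chart p.1 p.2) (h, v) := by
  have f1 : AnalyticAt ℂ (fun p : ℂ × ℂ × ℂ => p.1) (h, v) := analyticAt_fst
  have f2 : AnalyticAt ℂ (fun p : ℂ × ℂ × ℂ => p.2.1) (h, v) :=
    AnalyticAt.comp (g := Prod.fst) analyticAt_fst analyticAt_snd
  have f3 : AnalyticAt ℂ (fun p : ℂ × ℂ × ℂ => p.2.2) (h, v) :=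
    AnalyticAt.comp (g := Prod.snd) analyticAt_snd analyticAt_snd
  have hd : AnalyticAt ℂ (fun p : ℂ × ℂ × ℂ => 1 + p.2.1 ^ 2) (h, v) :=
    analyticAt_const.add (f2.pow 2)
  exact (((f1.mul ((f2.pow 2).sub analyticAt_const)).sub
      ((analyticAt_const.mul f2).mul f3)).div hd h1).prod
    ((((analyticAt_const.mul f1).mul f2).add (f3.mul ((f2.pow 2).sub analyticAt_const))).div hd h1)

theorem analyticAt_actionVar {v : ℂ × ℂ} (h1 : 1 + v.1 ^ 2 ≠ 0) :
    AnalyticAt ℂ actionVar v := by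
  have f1 : AnalyticAt ℂ (fun v : ℂ × ℂ => v.1) v := analyticAt_fst
  have f2 : AnalyticAt ℂ (fun v : ℂ × ℂ => v.2) v := analyticAt_snd
  exact (analyticAt_const.mul f2).div (analyticAt_const.add (f1.pow 2)) h1

theorem analyticAt_phaseVar {v : ℂ × ℂ} (h1 : 1 + v.1 ^ 2 ≠ 0) :
    AnalyticAt ℂ phaseVar v := by
  have f1 : AnalyticAt ℂ (fun v : ℂ × ℂ => v.1) v := analyticAt_fst
  exact (((analyticAt_actionVar h1).div analyticAt_const (by norm_num)).neg).mul
    (f1.add ((f1.pow 3).div analyticAt_const (by norm_num)))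

/-! ### The inverse of the cubic polynomial -/

/-- The cubic polynomial that relates phase and slope. -/
noncomputable def slopeCubic (u : ℂ) : ℂ := u + u ^ 3 / 3

theorem hasDerivAt_slopeCubic (u : ℂ) : HasDerivAt slopeCubic (1 + u ^ 2) u := by
  refine ((hasDerivAt_id u).add (((hasDerivAt_id u).pow 3).div_const 3)).congr_deriv ?_
  simp only [id]
  push_cast
  ring

theorem analyticAt_slopeCubic (u : ℂ) : AnalyticAt ℂ slopeCubic u :=
  analyticAt_id.add ((analyticAt_id.pow 3).div analyticAt_const (by norm_num))

theorem one_add_real_sq_ne (b : ℝ) : (1 : ℂ) + (b : ℂ) ^ 2 ≠ 0 := by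
  have : ((1 + b ^ 2 : ℝ) : ℂ) ≠ 0 := Complex.ofReal_ne_zero.2 (by positivity)
  simpa using this

theorem deriv_slopeCubic_ne (b : ℝ) : deriv slopeCubic b ≠ 0 := by
  rw [(hasDerivAt_slopeCubic b).deriv]
  exact one_add_real_sq_ne b

/-- The local inverse of the cubic near the real number `b`. -/
noncomputable def slopeInv (b : ℝ) : ℂ → ℂ :=
  HasStrictDerivAt.localInverse slopeCubic (deriv slopeCubic b) b
    (analyticAt_slopeCubic b).hasStrictDerivAt (deriv_slopeCubic_ne b)

theorem analyticAt_slopeInv (b : ℝ) : AnalyticAt ℂ (slopeInv b) (slopeCubic b) :=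
  (analyticAt_slopeCubic b).analyticAt_localInverse (deriv_slopeCubic_ne b)

theorem slopeInv_apply (b : ℝ) : slopeInv b (slopeCubic b) = b :=
  HasStrictFDerivAt.localInverse_apply_image ..

theorem slopeCubic_slopeInv (b : ℝ) : ∀ᶠ y in 𝓝 (slopeCubic b), slopeCubic (slopeInv b y) = y :=
  HasStrictDerivAt.eventually_right_inverse (analyticAt_slopeCubic b).hasStrictDerivAt
    (deriv_slopeCubic_ne b)

/-- The difference quotient is 1 + b² + r/3 with |r| ≤ 0.63, hence nonzero. Injectivity identifies
the slope reached by the iteration with the value of the local inverse `slopeInv`. -/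
theorem slopeCubic_injOn {b : ℝ} {u u' : ℂ} (hb : |b| ≤ 1) (h : ‖u - b‖ ≤ 1 / 10)
    (h' : ‖u' - b‖ ≤ 1 / 10) (e : slopeCubic u = slopeCubic u') : u = u' := by
  set r : ℂ := 3 * b * (u - b) + 3 * b * (u' - b) + (u - b) * (u - b) + (u - b) * (u' - b)
    + (u' - b) * (u' - b) with hr
  have f : (u - u') * (((1 + b ^ 2 : ℝ) : ℂ) + r / 3) = 0 := by
    simp only [slopeCubic] at e
    rw [hr]
    push_cast
    linear_combination e
  rcases mul_eq_zero.1 f with f | f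
  · exact sub_eq_zero.1 f
  · exfalso
    have h3 : ‖(3 : ℂ)‖ = 3 := by norm_num
    have hbc : ‖(b : ℂ)‖ ≤ 1 := by rwa [Complex.norm_real, Real.norm_eq_abs]
    have b1 : ‖r‖ ≤ 3 * 1 * (1 / 10) + 3 * 1 * (1 / 10) + 1 / 10 * (1 / 10) + 1 / 10 * (1 / 10)
        + 1 / 10 * (1 / 10) := by
      rw [hr]
      refine (norm_add_le _ _).trans (add_le_add ((norm_add_le _ _).trans (add_le_add
        ((norm_add_le _ _).trans (add_le_add ((norm_add_le _ _).trans (add_le_add ?_ ?_)) ?_))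
          ?_)) ?_)
      all_goals simp only [norm_mul, h3]
      all_goals gcongr
    have b2 := norm_sub_le_norm_add ((1 + b ^ 2 : ℝ) : ℂ) (r / 3)
    rw [f, norm_zero, norm_div, h3, Complex.norm_real, Real.norm_eq_abs,
      abs_of_nonneg (by positivity)] at b2
    nlinarith [sq_nonneg b]

/-! ### A quarter of the return map -/

/-- The point of the plane with given action and phase, with slope near `b`. -/
noncomputable def ofActionPhase (b : ℝ) (p : ℂ × ℂ × ℂ) : ℂ × ℂ :=
  chart p.1 (slopeInv b (-4 * p.2.2 / p.2.1),
    p.2.1 * (1 + slopeInv b (-4 * p.2.2 / p.2.1) ^ 2) / 2)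

/-- The iterated map, in the plane. -/
noncomputable def leg (m : ℕ) (h : ℂ) (w : ℂ × ℂ) : ℂ × ℂ :=
  chart h ((tangentStep h)^[m] (tangentCoord h w))

/-- The adiabatic approximation of the iterated map, with total time `t`. -/
noncomputable def legLimit (b : ℝ) (h t : ℂ) (w : ℂ × ℂ) : ℂ × ℂ :=
  ofActionPhase b (h, actionVar (tangentCoord h w), phaseVar (tangentCoord h w) + t)

theorem analyticAt_ofActionPhase (b : ℝ) :
    AnalyticAt ℂ (ofActionPhase b) (0, 3, -(3 / 4) * slopeCubic b) := by
  set p₀ : ℂ × ℂ × ℂ := (0, 3, -(3 / 4) * slopeCubic b)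
  have f1 : AnalyticAt ℂ (fun p : ℂ × ℂ × ℂ => p.1) p₀ := analyticAt_fst
  have f2 : AnalyticAt ℂ (fun p : ℂ × ℂ × ℂ => p.2.1) p₀ :=
    AnalyticAt.comp (g := Prod.fst) analyticAt_fst analyticAt_snd
  have f3 : AnalyticAt ℂ (fun p : ℂ × ℂ × ℂ => p.2.2) p₀ :=
    AnalyticAt.comp (g := Prod.snd) analyticAt_snd analyticAt_snd
  have e : -4 * p₀.2.2 / p₀.2.1 = slopeCubic b := by
    change -4 * (-(3 / 4) * slopeCubic b) / 3 = _
    ring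
  have hu : AnalyticAt ℂ (fun p : ℂ × ℂ × ℂ => slopeInv b (-4 * p.2.2 / p.2.1)) p₀ := by
    refine AnalyticAt.comp (g := slopeInv b) (f := fun p : ℂ × ℂ × ℂ => -4 * p.2.2 / p.2.1) ?_
      ((analyticAt_const.mul f3).div f2 (by change (3 : ℂ) ≠ 0; norm_num))
    rw [e]
    exact analyticAt_slopeInv b
  have hS := (f2.mul ((analyticAt_const (v := (1 : ℂ))).add (hu.pow 2))).div
    (analyticAt_const (v := (2 : ℂ))) two_ne_zero
  refine AnalyticAt.comp (g := fun p : ℂ × ℂ × ℂ => chart p.1 p.2)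
    (f := fun p : ℂ × ℂ × ℂ => (p.1, slopeInv b (-4 * p.2.2 / p.2.1),
    p.2.1 * (1 + slopeInv b (-4 * p.2.2 / p.2.1) ^ 2) / 2)) ?_ (f1.prod (hu.prod hS))
  refine analyticAt_chart ?_
  simp only [e, slopeInv_apply]
  exact one_add_real_sq_ne b

theorem tangentCoord_denom_chart_ne {h : ℂ} {v : ℂ × ℂ} (h1 : 1 + v.1 ^ 2 ≠ 0)
    (h2 : v.2 ^ 2 + h ^ 2 ≠ 0) (h3 : 0 < v.2.re) :
    (chart h v).1 ^ 2 + (chart h v).2 ^ 2 - h * (chart h v).1 -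
      Complex.sqrt ((chart h v).1 ^ 2 + (chart h v).2 ^ 2 - h ^ 2) * (chart h v).2 ≠ 0 := by
  rw [chart_sq_add_sq h1, add_sub_cancel_right, Complex.sqrt_sq_of_re_pos h3]
  have hD : v.2 ^ 2 + h ^ 2 - h * (chart h v).1 - v.2 * (chart h v).2
      = (v.2 ^ 2 + h ^ 2) * 2 / (1 + v.1 ^ 2) := by
    simp only [chart]
    field_simp
    ring
  rw [hD]
  exact div_ne_zero (mul_ne_zero h2 two_ne_zero) h1

theorem analyticAt_tangentCoord_chart {h : ℂ} {v : ℂ × ℂ} (h1 : 1 + v.1 ^ 2 ≠ 0)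
    (h2 : v.2 ^ 2 + h ^ 2 ≠ 0) (h3 : 0 < v.2.re) (h4 : v.2 ^ 2 ∈ Complex.slitPlane) :
    AnalyticAt ℂ (fun p : ℂ × ℂ × ℂ => tangentCoord p.1 p.2) (h, chart h v) := by
  refine analyticAt_tangentCoord ?_ (tangentCoord_denom_chart_ne h1 h2 h3)
  rwa [chart_sq_add_sq h1, add_sub_cancel_right]

/-- The initial data of a leg: at phase `t₀` the slope is `a₀`, and one unit of time later it
is `b`. -/
structure LegData (t₀ a₀ b : ℝ) : Prop where
  phase_lower : -1 ≤ t₀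
  phase_upper : t₀ ≤ 0
  start_lower : -1 ≤ a₀
  start_upper : a₀ ≤ 1
  finish : |b| ≤ 1
  start_cubic : a₀ + a₀ ^ 3 / 3 = -(4 / 3) * t₀
  finish_cubic : b + b ^ 3 / 3 = -(4 / 3) * (t₀ + 1)

/-- The tangent coordinates of the initial point of a leg. -/
noncomputable def legStart (a₀ : ℝ) : ℂ × ℂ := (a₀, ((3 / 2 * (1 + a₀ ^ 2) : ℝ) : ℂ))

theorem tangentCoord_legStart (a₀ : ℝ) :
    tangentCoord 0 (chart 0 (legStart a₀)) = legStart a₀ := by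
  refine tangentCoord_chart (one_add_real_sq_ne a₀) ?_ ?_
  · have : ((3 / 2 * (1 + a₀ ^ 2) : ℝ) : ℂ) ≠ 0 := Complex.ofReal_ne_zero.2 (by positivity)
    simpa [legStart] using this
  · simp only [legStart, Complex.ofReal_re]; positivity

theorem analyticAt_tangentCoord_legStart (a₀ : ℝ) :
    AnalyticAt ℂ (fun p : ℂ × ℂ × ℂ => tangentCoord p.1 p.2) (0, chart 0 (legStart a₀)) := by
  have h : ((3 / 2 * (1 + a₀ ^ 2) : ℝ) : ℂ) ≠ 0 := Complex.ofReal_ne_zero.2 (by positivity)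
  refine analyticAt_tangentCoord_chart (one_add_real_sq_ne a₀) ?_ ?_ ?_
  · simpa [legStart] using h
  · simp only [legStart, Complex.ofReal_re]; positivity
  · simp only [legStart]
    rw [← Complex.ofReal_pow]
    exact Complex.ofReal_mem_slitPlane.2 (by positivity)

theorem actionVar_legStart (a₀ : ℝ) : actionVar (legStart a₀) = 3 := by
  have := one_add_real_sq_ne a₀
  simp only [actionVar, legStart]
  push_cast
  field_simp

theorem LegData.phaseVar_legStart {t₀ a₀ b : ℝ} (d : LegData t₀ a₀ b) :
    phaseVar (legStart a₀) = t₀ := by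
  rw [phaseVar, actionVar_legStart]
  simp only [legStart]
  have := congrArg ((↑) : ℝ → ℂ) d.start_cubic
  push_cast at this
  rw [this]
  ring

theorem LegData.slopeCubic_finish {t₀ a₀ b : ℝ} (d : LegData t₀ a₀ b) :
    -(3 / 4) * slopeCubic b = t₀ + 1 := by
  have := congrArg ((↑) : ℝ → ℂ) d.finish_cubic
  push_cast at this
  rw [slopeCubic, this]
  ring

theorem LegData.analyticAt_legLimit {t₀ a₀ b : ℝ} (d : LegData t₀ a₀ b) :
    AnalyticAt ℂ (fun p : ℂ × ℂ × ℂ × ℂ => legLimit b p.1 p.2.1 p.2.2)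
      (0, 1, chart 0 (legStart a₀)) := by
  set p₀ : ℂ × ℂ × ℂ × ℂ := (0, 1, chart 0 (legStart a₀))
  have f1 : AnalyticAt ℂ (fun p : ℂ × ℂ × ℂ × ℂ => p.1) p₀ := analyticAt_fst
  have f2 : AnalyticAt ℂ (fun p : ℂ × ℂ × ℂ × ℂ => p.2.1) p₀ :=
    AnalyticAt.comp (g := Prod.fst) analyticAt_fst analyticAt_snd
  have f3 : AnalyticAt ℂ (fun p : ℂ × ℂ × ℂ × ℂ => p.2.2) p₀ :=
    AnalyticAt.comp (g := Prod.snd) analyticAt_snd analyticAt_snd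
  have hT : AnalyticAt ℂ (fun p : ℂ × ℂ × ℂ × ℂ => tangentCoord p.1 p.2.2) p₀ :=
    AnalyticAt.comp (g := fun p : ℂ × ℂ × ℂ => tangentCoord p.1 p.2)
      (f := fun p : ℂ × ℂ × ℂ × ℂ => (p.1, p.2.2))
      (analyticAt_tangentCoord_legStart a₀) (f1.prod f3)
  have e : tangentCoord p₀.1 p₀.2.2 = legStart a₀ := tangentCoord_legStart a₀
  have h1 : 1 + (tangentCoord p₀.1 p₀.2.2).1 ^ 2 ≠ 0 := by
    rw [e]; exact one_add_real_sq_ne a₀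
  have hA : AnalyticAt ℂ (fun p : ℂ × ℂ × ℂ × ℂ => actionVar (tangentCoord p.1 p.2.2)) p₀ :=
    AnalyticAt.comp (g := actionVar) (analyticAt_actionVar h1) hT
  have hP : AnalyticAt ℂ (fun p : ℂ × ℂ × ℂ × ℂ => phaseVar (tangentCoord p.1 p.2.2)) p₀ :=
    AnalyticAt.comp (g := phaseVar) (analyticAt_phaseVar h1) hT
  refine AnalyticAt.comp (g := ofActionPhase b)
    (f := fun p : ℂ × ℂ × ℂ × ℂ => (p.1, actionVar (tangentCoord p.1 p.2.2),
      phaseVar (tangentCoord p.1 p.2.2) + p.2.1)) ?_ (f1.prod (hA.prod (hP.add f2)))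
  simp only [e]
  rw [actionVar_legStart, d.phaseVar_legStart, ← d.slopeCubic_finish]
  exact analyticAt_ofActionPhase b

theorem LegData.legLimit_base {t₀ a₀ b : ℝ} (d : LegData t₀ a₀ b) :
    legLimit b 0 1 (chart 0 (legStart a₀)) = chart 0 (legStart b) := by
  have h1 := actionVar_legStart a₀
  have h2 := d.phaseVar_legStart
  have h3 := d.slopeCubic_finish
  have h4 := slopeInv_apply b
  rw [legLimit, tangentCoord_legStart, ofActionPhase]
  simp only
  rw [h1, h2, ← h3, show -4 * (-(3 / 4) * slopeCubic b) / 3 = slopeCubic b by ring, h4, legStart]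
  push_cast
  ring_nf

theorem LegData.eventually_start {t₀ a₀ b : ℝ} (d : LegData t₀ a₀ b) {δ' : ℝ} (hδ'0 : 0 < δ') :
    ∀ᶠ p : ℂ × ℂ × ℂ in 𝓝 (0, chart 0 (legStart a₀)),
      ‖(tangentCoord p.1 p.2).1 - a₀‖ < 1 / 4 ∧
      ‖actionVar (tangentCoord p.1 p.2) - 3‖ < δ' ∧ ‖phaseVar (tangentCoord p.1 p.2) - t₀‖ < δ' ∧
      0 < (p.2.1 ^ 2 + p.2.2 ^ 2 - p.1 ^ 2).re ∧ p.2.1 ^ 2 + p.2.2 ^ 2 ≠ 0 ∧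
      (p.2.1 ^ 2 + p.2.2 ^ 2 - p.1 * p.2.1 -
        Complex.sqrt (p.2.1 ^ 2 + p.2.2 ^ 2 - p.1 ^ 2) * p.2.2 ≠ 0) ∧
      AnalyticAt ℂ (fun p : ℂ × ℂ × ℂ => tangentCoord p.1 p.2) p := by
  set q₀ : ℂ × ℂ × ℂ := (0, chart 0 (legStart a₀)) with hq₀
  have hcoord := (analyticAt_tangentCoord_legStart a₀).continuousAt
  have ne0 : 1 + (tangentCoord 0 (chart 0 (legStart a₀))).1 ^ 2 ≠ 0 := by
    rw [tangentCoord_legStart]; exact one_add_real_sq_ne a₀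
  have cA : ContinuousAt (fun p : ℂ × ℂ × ℂ => actionVar (tangentCoord p.1 p.2)) q₀ :=
    ContinuousAt.comp (g := actionVar) (analyticAt_actionVar ne0).continuousAt hcoord
  have cP : ContinuousAt (fun p : ℂ × ℂ × ℂ => phaseVar (tangentCoord p.1 p.2)) q₀ :=
    ContinuousAt.comp (g := phaseVar) (analyticAt_phaseVar ne0).continuousAt hcoord
  have vA : actionVar (tangentCoord q₀.1 q₀.2) = 3 := by
    rw [hq₀, tangentCoord_legStart, actionVar_legStart]
  have vP : phaseVar (tangentCoord q₀.1 q₀.2) = t₀ := by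
    rw [hq₀, tangentCoord_legStart, d.phaseVar_legStart]
  have vF : (tangentCoord q₀.1 q₀.2).1 = a₀ := by
    rw [hq₀, tangentCoord_legStart]; rfl
  have lt_of (f : ℂ × ℂ × ℂ → ℂ) (y : ℂ) (hf : ContinuousAt f q₀) (hy : f q₀ = y) {r : ℝ}
      (hr : 0 < r) : ∀ᶠ p in 𝓝 q₀, ‖f p - y‖ < r := by
    have := hf.eventually (p := fun z => ‖z - y‖ < r) (by
      rw [hy]; filter_upwards [Metric.ball_mem_nhds y hr] with z hz; simpa [dist_eq_norm] using hz)
    exact this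
  have hre : ContinuousAt (fun p : ℂ × ℂ × ℂ => (p.2.1 ^ 2 + p.2.2 ^ 2 - p.1 ^ 2).re) q₀ := by
    fun_prop
  have hden : ContinuousAt (fun p : ℂ × ℂ × ℂ => p.2.1 ^ 2 + p.2.2 ^ 2) q₀ := by fun_prop
  have vsq : (chart 0 (legStart a₀)).1 ^ 2 + (chart 0 (legStart a₀)).2 ^ 2
      = ((3 / 2 * (1 + a₀ ^ 2)) ^ 2 : ℝ) := by
    rw [chart_sq_add_sq (one_add_real_sq_ne a₀)]
    simp [legStart]
  have hpos : (0 : ℝ) < (3 / 2 * (1 + a₀ ^ 2)) ^ 2 := by positivity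
  refine (lt_of _ _ hcoord.fst vF (by norm_num)).and ((lt_of _ _ cA vA hδ'0).and
    ((lt_of _ _ cP vP hδ'0).and ((continuousAt_const.eventually_lt hre ?_).and
    ((hden.eventually_ne ?_).and ?_))))
  · change 0 < ((chart 0 (legStart a₀)).1 ^ 2 + (chart 0 (legStart a₀)).2 ^ 2 - 0 ^ 2).re
    rw [vsq, zero_pow two_ne_zero, sub_zero, Complex.ofReal_re]
    exact hpos
  · change (chart 0 (legStart a₀)).1 ^ 2 + (chart 0 (legStart a₀)).2 ^ 2 ≠ 0
    rw [vsq]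
    exact Complex.ofReal_ne_zero.2 hpos.ne'
  · refine Filter.Eventually.and ?_ (analyticAt_tangentCoord_legStart a₀).eventually_analyticAt
    refine ContinuousAt.eventually_ne ?_ ?_
    · refine ((by fun_prop : ContinuousAt (fun p : ℂ × ℂ × ℂ => p.2.1 ^ 2 + p.2.2 ^ 2
        - p.1 * p.2.1) q₀)).sub (ContinuousAt.mul ?_ (by fun_prop))
      exact hcoord.snd
    · have hS : ((3 / 2 * (1 + a₀ ^ 2) : ℝ) : ℂ) ≠ 0 := Complex.ofReal_ne_zero.2 (by positivity)
      refine tangentCoord_denom_chart_ne (one_add_real_sq_ne a₀) ?_ ?_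
      · simpa [legStart] using hS
      · simp only [legStart, Complex.ofReal_re]; positivity

/-- All steps of the iteration that starts at `w` stay near the leading order orbit. -/
structure GoodLeg (a₀ b : ℝ) (m : ℕ) (h : ℝ) (w : ℂ × ℂ) : Prop where
  chart_coord : chart (h : ℂ) (tangentCoord h w) = w
  radicand_re : 0 < (w.1 ^ 2 + w.2 ^ 2 - (h : ℂ) ^ 2).re
  start : ‖(tangentCoord h w).1 - a₀‖ ≤ 1 / 4
  finish : ‖((tangentStep h)^[m] (tangentCoord h w)).1 - b‖ ≤ 1 / 10
  near : ∀ j ≤ m, ∃ a : ℝ, NearOrbit a ((tangentStep h)^[j] (tangentCoord h w))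

/-- Errors of size 100h³ per step, over at most 1/h steps, change action and phase by at most 100h².
The map `ofActionPhase` is Lipschitz near the final data, so the leg differs from its adiabatic
limit by O(h²), uniformly on a complex ball. -/
theorem LegData.eventually_estimate {t₀ a₀ b : ℝ} (d : LegData t₀ a₀ b) :
    ∃ ε > (0 : ℝ), ∃ K > (0 : ℝ), ∃ h₁ > (0 : ℝ), ∀ h : ℝ, 0 < h → h < h₁ → ∀ m : ℕ, m * h ≤ 1 →
      1 - h ≤ m * h → ∀ w : ℂ × ℂ, ‖w - chart 0 (legStart a₀)‖ < ε →
      AnalyticAt ℂ (leg m h) w ∧ ‖leg m h w - legLimit b h (m * h) w‖ ≤ K * h ^ 2 ∧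
      GoodLeg a₀ b m h w := by
  set p₀ : ℂ × ℂ × ℂ := (0, 3, -(3 / 4) * slopeCubic b) with hp₀
  obtain ⟨K, U, hU, hK⟩ :=
    ((analyticAt_ofActionPhase b).contDiffAt (n := 1)).exists_lipschitzOnWith
  have hquot : ContinuousAt (fun p : ℂ × ℂ × ℂ => -4 * p.2.2 / p.2.1) p₀ := by
    refine ContinuousAt.div (by fun_prop) (by fun_prop) ?_
    change (3 : ℂ) ≠ 0
    norm_num
  have e₀ : -4 * p₀.2.2 / p₀.2.1 = slopeCubic b := by
    change -4 * (-(3 / 4) * slopeCubic b) / 3 = _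
    ring
  have E1 : ∀ᶠ p in 𝓝 p₀, p ∈ U ∧ slopeCubic (slopeInv b (-4 * p.2.2 / p.2.1))
      = -4 * p.2.2 / p.2.1 ∧ ‖slopeInv b (-4 * p.2.2 / p.2.1) - b‖ < 1 / 10 := by
    refine (Filter.eventually_of_mem hU fun _ h => h).and ((hquot.eventually
      (p := fun y => slopeCubic (slopeInv b y) = y) ?_).and
      (hquot.eventually (p := fun y => ‖slopeInv b y - b‖ < 1 / 10) ?_))
    · beta_reduce; rw [e₀]; exact slopeCubic_slopeInv b
    · beta_reduce
      rw [e₀]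
      have hc := ((analyticAt_slopeInv b).continuousAt.sub (continuousAt_const (y := (b : ℂ)))).norm
      refine hc.eventually_lt continuousAt_const ?_
      simp [slopeInv_apply]
  obtain ⟨δ, hδ, hE1⟩ := Metric.eventually_nhds_iff_ball.1 E1
  set δ' := min (δ / 4) (1 / 100) with hδ'
  have hδ'0 : 0 < δ' := by positivity
  obtain ⟨ρ, hρ, hE2⟩ := Metric.eventually_nhds_iff_ball.1 (d.eventually_start hδ'0)
  refine ⟨ρ, hρ, K * 100 + 1, by positivity, min (min ρ (δ / 4)) (1 / 2000), by positivity,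
    fun h h0 hlt m hm hm' w hw => ?_⟩
  have hρh : h < ρ := hlt.trans_le ((min_le_left _ _).trans (min_le_left _ _))
  have hδh : h < δ / 4 := hlt.trans_le ((min_le_left _ _).trans (min_le_right _ _))
  have h2000 : h ≤ 1 / 2000 := (hlt.trans_le (min_le_right _ _)).le
  have hnh : ‖(h : ℂ)‖ = h := by rw [Complex.norm_real, Real.norm_eq_abs, abs_of_pos h0]
  obtain ⟨g1, g2, g3, g4, g5, g6, g7⟩ := hE2 ((h : ℂ), w) (by
    rw [Metric.mem_ball, dist_eq_norm, Prod.norm_def]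
    exact max_lt (by simpa [abs_of_pos h0] using hρh) hw)
  dsimp only at g1 g2 g3 g4 g5 g6 g7
  obtain ⟨ct, ct'⟩ := chart_tangentCoord g5 g6
  have hδ1 : δ' ≤ δ / 4 := min_le_left _ _
  have hδ2 : δ' ≤ 1 / 100 := min_le_right _ _
  have orbit := orbit_estimate h0 h2000 d.phase_lower d.phase_upper d.start_lower d.start_upper
    d.start_cubic g1.le (g2.le.trans hδ2) (g3.le.trans hδ2)
  have near : ∀ j ≤ m, ∃ a : ℝ, NearOrbit a ((tangentStep h)^[j] (tangentCoord h w)) := by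
    intro j hj
    have hjm : (j : ℝ) * h ≤ m * h := by gcongr
    obtain ⟨⟨a, -, p⟩, -⟩ := orbit j (hjm.trans hm)
    exact ⟨a, p⟩
  have hcw : AnalyticAt ℂ (fun w => tangentCoord h w) w :=
    AnalyticAt.comp (g := fun p : ℂ × ℂ × ℂ => tangentCoord p.1 p.2)
      (f := fun w => ((h : ℂ), w)) g7 (analyticAt_const.prod analyticAt_id)
  have hit : ∀ j ≤ m, AnalyticAt ℂ (fun w => (tangentStep h)^[j] (tangentCoord h w)) w := by
    intro j
    induction j with
    | zero => intro _; exact hcw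
    | succ j ih =>
      intro hj
      obtain ⟨a, p⟩ := near j (by omega)
      have := AnalyticAt.comp (g := tangentStep h)
        (f := fun w => (tangentStep h)^[j] (tangentCoord h w))
        (p.analyticAt_tangentStep h0 (by linarith)) (ih (by omega))
      refine this.congr (Filter.Eventually.of_forall fun w => ?_)
      exact (Function.iterate_succ_apply' ..).symm
  obtain ⟨⟨a, ha, p⟩, oJ, oT⟩ := orbit m hm
  set v := (tangentStep h)^[m] (tangentCoord h w) with hv
  set v₀ := tangentCoord (h : ℂ) w with hv₀
  refine ⟨?_, ?_⟩
  · refine AnalyticAt.comp (g := chart (h : ℂ))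
      (f := fun w => (tangentStep h)^[m] (tangentCoord h w)) ?_ (hit m le_rfl)
    exact AnalyticAt.comp (g := fun p : ℂ × ℂ × ℂ => chart p.1 p.2)
      (f := fun v => ((h : ℂ), v)) (analyticAt_chart p.one_add_sq_ne_zero)
      (analyticAt_const.prod analyticAt_id)
  have err : 100 * (m : ℝ) * h ^ 3 ≤ 100 * h ^ 2 := by
    calc 100 * (m : ℝ) * h ^ 3 = (m * h) * (100 * h ^ 2) := by ring
      _ ≤ 1 * (100 * h ^ 2) := by gcongr
      _ = _ := one_mul _
  have sm : 100 * h ^ 2 ≤ h := by nlinarith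
  have hmem (J T : ℂ) (hJ : ‖J - 3‖ < δ) (hT : ‖T - (t₀ + 1)‖ < δ) :
      ((h : ℂ), J, T) ∈ Metric.ball p₀ δ := by
    rw [Metric.mem_ball, dist_eq_norm, Prod.norm_def, Prod.norm_def]
    refine max_lt ?_ (max_lt hJ ?_)
    · simp only [hp₀, Prod.fst_sub, sub_zero]; rw [hnh]; linarith
    · simp only [hp₀, Prod.snd_sub, d.slopeCubic_finish]; exact hT
  have tm : ‖((m * h : ℝ) : ℂ) - 1‖ ≤ h := by
    rw [← Complex.ofReal_one, ← Complex.ofReal_sub, Complex.norm_real, Real.norm_eq_abs, abs_le]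
    constructor <;> linarith
  push_cast at tm
  have T₀ : ‖phaseVar v₀ + m * h - (t₀ + 1)‖ < δ / 2 := by
    have e : phaseVar v₀ + m * h - (t₀ + 1) = (phaseVar v₀ - t₀) + (m * h - 1 : ℂ) := by ring
    rw [e]
    exact (norm_add_le _ _).trans_lt (by linarith)
  have T₁ : ‖phaseVar v - (t₀ + 1)‖ < δ := by
    have e : phaseVar v - (t₀ + 1)
      = (phaseVar v - phaseVar v₀ - m * h) + (phaseVar v₀ + m * h - (t₀ + 1)) := by ring
    rw [e]
    exact (norm_add_le _ _).trans_lt (by linarith)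
  have J₁ : ‖actionVar v - 3‖ < δ := by
    have e : actionVar v - 3 = (actionVar v - actionVar v₀) + (actionVar v₀ - 3) := by ring
    rw [e]
    exact (norm_add_le _ _).trans_lt (by linarith)
  obtain ⟨U₁, c₁, s₁⟩ := hE1 _ (hmem _ _ J₁ T₁)
  obtain ⟨U₀, -, -⟩ := hE1 _ (hmem (actionVar v₀) (phaseVar v₀ + m * h) (by linarith)
    (by linarith))
  dsimp only at c₁ s₁
  have hJ0 : actionVar v ≠ 0 := by
    intro h'
    have := p.action
    rw [h', zero_sub, norm_neg] at this
    norm_num at this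
  -- The elapsed time m h lies in [1 - h, 1] with h ≤ 1/2000, and the inverse of the cubic is
  -- 1-Lipschitz on the reals; 4h/3 is then at most this bound.
  have hab : |a - b| ≤ 2 / 3 * (1 / 1000) := by
    have q : 0 ≤ a ^ 2 + a * b + b ^ 2 := by nlinarith [sq_nonneg (a + b), sq_nonneg (a - b)]
    have e : |a - b| * (1 + (a ^ 2 + a * b + b ^ 2) / 3) ≤ 4 / 3 * h := by
      rw [← abs_of_nonneg (show 0 ≤ 1 + (a ^ 2 + a * b + b ^ 2) / 3 by positivity), ← abs_mul]
      have : (a - b) * (1 + (a ^ 2 + a * b + b ^ 2) / 3) = 4 / 3 * (1 - m * h) := by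
        linear_combination ha - d.finish_cubic
      rw [this, abs_of_nonneg (by linarith)]
      linarith
    nlinarith [abs_nonneg (a - b)]
  have su : ‖v.1 - b‖ ≤ 1 / 10 := by
    have e : v.1 - b = (v.1 - a) + ((a - b : ℝ) : ℂ) := by push_cast; ring
    rw [e]
    refine (norm_add_le _ _).trans ?_
    rw [Complex.norm_real, Real.norm_eq_abs]
    have := p.fst
    linarith
  -- Both sides solve the same cubic equation within 1/10 of b.
  have hslope : slopeInv b (-4 * phaseVar v / actionVar v) = v.1 := by
    refine slopeCubic_injOn d.finish s₁.le su ?_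
    rw [c₁, slopeCubic, phaseVar]
    field_simp
  have hleg : leg m h w = ofActionPhase b ((h : ℂ), actionVar v, phaseVar v) := by
    rw [leg, ← hv, ofActionPhase]
    dsimp only
    rw [hslope, ← p.snd_eq]
  refine ⟨?_, ct, g4, g1.le, su, near⟩
  rw [hleg, legLimit, ← dist_eq_norm]
  refine (hK.dist_le_mul _ U₁ _ U₀).trans ?_
  have hdist : dist ((h : ℂ), actionVar v, phaseVar v)
      ((h : ℂ), actionVar v₀, phaseVar v₀ + m * h) ≤ 100 * h ^ 2 := by
    rw [dist_eq_norm, Prod.norm_def, Prod.norm_def]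
    refine max_le (by simp; positivity) (max_le (oJ.trans err) ?_)
    refine le_trans (le_of_eq ?_) (oT.trans err)
    congr 1
    simp only [Prod.snd_sub]
    ring
  calc (K : ℝ) * _ ≤ K * (100 * h ^ 2) := by gcongr
    _ ≤ (K * 100 + 1) * h ^ 2 := by nlinarith [sq_nonneg h]

open Filter

/-! ### Families of maps with an analytic limit -/

/-- Near `w₀` the maps `f n` are analytic and agree with `F (1 / n, ·)` up to `O(n⁻²)`. -/
structure HasAnalyticLimit (f : ℕ → ℂ × ℂ → ℂ × ℂ) (F : ℂ × ℂ × ℂ → ℂ × ℂ) (w₀ w₁ : ℂ × ℂ) :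
    Prop where
  analyticAt : AnalyticAt ℂ F (0, w₀)
  base : F (0, w₀) = w₁
  close : ∃ K > (0 : ℝ), ∀ᶠ p : ℕ × ℂ × ℂ in atTop ×ˢ 𝓝 w₀,
    AnalyticAt ℂ (f p.1) p.2 ∧ ‖f p.1 p.2 - F ((p.1 : ℂ)⁻¹, p.2)‖ ≤ K / (p.1 : ℝ) ^ 2

namespace HasAnalyticLimit

variable {f g : ℕ → ℂ × ℂ → ℂ × ℂ} {F G : ℂ × ℂ × ℂ → ℂ × ℂ} {w₀ w₁ w₂ : ℂ × ℂ}

theorem _root_.tendsto_natCast_inv_complex :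
    Tendsto (fun n : ℕ => (n : ℂ)⁻¹) atTop (𝓝 0) := by
  exact tendsto_inv_atTop_nhds_zero_nat (𝕜 := ℂ)

theorem _root_.tendsto_inv_prod (w₀ : ℂ × ℂ) :
    Tendsto (fun p : ℕ × ℂ × ℂ => ((p.1 : ℂ)⁻¹, p.2)) (atTop ×ˢ 𝓝 w₀) (𝓝 (0, w₀)) := by
  exact (tendsto_natCast_inv_complex.comp tendsto_fst).prodMk_nhds tendsto_snd

theorem tendsto_limit (H : HasAnalyticLimit f F w₀ w₁) :
    Tendsto (fun p : ℕ × ℂ × ℂ => F ((p.1 : ℂ)⁻¹, p.2)) (atTop ×ˢ 𝓝 w₀) (𝓝 w₁) := by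
  have := H.analyticAt.continuousAt.tendsto.comp (tendsto_inv_prod w₀)
  rwa [H.base] at this

theorem tendsto (H : HasAnalyticLimit f F w₀ w₁) :
    Tendsto (fun p : ℕ × ℂ × ℂ => f p.1 p.2) (atTop ×ˢ 𝓝 w₀) (𝓝 w₁) := by
  obtain ⟨K, hK, hc⟩ := H.close
  have h0 : Tendsto (fun p : ℕ × ℂ × ℂ => f p.1 p.2 - F ((p.1 : ℂ)⁻¹, p.2)) (atTop ×ˢ 𝓝 w₀)
      (𝓝 0) := by
    refine squeeze_zero_norm' (hc.mono fun p hp => hp.2) ?_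
    have : Tendsto (fun n : ℕ => K / (n : ℝ) ^ 2) atTop (𝓝 0) :=
      tendsto_const_nhds.div_atTop
        ((tendsto_pow_atTop two_ne_zero).comp tendsto_natCast_atTop_atTop)
    exact this.comp tendsto_fst
  simpa using h0.add H.tendsto_limit

/-- The error of the inner family is multiplied by a Lipschitz constant of the outer limit, so the
order n⁻² survives composition. The parameter 1/n is passed on unchanged. -/
theorem comp (H' : HasAnalyticLimit g G w₁ w₂) (H : HasAnalyticLimit f F w₀ w₁) :
    HasAnalyticLimit (fun n w => g n (f n w)) (fun p => G (p.1, F p)) w₀ w₂ := by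
  refine ⟨?_, by rw [H.base, H'.base], ?_⟩
  · refine AnalyticAt.comp (g := G) (f := fun p : ℂ × ℂ × ℂ => (p.1, F p)) ?_
      (analyticAt_fst.prod H.analyticAt)
    rw [H.base]; exact H'.analyticAt
  obtain ⟨K, hK, hc⟩ := H.close
  obtain ⟨K', hK', hc'⟩ := H'.close
  obtain ⟨L, U, hU, hL⟩ := (H'.analyticAt.contDiffAt (n := 1)).exists_lipschitzOnWith
  have t1 : Tendsto (fun p : ℕ × ℂ × ℂ => (p.1, f p.1 p.2)) (atTop ×ˢ 𝓝 w₀) (atTop ×ˢ 𝓝 w₁) :=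
    tendsto_fst.prodMk H.tendsto
  have t2 := (tendsto_inv_prod w₁).comp t1
  have t3 : Tendsto (fun p : ℕ × ℂ × ℂ => ((p.1 : ℂ)⁻¹, F ((p.1 : ℂ)⁻¹, p.2))) (atTop ×ˢ 𝓝 w₀)
      (𝓝 (0, w₁)) := (tendsto_inv_prod w₁).comp (tendsto_fst.prodMk H.tendsto_limit)
  refine ⟨K' + L * K, by positivity, ?_⟩
  filter_upwards [hc, t1.eventually hc', t2.eventually hU, t3.eventually hU] with p h1 h2 h3 h4
  refine ⟨AnalyticAt.comp (g := g p.1) h2.1 h1.1, ?_⟩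
  have e1 := h2.2
  have e2 := hL.dist_le_mul _ h3 _ h4
  rw [dist_eq_norm, dist_eq_norm] at e2
  have e3 : ‖((p.1 : ℂ)⁻¹, f p.1 p.2) - ((p.1 : ℂ)⁻¹, F ((p.1 : ℂ)⁻¹, p.2))‖
      ≤ K / (p.1 : ℝ) ^ 2 := by
    rw [Prod.norm_def]
    refine max_le ?_ h1.2
    simp only [Prod.fst_sub, sub_self, norm_zero]
    positivity
  refine (norm_sub_le_norm_sub_add_norm_sub _ (G ((p.1 : ℂ)⁻¹, f p.1 p.2)) _).trans ?_
  refine (add_le_add e1 (e2.trans (mul_le_mul_of_nonneg_left e3 L.2))).trans (le_of_eq ?_)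
  ring

/-- Maps that are given by an analytic function of `1 / n` and the point. -/
theorem of_eq (hF : AnalyticAt ℂ F (0, w₀)) (h0 : F (0, w₀) = w₁) :
    HasAnalyticLimit (fun n w => F ((n : ℂ)⁻¹, w)) F w₀ w₁ := by
  refine ⟨hF, h0, 1, one_pos, ?_⟩
  filter_upwards [(tendsto_inv_prod w₀).eventually hF.eventually_analyticAt] with p hp
  refine ⟨AnalyticAt.comp (g := F) (f := fun w => ((p.1 : ℂ)⁻¹, w)) hp
    (analyticAt_const.prod analyticAt_id), ?_⟩
  rw [sub_self, norm_zero]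
  positivity

/-- At distance `O(1 / n)` from the base point, the maps are affine to leading order. -/
theorem eventually_affine (H : HasAnalyticLimit f F w₀ w₁) {A : ℂ × ℂ × ℂ →L[ℂ] ℂ × ℂ}
    (hA : HasFDerivAt F A (0, w₀)) (R : ℝ) {ρ : ℝ} (hρ : 0 < ρ) :
    ∀ᶠ n : ℕ in atTop, ∀ η : ℂ × ℂ, ‖η‖ ≤ R →
      ‖(n : ℂ) • (f n (w₀ + (n : ℂ)⁻¹ • η) - w₁) - A (1, η)‖ ≤ ρ := by
  obtain ⟨K, hK, hc⟩ := H.close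
  set c := ρ / (2 * (|R| + 1)) with hcdef
  have hcpos : 0 < c := by positivity
  have hlin := (hasFDerivAt_iff_isLittleO_nhds_zero.1 hA).def hcpos
  obtain ⟨δ, hδ, hδ'⟩ := Metric.eventually_nhds_iff_ball.1 hlin
  obtain ⟨P, hP, Q, hQ, hPQ⟩ := Filter.eventually_prod_iff.1 hc
  obtain ⟨ε, hε, hQε⟩ := Metric.eventually_nhds_iff_ball.1 hQ
  have tinv : Tendsto (fun n : ℕ => (|R| + 1) / (n : ℝ)) atTop (𝓝 0) :=
    tendsto_const_nhds.div_atTop tendsto_natCast_atTop_atTop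
  have tK : Tendsto (fun n : ℕ => K / (n : ℝ)) atTop (𝓝 0) :=
    tendsto_const_nhds.div_atTop tendsto_natCast_atTop_atTop
  filter_upwards [hP, tinv.eventually_lt_const hδ, tinv.eventually_lt_const hε,
    tK.eventually_lt_const (half_pos hρ), eventually_gt_atTop 0] with n h1 h2 h3 h4 h5 η hη
  have hn : (0 : ℝ) < n := by exact_mod_cast h5
  have hnc : (n : ℂ) ≠ 0 := by exact_mod_cast h5.ne'
  have hη' : ‖η‖ ≤ |R| + 1 := by linarith [le_abs_self R]
  have hnn : ‖(n : ℂ)⁻¹‖ = (n : ℝ)⁻¹ := by rw [norm_inv, Complex.norm_natCast]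
  have s1 : ‖(n : ℂ)⁻¹ • η‖ ≤ (|R| + 1) / n := by
    rw [norm_smul, hnn, div_eq_inv_mul]; gcongr
  have hclose := (hPQ h1 (hQε (w₀ + (n : ℂ)⁻¹ • η) (by
    rw [Metric.mem_ball, dist_eq_norm, add_sub_cancel_left]; linarith))).2
  dsimp only at hclose
  have s2 : ‖(((n : ℂ)⁻¹, (n : ℂ)⁻¹ • η) : ℂ × ℂ × ℂ)‖ ≤ (|R| + 1) / n := by
    rw [Prod.norm_def]
    refine max_le ?_ s1
    rw [hnn, inv_eq_one_div]
    gcongr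
    linarith [abs_nonneg R]
  have hd := hδ' ((n : ℂ)⁻¹, (n : ℂ)⁻¹ • η) (by
    rw [Metric.mem_ball, dist_zero_right]; linarith)
  rw [show ((0 : ℂ), w₀) + ((n : ℂ)⁻¹, (n : ℂ)⁻¹ • η) = ((n : ℂ)⁻¹, w₀ + (n : ℂ)⁻¹ • η) by
    simp, H.base] at hd
  have hsm : A ((n : ℂ)⁻¹, (n : ℂ)⁻¹ • η) = (n : ℂ)⁻¹ • A (1, η) := by
    rw [← map_smul]; simp
  rw [hsm] at hd
  -- Two errors are separated: the O(n⁻²) distance to the analytic limit, worth K/n after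
  -- multiplication by n, and the linearisation error, made at most ρ/2 by the choice of c.
  have e : (n : ℂ) • (f n (w₀ + (n : ℂ)⁻¹ • η) - w₁) - A (1, η)
      = (n : ℂ) • ((f n (w₀ + (n : ℂ)⁻¹ • η) - F ((n : ℂ)⁻¹, w₀ + (n : ℂ)⁻¹ • η))
        + (F ((n : ℂ)⁻¹, w₀ + (n : ℂ)⁻¹ • η) - w₁ - (n : ℂ)⁻¹ • A (1, η))) := by
    simp only [smul_add, smul_sub, smul_inv_smul₀ hnc]
    abel
  rw [e, norm_smul, Complex.norm_natCast]
  calc (n : ℝ) * _ ≤ n * (K / (n : ℝ) ^ 2 + c * ((|R| + 1) / n)) := by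
        gcongr
        exact (norm_add_le _ _).trans (add_le_add hclose (hd.trans (by gcongr)))
    _ = K / n + ρ / 2 := by rw [hcdef]; field_simp
    _ ≤ ρ := by linarith

end HasAnalyticLimit

/-! ### The legs -/

theorem legData_first : LegData (-1) 1 0 := by
  constructor <;> norm_num

theorem legData_second : LegData 0 0 (-1) := by
  constructor <;> norm_num

theorem chart_legStart_one : chart 0 (legStart 1) = (-3, 0) := by
  simp only [chart, legStart]; norm_num

theorem chart_legStart_zero : chart 0 (legStart 0) = (0, -(3 / 2)) := by
  simp only [chart, legStart]; norm_num

theorem chart_legStart_neg_one : chart 0 (legStart (-1)) = (3, 0) := by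
  simp only [chart, legStart]; norm_num

/-- The limit of the legs with `n - l` steps. -/
noncomputable def legFamily (b : ℝ) (l : ℕ) (p : ℂ × ℂ × ℂ) : ℂ × ℂ :=
  legLimit b p.1 (1 - l * p.1) p.2

theorem LegData.analyticAt_legFamily {t₀ a₀ b : ℝ} (d : LegData t₀ a₀ b) (l : ℕ) :
    AnalyticAt ℂ (legFamily b l) (0, chart 0 (legStart a₀)) := by
  refine AnalyticAt.comp (g := fun p : ℂ × ℂ × ℂ × ℂ => legLimit b p.1 p.2.1 p.2.2)
    (f := fun p : ℂ × ℂ × ℂ => (p.1, 1 - l * p.1, p.2)) ?_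
    (analyticAt_fst.prod ((analyticAt_const.sub (analyticAt_const.mul analyticAt_fst)).prod
      analyticAt_snd))
  simpa using d.analyticAt_legLimit

theorem LegData.eventually_natCast {t₀ a₀ b : ℝ} (d : LegData t₀ a₀ b) (l : ℕ) (hl : l ≤ 1) :
    ∃ K > (0 : ℝ), ∀ᶠ p : ℕ × ℂ × ℂ in atTop ×ˢ 𝓝 (chart 0 (legStart a₀)),
      AnalyticAt ℂ (leg (p.1 - l) ((p.1 : ℝ)⁻¹ : ℝ)) p.2 ∧
      ‖leg (p.1 - l) ((p.1 : ℝ)⁻¹ : ℝ) p.2 - legFamily b l ((p.1 : ℂ)⁻¹, p.2)‖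
        ≤ K / (p.1 : ℝ) ^ 2 ∧
      GoodLeg a₀ b (p.1 - l) (p.1 : ℝ)⁻¹ p.2 := by
  obtain ⟨ε, hε, K, hK, h₁, hh, H⟩ := d.eventually_estimate
  refine ⟨K, hK, ?_⟩
  have ev : ∀ᶠ n : ℕ in atTop, (n : ℝ)⁻¹ < h₁ :=
    (tendsto_inv_atTop_nhds_zero_nat (𝕜 := ℝ)).eventually_lt_const hh
  refine ((ev.and (eventually_gt_atTop 1)).prod_mk (Metric.ball_mem_nhds _ hε)).mono ?_
  rintro ⟨n, w⟩ ⟨⟨h1, h2⟩, hw⟩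
  have hn : (0 : ℝ) < n := by exact_mod_cast (by omega : 0 < n)
  have hm : ((n - l : ℕ) : ℝ) * (n : ℝ)⁻¹ = 1 - l * (n : ℝ)⁻¹ := by
    rw [Nat.cast_sub (by omega), sub_mul, mul_inv_cancel₀ hn.ne']
  have hl' : (l : ℝ) ≤ 1 := by exact_mod_cast hl
  have hi : 0 < (n : ℝ)⁻¹ := by positivity
  obtain ⟨g1, g2, g3⟩ := H (n : ℝ)⁻¹ hi h1 (n - l) (by
    rw [hm]; nlinarith [mul_nonneg (Nat.cast_nonneg (α := ℝ) l) hi.le]) (by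
    rw [hm]; nlinarith) w (by simpa [dist_eq_norm] using hw)
  refine ⟨g1, ?_, g3⟩
  have hmc : ((n - l : ℕ) : ℂ) * ((n : ℝ)⁻¹ : ℝ) = 1 - l * (n : ℂ)⁻¹ := by
    have := congrArg ((↑) : ℝ → ℂ) hm
    push_cast at this ⊢
    exact this
  rw [hmc] at g2
  rw [legFamily, div_eq_mul_inv, ← inv_pow]
  simpa using g2

theorem LegData.hasAnalyticLimit {t₀ a₀ b : ℝ} (d : LegData t₀ a₀ b) (l : ℕ) (hl : l ≤ 1) :
    HasAnalyticLimit (fun n => leg (n - l) ((n : ℝ)⁻¹ : ℝ)) (legFamily b l)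
      (chart 0 (legStart a₀)) (chart 0 (legStart b)) := by
  obtain ⟨K, hK, h⟩ := d.eventually_natCast l hl
  refine ⟨d.analyticAt_legFamily l, ?_, K, hK, h.mono fun p hp => ⟨hp.1, hp.2.1⟩⟩
  rw [legFamily]
  simpa using d.legLimit_base

/-! ### The derivatives of the legs -/

theorem Complex.hasDerivAt_sqrt_sq {s : ℂ} (hs : 0 < s.re) (hs' : s ^ 2 ∈ Complex.slitPlane) :
    HasDerivAt Complex.sqrt (1 / (2 * s)) (s ^ 2) := by
  have hd := (Complex.analyticAt_sqrt hs').differentiableAt.hasDerivAt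
  have h2 := hd.pow 2
  have e : (fun z => Complex.sqrt z) ^ 2 = (fun z => z) := by
    ext z; exact Complex.sqrt_sq' z
  have h3 : HasDerivAt (fun z : ℂ => z) _ (s ^ 2) := e ▸ h2
  have := h3.unique (hasDerivAt_id' _)
  rw [Complex.sqrt_sq_of_re_pos hs] at this
  have hs0 : s ≠ 0 := by rintro rfl; simp at hs
  refine hd.congr_deriv ?_
  rw [eq_div_iff (by simpa using hs0)]
  push_cast at this
  linear_combination this

theorem hasDerivAt_slopeInv (b : ℝ) :
    HasDerivAt (slopeInv b) (1 / (1 + (b : ℂ) ^ 2)) (slopeCubic b) := by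
  have := ((analyticAt_slopeCubic b).hasStrictDerivAt.to_localInverse
    (deriv_slopeCubic_ne b)).hasDerivAt
  refine HasDerivAt.congr_deriv (f := slopeInv b) this ?_
  rw [(hasDerivAt_slopeCubic b).deriv, one_div]

section Curves

variable {h t x y : ℂ → ℂ} {h' t' x' y' : ℂ}

theorem hasDerivAt_tangentCoord_first (hh : HasDerivAt h h' 0) (hx : HasDerivAt x x' 0)
    (hy : HasDerivAt y y' 0) (h0 : h 0 = 0) (x0 : x 0 = -3) (y0 : y 0 = 0) :
    HasDerivAt (fun s => (tangentCoord (h s) (x s, y s)).1) ((y' - h') / 3) 0 ∧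
    HasDerivAt (fun s => (tangentCoord (h s) (x s, y s)).2) (-x') 0 := by
  have hr := ((hx.pow 2).add (hy.pow 2)).sub (hh.pow 2)
  have hS : HasDerivAt (fun s => Complex.sqrt (x s ^ 2 + y s ^ 2 - h s ^ 2)) (-x') 0 := by
    have h9 : (3 : ℂ) ^ 2 = x 0 ^ 2 + y 0 ^ 2 - h 0 ^ 2 := by rw [h0, x0, y0]; norm_num
    have hq := Complex.hasDerivAt_sqrt_sq (s := 3) (by norm_num) (by
      norm_num)
    rw [h9] at hq
    refine (HasDerivAt.comp (h := fun s => x s ^ 2 + y s ^ 2 - h s ^ 2) 0 hq hr).congr_deriv ?_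
    rw [h0, x0, y0]; push_cast; ring
  have S0 : Complex.sqrt (x 0 ^ 2 + y 0 ^ 2 - h 0 ^ 2) = 3 := by
    rw [h0, x0, y0, show (-3 : ℂ) ^ 2 + 0 ^ 2 - 0 ^ 2 = 3 ^ 2 by norm_num]
    exact Complex.sqrt_sq_of_re_pos (by norm_num)
  refine ⟨?_, hS⟩
  simp only [tangentCoord]
  set S := fun s => Complex.sqrt (x s ^ 2 + y s ^ 2 - h s ^ 2) with hSdef
  change S 0 = _ at S0
  have hN := (hh.mul hy).sub (hS.mul hx)
  have hD := (((hx.pow 2).add (hy.pow 2)).sub (hh.mul hx)).sub (hS.mul hy)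
  change HasDerivAt (fun s => (h s * y s - S s * x s) /
    (x s ^ 2 + y s ^ 2 - h s * x s - S s * y s)) _ 0
  clear_value S
  refine (hN.div hD ?_).congr_deriv ?_
  · simp only [Pi.mul_apply, Pi.add_apply, Pi.sub_apply, Pi.pow_apply, S0, h0, x0, y0]; norm_num
  · simp only [Pi.mul_apply, Pi.add_apply, Pi.sub_apply, Pi.pow_apply, S0, h0, x0, y0]
    push_cast; ring

theorem hasDerivAt_tangentCoord_second (hh : HasDerivAt h h' 0) (hx : HasDerivAt x x' 0)
    (hy : HasDerivAt y y' 0) (h0 : h 0 = 0) (x0 : x 0 = 0) (y0 : y 0 = -(3 / 2)) :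
    HasDerivAt (fun s => (tangentCoord (h s) (x s, y s)).1) (-(h' + x') / 3) 0 ∧
    HasDerivAt (fun s => (tangentCoord (h s) (x s, y s)).2) (-y') 0 := by
  have hr := ((hx.pow 2).add (hy.pow 2)).sub (hh.pow 2)
  have hS : HasDerivAt (fun s => Complex.sqrt (x s ^ 2 + y s ^ 2 - h s ^ 2)) (-y') 0 := by
    have h9 : (3 / 2 : ℂ) ^ 2 = x 0 ^ 2 + y 0 ^ 2 - h 0 ^ 2 := by rw [h0, x0, y0]; norm_num
    have hq := Complex.hasDerivAt_sqrt_sq (s := 3 / 2) (by norm_num) (by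
      rw [show (3 / 2 : ℂ) ^ 2 = ((9 / 4 : ℝ) : ℂ) by push_cast; norm_num]
      exact Complex.ofReal_mem_slitPlane.2 (by norm_num))
    rw [h9] at hq
    refine (HasDerivAt.comp (h := fun s => x s ^ 2 + y s ^ 2 - h s ^ 2) 0 hq hr).congr_deriv ?_
    rw [h0, x0, y0]; push_cast; ring
  have S0 : Complex.sqrt (x 0 ^ 2 + y 0 ^ 2 - h 0 ^ 2) = 3 / 2 := by
    rw [h0, x0, y0, show (0 : ℂ) ^ 2 + (-(3 / 2)) ^ 2 - 0 ^ 2 = (3 / 2) ^ 2 by norm_num]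
    exact Complex.sqrt_sq_of_re_pos (by norm_num)
  refine ⟨?_, hS⟩
  simp only [tangentCoord]
  set S := fun s => Complex.sqrt (x s ^ 2 + y s ^ 2 - h s ^ 2) with hSdef
  change S 0 = _ at S0
  have hN := (hh.mul hy).sub (hS.mul hx)
  have hD := (((hx.pow 2).add (hy.pow 2)).sub (hh.mul hx)).sub (hS.mul hy)
  change HasDerivAt (fun s => (h s * y s - S s * x s) /
    (x s ^ 2 + y s ^ 2 - h s * x s - S s * y s)) _ 0
  clear_value S
  refine (hN.div hD ?_).congr_deriv ?_
  · simp only [Pi.mul_apply, Pi.add_apply, Pi.sub_apply, Pi.pow_apply, S0, h0, x0, y0]; norm_num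
  · simp only [Pi.mul_apply, Pi.add_apply, Pi.sub_apply, Pi.pow_apply, S0, h0, x0, y0]
    push_cast; ring

theorem hasDerivAt_actionVar {u s : ℂ → ℂ} {u' s' : ℂ} (hu : HasDerivAt u u' 0)
    (hs : HasDerivAt s s' 0) (hn : 1 + u 0 ^ 2 ≠ 0) :
    HasDerivAt (fun r => actionVar (u r, s r))
      ((2 * s' * (1 + u 0 ^ 2) - 2 * s 0 * (2 * u 0 * u')) / (1 + u 0 ^ 2) ^ 2) 0 := by
  refine ((hs.const_mul 2).div ((hu.pow 2).const_add 1) hn).congr_deriv ?_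
  simp only [Pi.pow_apply]
  push_cast
  ring

theorem hasDerivAt_phaseVar {u s J : ℂ → ℂ} {u' J' : ℂ} (hu : HasDerivAt u u' 0)
    (hJ : HasDerivAt J J' 0) (hJe : ∀ r, J r = actionVar (u r, s r)) :
    HasDerivAt (fun r => phaseVar (u r, s r))
      (-(J' / 4) * slopeCubic (u 0) - J 0 / 4 * ((1 + u 0 ^ 2) * u')) 0 := by
  have hc : HasDerivAt (fun r => slopeCubic (u r)) ((1 + u 0 ^ 2) * u') 0 :=
    HasDerivAt.comp (h := u) 0 (hasDerivAt_slopeCubic (u 0)) hu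
  have := ((hJ.div_const 4).neg.mul hc).congr_deriv (g' := -(J' / 4) * slopeCubic (u 0)
    - J 0 / 4 * ((1 + u 0 ^ 2) * u')) (by simp; ring)
  refine this.congr_of_eventuallyEq (Filter.Eventually.of_forall fun r => ?_)
  simp [phaseVar, slopeCubic, hJe]

theorem hasDerivAt_chart {u S : ℂ → ℂ} {u' S' : ℂ} (hh : HasDerivAt h h' 0)
    (hu : HasDerivAt u u' 0) (hS : HasDerivAt S S' 0) (hn : 1 + u 0 ^ 2 ≠ 0) :
    HasDerivAt (fun s => chart (h s) (u s, S s))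
      (((h' * (u 0 ^ 2 - 1) + h 0 * (2 * u 0 * u') - 2 * (u' * S 0 + u 0 * S')) * (1 + u 0 ^ 2) -
          (h 0 * (u 0 ^ 2 - 1) - 2 * u 0 * S 0) * (2 * u 0 * u')) / (1 + u 0 ^ 2) ^ 2,
        ((2 * (h' * u 0 + h 0 * u') + S' * (u 0 ^ 2 - 1) + S 0 * (2 * u 0 * u')) * (1 + u 0 ^ 2) -
          (2 * h 0 * u 0 + S 0 * (u 0 ^ 2 - 1)) * (2 * u 0 * u')) / (1 + u 0 ^ 2) ^ 2) 0 := by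
  have hden := (hu.pow 2).const_add 1
  have hX := ((hh.mul ((hu.pow 2).sub_const 1)).sub ((hu.const_mul 2).mul hS)).div hden hn
  have hY := (((hh.const_mul 2).mul hu).add (hS.mul ((hu.pow 2).sub_const 1))).div hden hn
  refine HasDerivAt.prodMk (hX.congr_deriv ?_) (hY.congr_deriv ?_)
  · simp only [Pi.mul_apply, Pi.sub_apply, Pi.pow_apply]
    push_cast
    ring
  · simp only [Pi.mul_apply, Pi.add_apply, Pi.pow_apply]
    push_cast
    ring

theorem hasDerivAt_ofActionPhase {b : ℝ} {J T : ℂ → ℂ} {J' T' : ℂ} (hh : HasDerivAt h h' 0)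
    (hJ : HasDerivAt J J' 0) (hT : HasDerivAt T T' 0) (h0 : h 0 = 0) (J0 : J 0 = 3)
    (T0 : T 0 = -(3 / 4) * slopeCubic b) {u' S' : ℂ}
    (hu' : u' = (-(4 / 3) * T' - slopeCubic b * J' / 3) / (1 + (b : ℂ) ^ 2))
    (hS' : S' = J' * (1 + (b : ℂ) ^ 2) / 2 + 3 * b * u') :
    HasDerivAt (fun s => ofActionPhase b (h s, J s, T s))
      (((h' * ((b : ℂ) ^ 2 - 1) - 2 * (u' * (3 * (1 + (b : ℂ) ^ 2) / 2) + b * S')) *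
          (1 + (b : ℂ) ^ 2) + 2 * b * (3 * (1 + (b : ℂ) ^ 2) / 2) * (2 * b * u')) /
          (1 + (b : ℂ) ^ 2) ^ 2,
        ((2 * h' * b + S' * ((b : ℂ) ^ 2 - 1) + 3 * (1 + (b : ℂ) ^ 2) / 2 * (2 * b * u')) *
          (1 + (b : ℂ) ^ 2) - 3 * (1 + (b : ℂ) ^ 2) / 2 * ((b : ℂ) ^ 2 - 1) * (2 * b * u')) /
          (1 + (b : ℂ) ^ 2) ^ 2) 0 := by
  have hb := one_add_real_sq_ne b
  have e0 : -4 * T 0 / J 0 = slopeCubic b := by rw [T0, J0]; ring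
  have hy := (hT.const_mul (-4)).div hJ (by rw [J0]; norm_num)
  have hi := hasDerivAt_slopeInv b
  rw [← e0] at hi
  have hu : HasDerivAt (fun s => slopeInv b (-4 * T s / J s)) u' 0 := by
    refine (HasDerivAt.comp (h := fun s => -4 * T s / J s) 0 hi hy).congr_deriv ?_
    rw [hu', T0, J0]
    field_simp
  have u0 : slopeInv b (-4 * T 0 / J 0) = b := by rw [e0, slopeInv_apply]
  simp only [ofActionPhase]
  set u := fun s => slopeInv b (-4 * T s / J s) with hudef
  change u 0 = b at u0
  change HasDerivAt (fun s => chart (h s) (u s, J s * (1 + u s ^ 2) / 2)) _ 0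
  clear_value u
  have hS : HasDerivAt (fun s => J s * (1 + u s ^ 2) / 2) S' 0 := by
    refine ((hJ.mul ((hu.pow 2).const_add 1)).div_const 2).congr_deriv ?_
    simp only [Pi.pow_apply]
    rw [u0, hS', J0]
    push_cast
    ring
  refine (hasDerivAt_chart hh hu hS (by rwa [u0])).congr_deriv ?_
  rw [u0, h0, J0]
  ext
  · simp only
    congr 1
    ring
  · simp only
    ring

end Curves

/-- The derivative applied to `v` is a derivative along a complex line, so the linear part of a leg
can be computed by one-variable calculus through the chain of coordinate changes. -/
theorem hasDerivAt_legFamily_line {b : ℝ} {l : ℕ} {w₀ : ℂ × ℂ}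
    (h : AnalyticAt ℂ (legFamily b l) (0, w₀)) (v : ℂ × ℂ × ℂ) :
    HasDerivAt (fun s : ℂ => legLimit b (s * v.1) (1 - l * (s * v.1))
      (w₀.1 + s * v.2.1, w₀.2 + s * v.2.2)) (fderiv ℂ (legFamily b l) (0, w₀) v) 0 := by
  have hl : HasDerivAt (fun s : ℂ => ((0, w₀) : ℂ × ℂ × ℂ) + s • v) v 0 := by
    simpa using ((hasDerivAt_id (0 : ℂ)).smul_const v).const_add ((0, w₀) : ℂ × ℂ × ℂ)
  have hf : HasFDerivAt (legFamily b l) (fderiv ℂ (legFamily b l) (0, w₀))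
      (((0, w₀) : ℂ × ℂ × ℂ) + (0 : ℂ) • v) := by
    simpa using h.differentiableAt.hasFDerivAt
  have := hf.comp_hasDerivAt 0 hl
  refine this.congr_of_eventuallyEq (Filter.Eventually.of_forall fun s => ?_)
  simp only [Function.comp, legFamily, Prod.fst_add, Prod.snd_add, Prod.smul_fst, Prod.smul_snd,
    smul_eq_mul, zero_add]
  rfl

theorem hasDerivAt_const_mul_id (c : ℂ) : HasDerivAt (fun s : ℂ => s * c) c 0 := by
  simpa using (hasDerivAt_id (0 : ℂ)).mul_const c

/-- The term with `l` is the omitted time l h' multiplied by the limiting velocity (4, 0) at the end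
of the leg. On the second leg that velocity is (2, 2). -/
theorem fderiv_legFamily_first (l : ℕ) (h' x' y' : ℂ) :
    fderiv ℂ (legFamily 0 l) (0, (-3, 0)) (h', x', y') =
      (4 / 3 * x' - 2 / 3 * y' - h' / 3 - 4 * l * h', (x' + y' - h') / 2) := by
  have hA := legData_first.analyticAt_legFamily l
  rw [chart_legStart_one] at hA
  refine (hasDerivAt_legFamily_line hA (h', x', y')).unique ?_
  have hh := hasDerivAt_const_mul_id h'
  have hx := (hasDerivAt_const_mul_id x').const_add (-3 : ℂ)
  have hy := (hasDerivAt_const_mul_id y').const_add (0 : ℂ)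
  have ht := (hh.const_mul (l : ℂ)).const_sub 1
  obtain ⟨hu, hS⟩ := hasDerivAt_tangentCoord_first hh hx hy (by simp) (by simp) (by simp)
  have e := tangentCoord_legStart 1
  rw [chart_legStart_one] at e
  have eu : (tangentCoord (0 * h') (-3 + 0 * x', 0 + 0 * y')).1 = 1 := by simp [e, legStart]
  have eS : (tangentCoord (0 * h') (-3 + 0 * x', 0 + 0 * y')).2 = 3 := by
    simp [e, legStart]; norm_num
  have hJ := hasDerivAt_actionVar hu hS (by rw [eu]; norm_num)
  have hT := hasDerivAt_phaseVar (s := fun s => (tangentCoord (s * h') (-3 + s * x', 0 + s * y')).2)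
    hu hJ (fun r => rfl)
  have := hasDerivAt_ofActionPhase (b := 0) hh hJ (hT.add ht) (by simp)
    (by rw [eu, eS, actionVar]; norm_num)
    (by simp only [Pi.add_apply]; rw [eu, eS, phaseVar, actionVar, slopeCubic]; norm_num) rfl rfl
  refine HasDerivAt.congr_deriv this ?_
  rw [eu, eS]
  ext
  · simp [slopeCubic, actionVar]; ring
  · simp [slopeCubic, actionVar]; ring

theorem fderiv_legFamily_second (l : ℕ) (h' x' y' : ℂ) :
    fderiv ℂ (legFamily (-1) l) (0, (0, -(3 / 2))) (h', x', y') =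
      (x' / 2 - 2 / 3 * y' + h' / 2 - 2 * l * h',
        x' / 2 + 4 / 3 * y' - h' / 2 - 2 * l * h') := by
  have hA := legData_second.analyticAt_legFamily l
  rw [chart_legStart_zero] at hA
  refine (hasDerivAt_legFamily_line hA (h', x', y')).unique ?_
  have hh := hasDerivAt_const_mul_id h'
  have hx := (hasDerivAt_const_mul_id x').const_add (0 : ℂ)
  have hy := (hasDerivAt_const_mul_id y').const_add (-(3 / 2) : ℂ)
  have ht := (hh.const_mul (l : ℂ)).const_sub 1
  obtain ⟨hu, hS⟩ := hasDerivAt_tangentCoord_second hh hx hy (by simp) (by simp) (by simp)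
  have e := tangentCoord_legStart 0
  rw [chart_legStart_zero] at e
  have eu : (tangentCoord (0 * h') (0 + 0 * x', -(3 / 2) + 0 * y')).1 = 0 := by simp [e, legStart]
  have eS : (tangentCoord (0 * h') (0 + 0 * x', -(3 / 2) + 0 * y')).2 = 3 / 2 := by
    simp [e, legStart]
  have hJ := hasDerivAt_actionVar hu hS (by rw [eu]; norm_num)
  have hT := hasDerivAt_phaseVar
    (s := fun s => (tangentCoord (s * h') (0 + s * x', -(3 / 2) + s * y')).2) hu hJ (fun r => rfl)
  have := hasDerivAt_ofActionPhase (b := -1) hh hJ (hT.add ht) (by simp)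
    (by rw [eu, eS, actionVar]; norm_num)
    (by simp only [Pi.add_apply]; rw [eu, eS, phaseVar, actionVar, slopeCubic]; norm_num) rfl rfl
  refine HasDerivAt.congr_deriv this ?_
  rw [eu, eS]
  ext
  · simp [slopeCubic, actionVar]; ring
  · simp [slopeCubic, actionVar]; ring

/-! ### Real points -/

/-- A real point, as a point of the complex plane. -/
def complexify (x : ℝ × ℝ) : ℂ × ℂ := (x.1, x.2)

theorem complexify_injective : Function.Injective complexify := by
  intro x y h
  have h1 := congrArg Prod.fst h
  have h2 := congrArg Prod.snd h
  exact Prod.ext (Complex.ofReal_injective h1) (Complex.ofReal_injective h2)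

theorem norm_complexify (x : ℝ × ℝ) : ‖complexify x‖ = ‖x‖ := by
  simp [complexify, Prod.norm_def]

theorem complexify_sub (x y : ℝ × ℝ) : complexify (x - y) = complexify x - complexify y := by
  simp [complexify]

theorem complexify_add (x y : ℝ × ℝ) : complexify (x + y) = complexify x + complexify y := by
  simp [complexify]

theorem complexify_neg (x : ℝ × ℝ) : complexify (-x) = -complexify x := by
  simp [complexify]

theorem complexify_smul (c : ℝ) (x : ℝ × ℝ) : complexify (c • x) = (c : ℂ) • complexify x := by
  simp [complexify]

theorem complexify_inv_smul (n : ℕ) (x : ℝ × ℝ) :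
    complexify ((n : ℝ)⁻¹ • x) = (n : ℂ)⁻¹ • complexify x := by
  simp [complexify]

theorem chart_complexify (h : ℝ) (v : ℝ × ℝ) :
    chart (h : ℂ) (complexify v) = complexify (chart h v) := by
  simp [complexify, chart]

theorem chart_scale {n : ℝ} (hn : n ≠ 0) (u S : ℝ) :
    chart 1 (u, n * S) = n • chart n⁻¹ (u, S) := by
  have := one_add_sq_ne u
  simp only [chart]
  ext
  · simp only [Prod.smul_mk, smul_eq_mul]; field_simp
  · simp only [Prod.smul_mk, smul_eq_mul]; field_simp

theorem Complex.sqrt_ofReal {r : ℝ} (hr : 0 < r) : Complex.sqrt (r : ℂ) = (√r : ℝ) := by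
  have : (r : ℂ) = ((√r : ℝ) : ℂ) ^ 2 := by
    rw [← Complex.ofReal_pow, Real.sq_sqrt hr.le]
  rw [this, Complex.sqrt_sq_of_re_pos (by rw [Complex.ofReal_re]; positivity)]

theorem NearOrbit.tangentStep_complexify {a : ℝ} {v : ℝ × ℝ} (p : NearOrbit a (complexify v))
    {h : ℝ} (h0 : 0 < h) (h1 : h ≤ 1 / 1000) :
    ∃ v' : ℝ × ℝ, tangentStep h (complexify v) = complexify v' := by
  set r := v.2 ^ 2 + 8 * h * (h - v.2 * v.1) / (1 + v.1 ^ 2) with hr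
  have e : (complexify v).2 ^ 2 + 8 * (h : ℂ) * (h - (complexify v).2 * (complexify v).1) /
      (1 + (complexify v).1 ^ 2) = (r : ℂ) := by
    rw [hr]; simp [complexify]
  have hpos := p.radicand_re h0 h1
  rw [e, Complex.ofReal_re] at hpos
  have en : nextLength h (complexify v) = (√r : ℝ) := by
    rw [nextLength, e, Complex.sqrt_ofReal (by linarith)]
  refine ⟨(v.1 - 4 * h / (v.2 + √r), √r), ?_⟩
  rw [tangentStep, en]
  simp [complexify]

theorem tangentCoord_complexify {h : ℝ} {x : ℝ × ℝ}
    (hr : 0 < ((complexify x).1 ^ 2 + (complexify x).2 ^ 2 - (h : ℂ) ^ 2).re) :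
    ∃ v : ℝ × ℝ, tangentCoord h (complexify x) = complexify v := by
  set r := x.1 ^ 2 + x.2 ^ 2 - h ^ 2 with hr'
  have e : (complexify x).1 ^ 2 + (complexify x).2 ^ 2 - (h : ℂ) ^ 2 = (r : ℂ) := by
    rw [hr']; simp [complexify]
  rw [e, Complex.ofReal_re] at hr
  refine ⟨((h * x.2 - √r * x.1) / (x.1 ^ 2 + x.2 ^ 2 - h * x.1 - √r * x.2), √r), ?_⟩
  rw [tangentCoord, e, Complex.sqrt_ofReal hr]
  simp [complexify]

/-- At real points the radicands are positive reals, so the complex orbit stays real. Multiplying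
lengths by n turns the step 1/n into the step for the unit half-disc. -/
theorem GoodLeg.exists_run {a₀ b : ℝ} {m n : ℕ} (hn : 1000 ≤ n) {x : ℝ × ℝ}
    (g : GoodLeg a₀ b m (n : ℝ)⁻¹ (complexify ((n : ℝ)⁻¹ • x))) :
    ∃ v : ℕ → ℝ × ℝ, Run v m ∧ chart 1 (v 0) = x ∧
      leg m ((n : ℝ)⁻¹ : ℝ) (complexify ((n : ℝ)⁻¹ • x))
        = complexify ((n : ℝ)⁻¹ • chart 1 (v m)) ∧
      |(v 0).1 - a₀| ≤ 1 / 4 ∧ |(v m).1 - b| ≤ 1 / 10 ∧ ∀ j ≤ m, 12 / 10 * n ≤ (v j).2 := by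
  have hnR : (1000 : ℝ) ≤ n := by exact_mod_cast hn
  have hn0 : (n : ℝ) ≠ 0 := by linarith
  set h : ℝ := (n : ℝ)⁻¹ with hh
  have h0 : 0 < h := by positivity
  have h1 : h ≤ 1 / 1000 := by
    rw [hh, inv_eq_one_div]; gcongr
  set w := complexify (h • x) with hw
  have real : ∀ j ≤ m, ∃ r : ℝ × ℝ, (tangentStep h)^[j] (tangentCoord h w) = complexify r := by
    intro j
    induction j with
    | zero => intro _; exact tangentCoord_complexify g.radicand_re
    | succ j ih =>
      intro hj
      obtain ⟨r, hr⟩ := ih (by omega)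
      obtain ⟨a, p⟩ := g.near j (by omega)
      rw [hr] at p
      rw [Function.iterate_succ_apply', hr]
      exact p.tangentStep_complexify h0 h1
  choose! r hr using real
  have hpos : ∀ j ≤ m, 12 / 10 ≤ (r j).2 := by
    intro j hj
    obtain ⟨a, p⟩ := g.near j hj
    have := p.snd_re
    rw [hr j hj] at this
    simpa [complexify] using this
  have hn' : (0 : ℝ) < n := by linarith
  refine ⟨fun j => ((r j).1, n * (r j).2), ⟨fun j hj => ?_, fun j hj => ?_⟩, ?_, ?_, ?_, ?_,
    fun j hj => ?_⟩
  · obtain ⟨a, p⟩ := g.near j hj.le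
    have s := p.stepRel h
    rw [← Function.iterate_succ_apply' (tangentStep h), hr j hj.le, hr (j + 1) hj] at s
    obtain ⟨s1, s2⟩ := s
    simp only [complexify] at s1 s2
    have s1' : ((r j).2 + (r (j + 1)).2) * ((r j).1 - (r (j + 1)).1) = 4 * h := by
      exact_mod_cast s1
    have s2' : ((r (j + 1)).2 - (r j).2) * (1 + (r j).1 * (r (j + 1)).1)
        = -2 * h * ((r j).1 + (r (j + 1)).1) := by
      exact_mod_cast s2
    have hnh : n * h = 1 := mul_inv_cancel₀ hn0
    constructor
    · simp only
      linear_combination n * s1' + 4 * hnh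
    · simp only
      linear_combination n * s2' - 2 * ((r j).1 + (r (j + 1)).1) * hnh
  · have := hpos j hj
    positivity
  · simp only
    rw [chart_scale hn0]
    have e := g.chart_coord
    have e0 := hr 0 (Nat.zero_le m)
    rw [Function.iterate_zero, id] at e0
    rw [e0, chart_complexify, hw] at e
    have e' : chart (n : ℝ)⁻¹ ((r 0).1, (r 0).2) = h • x := complexify_injective e
    rw [e', smul_inv_smul₀ hn0]
  · simp only
    rw [chart_scale hn0, hh, inv_smul_smul₀ hn0, leg, ← hh, hr m le_rfl]
    exact chart_complexify _ _
  · have := g.start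
    have e0 := hr 0 (Nat.zero_le m)
    rw [Function.iterate_zero, id] at e0
    rw [e0, complexify, ← Complex.ofReal_sub, Complex.norm_real] at this
    exact this
  · have := g.finish
    rw [hr m le_rfl, complexify, ← Complex.ofReal_sub, Complex.norm_real] at this
    exact this
  · have := hpos j hj
    simp only
    nlinarith

theorem LegData.eventually_run {t₀ a₀ b : ℝ} (d : LegData t₀ a₀ b) {l : ℕ} (hl : l ≤ 1)
    {W₀ W₁ : ℝ × ℝ} (h₀ : chart 0 (legStart a₀) = complexify W₀)
    (h₁ : chart 0 (legStart b) = complexify W₁) (R : ℝ) {ρ : ℝ} (hρ : 0 < ρ) :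
    ∀ᶠ n : ℕ in atTop, ∀ x : ℝ × ℝ, ‖x - (n : ℝ) • W₀‖ ≤ R → ∃ v : ℕ → ℝ × ℝ,
      Run v (n - l) ∧ chart 1 (v 0) = x ∧
      leg (n - l) ((n : ℝ)⁻¹ : ℝ) (complexify ((n : ℝ)⁻¹ • x))
        = complexify ((n : ℝ)⁻¹ • chart 1 (v (n - l))) ∧
      |(v 0).1 - a₀| ≤ 1 / 4 ∧ |(v (n - l)).1 - b| ≤ 1 / 10 ∧
      (∀ j ≤ n - l, 12 / 10 * n ≤ (v j).2) ∧
      ‖complexify (chart 1 (v (n - l)) - (n : ℝ) • W₁) -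
        fderiv ℂ (legFamily b l) (0, chart 0 (legStart a₀))
          (1, complexify (x - (n : ℝ) • W₀))‖ ≤ ρ := by
  obtain ⟨K, hK, hc⟩ := d.eventually_natCast l hl
  obtain ⟨P, hP, Q, hQ, hPQ⟩ := Filter.eventually_prod_iff.1 hc
  obtain ⟨ε, hε, hQε⟩ := Metric.eventually_nhds_iff_ball.1 hQ
  have tinv : Tendsto (fun n : ℕ => (|R| + 1) / (n : ℝ)) atTop (𝓝 0) :=
    tendsto_const_nhds.div_atTop tendsto_natCast_atTop_atTop
  have aff := (d.hasAnalyticLimit l hl).eventually_affine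
    (d.analyticAt_legFamily l).differentiableAt.hasFDerivAt R hρ
  filter_upwards [hP, tinv.eventually_lt_const hε, aff, eventually_ge_atTop 1000]
    with n n1 n2 n3 n4 x hx
  have hn : (0 : ℝ) < n := by exact_mod_cast (by omega : 0 < n)
  have hnc : (n : ℂ) ≠ 0 := by exact_mod_cast (by omega : n ≠ 0)
  have e : complexify ((n : ℝ)⁻¹ • x)
      = chart 0 (legStart a₀) + (n : ℂ)⁻¹ • complexify (x - (n : ℝ) • W₀) := by
    rw [h₀, ← complexify_inv_smul, smul_sub, inv_smul_smul₀ hn.ne', complexify_sub]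
    abel
  have g := (hPQ n1 (hQε (complexify ((n : ℝ)⁻¹ • x)) (by
    rw [e, Metric.mem_ball, dist_eq_norm, add_sub_cancel_left, norm_smul, norm_complexify,
      norm_inv, Complex.norm_natCast]
    refine lt_of_le_of_lt ?_ n2
    rw [div_eq_inv_mul]
    gcongr
    linarith [le_abs_self R]))).2.2
  obtain ⟨v, r1, r2, r3, r4, r5, r6⟩ := g.exists_run n4
  refine ⟨v, r1, r2, r3, r4, r5, r6, ?_⟩
  have := n3 (complexify (x - (n : ℝ) • W₀)) (by rwa [norm_complexify])
  rw [← e, r3, complexify_inv_smul, smul_sub, smul_inv_smul₀ hnc, h₁] at this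
  rwa [complexify_sub, complexify_smul, Complex.ofReal_natCast]

theorem abs_le_of_norm_complexify_sub_le {x y : ℝ × ℝ} {ρ : ℝ}
    (h : ‖complexify x - complexify y‖ ≤ ρ) : |x.1 - y.1| ≤ ρ ∧ |x.2 - y.2| ≤ ρ := by
  rw [← complexify_sub, norm_complexify, Prod.norm_def] at h
  exact ⟨(le_max_left _ _).trans h, (le_max_right _ _).trans h⟩

theorem eventually_run_first (l : ℕ) (hl : l ≤ 1) (R : ℝ) {ρ : ℝ} (hρ : 0 < ρ) :
    ∀ᶠ n : ℕ in atTop, ∀ x : ℝ × ℝ, |x.1 + 3 * n| ≤ R → |x.2| ≤ R → ∃ v : ℕ → ℝ × ℝ,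
      Run v (n - l) ∧ chart 1 (v 0) = x ∧
      leg (n - l) ((n : ℝ)⁻¹ : ℝ) (complexify ((n : ℝ)⁻¹ • x))
        = complexify ((n : ℝ)⁻¹ • chart 1 (v (n - l))) ∧ |(v 0).1 - 1| ≤ 1 / 4 ∧
      |(chart 1 (v (n - l))).1 - (4 / 3 * (x.1 + 3 * n) - 2 / 3 * x.2 - 1 / 3 - 4 * l)| ≤ ρ ∧
      |(chart 1 (v (n - l))).2 + 3 / 2 * n - (x.1 + 3 * n + x.2 - 1) / 2| ≤ ρ := by
  have h₀ : chart 0 (legStart 1) = complexify (-3, 0) := by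
    rw [chart_legStart_one]; simp [complexify]
  have h₁ : chart 0 (legStart 0) = complexify (0, -(3 / 2)) := by
    rw [chart_legStart_zero]; simp [complexify]
  filter_upwards [legData_first.eventually_run hl h₀ h₁ R hρ] with n hn x hx1 hx2
  obtain ⟨v, r1, r2, r3, r4, r5, -, r6⟩ := hn x (by
    rw [Prod.norm_def]
    refine max_le ?_ ?_
    · rw [Real.norm_eq_abs]
      refine le_of_eq_of_le ?_ hx1
      congr 1
      simp; ring
    · simpa using hx2)
  refine ⟨v, r1, r2, r3, r4, ?_⟩
  rw [chart_legStart_one] at r6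
  simp only [complexify] at r6
  rw [fderiv_legFamily_first] at r6
  have e : ((4 / 3 * (((x - (n : ℝ) • ((-3, 0) : ℝ × ℝ)).1 : ℝ) : ℂ)
      - 2 / 3 * (((x - (n : ℝ) • ((-3, 0) : ℝ × ℝ)).2 : ℝ) : ℂ) - 1 / 3 - 4 * l * 1,
      ((((x - (n : ℝ) • ((-3, 0) : ℝ × ℝ)).1 : ℝ) : ℂ)
      + (((x - (n : ℝ) • ((-3, 0) : ℝ × ℝ)).2 : ℝ) : ℂ) - 1) / 2) : ℂ × ℂ)
      = complexify (4 / 3 * (x.1 + 3 * n) - 2 / 3 * x.2 - 1 / 3 - 4 * l,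
        (x.1 + 3 * n + x.2 - 1) / 2) := by
    simp [complexify]
    ring
  rw [e] at r6
  obtain ⟨q1, q2⟩ := abs_le_of_norm_complexify_sub_le r6
  refine ⟨by simpa using q1, ?_⟩
  refine le_of_eq_of_le ?_ q2
  congr 1
  simp
  ring

theorem eventually_run_second (l : ℕ) (hl : l ≤ 1) (R : ℝ) {ρ : ℝ} (hρ : 0 < ρ) :
    ∀ᶠ n : ℕ in atTop, ∀ x : ℝ × ℝ, |x.1| ≤ R → |x.2 + 3 / 2 * n| ≤ R → ∃ v : ℕ → ℝ × ℝ,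
      Run v (n - l) ∧ chart 1 (v 0) = x ∧
      leg (n - l) ((n : ℝ)⁻¹ : ℝ) (complexify ((n : ℝ)⁻¹ • x))
        = complexify ((n : ℝ)⁻¹ • chart 1 (v (n - l))) ∧
      |(v (n - l)).1 + 1| ≤ 1 / 10 ∧ (∀ j ≤ n - l, 12 / 10 * n ≤ (v j).2) ∧
      |(chart 1 (v (n - l))).1 - 3 * n
        - (x.1 / 2 - 2 / 3 * (x.2 + 3 / 2 * n) + 1 / 2 - 2 * l)| ≤ ρ ∧
      |(chart 1 (v (n - l))).2
        - (x.1 / 2 + 4 / 3 * (x.2 + 3 / 2 * n) - 1 / 2 - 2 * l)| ≤ ρ := by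
  have h₀ : chart 0 (legStart 0) = complexify (0, -(3 / 2)) := by
    rw [chart_legStart_zero]; simp [complexify]
  have h₁ : chart 0 (legStart (-1)) = complexify (3, 0) := by
    rw [chart_legStart_neg_one]; simp [complexify]
  filter_upwards [legData_second.eventually_run hl h₀ (by exact_mod_cast h₁) R hρ] with n hn x hx1 hx2
  obtain ⟨v, r1, r2, r3, r4, r5, r7, r6⟩ := hn x (by
    rw [Prod.norm_def]
    refine max_le (by simpa using hx1) ?_
    rw [Real.norm_eq_abs]
    refine le_of_eq_of_le ?_ hx2
    congr 1
    simp; ring)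
  refine ⟨v, r1, r2, r3, by simpa using r5, r7, ?_⟩
  rw [chart_legStart_zero] at r6
  simp only [complexify] at r6
  rw [fderiv_legFamily_second] at r6
  have e : (((((x - (n : ℝ) • ((0, -(3 / 2)) : ℝ × ℝ)).1 : ℝ) : ℂ) / 2
      - 2 / 3 * (((x - (n : ℝ) • ((0, -(3 / 2)) : ℝ × ℝ)).2 : ℝ) : ℂ) + 1 / 2 - 2 * l * 1,
      (((x - (n : ℝ) • ((0, -(3 / 2)) : ℝ × ℝ)).1 : ℝ) : ℂ) / 2
      + 4 / 3 * (((x - (n : ℝ) • ((0, -(3 / 2)) : ℝ × ℝ)).2 : ℝ) : ℂ) - 1 / 2 - 2 * l * 1) : ℂ × ℂ)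
      = complexify (x.1 / 2 - 2 / 3 * (x.2 + 3 / 2 * n) + 1 / 2 - 2 * l,
        x.1 / 2 + 4 / 3 * (x.2 + 3 / 2 * n) - 1 / 2 - 2 * l) := by
    simp [complexify]
    ring
  rw [e] at r6
  obtain ⟨q1, q2⟩ := abs_le_of_norm_complexify_sub_le r6
  refine ⟨?_, by simpa using q2⟩
  refine le_of_eq_of_le ?_ q1
  congr 1
  simp
  ring

/-! ### The return map in scaled coordinates -/

/-- The limit of the first (`l = 1`) and second (`l = 0`) halves of the return map. -/
noncomputable def halfFamily (l : ℕ) (p : ℂ × ℂ × ℂ) : ℂ × ℂ :=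
  legFamily (-1) l (p.1, legFamily 0 l p + (2 * p.1, 0))

/-- The limit of the return map, in scaled coordinates. -/
noncomputable def returnFamily (p : ℂ × ℂ × ℂ) : ℂ × ℂ :=
  halfFamily 0 (p.1, -halfFamily 1 (p.1, (2 * p.1, 0) - p.2)) - (2 * p.1, 0)

/-- Half of the return map, in scaled coordinates. -/
noncomputable def halfMap (l n : ℕ) (w : ℂ × ℂ) : ℂ × ℂ :=
  leg (n - l) ((n : ℝ)⁻¹ : ℝ) (leg (n - l) ((n : ℝ)⁻¹ : ℝ) w + (2 * (n : ℂ)⁻¹, 0))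

/-- The return map, in scaled coordinates. -/
noncomputable def scaledReturn (n : ℕ) (Z : ℂ × ℂ) : ℂ × ℂ :=
  halfMap 0 n (-halfMap 1 n ((2 * (n : ℂ)⁻¹, 0) - Z)) - (2 * (n : ℂ)⁻¹, 0)

theorem analyticAt_const_mul_fst_zero (p₀ : ℂ × ℂ × ℂ) :
    AnalyticAt ℂ (fun p : ℂ × ℂ × ℂ => ((2 * p.1, 0) : ℂ × ℂ)) p₀ :=
  (analyticAt_const.mul analyticAt_fst).prod analyticAt_const

theorem hasAnalyticLimit_halfMap {l : ℕ} (hl : l ≤ 1) :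
    HasAnalyticLimit (halfMap l) (halfFamily l) (-3, 0) (3, 0) := by
  have L1 := legData_first.hasAnalyticLimit l hl
  have L2 := legData_second.hasAnalyticLimit l hl
  rw [chart_legStart_one, chart_legStart_zero] at L1
  rw [chart_legStart_zero, chart_legStart_neg_one] at L2
  have T : HasAnalyticLimit (fun n w => w + (2 * (n : ℂ)⁻¹, 0)) (fun p => p.2 + (2 * p.1, 0))
      (0, -(3 / 2)) (0, -(3 / 2)) :=
    HasAnalyticLimit.of_eq (F := fun p => p.2 + (2 * p.1, 0))
      (analyticAt_snd.add (analyticAt_const_mul_fst_zero _)) (by simp)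
  exact L2.comp (T.comp L1)

theorem hasAnalyticLimit_scaledReturn :
    HasAnalyticLimit scaledReturn returnFamily (3, 0) (3, 0) := by
  have T₁ : HasAnalyticLimit (fun n w => (2 * (n : ℂ)⁻¹, 0) - w) (fun p => (2 * p.1, 0) - p.2)
      (3, 0) (-3, 0) :=
    HasAnalyticLimit.of_eq (F := fun p => (2 * p.1, 0) - p.2)
      ((analyticAt_const_mul_fst_zero _).sub analyticAt_snd) (by simp)
  have T₂ : HasAnalyticLimit (fun _ w => -w) (fun p => -p.2) (3, 0) (-3, 0) :=
    HasAnalyticLimit.of_eq (F := fun p => -p.2) analyticAt_snd.neg (by simp)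
  have T₃ : HasAnalyticLimit (fun n w => w - (2 * (n : ℂ)⁻¹, 0)) (fun p => p.2 - (2 * p.1, 0))
      (3, 0) (3, 0) :=
    HasAnalyticLimit.of_eq (F := fun p => p.2 - (2 * p.1, 0))
      (analyticAt_snd.sub (analyticAt_const_mul_fst_zero _)) (by simp)
  exact T₃.comp ((hasAnalyticLimit_halfMap (l := 0) (by norm_num)).comp
    (T₂.comp ((hasAnalyticLimit_halfMap (l := 1) le_rfl).comp T₁)))

/-- By the formula for the new abscissa, x' < 1 is equivalent to us > 1, so u has the sign of s. The
companion `fst_neg_of_one_lt_chart_fst` uses that x > 1 is equivalent to us < -1. -/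
theorem StepRel.one_lt_of_chart_fst_lt {v v' : ℝ × ℝ} (r : StepRel 1 v v') (hv : 0 < v.2)
    (h : (chart 1 v').1 < 1) : 0 < v.1 := by
  rw [r.chart_fst (one_add_sq_ne _) (one_add_sq_ne _)] at h
  have h' : 1 < (1 * (v.1 ^ 2 - 1) + 2 * v.1 * v.2) / (1 + v.1 ^ 2) := by linarith
  rw [lt_div_iff₀ (by positivity)] at h'
  by_contra hc
  push Not at hc
  nlinarith [mul_nonneg (neg_nonneg.2 hc) hv.le]

theorem fst_neg_of_one_lt_chart_fst {v : ℝ × ℝ} (hv : 0 < v.2) (h : 1 < (chart 1 v).1) :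
    v.1 < 0 := by
  rw [chart, lt_div_iff₀ (by positivity)] at h
  by_contra hc
  push Not at hc
  nlinarith [mul_nonneg hc hv.le]

/-- The centre of the parallelogram `𝐑ₙ`. -/
noncomputable def centre (n : ℕ) : ℝ × ℝ := (3 * n - 3 / 4, 1)

-- The four affine approximations of the legs are composed. For the point `centre n` the first and
-- third legs end, to leading order, on the vertical axis, well inside the strip |x| < 1 where the
-- legs can be joined. The composed linear part has rows (-7/9, -4/9) and (8/9, -7/9).
set_option maxHeartbeats 1000000 in
theorem eventually_return : ∀ᶠ n : ℕ in atTop, ∀ z : ℝ × ℝ, ‖z - centre n‖ ≤ 1 / 25 →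
    ∃ z' : ℝ × ℝ, (∀ x₀ : ℝ, 1 ≤ x₀ → Segment x₀ z (4 * n - 1) z') ∧
      scaledReturn n (complexify ((n : ℝ)⁻¹ • z)) = complexify ((n : ℝ)⁻¹ • z') ∧
      |z'.1 - ((centre n).1 - 7 / 9 * (z - centre n).1 - 4 / 9 * (z - centre n).2)| ≤ 1 / 100 ∧
      |z'.2 - ((centre n).2 + 8 / 9 * (z - centre n).1 - 7 / 9 * (z - centre n).2)| ≤ 1 / 100 := by
  -- Each leg is affine up to 1/1000, and the four errors, amplified by the linear parts of later
  -- legs, add up to less than 1/100. The radius 10 used below is a crude bound on the offsets at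
  -- the four starting points.
  have hρ : (0 : ℝ) < 1 / 1000 := by norm_num
  filter_upwards [eventually_run_first 1 le_rfl 10 hρ, eventually_run_second 1 le_rfl 10 hρ,
    eventually_run_first 0 zero_le_one 10 hρ, eventually_run_second 0 zero_le_one 10 hρ,
    eventually_ge_atTop 1000] with n f₁ f₂ f₃ f₄ hn z hz
  have hnR : (1000 : ℝ) ≤ n := by exact_mod_cast hn
  rw [Prod.norm_def, sup_le_iff, Real.norm_eq_abs, Real.norm_eq_abs, abs_le, abs_le] at hz
  simp only [centre, Prod.fst_sub, Prod.snd_sub] at hz ⊢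
  obtain ⟨⟨z1, z2⟩, z3, z4⟩ := hz
  push_cast at f₁ f₂ f₃ f₄
  obtain ⟨v₁, r₁, s₁, l₁, a₁, p₁, q₁⟩ := f₁ (2 - z.1, -z.2)
    (by rw [abs_le]; constructor <;> simp only <;> linarith)
    (by rw [abs_le]; constructor <;> simp only <;> linarith)
  simp only [abs_le] at p₁ q₁ a₁
  obtain ⟨p₁, p₁'⟩ := p₁
  obtain ⟨q₁, q₁'⟩ := q₁
  obtain ⟨v₂, r₂, s₂, l₂, -, -, p₂, q₂⟩ := f₂ (chart 1 (v₁ (n - 1)) + (2, 0))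
    (by rw [abs_le]; constructor <;> simp only [Prod.fst_add] <;> linarith)
    (by rw [abs_le]; constructor <;> simp only [Prod.snd_add] <;> linarith)
  simp only [abs_le, Prod.fst_add, Prod.snd_add] at p₂ q₂
  obtain ⟨p₂, p₂'⟩ := p₂
  obtain ⟨q₂, q₂'⟩ := q₂
  obtain ⟨v₃, r₃, s₃, l₃, a₃, p₃, q₃⟩ := f₃ (-chart 1 (v₂ (n - 1)))
    (by rw [abs_le]; constructor <;> simp only [Prod.fst_neg] <;> linarith)
    (by rw [abs_le]; constructor <;> simp only [Prod.snd_neg] <;> linarith)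
  simp only [abs_le, Prod.fst_neg, Prod.snd_neg, Nat.sub_zero] at p₃ q₃ a₃
  obtain ⟨p₃, p₃'⟩ := p₃
  obtain ⟨q₃, q₃'⟩ := q₃
  obtain ⟨v₄, r₄, s₄, l₄, a₄, d₄, p₄, q₄⟩ := f₄ (chart 1 (v₃ n) + (2, 0))
    (by rw [abs_le]; constructor <;> simp only [Prod.fst_add] <;> linarith)
    (by rw [abs_le]; constructor <;> simp only [Prod.snd_add] <;> linarith)
  simp only [abs_le, Prod.fst_add, Prod.snd_add, Nat.sub_zero] at p₄ q₄ a₄ d₄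
  obtain ⟨p₄, p₄'⟩ := p₄
  obtain ⟨q₄, q₄'⟩ := q₄
  rw [Nat.sub_zero] at l₃ l₄ r₃ r₄
  -- For |u| near 1 one step moves the ordinate by nearly 2. Ordinates near ±1 thus reach the far
  -- side of the axis, or pass height 2 on the first leg, in a single step.
  have slope {u : ℝ} (h1 : 3 / 4 ≤ u) (h2 : u ≤ 5 / 4) : 19 / 10 ≤ 4 * u / (1 + u ^ 2) := by
    rw [le_div_iff₀ (by positivity)]; nlinarith
  have n1 : n - 1 - 1 + 1 = n - 1 := by omega
  have n0 : n - 1 + 1 = n := by omega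
  have e1 : chart 1 (v₁ 0) = (2 - z.1, -z.2) := s₁
  refine ⟨((chart 1 (v₄ n)).1 - 2, (chart 1 (v₄ n)).2), fun x₀ hx => ?_, ?_, ?_, ?_⟩
  · have key := segment_return hx (m := n - 1) (k := n) (by omega) (by omega) r₁ r₂ r₃ r₄ s₂ s₃ s₄
      ?_ (by linarith) (by linarith) ?_ ?_ ?_ (by linarith) ?_ (by linarith) (by linarith) ?_ ?_ ?_
    · rw [e1] at key
      have hz : ((2 - (2 - z.1, -z.2).1, -(2 - z.1, -z.2).2) : ℝ × ℝ) = z :=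
        Prod.ext (sub_sub_cancel _ _) (neg_neg _)
      rw [hz, show n - 1 + 1 + (n - 1) + n + n = 4 * n - 1 by omega] at key
      exact key
    · have := r₁.rel (n - 1 - 1) (by omega)
      rw [n1] at this
      exact this.one_lt_of_chart_fst_lt (r₁.pos _ (by omega)) (by linarith)
    · rw [e1]; simp only; linarith
    · rw [(r₁.rel 0 (by omega)).chart_snd_eq, e1]
      have := slope (u := (v₁ 0).1) (by linarith [a₁.1]) (by linarith [a₁.2])
      simp only
      linarith
    · refine fst_neg_of_one_lt_chart_fst (r₂.pos 0 (by omega)) ?_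
      rw [s₂]; simp only [Prod.fst_add]; linarith
    · have := r₃.rel (n - 1) (by omega)
      rw [n0] at this
      exact this.one_lt_of_chart_fst_lt (r₃.pos _ (by omega)) (by linarith)
    · rw [(r₃.rel 0 (by omega)).chart_snd_eq, s₃]
      have := slope (u := (v₃ 0).1) (by linarith [a₃.1]) (by linarith [a₃.2])
      simp only [Prod.snd_neg]
      linarith
    · refine fst_neg_of_one_lt_chart_fst (r₄.pos 0 (by omega)) ?_
      rw [s₄]; simp only [Prod.fst_add]; linarith
    · have rel := r₄.rel (n - 1) (by omega)
      rw [n0] at rel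
      have hy := rel.chart_snd_eq
      have hs := rel.sum
      have d1 := d₄ (n - 1) (by omega)
      have d2 := d₄ n le_rfl
      have m1 : (v₄ n).1 < (v₄ (n - 1)).1 := rel.fst_lt (by linarith) (by linarith)
      -- Tangent lengths are at least 1.2n, so (s + s')(u - u') = 4 leaves little change of slope in
      -- the last step; the slope just before the end is still close to -1.
      have m2 : (v₄ (n - 1)).1 - (v₄ n).1 ≤ 1 / 100 := by
        by_contra hc
        push Not at hc
        nlinarith
      have := slope (u := -(v₄ (n - 1)).1) (by linarith) (by linarith)
      rw [neg_sq, mul_neg, neg_div] at this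
      linarith
  · have two : ((2 * (n : ℂ)⁻¹, 0) : ℂ × ℂ) = complexify ((n : ℝ)⁻¹ • (2, 0)) := by
      simp [complexify]; ring
    have E1 : ((2 * (n : ℂ)⁻¹, 0) : ℂ × ℂ) - complexify ((n : ℝ)⁻¹ • z)
        = complexify ((n : ℝ)⁻¹ • (2 - z.1, -z.2)) := by
      rw [two, ← complexify_sub, ← smul_sub]
      refine congrArg _ (congrArg _ (Prod.ext ?_ ?_)) <;> simp
    rw [scaledReturn, halfMap, halfMap, Complex.ofReal_inv, Complex.ofReal_natCast, E1, l₁, two, ← complexify_add, ← smul_add, l₂,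
      ← complexify_neg, ← smul_neg, Nat.sub_zero, l₃, ← complexify_add, ← smul_add, l₄,
      ← complexify_sub, ← smul_sub]
    refine congrArg _ (congrArg _ (Prod.ext ?_ ?_)) <;> simp
  · rw [abs_le]; constructor <;> simp only <;> linarith
  · rw [abs_le]; constructor <;> simp only <;> linarith

/-! ### Convergence of analytic maps at rate `1 / n` -/

/-- Near the origin the maps `f n` are analytic and converge to `F` at the rate `1 / n`. -/
structure CloseTo {V : Type*} [NormedAddCommGroup V] [NormedSpace ℂ V] (f : ℕ → ℂ × ℂ → V)
    (F : ℂ × ℂ → V) : Prop where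
  analyticAt : AnalyticAt ℂ F 0
  close : ∃ K > (0 : ℝ), ∀ᶠ p : ℕ × ℂ × ℂ in atTop ×ˢ 𝓝 0,
    AnalyticAt ℂ (f p.1) p.2 ∧ ‖f p.1 p.2 - F p.2‖ ≤ K / (p.1 : ℝ)

theorem Filter.Eventually.exists_ball {P : ℕ × ℂ × ℂ → Prop}
    (h : ∀ᶠ p in (atTop : Filter ℕ) ×ˢ 𝓝 (0 : ℂ × ℂ), P p) :
    ∃ r > (0 : ℝ), ∃ N : ℕ, ∀ n ≥ N, ∀ y : ℂ × ℂ, ‖y‖ < r → P (n, y) := by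
  obtain ⟨A, hA, B, hB, hAB⟩ := Filter.eventually_prod_iff.1 h
  obtain ⟨N, hN⟩ := eventually_atTop.1 hA
  obtain ⟨r, hr, hB'⟩ := Metric.eventually_nhds_iff_ball.1 hB
  exact ⟨r, hr, N, fun n hn y hy => hAB (hN n hn) (hB' y (by simpa using hy))⟩

theorem eventually_of_exists_ball {P : ℕ × ℂ × ℂ → Prop} {r : ℝ} (hr : 0 < r) {N : ℕ}
    (h : ∀ n ≥ N, ∀ y : ℂ × ℂ, ‖y‖ < r → P (n, y)) :
    ∀ᶠ p in (atTop : Filter ℕ) ×ˢ 𝓝 (0 : ℂ × ℂ), P p := by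
  refine ((eventually_ge_atTop N).prod_mk (Metric.ball_mem_nhds _ hr)).mono ?_
  rintro ⟨n, y⟩ ⟨h1, h2⟩
  exact h n h1 y (by simpa using h2)

namespace CloseTo

variable {V W : Type*} [NormedAddCommGroup V] [NormedSpace ℂ V] [NormedAddCommGroup W]
  [NormedSpace ℂ W] [CompleteSpace V] [CompleteSpace W] {f : ℕ → ℂ × ℂ → V} {F : ℂ × ℂ → V}

theorem exists_ball (h : CloseTo f F) : ∃ r > (0 : ℝ), ∃ K > (0 : ℝ), ∃ N : ℕ,
    (∀ y : ℂ × ℂ, ‖y‖ < r → AnalyticAt ℂ F y) ∧ ∀ n ≥ N, ∀ y : ℂ × ℂ, ‖y‖ < r →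
      AnalyticAt ℂ (f n) y ∧ ‖f n y - F y‖ ≤ K / (n : ℝ) := by
  obtain ⟨K, hK, hc⟩ := h.close
  obtain ⟨r, hr, N, hN⟩ := hc.exists_ball
  obtain ⟨s, hs, hF⟩ := Metric.eventually_nhds_iff_ball.1 h.analyticAt.eventually_analyticAt
  exact ⟨min r s, by positivity, K, hK, N,
    fun y hy => hF y (by simpa using hy.trans_le (min_le_right _ _)),
    fun n hn y hy => hN n hn y (hy.trans_le (min_le_left _ _))⟩

theorem tendsto (h : CloseTo f F) :
    Tendsto (fun p : ℕ × ℂ × ℂ => f p.1 p.2) (atTop ×ˢ 𝓝 0) (𝓝 (F 0)) := by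
  obtain ⟨K, hK, hc⟩ := h.close
  have h0 : Tendsto (fun p : ℕ × ℂ × ℂ => f p.1 p.2 - F p.2) (atTop ×ˢ 𝓝 0) (𝓝 0) := by
    refine squeeze_zero_norm' (hc.mono fun p hp => hp.2) ?_
    have : Tendsto (fun n : ℕ => K / (n : ℝ)) atTop (𝓝 0) :=
      tendsto_const_nhds.div_atTop tendsto_natCast_atTop_atTop
    exact this.comp tendsto_fst
  have h1 : Tendsto (fun p : ℕ × ℂ × ℂ => F p.2) (atTop ×ˢ 𝓝 0) (𝓝 (F 0)) :=
    h.analyticAt.continuousAt.tendsto.comp tendsto_snd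
  simpa using h0.add h1

theorem eventually_analyticAt (h : CloseTo f F) :
    ∀ᶠ p : ℕ × ℂ × ℂ in atTop ×ˢ 𝓝 0, AnalyticAt ℂ (f p.1) p.2 := by
  obtain ⟨K, hK, hc⟩ := h.close
  exact hc.mono fun p hp => hp.1

theorem eventually_analyticAt_zero (h : CloseTo f F) : ∀ᶠ n in atTop, AnalyticAt ℂ (f n) 0 := by
  obtain ⟨r, hr, K, hK, N, -, hc⟩ := h.exists_ball
  filter_upwards [eventually_ge_atTop N] with n hn
  exact (hc n hn 0 (by simpa using hr)).1

theorem eventually_norm_le (h : CloseTo f F) :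
    ∃ K > (0 : ℝ), ∀ᶠ n in atTop, ‖f n 0 - F 0‖ ≤ K / (n : ℝ) := by
  obtain ⟨r, hr, K, hK, N, -, hc⟩ := h.exists_ball
  refine ⟨K, hK, ?_⟩
  filter_upwards [eventually_ge_atTop N] with n hn
  exact (hc n hn 0 (by simpa using hr)).2

theorem tendsto_zero (h : CloseTo f F) : Tendsto (fun n => f n 0) atTop (𝓝 (F 0)) :=
  h.tendsto.comp (tendsto_id.prodMk tendsto_const_nhds : Tendsto (fun n : ℕ => (n, (0 : ℂ × ℂ)))
    atTop (atTop ×ˢ 𝓝 0))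

theorem const (hF : AnalyticAt ℂ F 0) : CloseTo (fun _ => F) F := by
  refine ⟨hF, 1, one_pos, ?_⟩
  filter_upwards [tendsto_snd.eventually hF.eventually_analyticAt] with p hp
  refine ⟨hp, ?_⟩
  rw [sub_self, norm_zero]
  positivity

theorem of_seq {a : ℕ → V} {a₀ : V} {K : ℝ} (h : ∀ᶠ n in atTop, ‖a n - a₀‖ ≤ K / (n : ℝ)) :
    CloseTo (fun n _ => a n) (fun _ => a₀) := by
  refine ⟨analyticAt_const, |K| + 1, by positivity, ?_⟩
  filter_upwards [tendsto_fst.eventually h] with p hp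
  refine ⟨analyticAt_const, hp.trans ?_⟩
  gcongr
  linarith [le_abs_self K]

theorem eval_zero (h : CloseTo f F) : CloseTo (fun n _ => f n 0) (fun _ => F 0) := by
  obtain ⟨K, hK, hc⟩ := h.eventually_norm_le
  exact of_seq hc

theorem congr {g : ℕ → ℂ × ℂ → V} (h : CloseTo f F)
    (e : ∀ᶠ p : ℕ × ℂ × ℂ in atTop ×ˢ 𝓝 0, g p.1 p.2 = f p.1 p.2) : CloseTo g F := by
  obtain ⟨r, hr, K, hK, N, h1, h2⟩ := h.exists_ball
  obtain ⟨s, hs, N', he⟩ := e.exists_ball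
  refine ⟨h.analyticAt, K, hK, eventually_of_exists_ball (lt_min hr hs) (N := max N N') ?_⟩
  intro n hn y hy
  obtain ⟨a, b⟩ := h2 n ((le_max_left _ _).trans hn) y (hy.trans_le (min_le_left _ _))
  have hn' := (le_max_right N N').trans hn
  dsimp only
  rw [he n hn' y (hy.trans_le (min_le_right _ _))]
  refine ⟨a.congr ?_, b⟩
  have : ∀ᶠ x in 𝓝 y, ‖x‖ < min r s := (continuous_norm.continuousAt).eventually_lt
    continuousAt_const hy
  filter_upwards [this] with x hx
  exact (he n hn' x (hx.trans_le (min_le_right _ _))).symm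

theorem prod {g : ℕ → ℂ × ℂ → W} {G : ℂ × ℂ → W} (h : CloseTo f F) (h' : CloseTo g G) :
    CloseTo (fun n y => (f n y, g n y)) (fun y => (F y, G y)) := by
  obtain ⟨K, hK, hc⟩ := h.close
  obtain ⟨K', hK', hc'⟩ := h'.close
  refine ⟨h.analyticAt.prod h'.analyticAt, max K K', by positivity, ?_⟩
  filter_upwards [hc, hc'] with p a b
  refine ⟨a.1.prod b.1, ?_⟩
  rw [Prod.norm_def]
  refine max_le (a.2.trans ?_) (b.2.trans ?_)
  · gcongr; exact le_max_left _ _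
  · gcongr; exact le_max_right _ _

/-- An analytic map is Lipschitz near the limit value, so it preserves the rate 1/n. The algebraic
operations below are instances of this. -/
theorem map {Φ : V → W} (hΦ : AnalyticAt ℂ Φ (F 0)) (h : CloseTo f F) :
    CloseTo (fun n y => Φ (f n y)) (fun y => Φ (F y)) := by
  obtain ⟨K, hK, hc⟩ := h.close
  obtain ⟨L, U, hU, hL⟩ := (hΦ.contDiffAt (n := 1)).exists_lipschitzOnWith
  have h1 : Tendsto (fun p : ℕ × ℂ × ℂ => F p.2) (atTop ×ˢ 𝓝 0) (𝓝 (F 0)) :=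
    h.analyticAt.continuousAt.tendsto.comp tendsto_snd
  refine ⟨AnalyticAt.comp (g := Φ) hΦ h.analyticAt, L * K + 1, by positivity, ?_⟩
  filter_upwards [hc, h.tendsto.eventually hU, h1.eventually hU,
    h.tendsto.eventually hΦ.eventually_analyticAt] with p a b c d
  refine ⟨AnalyticAt.comp (g := Φ) d a.1, ?_⟩
  rw [← dist_eq_norm]
  refine (hL.dist_le_mul _ b _ c).trans ?_
  rw [dist_eq_norm]
  calc (L : ℝ) * _ ≤ L * (K / p.1) := by gcongr; exact a.2
    _ = L * K / p.1 := by ring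
    _ ≤ (L * K + 1) / p.1 := by gcongr; linarith

theorem clm (A : V →L[ℂ] W) (h : CloseTo f F) : CloseTo (fun n y => A (f n y)) (fun y => A (F y)) :=
  map (A.analyticAt _) h

theorem comp {g : ℕ → ℂ × ℂ → ℂ × ℂ} {G : ℂ × ℂ → ℂ × ℂ} (h : CloseTo f F) (h' : CloseTo g G)
    (h0 : G 0 = 0) : CloseTo (fun n y => f n (g n y)) (fun y => F (G y)) := by
  have hF : AnalyticAt ℂ F (G 0) := by rw [h0]; exact h.analyticAt
  have hm := map hF h'
  obtain ⟨K, hK, hc⟩ := h.close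
  obtain ⟨K', hK', hc'⟩ := hm.close
  obtain ⟨L, hL, hd⟩ := h'.close
  have t1 : Tendsto (fun p : ℕ × ℂ × ℂ => (p.1, g p.1 p.2)) (atTop ×ˢ 𝓝 0) (atTop ×ˢ 𝓝 0) := by
    have := h'.tendsto
    rw [h0] at this
    exact tendsto_fst.prodMk this
  refine ⟨hm.analyticAt, K + K', by positivity, ?_⟩
  filter_upwards [t1.eventually hc, hc', hd] with p a b c
  refine ⟨AnalyticAt.comp (g := f p.1) a.1 c.1, ?_⟩
  rw [add_div]
  exact (norm_sub_le_norm_sub_add_norm_sub _ (F (g p.1 p.2)) _).trans (add_le_add a.2 b.2)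

theorem add {g : ℕ → ℂ × ℂ → V} {G : ℂ × ℂ → V} (h : CloseTo f F) (h' : CloseTo g G) :
    CloseTo (fun n y => f n y + g n y) (fun y => F y + G y) :=
  map (Φ := fun p : V × V => p.1 + p.2) (analyticAt_fst.add analyticAt_snd) (h.prod h')

theorem sub {g : ℕ → ℂ × ℂ → V} {G : ℂ × ℂ → V} (h : CloseTo f F) (h' : CloseTo g G) :
    CloseTo (fun n y => f n y - g n y) (fun y => F y - G y) :=
  map (Φ := fun p : V × V => p.1 - p.2) (analyticAt_fst.sub analyticAt_snd) (h.prod h')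

theorem mul {f g : ℕ → ℂ × ℂ → ℂ} {F G : ℂ × ℂ → ℂ} (h : CloseTo f F) (h' : CloseTo g G) :
    CloseTo (fun n y => f n y * g n y) (fun y => F y * G y) :=
  map (Φ := fun p : ℂ × ℂ => p.1 * p.2) (analyticAt_fst.mul analyticAt_snd) (h.prod h')

theorem pow {f : ℕ → ℂ × ℂ → ℂ} {F : ℂ × ℂ → ℂ} (h : CloseTo f F) (k : ℕ) :
    CloseTo (fun n y => f n y ^ k) (fun y => F y ^ k) :=
  map (Φ := fun p : ℂ => p ^ k) (analyticAt_id.pow k) h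

theorem inv {f : ℕ → ℂ × ℂ → ℂ} {F : ℂ × ℂ → ℂ} (h : CloseTo f F) (h0 : F 0 ≠ 0) :
    CloseTo (fun n y => (f n y)⁻¹) (fun y => (F y)⁻¹) :=
  map (Φ := fun p : ℂ => p⁻¹) (analyticAt_id.inv h0) h

theorem div {f g : ℕ → ℂ × ℂ → ℂ} {F G : ℂ × ℂ → ℂ} (h : CloseTo f F) (h' : CloseTo g G)
    (h0 : G 0 ≠ 0) : CloseTo (fun n y => f n y / g n y) (fun y => F y / G y) := by
  simpa only [div_eq_mul_inv] using h.mul (h'.inv h0)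

theorem sum {ι : Type*} (s : Finset ι) {f : ι → ℕ → ℂ × ℂ → V} {F : ι → ℂ × ℂ → V}
    (h : ∀ i ∈ s, CloseTo (f i) (F i)) :
    CloseTo (fun n y => ∑ i ∈ s, f i n y) (fun y => ∑ i ∈ s, F i y) := by
  classical
  induction s using Finset.induction_on with
  | empty => simpa using const (F := fun _ => (0 : V)) analyticAt_const
  | insert i s hi ih =>
    simp only [Finset.sum_insert hi]
    exact (h i (by simp)).add (ih fun j hj => h j (by simp [hj]))

theorem id : CloseTo (fun _ y => y) (fun y => y) := const analyticAt_id

theorem fst {f : ℕ → ℂ × ℂ → V × W} {F : ℂ × ℂ → V × W} (h : CloseTo f F) :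
    CloseTo (fun n y => (f n y).1) (fun y => (F y).1) :=
  map (Φ := fun p : V × W => p.1) analyticAt_fst h

theorem snd {f : ℕ → ℂ × ℂ → V × W} {F : ℂ × ℂ → V × W} (h : CloseTo f F) :
    CloseTo (fun n y => (f n y).2) (fun y => (F y).2) :=
  map (Φ := fun p : V × W => p.2) analyticAt_snd h

/-- Cauchy's estimate on half the radius: uniform closeness of holomorphic maps passes to their
derivatives at the same rate. This is what the complexification is for. -/
theorem fderiv (h : CloseTo f F) :
    CloseTo (fun n => _root_.fderiv ℂ (f n)) (_root_.fderiv ℂ F) := by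
  obtain ⟨r, hr, K, hK, N, h1, h2⟩ := h.exists_ball
  refine ⟨h.analyticAt.fderiv, 2 * K / (r / 2), by positivity,
    eventually_of_exists_ball (r := r / 2) (by positivity) (N := N) ?_⟩
  intro n hn y hy
  have sub : ∀ z ∈ Metric.ball y (r / 2), ‖z‖ < r := by
    intro z hz
    rw [Metric.mem_ball, dist_eq_norm] at hz
    have := norm_add_le (z - y) y
    rw [sub_add_cancel] at this
    linarith
  have hyr : ‖y‖ < r := by linarith
  refine ⟨(h2 n hn y hyr).1.fderiv, ?_⟩
  have hd : ‖_root_.fderiv ℂ (fun z => f n z - F z) y‖ ≤ (2 * (K / n)) / (r / 2) := by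
    refine Complex.norm_fderiv_le_div_of_mapsTo_ball (R₂ := 2 * (K / n)) ?_ ?_ (by positivity)
    · intro z hz
      exact ((h2 n hn z (sub z hz)).1.sub
        (h1 z (sub z hz))).differentiableAt.differentiableWithinAt
    · intro z hz
      rw [Metric.mem_closedBall, dist_eq_norm]
      refine (norm_sub_le _ _).trans ?_
      linarith [(h2 n hn z (sub z hz)).2, (h2 n hn y hyr).2]
  have e : _root_.fderiv ℂ (fun z => f n z - F z) y
      = _root_.fderiv ℂ (f n) y - _root_.fderiv ℂ F y :=
    fderiv_fun_sub (h2 n hn y hyr).1.differentiableAt (h1 y hyr).differentiableAt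
  rw [e] at hd
  refine hd.trans (le_of_eq ?_)
  ring

theorem iteratedFDeriv (h : CloseTo f F) (k : ℕ) :
    CloseTo (fun n => _root_.iteratedFDeriv ℂ k (f n)) (_root_.iteratedFDeriv ℂ k F) := by
  induction k with
  | zero =>
    exact clm (continuousMultilinearCurryFin0 ℂ (ℂ × ℂ) V).symm.toContinuousLinearEquiv.toContinuousLinearMap h
  | succ k ih =>
    exact clm (continuousMultilinearCurryLeftEquiv ℂ (fun _ : Fin (k + 1) => ℂ × ℂ)
      V).symm.toContinuousLinearEquiv.toContinuousLinearMap ih.fderiv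

theorem eventually_bounded (h : CloseTo f F) :
    ∃ B > (0 : ℝ), ∀ᶠ p : ℕ × ℂ × ℂ in atTop ×ˢ 𝓝 0, ‖f p.1 p.2‖ ≤ B := by
  refine ⟨‖F 0‖ + 1, by positivity, ?_⟩
  have := h.tendsto.norm.eventually_le_const (show ‖F 0‖ < ‖F 0‖ + 1 by linarith)
  exact this

end CloseTo

/-! ### Vanishing jets -/

theorem AnalyticAt.iteratedFDeriv_at {V : Type*} [NormedAddCommGroup V] [NormedSpace ℂ V]
    [CompleteSpace V] {f : ℂ × ℂ → V} {x : ℂ × ℂ} (hf : AnalyticAt ℂ f x) (k : ℕ) :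
    AnalyticAt ℂ (iteratedFDeriv ℂ k f) x := by
  induction k with
  | zero =>
    exact (continuousMultilinearCurryFin0 ℂ (ℂ × ℂ) V).symm.toContinuousLinearEquiv.analyticAt _
      |>.comp hf
  | succ k ih =>
    exact ((continuousMultilinearCurryLeftEquiv ℂ (fun _ : Fin (k + 1) => ℂ × ℂ)
      V).symm.toContinuousLinearEquiv.analyticAt _).comp ih.fderiv

/-- `f` vanishes at the origin to order `d`. -/
def VanishesTo {V : Type*} [NormedAddCommGroup V] (f : ℂ × ℂ → V) (d : ℕ) : Prop :=
  f =O[𝓝 0] fun y => ‖y‖ ^ d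

namespace VanishesTo

variable {V : Type*} [NormedAddCommGroup V] {f g : ℂ × ℂ → V} {d : ℕ}

theorem mono {e : ℕ} (h : VanishesTo f d) (he : e ≤ d) : VanishesTo f e := by
  refine h.trans (Asymptotics.IsBigO.of_bound 1 ?_)
  filter_upwards [Metric.ball_mem_nhds (0 : ℂ × ℂ) one_pos] with y hy
  rw [mem_ball_zero_iff] at hy
  rw [norm_pow, norm_pow, norm_norm, one_mul]
  exact pow_le_pow_of_le_one (norm_nonneg _) hy.le he

theorem add (h : VanishesTo f d) (h' : VanishesTo g d) : VanishesTo (fun y => f y + g y) d :=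
  Asymptotics.IsBigO.add h h'

theorem sub (h : VanishesTo f d) (h' : VanishesTo g d) : VanishesTo (fun y => f y - g y) d :=
  Asymptotics.IsBigO.sub h h'

theorem congr (h : VanishesTo f d) (e : ∀ y, g y = f y) : VanishesTo g d := by
  have : g = f := funext e
  rwa [this]

theorem mul {f g : ℂ × ℂ → ℂ} {e : ℕ} (h : VanishesTo f d) (h' : VanishesTo g e) :
    VanishesTo (fun y => f y * g y) (d + e) := by
  simpa only [VanishesTo, pow_add] using Asymptotics.IsBigO.mul h h'

theorem pow {f : ℂ × ℂ → ℂ} (h : VanishesTo f 1) (k : ℕ) : VanishesTo (fun y => f y ^ k) k := by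
  simpa [VanishesTo] using Asymptotics.IsBigO.pow h k

theorem const_mul {f : ℂ × ℂ → ℂ} (h : VanishesTo f d) (c : ℂ) :
    VanishesTo (fun y => c * f y) d :=
  Asymptotics.IsBigO.const_mul_left h c

theorem sum {ι : Type*} {s : Finset ι} {f : ι → ℂ × ℂ → V} (h : ∀ i ∈ s, VanishesTo (f i) d) :
    VanishesTo (fun y => ∑ i ∈ s, f i y) d :=
  Asymptotics.IsBigO.fun_sum h

theorem zero_of_continuousAt (h : ContinuousAt f 0) : VanishesTo f 0 := by
  have := h.norm.isBoundedUnder_le.isBigO_one (F := ℝ)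
  simpa [VanishesTo] using this

theorem comp (h : VanishesTo f d) {g : ℂ × ℂ → ℂ × ℂ} (hg : VanishesTo g 1)
    (hc : ContinuousAt g 0) (h0 : g 0 = 0) : VanishesTo (fun y => f (g y)) d := by
  have t : Tendsto g (𝓝 0) (𝓝 0) := by simpa [h0] using hc.tendsto
  refine (h.comp_tendsto t).trans ?_
  have := (hg.norm_left).pow d
  simpa [Function.comp_def] using this

theorem apply_zero (h : VanishesTo f (d + 1)) : f 0 = 0 := by
  obtain ⟨c, hc⟩ := h.bound
  have := hc.self_of_nhds
  simpa using this

variable [NormedSpace ℂ V] [CompleteSpace V]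

theorem of_analyticAt (hf : AnalyticAt ℂ f 0) (h0 : f 0 = 0) : VanishesTo f 1 := by
  have := hf.differentiableAt.isBigO_sub
  simpa [VanishesTo, h0] using this.norm_right

/-- Cauchy's estimate on the ball of radius ‖y‖ about y, on which f is of size at most
c(2‖y‖)^(d+1). At y = 0 the ball degenerates, and the derivative is estimated directly. -/
theorem fderiv (hf : AnalyticAt ℂ f 0) (h : VanishesTo f (d + 1)) :
    VanishesTo (_root_.fderiv ℂ f) d := by
  obtain ⟨c, hc0, hc⟩ := h.exists_pos
  obtain ⟨r, hr, hb⟩ := Metric.eventually_nhds_iff_ball.1 (hc.bound.and hf.eventually_analyticAt)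
  refine Asymptotics.IsBigO.of_bound (2 * c * 2 ^ (d + 1)) ?_
  filter_upwards [Metric.ball_mem_nhds (0 : ℂ × ℂ) (half_pos hr)] with y hy
  rw [mem_ball_zero_iff] at hy
  rcases eq_or_ne y 0 with rfl | hy0
  · rcases Nat.eq_zero_or_pos d with rfl | hd
    · have hle : ‖_root_.fderiv ℂ f 0‖ ≤ c := by
        refine norm_fderiv_le_of_lip' ℂ hc0.le ?_
        filter_upwards [hc.bound] with z hz
        have := h.apply_zero
        simpa [this] using hz
      norm_num
      linarith
    · have hle : HasFDerivAt f (0 : ℂ × ℂ →L[ℂ] V) 0 := by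
        rw [hasFDerivAt_iff_isLittleO_nhds_zero]
        simp only [zero_add, h.apply_zero, sub_zero, zero_apply]
        refine Asymptotics.IsBigO.trans_isLittleO h ?_
        have := Asymptotics.isLittleO_norm_pow_id (E' := ℂ × ℂ) (n := d + 1) (by omega)
        exact this
      rw [hle.fderiv, norm_zero]
      positivity
  · have hyp : 0 < ‖y‖ := norm_pos_iff.2 hy0
    have inb : ∀ z ∈ Metric.ball y ‖y‖, ‖z‖ < 2 * ‖y‖ := by
      intro z hz
      rw [Metric.mem_ball, dist_eq_norm] at hz
      have := norm_add_le (z - y) y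
      rw [sub_add_cancel] at this
      linarith
    have bd : ∀ z ∈ Metric.ball y ‖y‖, ‖f z‖ ≤ c * (2 * ‖y‖) ^ (d + 1) := by
      intro z hz
      have hz' := inb z hz
      refine ((hb z (by rw [mem_ball_zero_iff]; linarith)).1).trans ?_
      rw [norm_pow, norm_norm]
      gcongr
    have := Complex.norm_fderiv_le_div_of_mapsTo_ball (f := f) (c := y) (R₁ := ‖y‖)
      (R₂ := 2 * (c * (2 * ‖y‖) ^ (d + 1))) ?_ ?_ hyp
    · refine this.trans (le_of_eq ?_)
      rw [norm_pow, norm_norm, mul_pow, pow_succ ‖y‖]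
      field_simp
    · intro z hz
      have hz' := inb z hz
      exact (hb z (by rw [mem_ball_zero_iff]; linarith)).2.differentiableAt.differentiableWithinAt
    · intro z hz
      rw [Metric.mem_closedBall, dist_eq_norm]
      refine (norm_sub_le _ _).trans ?_
      linarith [bd z hz, bd y (Metric.mem_ball_self hyp)]

theorem iteratedFDeriv (hf : AnalyticAt ℂ f 0) :
    ∀ (k : ℕ) {e : ℕ}, VanishesTo f (e + k) → VanishesTo (_root_.iteratedFDeriv ℂ k f) e := by
  intro k
  induction k with
  | zero =>
    intro e h
    refine Asymptotics.IsBigO.of_norm_left ?_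
    simpa only [norm_iteratedFDeriv_zero, add_zero] using Asymptotics.IsBigO.norm_left h
  | succ k ih =>
    intro e h
    have h1 := ih (e := e + 1) (by rwa [add_assoc, add_comm 1 k])
    have h2 := VanishesTo.fderiv (hf.iteratedFDeriv_at k) h1
    refine Asymptotics.IsBigO.of_norm_left ?_
    simpa only [norm_fderiv_iteratedFDeriv] using Asymptotics.IsBigO.norm_left h2

end VanishesTo

/-! ### Uniform Taylor estimates and inverses -/

theorem norm_le_of_norm_fderiv_le {V : Type*} [NormedAddCommGroup V] [NormedSpace ℂ V]
    {f : ℂ × ℂ → V} {r K : ℝ} {d : ℕ} (hK : 0 ≤ K) (h0 : f 0 = 0)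
    (hf : ∀ y : ℂ × ℂ, ‖y‖ < r → AnalyticAt ℂ f y)
    (hd : ∀ y : ℂ × ℂ, ‖y‖ < r → ‖fderiv ℂ f y‖ ≤ K * ‖y‖ ^ d) {y : ℂ × ℂ} (hy : ‖y‖ < r) :
    ‖f y‖ ≤ K * ‖y‖ ^ (d + 1) := by
  have sub : ∀ z ∈ Metric.closedBall (0 : ℂ × ℂ) ‖y‖, ‖z‖ ≤ ‖y‖ := fun z hz => by simpa using hz
  have := (convex_closedBall (0 : ℂ × ℂ) ‖y‖).norm_image_sub_le_of_norm_fderiv_le (𝕜 := ℂ) (f := f)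
    (C := K * ‖y‖ ^ d) (fun z hz => (hf z ((sub z hz).trans_lt hy)).differentiableAt)
    (fun z hz => (hd z ((sub z hz).trans_lt hy)).trans (by gcongr; exact sub z hz))
    (x := 0) (y := y) (by simp) (by simp)
  rw [h0, sub_zero, sub_zero] at this
  rw [pow_succ, ← mul_assoc]
  exact this

theorem VanishesTo.of_fderiv {V : Type*} [NormedAddCommGroup V] [NormedSpace ℂ V]
    [CompleteSpace V] {f : ℂ × ℂ → V} {d : ℕ} (hf : AnalyticAt ℂ f 0) (h0 : f 0 = 0)
    (h : VanishesTo (_root_.fderiv ℂ f) d) : VanishesTo f (d + 1) := by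
  obtain ⟨c, hc0, hc⟩ := Asymptotics.IsBigO.exists_pos h
  obtain ⟨r, hr, hb⟩ := Metric.eventually_nhds_iff_ball.1 (hc.bound.and hf.eventually_analyticAt)
  refine Asymptotics.IsBigO.of_bound c ?_
  filter_upwards [Metric.ball_mem_nhds (0 : ℂ × ℂ) hr] with y hy
  rw [norm_pow, norm_norm]
  refine norm_le_of_norm_fderiv_le (r := r) hc0.le h0 (fun z hz => (hb z (by simpa using hz)).2)
    (fun z hz => ?_) (by simpa using hy)
  simpa using (hb z (by simpa using hz)).1

theorem VanishesTo.two_of_hasFDerivAt {V : Type*} [NormedAddCommGroup V] [NormedSpace ℂ V]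
    [CompleteSpace V] {f : ℂ × ℂ → V} (hf : AnalyticAt ℂ f 0) (h0 : f 0 = 0)
    (h : HasFDerivAt f (0 : ℂ × ℂ →L[ℂ] V) 0) : VanishesTo f 2 :=
  .of_fderiv hf h0 (.of_analyticAt hf.fderiv h.fderiv)

/-- The derivatives of order d are bounded uniformly in n, and those of lower order vanish at the
origin. Each integration from the origin gains one power of ‖y‖ with the same constant. -/
theorem CloseTo.norm_iteratedFDeriv_le {V : Type*} [NormedAddCommGroup V] [NormedSpace ℂ V]
    [CompleteSpace V] {f : ℕ → ℂ × ℂ → V} {F : ℂ × ℂ → V} {d : ℕ} (h : CloseTo f F)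
    (hd : ∀ᶠ n in atTop, VanishesTo (f n) d) {k : ℕ} (hk : k ≤ d) :
    ∃ K > (0 : ℝ), ∀ᶠ p : ℕ × ℂ × ℂ in atTop ×ˢ 𝓝 0,
      ‖_root_.iteratedFDeriv ℂ k (f p.1) p.2‖ ≤ K * ‖p.2‖ ^ (d - k) := by
  induction hk using Nat.decreasingInduction with
  | self =>
    obtain ⟨K, hK, hb⟩ := (h.iteratedFDeriv d).eventually_bounded
    exact ⟨K, hK, hb.mono fun p hp => by simpa using hp⟩
  | of_succ k hk ih =>
    obtain ⟨K, hK, hb⟩ := ih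
    obtain ⟨r, hr, N, hN⟩ := (hb.and h.eventually_analyticAt).exists_ball
    obtain ⟨N', hN'⟩ := eventually_atTop.1 hd
    refine ⟨K, hK, eventually_of_exists_ball hr (N := max N N') fun n hn y hy => ?_⟩
    have hn1 := (le_max_left _ _).trans hn
    have hn2 := (le_max_right _ _).trans hn
    obtain ⟨e, he⟩ : ∃ e, d = e + 1 + k := ⟨d - (k + 1), by omega⟩
    have h0 : _root_.iteratedFDeriv ℂ k (f n) 0 = 0 := by
      have := hN' n hn2
      rw [he] at this
      exact (VanishesTo.iteratedFDeriv (hN n hn1 0 (by simpa using hr)).2 k this).apply_zero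
    have e1 : d - k = e + 1 := by omega
    have e2 : d - (k + 1) = e := by omega
    rw [e1]
    refine norm_le_of_norm_fderiv_le hK.le h0 (fun z hz => ?_) (fun z hz => ?_) hy
    · exact (hN n hn1 z hz).2.iteratedFDeriv_at k
    · rw [norm_fderiv_iteratedFDeriv, ← e2]
      exact (hN n hn1 z hz).1

/-! ### Taylor coefficients and inverses, uniformly in n -/

/-- The coefficient of `u ^ j v ^ (d - j)` in the Taylor polynomial of `f` at the origin. -/
noncomputable def taylorCoeff (d j : ℕ) (f : ℂ × ℂ → ℂ) : ℂ :=
  (d.factorial : ℂ)⁻¹ * ∑ s ∈ Finset.powersetCard j (Finset.univ : Finset (Fin d)),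
    iteratedFDeriv ℂ d f 0 (s.piecewise (fun _ => (1, 0)) (fun _ => (0, 1)))

theorem multilinear_apply_diag {d : ℕ} (q : ContinuousMultilinearMap ℂ (fun _ : Fin d => ℂ × ℂ) ℂ)
    (y : ℂ × ℂ) : q (fun _ => y) = ∑ j ∈ Finset.range (d + 1),
      (∑ s ∈ Finset.powersetCard j (Finset.univ : Finset (Fin d)),
        q (s.piecewise (fun _ => (1, 0)) (fun _ => (0, 1)))) * (y.1 ^ j * y.2 ^ (d - j)) := by
  have e : (fun _ : Fin d => y) = (fun _ => y.1 • ((1, 0) : ℂ × ℂ)) + fun _ => y.2 • (0, 1) := by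
    funext i; ext <;> simp
  rw [e]
  have := q.toMultilinearMap.map_add_univ (fun _ => y.1 • ((1, 0) : ℂ × ℂ)) fun _ => y.2 • (0, 1)
  rw [show q ((fun _ => y.1 • ((1, 0) : ℂ × ℂ)) + fun _ => y.2 • (0, 1)) = _ from this]
  have e2 : ∀ s : Finset (Fin d), q.toMultilinearMap (s.piecewise
      (fun _ => y.1 • ((1, 0) : ℂ × ℂ)) fun _ => y.2 • (0, 1)) = y.1 ^ s.card * y.2 ^ (d - s.card) *
        q (s.piecewise (fun _ => (1, 0)) (fun _ => (0, 1))) := by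
    intro s
    have e3 : (s.piecewise (fun _ => y.1 • ((1, 0) : ℂ × ℂ)) fun _ => y.2 • (0, 1)) =
        fun i => (s.piecewise (fun _ => y.1) (fun _ => y.2) : Fin d → ℂ) i •
          (s.piecewise (fun _ => ((1, 0) : ℂ × ℂ)) (fun _ => (0, 1)) : Fin d → ℂ × ℂ) i := by
      funext i
      by_cases hi : i ∈ s <;> simp [hi]
    rw [e3, MultilinearMap.map_smul_univ, Finset.prod_piecewise]
    simp [Finset.card_sdiff, Finset.inter_comm]
  simp_rw [e2]
  rw [← Finset.powerset_univ, Finset.sum_powerset]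
  simp only [Finset.card_univ, Fintype.card_fin]
  refine Finset.sum_congr rfl fun j hj => ?_
  rw [Finset.sum_mul]
  refine Finset.sum_congr rfl fun s hs => ?_
  rw [(Finset.mem_powersetCard.1 hs).2]
  ring

theorem VanishesTo.sub_taylor {f : ℂ × ℂ → ℂ} {d : ℕ} (hf : AnalyticAt ℂ f 0)
    (h : VanishesTo f d) : VanishesTo (fun w => f w -
      ∑ j ∈ Finset.range (d + 1), taylorCoeff d j f * (w.1 ^ j * w.2 ^ (d - j))) (d + 1) := by
  obtain ⟨p, r, hp⟩ := hf
  have part : ∀ k, VanishesTo (fun y => f y - p.partialSum k y) k := by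
    intro k
    have := HasFPowerSeriesAt.isBigO_sub_partialSum_pow ⟨r, hp⟩ k
    simpa [VanishesTo] using this
  -- Vanishing to order d kills the homogeneous parts one degree at a time: once the lower ones are
  -- gone, the part of degree k is itself O(‖y‖^(k+1)).
  have low : ∀ k < d, ∀ y, p k (fun _ => y) = 0 := by
    intro k
    induction k using Nat.strong_induction_on with
    | _ k ih =>
      intro hk y
      refine Asymptotics.IsBigO.continuousMultilinearMap_apply_eq_zero ?_ y
      have h1 := (h.mono hk).sub (part (k + 1))
      refine Asymptotics.IsBigO.congr_left h1 fun y => ?_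
      rw [sub_sub_cancel, FormalMultilinearSeries.partialSum, Finset.sum_range_succ,
        Finset.sum_eq_zero, zero_add]
      exact fun i hi => ih i (Finset.mem_range.1 hi) ((Finset.mem_range.1 hi).trans hk) y
  refine (part (d + 1)).congr fun y => ?_
  congr 1
  have hps : p.partialSum (d + 1) y = p d fun _ => y := by
    rw [FormalMultilinearSeries.partialSum, Finset.sum_range_succ, Finset.sum_eq_zero
      (fun i hi => low i (Finset.mem_range.1 hi) y), zero_add]
  rw [hps]
  have := hp.factorial_smul y d
  rw [multilinear_apply_diag (_root_.iteratedFDeriv ℂ d f 0)] at this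
  have hd : (d.factorial : ℂ) ≠ 0 := by exact_mod_cast d.factorial_ne_zero
  rw [nsmul_eq_mul] at this
  simp only [taylorCoeff]
  apply mul_left_cancel₀ hd
  rw [show (d.factorial : ℂ) * p d (fun _ => y) = _ from this, Finset.mul_sum]
  refine Finset.sum_congr rfl fun j _ => ?_
  rw [mul_assoc, mul_inv_cancel_left₀ hd]

/-- On the line w = (ts, t) the difference of the two forms is S(s) t^d. Vanishing to order d + 1
forces S(s) = 0 for every s, and a polynomial with no nonzero value has zero coefficients. -/
theorem taylor_unique {d : ℕ} {a b : ℕ → ℂ}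
    (h : VanishesTo (fun w : ℂ × ℂ =>
      ∑ j ∈ Finset.range (d + 1), a j * (w.1 ^ j * w.2 ^ (d - j)) -
      ∑ j ∈ Finset.range (d + 1), b j * (w.1 ^ j * w.2 ^ (d - j))) (d + 1)) {j : ℕ} (hj : j ≤ d) :
    a j = b j := by
  have key : ∀ s : ℂ, ∑ j ∈ Finset.range (d + 1), (a j - b j) * s ^ j = 0 := by
    intro s
    have hc : VanishesTo (fun w : ℂ × ℂ => (w.1 * s, w.1)) 1 := by
      refine .of_analyticAt ?_ (by simp)
      exact (analyticAt_fst.mul analyticAt_const).prod analyticAt_fst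
    have h2 := h.comp hc (by fun_prop) (by simp)
    by_contra hne
    set S := ∑ j ∈ Finset.range (d + 1), (a j - b j) * s ^ j with hS
    have h3 : VanishesTo (fun w : ℂ × ℂ => S * w.1 ^ d) (d + 1) := by
      refine h2.congr fun w => ?_
      rw [← Finset.sum_sub_distrib, hS, Finset.sum_mul]
      refine Finset.sum_congr rfl fun j hj => ?_
      have : w.1 ^ d = w.1 ^ j * w.1 ^ (d - j) := by
        rw [← pow_add]; congr 1; have := Finset.mem_range.1 hj; omega
      rw [this, mul_pow]; ring
    obtain ⟨c, hc0, hc⟩ := Asymptotics.IsBigO.exists_pos h3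
    obtain ⟨r, hr, hb⟩ := Metric.eventually_nhds_iff_ball.1 hc.bound
    have hS0 : 0 < ‖S‖ := norm_pos_iff.2 hne
    set t := min (r / 2) (‖S‖ / (2 * c)) with ht
    have ht0 : 0 < t := by positivity
    have := hb ((t : ℂ), 0) (by
      simp only [Metric.mem_ball, dist_zero_right, Prod.norm_def, norm_zero]
      rw [Complex.norm_real, Real.norm_eq_abs, abs_of_pos ht0, max_eq_left ht0.le]
      exact (min_le_left _ _).trans_lt (by linarith))
    simp only [Prod.norm_def, norm_zero, norm_mul, norm_pow, Complex.norm_real,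
      Real.norm_eq_abs, abs_of_pos ht0, max_eq_left ht0.le] at this
    have h4 : c * t ≤ ‖S‖ / 2 := by
      calc c * t ≤ c * (‖S‖ / (2 * c)) := by gcongr; exact min_le_right _ _
        _ = ‖S‖ / 2 := by field_simp
    have h5 : 0 < t ^ d := by positivity
    rw [pow_succ] at this
    nlinarith
  have hp : (∑ j ∈ Finset.range (d + 1), Polynomial.C (a j - b j) * Polynomial.X ^ j) = 0 := by
    apply Polynomial.funext
    intro s
    simpa [Polynomial.eval_finsetSum] using key s
  have := congrArg (fun p => p.coeff j) hp
  simp only [Polynomial.finsetSum_coeff, Polynomial.coeff_C_mul, Polynomial.coeff_X_pow,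
    Polynomial.coeff_zero] at this
  rw [Finset.sum_eq_single j (fun i _ hij => by simp [hij.symm])
    (fun hj' => absurd (Finset.mem_range.2 (by omega)) hj')] at this
  simpa [sub_eq_zero] using this

theorem taylorCoeff_eq {f : ℂ × ℂ → ℂ} {d : ℕ} {a : ℕ → ℂ} (hf : AnalyticAt ℂ f 0)
    (h : VanishesTo (fun w => f w -
      ∑ j ∈ Finset.range (d + 1), a j * (w.1 ^ j * w.2 ^ (d - j))) (d + 1))
    (hd : VanishesTo f d) {j : ℕ} (hj : j ≤ d) : taylorCoeff d j f = a j := by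
  refine taylor_unique (a := fun j => taylorCoeff d j f)
    ((h.sub (hd.sub_taylor hf)).congr fun w => ?_) hj
  rw [sub_sub_sub_cancel_left]

/-- Convergence of Taylor coefficients at rate 1/n is what makes the solutions of the homological
equations converge with the maps. -/
theorem CloseTo.taylorCoeff {f : ℕ → ℂ × ℂ → ℂ} {F : ℂ × ℂ → ℂ} (h : CloseTo f F) (d j : ℕ) :
    CloseTo (fun n _ => taylorCoeff d j (f n)) (fun _ => _root_.taylorCoeff d j F) := by
  refine (CloseTo.const analyticAt_const).mul (CloseTo.sum _ fun s _ => ?_)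
  exact ((h.iteratedFDeriv d).eval_zero).clm (ContinuousMultilinearMap.apply ℂ _ ℂ _)

/-- On the ball of radius r the map differs from the identity by a 1/2-Lipschitz map, hence is
expanding up to the factor 1/2 and covers the ball of radius r/4. These radii do not depend on f,
which gives inverses of a family on a common ball. -/
theorem inverse_of_near_id {f : ℂ × ℂ → ℂ × ℂ} {r : ℝ} (hr : 0 < r)
    (hf : ∀ y : ℂ × ℂ, ‖y‖ < r → AnalyticAt ℂ f y)
    (hd : ∀ y : ℂ × ℂ, ‖y‖ < r → ‖fderiv ℂ f y - ContinuousLinearMap.id ℂ (ℂ × ℂ)‖ ≤ 1 / 2)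
    (h0 : f 0 = 0) :
    (∃ κ : ℂ × ℂ → ℂ × ℂ, ∀ w : ℂ × ℂ, ‖w‖ < r / 4 →
      AnalyticAt ℂ κ w ∧ ‖κ w‖ < r ∧ f (κ w) = w) ∧
    ∀ y y' : ℂ × ℂ, ‖y‖ < r → ‖y'‖ < r → ‖y - y'‖ ≤ 2 * ‖f y - f y'‖ := by
  have happ : ApproximatesLinearOn f
      ((ContinuousLinearEquiv.refl ℂ (ℂ × ℂ) : (ℂ × ℂ) ≃L[ℂ] ℂ × ℂ) : ℂ × ℂ →L[ℂ] ℂ × ℂ)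
      (Metric.ball 0 r) (1 / 2) := by
    intro x hx y hy
    have := (convex_ball (0 : ℂ × ℂ) r).norm_image_sub_le_of_norm_hasFDerivWithin_le' (𝕜 := ℂ)
      (f := f) (f' := fderiv ℂ f) (φ := ContinuousLinearMap.id ℂ (ℂ × ℂ)) (C := 1 / 2)
      (fun z hz => (hf z (by simpa using hz)).differentiableAt.hasFDerivAt.hasFDerivWithinAt)
      (fun z hz => hd z (by simpa using hz)) hy hx
    simpa using this
  have hanti : ∀ y y' : ℂ × ℂ, ‖y‖ < r → ‖y'‖ < r → ‖y - y'‖ ≤ 2 * ‖f y - f y'‖ := by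
    intro y y' hy hy'
    have h1 := happ y (by simpa using hy) y' (by simpa using hy')
    simp only [ContinuousLinearEquiv.coe_refl, ContinuousLinearMap.id_apply, NNReal.coe_div,
      NNReal.coe_one, NNReal.coe_ofNat] at h1
    have h2 := norm_sub_le (f y - f y') (f y - f y' - (y - y'))
    rw [sub_sub_cancel] at h2
    linarith
  refine ⟨?_, hanti⟩
  have hc : Subsingleton (ℂ × ℂ) ∨ (1 / 2 : NNReal) <
      ‖((ContinuousLinearEquiv.refl ℂ (ℂ × ℂ)).symm : ℂ × ℂ →L[ℂ] ℂ × ℂ)‖₊⁻¹ := by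
    right
    have : ‖((ContinuousLinearEquiv.refl ℂ (ℂ × ℂ)).symm : ℂ × ℂ →L[ℂ] ℂ × ℂ)‖₊ = 1 := by
      ext; simp
    rw [this, inv_one]
    exact NNReal.half_lt_self one_ne_zero
  set e := happ.toOpenPartialHomeomorph f _ hc Metric.isOpen_ball with he
  have hef : ∀ x, e x = f x := fun x => rfl
  have hes : e.source = Metric.ball 0 r := rfl
  have htar : ∀ w : ℂ × ℂ, ‖w‖ < r / 4 → w ∈ e.target := by
    intro w hw
    have := happ.closedBall_subset_target hc Metric.isOpen_ball (b := 0) (ε := r / 2) (by positivity)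
      (Metric.closedBall_subset_ball (by linarith))
    refine this ?_
    rw [h0, mem_closedBall_zero_iff]
    have hn : ‖((ContinuousLinearEquiv.refl ℂ (ℂ × ℂ)).symm : ℂ × ℂ →L[ℂ] ℂ × ℂ)‖₊ = 1 := by
      ext; simp
    rw [hn]
    norm_num
    linarith
  refine ⟨e.symm, fun w hw => ?_⟩
  have hws : ‖e.symm w‖ < r := by
    have := e.map_target (htar w hw)
    rw [hes] at this
    simpa using this
  refine ⟨?_, hws, by rw [← hef]; exact e.right_inv (htar w hw)⟩
  have hlt : ‖ContinuousLinearMap.id ℂ (ℂ × ℂ) - fderiv ℂ f (e.symm w)‖ < 1 := by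
    rw [norm_sub_rev]
    exact (hd _ hws).trans_lt (by norm_num)
  let u := Units.oneSub (ContinuousLinearMap.id ℂ (ℂ × ℂ) - fderiv ℂ f (e.symm w)) hlt
  refine e.analyticAt_symm (i := ContinuousLinearEquiv.unitsEquiv ℂ (ℂ × ℂ) u) (htar w hw)
    (hf _ hws) ?_
  change _ = (u : (ℂ × ℂ) →L[ℂ] ℂ × ℂ)
  rw [Units.val_oneSub, ContinuousLinearMap.one_def, sub_sub_cancel]
  rfl

theorem CloseTo.exists_inverse {f : ℕ → ℂ × ℂ → ℂ × ℂ} {F : ℂ × ℂ → ℂ × ℂ} (h : CloseTo f F)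
    (hd : ∀ᶠ n in atTop, VanishesTo (fun w => f n w - w) 2)
    (hF : VanishesTo (fun w => F w - w) 2) :
    ∃ κ κ', CloseTo κ κ' ∧ (∀ᶠ n in atTop, κ n 0 = 0) ∧
      (∀ᶠ p : ℕ × ℂ × ℂ in atTop ×ˢ 𝓝 0, f p.1 (κ p.1 p.2) = p.2) ∧
      ∀ᶠ p : ℕ × ℂ × ℂ in atTop ×ˢ 𝓝 0, κ p.1 (f p.1 p.2) = p.2 := by
  have hF0 : F 0 = 0 := by simpa using hF.apply_zero
  have hFd : _root_.fderiv ℂ F 0 = ContinuousLinearMap.id ℂ (ℂ × ℂ) := by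
    have h1 := (hF.fderiv (h.analyticAt.sub analyticAt_id)).apply_zero
    rwa [fderiv_sub h.analyticAt.differentiableAt differentiableAt_id, fderiv_id,
      sub_eq_zero] at h1
  have hnear : ∀ᶠ p : ℕ × ℂ × ℂ in atTop ×ˢ 𝓝 0,
      ‖_root_.fderiv ℂ (f p.1) p.2 - ContinuousLinearMap.id ℂ (ℂ × ℂ)‖ ≤ 1 / 2 := by
    have := h.fderiv.tendsto
    rw [hFd] at this
    filter_upwards [this (Metric.closedBall_mem_nhds _ (by norm_num : (0 : ℝ) < 1 / 2))] with p hp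
    simpa [dist_eq_norm] using hp
  have hnearF : ∀ᶠ y in 𝓝 (0 : ℂ × ℂ),
      ‖_root_.fderiv ℂ F y - ContinuousLinearMap.id ℂ (ℂ × ℂ)‖ ≤ 1 / 2 := by
    have := h.analyticAt.fderiv.continuousAt.tendsto
    rw [hFd] at this
    filter_upwards [this (Metric.closedBall_mem_nhds _ (by norm_num : (0 : ℝ) < 1 / 2))] with p hp
    simpa [dist_eq_norm] using hp
  obtain ⟨r₁, hr₁, K, hK, N₁, hA, hB⟩ := h.exists_ball
  obtain ⟨r₂, hr₂, N₂, hN₂⟩ := hnear.exists_ball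
  obtain ⟨r₃, hr₃, h3⟩ := Metric.eventually_nhds_iff_ball.1 hnearF
  obtain ⟨N₃, hN₃⟩ := eventually_atTop.1 hd
  set r := min r₁ (min r₂ r₃)
  have hr : 0 < r := by positivity
  have l1 : ∀ {x : ℝ}, x < r → x < r₁ := fun h => h.trans_le (min_le_left _ _)
  have l2 : ∀ {x : ℝ}, x < r → x < r₂ :=
    fun h => h.trans_le ((min_le_right _ _).trans (min_le_left _ _))
  have l3 : ∀ {x : ℝ}, x < r → x < r₃ :=
    fun h => h.trans_le ((min_le_right _ _).trans (min_le_right _ _))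
  obtain ⟨⟨κ', hκ'⟩, -⟩ := inverse_of_near_id hr (fun y hy => hA y (l1 hy))
    (fun y hy => h3 y (by simpa using l3 hy)) hF0
  have H : ∀ n, ∃ κ : ℂ × ℂ → ℂ × ℂ, max N₁ (max N₂ N₃) ≤ n →
      (∀ w : ℂ × ℂ, ‖w‖ < r / 4 → AnalyticAt ℂ κ w ∧ ‖κ w‖ < r ∧ f n (κ w) = w) ∧
      ∀ y y' : ℂ × ℂ, ‖y‖ < r → ‖y'‖ < r → ‖y - y'‖ ≤ 2 * ‖f n y - f n y'‖ := by
    intro n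
    by_cases hn : max N₁ (max N₂ N₃) ≤ n
    · simp only [max_le_iff] at hn
      obtain ⟨⟨κ, hκ⟩, ha⟩ := inverse_of_near_id hr (fun y hy => (hB n hn.1 y (l1 hy)).1)
        (fun y hy => hN₂ n hn.2.1 y (l2 hy)) (by simpa using (hN₃ n hn.2.2).apply_zero)
      exact ⟨κ, fun _ => ⟨hκ, ha⟩⟩
    · exact ⟨0, fun h => absurd h hn⟩
  choose κ hκ using H
  have hclose : CloseTo κ κ' := by
    refine ⟨(hκ' 0 (by simpa using hr)).1, 2 * K, by positivity,
      eventually_of_exists_ball (r := r / 4) (by positivity) (N := max N₁ (max N₂ N₃)) ?_⟩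
    intro n hn w hw
    obtain ⟨k1, k2⟩ := hκ n hn
    refine ⟨(k1 w hw).1, (k2 _ _ (k1 w hw).2.1 (hκ' w hw).2.1).trans ?_⟩
    rw [(k1 w hw).2.2]
    have := (hB n ((le_max_left _ _).trans hn) (κ' w) (l1 (hκ' w hw).2.1)).2
    rw [(hκ' w hw).2.2, norm_sub_rev] at this
    calc _ ≤ 2 * (K / n) := by gcongr
      _ = _ := by ring
  refine ⟨κ, κ', hclose, ?_, ?_, ?_⟩
  · filter_upwards [eventually_ge_atTop (max N₁ (max N₂ N₃))] with n hn
    obtain ⟨k1, k2⟩ := hκ n hn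
    have h1 := k1 0 (by simpa using hr)
    have h2 := k2 (κ n 0) 0 h1.2.1 (by simpa using hr)
    have h4 : f n 0 = 0 := by
      simp only [max_le_iff] at hn
      simpa using (hN₃ n hn.2.2).apply_zero
    rw [h1.2.2, h4] at h2
    simpa using h2
  · refine eventually_of_exists_ball (r := r / 4) (by positivity) (N := max N₁ (max N₂ N₃)) ?_
    exact fun n hn w hw => ((hκ n hn).1 w hw).2.2
  · have ht := h.tendsto
    rw [hF0] at ht
    have hb : ∀ᶠ p : ℕ × ℂ × ℂ in atTop ×ˢ 𝓝 0, ‖f p.1 p.2‖ < r / 4 := by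
      filter_upwards [ht (Metric.ball_mem_nhds _ (by positivity : 0 < r / 4))] with p hp
      simpa using hp
    filter_upwards [hb, (eventually_ge_atTop (max N₁ (max N₂ N₃))).prod_mk
      (Metric.ball_mem_nhds (0 : ℂ × ℂ) hr)] with p hp hp'
    obtain ⟨k1, k2⟩ := hκ p.1 hp'.1
    have h1 := k1 _ hp
    have h2 := k2 _ _ h1.2.1 (by simpa using hp'.2 : ‖p.2‖ < r)
    rw [h1.2.2, sub_self, norm_zero, mul_zero] at h2
    exact sub_eq_zero.1 (norm_le_zero_iff.1 h2)

/-! ### Reduction to normal form -/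

namespace VanishesTo

theorem mul_sub_mul {f f' h h' : ℂ × ℂ → ℂ} {a b : ℕ} (hf : VanishesTo (fun w => f w - f' w) (a + 1))
    (hf' : VanishesTo f' a) (hh : VanishesTo (fun w => h w - h' w) (b + 1)) (hh' : VanishesTo h b) :
    VanishesTo (fun w => f w * h w - f' w * h' w) (a + b + 1) := by
  have h1 := (hf.mul hh').mono (show a + b + 1 ≤ a + 1 + b by omega)
  have h2 := (hf'.mul hh).mono (show a + b + 1 ≤ a + (b + 1) by omega)
  exact (h1.add h2).congr fun w => by ring

theorem coord_fst (a : ℂ) : VanishesTo (fun w : ℂ × ℂ => a * w.1) 1 :=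
  .of_analyticAt (analyticAt_const.mul analyticAt_fst) (by simp)

theorem coord_snd (a : ℂ) : VanishesTo (fun w : ℂ × ℂ => a * w.2) 1 :=
  .of_analyticAt (analyticAt_const.mul analyticAt_snd) (by simp)

theorem pow_sub_pow {f f' : ℂ × ℂ → ℂ} (hf : VanishesTo (fun w => f w - f' w) 2)
    (hf' : VanishesTo f' 1) (j : ℕ) : VanishesTo (fun w => f w ^ j - f' w ^ j) (j + 1) := by
  have hf1 : VanishesTo f 1 := ((hf.mono one_le_two).add hf').congr fun w => by ring
  induction j with
  | zero =>
    simpa using (VanishesTo.of_analyticAt (f := fun _ : ℂ × ℂ => (0 : ℂ)) analyticAt_const rfl)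
  | succ j ih =>
    exact (mul_sub_mul ih (hf'.pow j) hf hf1).congr fun w => by rw [pow_succ, pow_succ]

theorem monomial_sub {c e : ℂ × ℂ → ℂ} {a b : ℂ} (hc : VanishesTo (fun w => c w - a * w.1) 2)
    (he : VanishesTo (fun w => e w - b * w.2) 2) (j k : ℕ) :
    VanishesTo (fun w => c w ^ j * e w ^ k - a ^ j * b ^ k * (w.1 ^ j * w.2 ^ k)) (j + k + 1) := by
  have he1 : VanishesTo e 1 := ((he.mono one_le_two).add (coord_snd b)).congr fun w => by ring
  refine (mul_sub_mul (pow_sub_pow hc (coord_fst a) j) ((coord_fst a).pow j)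
    (pow_sub_pow he (coord_snd b) k) (he1.pow k)).congr fun w => ?_
  rw [mul_pow, mul_pow]; ring

end VanishesTo

/-- The function `c` plus a homogeneous polynomial of degree `d` in `c` and `e`. -/
def addForm (b : ℕ → ℂ) (d : ℕ) (c e : ℂ × ℂ → ℂ) (w : ℂ × ℂ) : ℂ :=
  c w + ∑ j ∈ Finset.range (d + 1), b j * (c w ^ j * e w ^ (d - j))

/-- The defect of the twist equation for `c`. -/
def twistDefect (g : ℂ × ℂ → ℂ × ℂ) (l β : ℂ) (c e : ℂ × ℂ → ℂ) (w : ℂ × ℂ) : ℂ :=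
  c (g w) - l * c w * (1 + Complex.I * β * (c w * e w))

/-- The map `g` fixes the origin and its linear part is `diag (l, m)`. -/
structure HasDiagonalPart (g : ℂ × ℂ → ℂ × ℂ) (l m : ℂ) : Prop where
  continuousAt : ContinuousAt g 0
  map_zero : g 0 = 0
  vanishesTo : VanishesTo g 1
  fst : VanishesTo (fun w => (g w).1 - l * w.1) 2
  snd : VanishesTo (fun w => (g w).2 - m * w.2) 2

namespace HasDiagonalPart

variable {g : ℂ × ℂ → ℂ × ℂ} {l m : ℂ} {c e : ℂ × ℂ → ℂ}

theorem comp_fst (hg : HasDiagonalPart g l m) (hc : VanishesTo (fun w => c w - w.1) 2) :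
    VanishesTo (fun w => c (g w) - l * w.1) 2 :=
  ((hc.comp hg.vanishesTo hg.continuousAt hg.map_zero).add hg.fst).congr fun w => by ring

theorem comp_snd (hg : HasDiagonalPart g l m) (he : VanishesTo (fun w => e w - w.2) 2) :
    VanishesTo (fun w => e (g w) - m * w.2) 2 :=
  ((he.comp hg.vanishesTo hg.continuousAt hg.map_zero).add hg.snd).congr fun w => by ring

theorem sum_form {d : ℕ} (b : ℕ → ℂ) {l m : ℂ} (hc : VanishesTo (fun w => c w - l * w.1) 2)
    (he : VanishesTo (fun w => e w - m * w.2) 2) :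
    VanishesTo (fun w => ∑ j ∈ Finset.range (d + 1), b j * (c w ^ j * e w ^ (d - j)) -
      ∑ j ∈ Finset.range (d + 1), b j * (l ^ j * m ^ (d - j) * (w.1 ^ j * w.2 ^ (d - j))))
      (d + 1) := by
  refine (VanishesTo.sum (s := Finset.range (d + 1)) (f := fun j w => b j * (c w ^ j * e w ^ (d - j) -
    l ^ j * m ^ (d - j) * (w.1 ^ j * w.2 ^ (d - j)))) fun j hj => ?_).congr fun w => ?_
  · have := VanishesTo.monomial_sub hc he j (d - j)
    rw [Nat.add_sub_cancel' (Nat.lt_succ_iff.1 (Finset.mem_range.1 hj))] at this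
    exact this.const_mul _
  · rw [← Finset.sum_sub_distrib]
    exact Finset.sum_congr rfl fun j _ => by ring

theorem form_vanishesTo {d : ℕ} (b : ℕ → ℂ) (hc : VanishesTo c 1) (he : VanishesTo e 1) :
    VanishesTo (fun w => ∑ j ∈ Finset.range (d + 1), b j * (c w ^ j * e w ^ (d - j))) d := by
  refine VanishesTo.sum (f := fun j w => b j * (c w ^ j * e w ^ (d - j))) fun j hj => ?_
  refine VanishesTo.const_mul ?_ _
  refine ((hc.pow j).mul (he.pow (d - j))).mono ?_
  omega

theorem vanishesTo_one_fst (hc : VanishesTo (fun w => c w - w.1) 2) : VanishesTo c 1 :=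
  ((hc.mono one_le_two).add (VanishesTo.coord_fst 1)).congr fun w => by ring

theorem vanishesTo_one_snd (he : VanishesTo (fun w => e w - w.2) 2) : VanishesTo e 1 :=
  ((he.mono one_le_two).add (VanishesTo.coord_snd 1)).congr fun w => by ring

theorem twistDefect_vanishesTo_two (hg : HasDiagonalPart g l m) (β : ℂ)
    (hc : VanishesTo (fun w => c w - w.1) 2) (he : VanishesTo (fun w => e w - w.2) 2) :
    VanishesTo (twistDefect g l β c e) 2 := by
  have h1 := hg.comp_fst hc
  have c1 := vanishesTo_one_fst hc
  have h2 := ((c1.mul c1).mul (vanishesTo_one_snd he)).const_mul (l * (Complex.I * β))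
  exact ((h1.sub (hc.const_mul l)).sub (h2.mono (by norm_num))).congr fun w => by
    simp only [twistDefect]; ring

/-- This is the homological equation. The linear parts diag(l, m) act on the monomial of index j by
l^j m^(d-j), so adding the form changes that coefficient of the defect by -(l - l^j m^(d-j)) b_j.
The changes made to the twist term and to e appear only in degrees above d. -/
theorem twistDefect_addForm {d : ℕ} (hd : 2 ≤ d) (hg : HasDiagonalPart g l m) {β : ℂ}
    {a b b' : ℕ → ℂ}
    (hc : VanishesTo (fun w => c w - w.1) 2) (he : VanishesTo (fun w => e w - w.2) 2)
    (h : VanishesTo (fun w => twistDefect g l β c e w -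
      ∑ j ∈ Finset.range (d + 1), a j * (w.1 ^ j * w.2 ^ (d - j))) (d + 1)) :
    VanishesTo (fun w => twistDefect g l β (addForm b d c e) (addForm b' d e c) w -
      ∑ j ∈ Finset.range (d + 1), (a j - (l - l ^ j * m ^ (d - j)) * b j) *
        (w.1 ^ j * w.2 ^ (d - j))) (d + 1) := by
  have c1 := vanishesTo_one_fst hc
  have e1 := vanishesTo_one_snd he
  have k1 := sum_form (d := d) b (hg.comp_fst hc) (hg.comp_snd he)
  have k2 := (sum_form (c := c) (e := e) (d := d) b (l := 1) (m := 1) (hc.congr fun w => by ring)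
    (he.congr fun w => by ring)).const_mul l
  have B1 := form_vanishesTo (d := d) b c1 e1
  have B2 := form_vanishesTo (d := d) b' e1 c1
  have C1 : VanishesTo (addForm b d c e) 1 := c1.add (B1.mono (by omega))
  have E1 : VanishesTo (addForm b' d e c) 1 := e1.add (B2.mono (by omega))
  have k3 := ((B1.mul ((C1.add c1).mul E1)).mono (show d + 1 ≤ d + (1 + 1) by omega)).const_mul
    (l * (Complex.I * β))
  have k4 := (((c1.mul c1).mul B2).mono (show d + 1 ≤ 1 + 1 + d by omega)).const_mul
    (l * (Complex.I * β))
  refine ((((h.add k1).sub k2).sub k3).sub k4).congr fun w => ?_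
  have s1 : ∑ j ∈ Finset.range (d + 1), (a j - (l - l ^ j * m ^ (d - j)) * b j) *
        (w.1 ^ j * w.2 ^ (d - j)) = ∑ j ∈ Finset.range (d + 1), a j * (w.1 ^ j * w.2 ^ (d - j)) +
      ∑ j ∈ Finset.range (d + 1), b j * (l ^ j * m ^ (d - j) * (w.1 ^ j * w.2 ^ (d - j))) -
      l * ∑ j ∈ Finset.range (d + 1), b j * (1 ^ j * 1 ^ (d - j) * (w.1 ^ j * w.2 ^ (d - j))) := by
    rw [Finset.mul_sum, ← Finset.sum_add_distrib, ← Finset.sum_sub_distrib]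
    refine Finset.sum_congr rfl fun j _ => ?_
    rw [one_pow, one_pow]; ring
  rw [s1]
  simp only [twistDefect, addForm]
  generalize ∑ j ∈ Finset.range (d + 1), b j * (c w ^ j * e w ^ (d - j)) = s₁
  generalize ∑ j ∈ Finset.range (d + 1), b' j * (e w ^ j * c w ^ (d - j)) = s₂
  generalize ∑ j ∈ Finset.range (d + 1), b j * (c (g w) ^ j * e (g w) ^ (d - j)) = s₃
  generalize ∑ j ∈ Finset.range (d + 1), a j * (w.1 ^ j * w.2 ^ (d - j)) = s₄
  generalize ∑ j ∈ Finset.range (d + 1), b j * (l ^ j * m ^ (d - j) *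
    (w.1 ^ j * w.2 ^ (d - j))) = s₅
  generalize ∑ j ∈ Finset.range (d + 1), b j * (1 ^ j * 1 ^ (d - j) *
    (w.1 ^ j * w.2 ^ (d - j))) = s₆
  ring

end HasDiagonalPart

/-- Two convergent families of analytic functions with linear parts `u` and `v` that are conjugate
to each other on the real plane `v = conj u`. -/
structure ConjugatePair (c e : ℕ → ℂ × ℂ → ℂ) (c' e' : ℂ × ℂ → ℂ) : Prop where
  close_fst : CloseTo c c'
  close_snd : CloseTo e e'
  lin_fst : ∀ᶠ n in atTop, VanishesTo (fun w => c n w - w.1) 2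
  lin_snd : ∀ᶠ n in atTop, VanishesTo (fun w => e n w - w.2) 2
  limit_fst : VanishesTo (fun w => c' w - w.1) 2
  limit_snd : VanishesTo (fun w => e' w - w.2) 2
  real : ∀ᶠ p : ℕ × ℂ in atTop ×ˢ 𝓝 0, e p.1 (p.2, starRingEnd ℂ p.2) =
    starRingEnd ℂ (c p.1 (p.2, starRingEnd ℂ p.2))

theorem CloseTo.conj {a : ℕ → ℂ} {a' : ℂ} (h : CloseTo (fun n _ => a n) (fun _ => a')) :
    CloseTo (fun n _ => starRingEnd ℂ (a n)) (fun _ => starRingEnd ℂ a') := by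
  obtain ⟨r, hr, K, hK, N, -, h2⟩ := h.exists_ball
  refine CloseTo.of_seq (K := K) ?_
  filter_upwards [eventually_ge_atTop N] with n hn
  rw [← map_sub, RCLike.norm_conj]
  exact (h2 n hn 0 (by simpa using hr)).2

namespace ConjugatePair

variable {c e : ℕ → ℂ × ℂ → ℂ} {c' e' : ℂ × ℂ → ℂ}

theorem closeTo_addForm {b : ℕ → ℕ → ℂ} {b' : ℕ → ℂ} {d : ℕ} (hc : CloseTo c c') (he : CloseTo e e')
    (hb : ∀ j ≤ d, CloseTo (fun n _ => b n j) (fun _ => b' j)) :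
    CloseTo (fun n => addForm (b n) d (c n) (e n)) (addForm b' d c' e') := by
  refine hc.add (CloseTo.sum _ fun j hj => ?_)
  exact (hb j (Nat.lt_succ_iff.1 (Finset.mem_range.1 hj))).mul ((hc.pow j).mul (he.pow (d - j)))

theorem lin_addForm {c e f : ℂ × ℂ → ℂ} {d : ℕ} (hd : 2 ≤ d) (b : ℕ → ℂ)
    (hc : VanishesTo (fun w => c w - f w) 2)
    (c1 : VanishesTo c 1) (e1 : VanishesTo e 1) :
    VanishesTo (fun w => addForm b d c e w - f w) 2 :=
  (hc.add ((HasDiagonalPart.form_vanishesTo b c1 e1).mono hd)).congr fun w => by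
    simp only [addForm]; ring

theorem addForm {b : ℕ → ℕ → ℂ} {b' : ℕ → ℂ} {d : ℕ} (hd : 2 ≤ d) (h : ConjugatePair c e c' e')
    (hb : ∀ j ≤ d, CloseTo (fun n _ => b n j) (fun _ => b' j)) :
    ConjugatePair (fun n => addForm (b n) d (c n) (e n))
      (fun n => _root_.addForm (fun j => starRingEnd ℂ (b n j)) d (e n) (c n))
      (_root_.addForm b' d c' e') (_root_.addForm (fun j => starRingEnd ℂ (b' j)) d e' c') where
  close_fst := closeTo_addForm h.close_fst h.close_snd hb
  close_snd := closeTo_addForm h.close_snd h.close_fst fun j hj => (hb j hj).conj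
  lin_fst := by
    filter_upwards [h.lin_fst, h.lin_snd] with n h1 h2
    exact lin_addForm hd _ h1 (HasDiagonalPart.vanishesTo_one_fst h1)
      (HasDiagonalPart.vanishesTo_one_snd h2)
  lin_snd := by
    filter_upwards [h.lin_fst, h.lin_snd] with n h1 h2
    exact lin_addForm hd _ h2 (HasDiagonalPart.vanishesTo_one_snd h2)
      (HasDiagonalPart.vanishesTo_one_fst h1)
  limit_fst := lin_addForm hd _ h.limit_fst (HasDiagonalPart.vanishesTo_one_fst h.limit_fst)
      (HasDiagonalPart.vanishesTo_one_snd h.limit_snd)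
  limit_snd := lin_addForm hd _ h.limit_snd (HasDiagonalPart.vanishesTo_one_snd h.limit_snd)
      (HasDiagonalPart.vanishesTo_one_fst h.limit_fst)
  real := by
    filter_upwards [h.real] with p hp
    simp only [_root_.addForm, map_add, map_sum, map_mul, map_pow, hp, Complex.conj_conj]

theorem closeTo_twistDefect {g : ℕ → ℂ × ℂ → ℂ × ℂ} {G : ℂ × ℂ → ℂ × ℂ} {l β : ℕ → ℂ} {l' β' : ℂ}
    (h : ConjugatePair c e c' e') (hg : CloseTo g G) (hG : G 0 = 0)
    (hl : CloseTo (fun n _ => l n) (fun _ => l')) (hβ : CloseTo (fun n _ => β n) (fun _ => β')) :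
    CloseTo (fun n => twistDefect (g n) (l n) (β n) (c n) (e n)) (twistDefect G l' β' c' e') := by
  refine (h.close_fst.comp hg hG).sub ((hl.mul h.close_fst).mul ?_)
  exact (CloseTo.const analyticAt_const).add
    (((CloseTo.const analyticAt_const).mul hβ).mul (h.close_fst.mul h.close_snd))

/-- The nonresonant terms of the defect are divided by l - l^j m^(d-j), in degrees 2, 3 and 4. These
divisors converge to nonzero limits, so all corrections converge. The limit pair is assumed to have
a defect with neither quadratic nor resonant cubic terms for the value β'; this fixes the limit of
the twist coefficients. -/
theorem exists_normalForm {g : ℕ → ℂ × ℂ → ℂ × ℂ} {G : ℂ × ℂ → ℂ × ℂ} {l m : ℕ → ℂ} {l' m' β' : ℂ}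
    (hg : CloseTo g G) (hl : CloseTo (fun n _ => l n) (fun _ => l'))
    (hm : CloseTo (fun n _ => m n) (fun _ => m'))
    (hgd : ∀ᶠ n in atTop, HasDiagonalPart (g n) (l n) (m n)) (hGd : G 0 = 0)
    (hlm' : l' * m' = 1)
    (hres : ∀ k : ℕ, 1 ≤ k → k ≤ 5 → l' ^ k ≠ 1)
    (h : ConjugatePair c e c' e') {x₀ x₁ x₃ : ℂ}
    (hlim : VanishesTo (fun w => twistDefect G l' β' c' e' w -
      (x₀ * w.2 ^ 3 + x₁ * (w.1 * w.2 ^ 2) + x₃ * w.1 ^ 3)) 4) :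
    ∃ (c₁ e₁ : ℕ → ℂ × ℂ → ℂ) (c₁' e₁' : ℂ × ℂ → ℂ) (β : ℕ → ℂ), ConjugatePair c₁ e₁ c₁' e₁' ∧
      CloseTo (fun n _ => β n) (fun _ => β') ∧
      ∀ᶠ n in atTop, VanishesTo (twistDefect (g n) (l n) (β n) (c₁ n) (e₁ n)) 5 := by
  have hl0 : l' ≠ 0 := left_ne_zero_of_mul_eq_one hlm'
  have step : ∀ (d : ℕ), 2 ≤ d →
      (∀ j ≤ d, ¬ (d = 3 ∧ j = 2) → l' - l' ^ j * m' ^ (d - j) ≠ 0) →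
      ∀ {c e : ℕ → ℂ × ℂ → ℂ} {c' e' : ℂ × ℂ → ℂ} {β : ℕ → ℂ} {β' : ℂ}, ConjugatePair c e c' e' →
      CloseTo (fun n _ => β n) (fun _ => β') →
      (∀ᶠ n in atTop, VanishesTo (twistDefect (g n) (l n) (β n) (c n) (e n)) d) →
      ∃ (c₁ e₁ : ℕ → ℂ × ℂ → ℂ) (b : ℕ → ℂ),
        (∀ j ≤ d, taylorCoeff d j (twistDefect G l' β' c' e') = 0 → b j = 0) ∧
        ConjugatePair c₁ e₁ (_root_.addForm b d c' e')
          (_root_.addForm (fun j => starRingEnd ℂ (b j)) d e' c') ∧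
        ∀ᶠ n in atTop, VanishesTo (fun w => twistDefect (g n) (l n) (β n) (c₁ n) (e₁ n) w -
          if d = 3 then taylorCoeff 3 2 (twistDefect (g n) (l n) (β n) (c n) (e n)) *
            (w.1 ^ 2 * w.2) else 0) (d + 1) := by
    intro d hd hden c e c' e' β β' h hβ hv
    have hR := h.closeTo_twistDefect hg hGd hl hβ
    set R := fun n => twistDefect (g n) (l n) (β n) (c n) (e n) with hRdef
    -- The monomial w₁² w₂ is resonant: its divisor tends to l'(1 - l'm') = 0. It is left in place,
    -- to be absorbed by the twist coefficient.
    let b : ℕ → ℕ → ℂ := fun n j => if d = 3 ∧ j = 2 then 0 else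
      taylorCoeff d j (R n) / (l n - l n ^ j * m n ^ (d - j))
    let b' : ℕ → ℂ := fun j => if d = 3 ∧ j = 2 then 0 else
      taylorCoeff d j (twistDefect G l' β' c' e') / (l' - l' ^ j * m' ^ (d - j))
    have hb : ∀ j ≤ d, CloseTo (fun n _ => b n j) (fun _ => b' j) := by
      intro j hj
      by_cases hj3 : d = 3 ∧ j = 2
      · simp only [b, b', if_pos hj3]
        exact CloseTo.const analyticAt_const
      · simp only [b, b', if_neg hj3]
        exact (hR.taylorCoeff d j).div (hl.sub ((hl.pow j).mul (hm.pow (d - j)))) (hden j hj hj3)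
    refine ⟨_, _, b', fun j hj h0 => ?_, h.addForm hd hb, ?_⟩
    · simp only [b', h0, zero_div, ite_self]
    · have hne : ∀ᶠ n in atTop, ∀ j ∈ Finset.range (d + 1), ¬ (d = 3 ∧ j = 2) →
          l n - l n ^ j * m n ^ (d - j) ≠ 0 := by
        rw [Filter.eventually_all_finset]
        intro j hj
        by_cases hj3 : d = 3 ∧ j = 2
        · exact Eventually.of_forall fun n h => absurd hj3 h
        · have h1 := ((hl.sub ((hl.pow j).mul (hm.pow (d - j)))).tendsto_zero).eventually_ne
            (hden j (Nat.lt_succ_iff.1 (Finset.mem_range.1 hj)) hj3)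
          exact h1.mono fun n hn _ => hn
      filter_upwards [hv, hgd, h.lin_fst, h.lin_snd, hne, hR.eventually_analyticAt_zero]
        with n hv hgd h1 h2 hne ha
      have k := hgd.twistDefect_addForm (b := b n) (b' := fun j => starRingEnd ℂ (b n j)) hd h1 h2
        (hv.sub_taylor ha)
      refine k.congr fun w => ?_
      congr 1
      symm
      split_ifs with h3
      · subst h3
        rw [Finset.sum_eq_single 2]
        · simp [b, hRdef]
        · intro j hj hj2
          have hj3 : ¬ ((3 : ℕ) = 3 ∧ j = 2) := by simp [hj2]
          have := hne j hj hj3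
          simp only [b, hRdef, hj2, and_false, if_false]
          rw [mul_div_cancel₀ _ this, sub_self, zero_mul]
        · simp
      · refine Finset.sum_eq_zero fun j hj => ?_
        have hj3 : ¬ (d = 3 ∧ j = 2) := by simp [h3]
        have := hne j hj hj3
        simp only [b, if_neg hj3, hRdef]
        rw [mul_div_cancel₀ _ this, sub_self, zero_mul]
  -- The limit divisors are l'(1 - l'^(2j-d-1)). For d = 2, 3, 4 the exponents have absolute value
  -- at most 5, and the exponent is zero only at the resonant index.
  have m0 : m' = l'⁻¹ := eq_inv_of_mul_eq_one_right hlm'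
  have r1 := hres 1 le_rfl (by norm_num)
  have r2 := hres 2 (by norm_num) (by norm_num)
  have r3 := hres 3 (by norm_num) (by norm_num)
  have r4 := hres 4 (by norm_num) (by norm_num)
  have r5 := hres 5 (by norm_num) (by norm_num)
  rw [pow_one] at r1
  have d2 : ∀ j ≤ 2, ¬ (2 = 3 ∧ j = 2) → l' - l' ^ j * m' ^ (2 - j) ≠ 0 := by
    intro j hj _ h0
    have h0 := sub_eq_zero.1 h0
    interval_cases j <;> simp [m0] at h0 <;> field_simp at h0
    · exact r3 h0
    · exact r1 h0
    · exact r1 h0.symm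
  have d3 : ∀ j ≤ 3, ¬ (3 = 3 ∧ j = 2) → l' - l' ^ j * m' ^ (3 - j) ≠ 0 := by
    intro j hj hj2 h0
    have h0 := sub_eq_zero.1 h0
    interval_cases j <;> simp [m0] at h0 hj2 <;> field_simp at h0
    · exact r4 h0
    · exact r2 h0
    · exact r2 h0.symm
  have d4 : ∀ j ≤ 4, ¬ (4 = 3 ∧ j = 2) → l' - l' ^ j * m' ^ (4 - j) ≠ 0 := by
    intro j hj hj2 h0
    have h0 := sub_eq_zero.1 h0
    interval_cases j <;> simp [m0] at h0 hj2 <;> field_simp at h0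
    · exact r5 h0
    · exact r3 h0
    · exact r1 h0
    · exact r1 h0.symm
    · exact r3 h0.symm
  have z0 : CloseTo (fun _ _ => (0 : ℂ)) (fun _ => 0) := CloseTo.const analyticAt_const
  obtain ⟨c₂, e₂, b₂, hb₂, P₂, V₂⟩ := step 2 le_rfl d2 h z0 (by
    filter_upwards [hgd, h.lin_fst, h.lin_snd] with n h1 h2 h3
    exact h1.twistDefect_vanishesTo_two 0 h2 h3)
  have c1 := HasDiagonalPart.vanishesTo_one_fst h.limit_fst
  have e1 := HasDiagonalPart.vanishesTo_one_snd h.limit_snd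
  have A0 : AnalyticAt ℂ (twistDefect G l' 0 c' e') 0 :=
    (h.closeTo_twistDefect hg hGd hl z0).analyticAt
  let x : ℕ → ℂ := fun j => if j = 0 then x₀ else if j = 1 then x₁ else
    if j = 2 then l' * (Complex.I * β') else x₃
  have L4 : VanishesTo (fun w => twistDefect G l' 0 c' e' w -
      ∑ j ∈ Finset.range (3 + 1), x j * (w.1 ^ j * w.2 ^ (3 - j))) 4 := by
    have hc' : VanishesTo (fun w => c' w - 1 * w.1) 2 := h.limit_fst.congr fun w => by ring
    have he' : VanishesTo (fun w => e' w - 1 * w.2) 2 := h.limit_snd.congr fun w => by ring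
    have k := (VanishesTo.monomial_sub hc' he' 2 1).const_mul (l' * (Complex.I * β'))
    refine (hlim.add k).congr fun w => ?_
    simp only [Finset.sum_range_succ, Finset.sum_range_zero, x, twistDefect]
    norm_num
    ring
  have L3 : VanishesTo (twistDefect G l' 0 c' e') 3 := by
    have k := HasDiagonalPart.form_vanishesTo (d := 3) x
      ((VanishesTo.coord_fst 1).congr fun w => by ring) ((VanishesTo.coord_snd 1).congr fun w => by ring)
    refine ((L4.mono (by norm_num)).add k).congr fun w => by ring
  -- The limit defect has no quadratic part, so the quadratic correction tends to zero and leaves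
  -- the limit pair unchanged. The cubic coefficients of the corrected families then converge to
  -- those of the original limit pair.
  have b₂0 : ∀ j ≤ 2, b₂ j = 0 := by
    intro j hj
    refine hb₂ j hj (taylorCoeff_eq (a := fun _ => 0) A0 ?_ (L3.mono (by norm_num)) hj)
    exact L3.congr fun w => by simp
  have c₂' : _root_.addForm b₂ 2 c' e' = c' := by
    funext w
    simp [_root_.addForm, Finset.sum_range_succ, b₂0]
  have e₂' : _root_.addForm (fun j => starRingEnd ℂ (b₂ j)) 2 e' c' = e' := by
    funext w
    simp [_root_.addForm, Finset.sum_range_succ, b₂0]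
  rw [c₂', e₂'] at P₂
  have V₂' : ∀ᶠ n in atTop, VanishesTo (twistDefect (g n) (l n) 0 (c₂ n) (e₂ n)) 3 :=
    V₂.mono fun n hn => hn.congr fun w => by simp
  obtain ⟨c₃, e₃, b₃, -, P₃, V₃⟩ := step 3 (by norm_num) d3 P₂ z0 V₂'
  -- The twist term contributes l iβ to the coefficient of w₁² w₂; β is chosen to cancel what is
  -- left there.
  let β : ℕ → ℂ := fun n => taylorCoeff 3 2 (twistDefect (g n) (l n) 0 (c₂ n) (e₂ n)) /
    (l n * Complex.I)
  have hβ : CloseTo (fun n _ => β n) (fun _ => β') := by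
    have k := ((P₂.closeTo_twistDefect hg hGd hl z0).taylorCoeff 3 2).div
      (hl.mul (CloseTo.const (F := fun _ => Complex.I) analyticAt_const))
      (mul_ne_zero hl0 Complex.I_ne_zero)
    rw [taylorCoeff_eq (a := x) A0 L4 L3 (by norm_num)] at k
    have e : x 2 / (l' * Complex.I) = β' := by
      simp only [x]
      norm_num
      field_simp [Complex.I_ne_zero]
    rwa [e] at k
  have hln : ∀ᶠ n in atTop, l n ≠ 0 := hl.tendsto_zero.eventually_ne hl0
  have V₃' : ∀ᶠ n in atTop, VanishesTo (twistDefect (g n) (l n) (β n) (c₃ n) (e₃ n)) 4 := by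
    filter_upwards [V₃, P₃.lin_fst, P₃.lin_snd, hln] with n hn h1 h2 h0
    have hc' : VanishesTo (fun w => c₃ n w - 1 * w.1) 2 := h1.congr fun w => by ring
    have he' : VanishesTo (fun w => e₃ n w - 1 * w.2) 2 := h2.congr fun w => by ring
    have k := (VanishesTo.monomial_sub hc' he' 2 1).const_mul (l n * (Complex.I * β n))
    refine (hn.sub k).congr fun w => ?_
    have e : taylorCoeff 3 2 (twistDefect (g n) (l n) 0 (c₂ n) (e₂ n)) =
        l n * (Complex.I * β n) := by
      simp only [β]
      field_simp [Complex.I_ne_zero]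
    rw [if_pos rfl, e]
    simp only [twistDefect]
    ring
  obtain ⟨c₄, e₄, b₄, -, P₄, V₄⟩ := step 4 (by norm_num) d4 P₃ hβ V₃'
  exact ⟨c₄, e₄, _, _, β, P₄, hβ, V₄.mono fun n hn => hn.congr fun w => by simp⟩

end ConjugatePair

/-! ### The limit of the return map -/

/-- At h = 0 the approximation is an exact flow: J is conserved and T advances by the elapsed time.
The work lies in checking that the charts are inverse to each other on a whole neighbourhood. -/
theorem LegData.eventually_legLimit {t₀ a₀ b : ℝ} (d : LegData t₀ a₀ b) :
    ∀ᶠ w in 𝓝 (chart 0 (legStart a₀)),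
      (chart 0 (tangentCoord 0 w) = w ∧ 1 + (tangentCoord 0 w).1 ^ 2 ≠ 0) ∧
      (chart 0 (tangentCoord 0 (legLimit b 0 1 w)) = legLimit b 0 1 w ∧
        1 + (tangentCoord 0 (legLimit b 0 1 w)).1 ^ 2 ≠ 0) ∧
      actionVar (tangentCoord 0 (legLimit b 0 1 w)) = actionVar (tangentCoord 0 w) ∧
      phaseVar (tangentCoord 0 (legLimit b 0 1 w)) = phaseVar (tangentCoord 0 w) + 1 := by
  set w₀ := chart (0 : ℂ) (legStart a₀)
  have e0 : tangentCoord 0 w₀ = legStart a₀ := tangentCoord_legStart a₀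
  have hT : ContinuousAt (fun w => tangentCoord 0 w) w₀ :=
    (analyticAt_tangentCoord_legStart a₀).continuousAt.comp
      (f := fun w => ((0 : ℂ), w)) (continuousAt_const.prodMk continuousAt_id)
  have hJ : Tendsto (fun w => actionVar (tangentCoord 0 w)) (𝓝 w₀) (𝓝 3) := by
    have h1 := (analyticAt_actionVar (v := legStart a₀) (one_add_real_sq_ne a₀)).continuousAt
    rw [← e0] at h1
    have := ContinuousAt.comp (f := fun w => tangentCoord 0 w) h1 hT
    have h2 := this.tendsto
    simp only [Function.comp_def, e0] at h2
    rwa [actionVar_legStart] at h2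
  have hP : Tendsto (fun w => phaseVar (tangentCoord 0 w)) (𝓝 w₀) (𝓝 (t₀ : ℂ)) := by
    have h1 := (analyticAt_phaseVar (v := legStart a₀) (one_add_real_sq_ne a₀)).continuousAt
    rw [← e0] at h1
    have := ContinuousAt.comp (f := fun w => tangentCoord 0 w) h1 hT
    have h2 := this.tendsto
    simp only [Function.comp_def, e0] at h2
    rwa [d.phaseVar_legStart] at h2
  have hq : Tendsto (fun w => -4 * (phaseVar (tangentCoord 0 w) + 1) / actionVar (tangentCoord 0 w))
      (𝓝 w₀) (𝓝 (slopeCubic b)) := by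
    have := ((hP.add_const 1).const_mul (-4)).div hJ three_ne_zero
    rw [← d.slopeCubic_finish,
      show -4 * (-(3 / 4) * slopeCubic b) / 3 = slopeCubic b by ring] at this
    exact this
  have hu' : Tendsto (fun w => slopeInv b (-4 * (phaseVar (tangentCoord 0 w) + 1) /
      actionVar (tangentCoord 0 w))) (𝓝 w₀) (𝓝 (b : ℂ)) := by
    have := (analyticAt_slopeInv b).continuousAt.tendsto.comp hq
    rwa [slopeInv_apply] at this
  have hS' : Tendsto (fun w => actionVar (tangentCoord 0 w) * (1 + slopeInv b
      (-4 * (phaseVar (tangentCoord 0 w) + 1) / actionVar (tangentCoord 0 w)) ^ 2) / 2)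
      (𝓝 w₀) (𝓝 (((3 / 2 * (1 + b ^ 2) : ℝ) : ℂ))) := by
    have := (hJ.mul ((hu'.pow 2).const_add 1)).div_const 2
    convert this using 2
    push_cast
    ring
  have c1 : ∀ᶠ w in 𝓝 w₀, w.1 ^ 2 + w.2 ^ 2 ≠ 0 := by
    have : ContinuousAt (fun w : ℂ × ℂ => w.1 ^ 2 + w.2 ^ 2) w₀ := by fun_prop
    refine this.eventually_ne ?_
    have h := chart_sq_add_sq (h := 0) (v := legStart a₀) (one_add_real_sq_ne a₀)
    rw [h]
    have : (legStart a₀).2 ≠ 0 := by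
      simp only [legStart]; exact Complex.ofReal_ne_zero.2 (by positivity)
    simpa using this
  have c2 : ∀ᶠ w in 𝓝 w₀, w.1 ^ 2 + w.2 ^ 2 - 0 * w.1 -
      Complex.sqrt (w.1 ^ 2 + w.2 ^ 2 - 0 ^ 2) * w.2 ≠ 0 := by
    have h : ContinuousAt (fun w : ℂ × ℂ => w.1 ^ 2 + w.2 ^ 2 - 0 * w.1 -
        (tangentCoord 0 w).2 * w.2) w₀ := by
      have := hT.snd
      fun_prop
    refine h.eventually_ne ?_
    refine tangentCoord_denom_chart_ne (one_add_real_sq_ne a₀) ?_ ?_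
    · have : ((3 / 2 * (1 + a₀ ^ 2) : ℝ) : ℂ) ≠ 0 := Complex.ofReal_ne_zero.2 (by positivity)
      simpa [legStart] using this
    · simp only [legStart, Complex.ofReal_re]; positivity
  have c3 := hJ.eventually_ne three_ne_zero
  have c4 : ∀ᶠ w in 𝓝 w₀, 1 + slopeInv b (-4 * (phaseVar (tangentCoord 0 w) + 1) /
      actionVar (tangentCoord 0 w)) ^ 2 ≠ 0 :=
    ((hu'.pow 2).const_add 1).eventually_ne (one_add_real_sq_ne b)
  have c5 := hS'.eventually ((Complex.continuous_re.isOpen_preimage _ isOpen_Ioi).mem_nhds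
    (show 0 < ((3 / 2 * (1 + b ^ 2) : ℝ) : ℂ).re by rw [Complex.ofReal_re]; positivity))
  have c6 := hq.eventually (slopeCubic_slopeInv b)
  filter_upwards [c1, c2, c3, c4, c5, c6] with w h1 h2 h3 h4 h5 h6
  refine ⟨chart_tangentCoord h1 h2, ?_⟩
  set J := actionVar (tangentCoord 0 w)
  set t := phaseVar (tangentCoord 0 w)
  set u := slopeInv b (-4 * (t + 1) / J)
  have e : legLimit b 0 1 w = chart 0 (u, J * (1 + u ^ 2) / 2) := rfl
  have e' : tangentCoord 0 (legLimit b 0 1 w) = (u, J * (1 + u ^ 2) / 2) := by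
    rw [e]
    refine tangentCoord_chart h4 ?_ h5
    simp only
    have : J * (1 + u ^ 2) / 2 ≠ 0 := div_ne_zero (mul_ne_zero h3 h4) two_ne_zero
    simpa using this
  rw [e']
  have a : actionVar (u, J * (1 + u ^ 2) / 2) = J := by
    simp only [actionVar]
    field_simp
  refine ⟨⟨e.symm, h4⟩, a, ?_⟩
  rw [phaseVar, a]
  simp only [slopeCubic] at h6 ⊢
  rw [h6]
  field_simp

/-! ### The limiting half return in parabolic coordinates -/

/-- The limit of half of the return map. -/
noncomputable def halfLimit (Z : ℂ × ℂ) : ℂ × ℂ := halfFamily 0 (0, -Z)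

/-- At h = 0 the translations by (2h, 0) and the missing step of the first half disappear, so both
halves become the same map. -/
theorem returnFamily_zero (Z : ℂ × ℂ) : returnFamily (0, Z) = halfLimit (halfLimit Z) := by
  simp [returnFamily, halfLimit, halfFamily, legFamily, Prod.mk_zero_zero]

/-- Parabolic coordinates with focus at the origin, normalised to vanish at (3, 0). For points Z =
`chart 0 (u, s)` on the relevant branch, |Z| - Z₂ = J and |Z| + Z₂ = J u². The map Z ↦ -Z exchanges
the two coordinates. -/
noncomputable def parabolicFst (Z : ℂ × ℂ) : ℂ := (Complex.sqrt (Z.1 ^ 2 + Z.2 ^ 2) + Z.2 - 3) / 6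

noncomputable def parabolicSnd (Z : ℂ × ℂ) : ℂ := (Complex.sqrt (Z.1 ^ 2 + Z.2 ^ 2) - Z.2 - 3) / 6

theorem analyticAt_halfLimit : AnalyticAt ℂ halfLimit (3, 0) := by
  have h := (hasAnalyticLimit_halfMap (l := 0) (by norm_num)).analyticAt
  refine AnalyticAt.comp (g := halfFamily 0) (f := fun Z : ℂ × ℂ => ((0 : ℂ), -Z)) ?_
    (analyticAt_const.prod analyticAt_id.neg)
  simpa using h

theorem halfLimit_base : halfLimit (3, 0) = (3, 0) := by
  have h := (hasAnalyticLimit_halfMap (l := 0) (by norm_num)).base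
  simpa [halfLimit] using h

theorem analyticAt_tangentCoord_neg :
    AnalyticAt ℂ (fun Z => (tangentCoord 0 (-Z)).1) (3, 0) := by
  refine AnalyticAt.comp (g := Prod.fst) (f := fun Z => tangentCoord 0 (-Z)) analyticAt_fst ?_
  refine AnalyticAt.comp (g := fun p : ℂ × ℂ × ℂ => tangentCoord p.1 p.2)
    (f := fun Z : ℂ × ℂ => ((0 : ℂ), -Z)) ?_ (analyticAt_const.prod analyticAt_id.neg)
  have := analyticAt_tangentCoord_legStart 1
  rw [chart_legStart_one] at this
  simpa using this

theorem analyticAt_tangentCoord_halfLimit :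
    AnalyticAt ℂ (fun Z => (tangentCoord 0 (halfLimit Z)).1) (3, 0) := by
  refine AnalyticAt.comp (g := Prod.fst) (f := fun Z => tangentCoord 0 (halfLimit Z))
    analyticAt_fst ?_
  refine AnalyticAt.comp (g := fun p : ℂ × ℂ × ℂ => tangentCoord p.1 p.2)
    (f := fun Z : ℂ × ℂ => ((0 : ℂ), halfLimit Z)) ?_ (analyticAt_const.prod analyticAt_halfLimit)
  have := analyticAt_tangentCoord_legStart (-1)
  rw [chart_legStart_neg_one] at this
  rwa [halfLimit_base]

theorem tangentCoord_base : (tangentCoord 0 (-3, 0)).1 = 1 ∧ (tangentCoord 0 (3, 0)).1 = -1 := by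
  have h1 := tangentCoord_legStart 1
  have h2 := tangentCoord_legStart (-1)
  rw [chart_legStart_one] at h1
  rw [chart_legStart_neg_one] at h2
  rw [h1, h2]
  simp [legStart]

theorem tangentCoord_zero_snd (Z : ℂ × ℂ) :
    (tangentCoord 0 Z).2 = Complex.sqrt (Z.1 ^ 2 + Z.2 ^ 2) := by
  simp [tangentCoord]

theorem parabolic_of_chart {Z : ℂ × ℂ} (h : chart 0 (tangentCoord 0 Z) = Z)
    (h1 : 1 + (tangentCoord 0 Z).1 ^ 2 ≠ 0) :
    3 * (1 + 2 * parabolicSnd Z) = actionVar (tangentCoord 0 Z) ∧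
    3 * (1 + 2 * parabolicFst Z) = actionVar (tangentCoord 0 Z) * (tangentCoord 0 Z).1 ^ 2 := by
  have hs := tangentCoord_zero_snd Z
  simp only [parabolicFst, parabolicSnd, actionVar, ← hs]
  have h2 := congrArg Prod.snd h
  simp only [chart] at h2
  rw [← h2]
  constructor <;> field_simp <;> ring

/-- J takes the same value 3(1 + 2x), with x = `parabolicFst Z`, at the start -Z and at the end of
the half return. The last relation says that the phase advances by 2 in between. -/
theorem eventually_halfLimit : ∀ᶠ Z in 𝓝 ((3, 0) : ℂ × ℂ),
    parabolicSnd (halfLimit Z) = parabolicFst Z ∧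
    1 + 2 * parabolicSnd Z = (1 + 2 * parabolicFst Z) * (tangentCoord 0 (-Z)).1 ^ 2 ∧
    1 + 2 * parabolicFst (halfLimit Z) =
      (1 + 2 * parabolicFst Z) * (tangentCoord 0 (halfLimit Z)).1 ^ 2 ∧
    3 * (1 + 2 * parabolicFst Z) * (slopeCubic (tangentCoord 0 (-Z)).1 -
      slopeCubic (tangentCoord 0 (halfLimit Z)).1) = 8 := by
  have L1 := legData_first.eventually_legLimit
  have L2 := legData_second.eventually_legLimit
  rw [chart_legStart_one] at L1
  rw [chart_legStart_zero] at L2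
  have hneg : Tendsto (fun Z : ℂ × ℂ => -Z) (𝓝 (3, 0)) (𝓝 (-3, 0)) := by
    have := (continuous_neg (G := ℂ × ℂ)).tendsto (3, 0)
    simpa using this
  have hc : Tendsto (fun Z : ℂ × ℂ => legLimit 0 0 1 (-Z)) (𝓝 (3, 0)) (𝓝 (0, -(3 / 2))) := by
    have h1 := (legData_first.analyticAt_legFamily 0).continuousAt
    have h0 : legFamily 0 0 (0, chart 0 (legStart 1)) = chart 0 (legStart 0) := by
      have := legData_first.legLimit_base
      simpa [legFamily] using this
    have h2 := h1.tendsto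
    rw [h0, chart_legStart_one, chart_legStart_zero] at h2
    have h3 : Tendsto (fun Z : ℂ × ℂ => ((0 : ℂ), -Z)) (𝓝 (3, 0)) (𝓝 (0, (-3, 0))) :=
      tendsto_const_nhds.prodMk_nhds hneg
    have := h2.comp h3
    simpa [Function.comp_def, legFamily] using this
  filter_upwards [hneg.eventually L1, hc.eventually L2] with Z h1 h2
  obtain ⟨⟨a1, a2⟩, -, a4, a5⟩ := h1
  obtain ⟨-, ⟨b1, b2⟩, b3, b4⟩ := h2
  have e : halfLimit Z = legLimit (-1) 0 1 (legLimit 0 0 1 (-Z)) := by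
    simp [halfLimit, halfFamily, legFamily, Prod.mk_zero_zero]
  rw [← e] at b1 b2 b3 b4
  rw [a4] at b3
  rw [a5] at b4
  obtain ⟨p1, p2⟩ := parabolic_of_chart a1 a2
  obtain ⟨q1, q2⟩ := parabolic_of_chart b1 b2
  have s1 : parabolicSnd (-Z) = parabolicFst Z := by simp [parabolicSnd, parabolicFst]
  have s2 : parabolicFst (-Z) = parabolicSnd Z := by
    simp [parabolicSnd, parabolicFst, sub_eq_add_neg]
  rw [s1] at p1
  rw [s2] at p2
  rw [b3] at q1 q2
  rw [← p1] at p2 q1 q2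
  refine ⟨?_, ?_, ?_, ?_⟩
  · linear_combination q1 / 6
  · linear_combination p2 / 3
  · linear_combination q2 / 3
  · rw [phaseVar, phaseVar, b3, ← p1] at b4
    simp only [slopeCubic]
    linear_combination 4 * b4

/-! ### The twist coefficient of the limit -/

theorem VanishesTo.congr_eventually {V : Type*} [NormedAddCommGroup V] {f g : ℂ × ℂ → V} {d : ℕ}
    (h : VanishesTo f d) (e : ∀ᶠ y in 𝓝 0, g y = f y) : VanishesTo g d :=
  Asymptotics.IsBigO.congr' h (e.mono fun _ h => h.symm) EventuallyEq.rfl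

/-- The number `√2 i`. -/
noncomputable def rootI : ℂ := Complex.I * (√2 : ℝ)

theorem rootI_sq : rootI ^ 2 = -2 := by
  rw [rootI, mul_pow, Complex.I_sq, ← Complex.ofReal_pow, Real.sq_sqrt zero_le_two]
  norm_num

theorem conj_rootI : starRingEnd ℂ rootI = -rootI := by
  simp [rootI]

/-- The point of the plane with eigencoordinates `w` at the limit fixed point. -/
noncomputable def planeOf (w : ℂ × ℂ) : ℂ × ℂ := (3 - rootI * (w.1 - w.2), 2 * (w.1 + w.2))

/-- The eigencoordinates at the limit fixed point. -/
noncomputable def coordOf (Z : ℂ × ℂ) : ℂ × ℂ :=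
  (Z.2 / 4 + rootI * (Z.1 - 3) / 4, Z.2 / 4 - rootI * (Z.1 - 3) / 4)

theorem coordOf_planeOf (w : ℂ × ℂ) : coordOf (planeOf w) = w := by
  ext
  · simp only [coordOf, planeOf]; linear_combination (-(w.1 - w.2) / 4) * rootI_sq
  · simp only [coordOf, planeOf]; linear_combination ((w.1 - w.2) / 4) * rootI_sq

theorem planeOf_coordOf (Z : ℂ × ℂ) : planeOf (coordOf Z) = Z := by
  ext
  · simp only [coordOf, planeOf]; linear_combination (-(Z.1 - 3) / 2) * rootI_sq
  · simp only [coordOf, planeOf]; ring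

theorem planeOf_zero : planeOf 0 = (3, 0) := by simp [planeOf]

theorem analyticAt_planeOf (w : ℂ × ℂ) : AnalyticAt ℂ planeOf w :=
  (analyticAt_const.sub (analyticAt_const.mul (analyticAt_fst.sub analyticAt_snd))).prod
    (analyticAt_const.mul (analyticAt_fst.add analyticAt_snd))

theorem analyticAt_coordOf (Z : ℂ × ℂ) : AnalyticAt ℂ coordOf Z := by
  have h1 : AnalyticAt ℂ (fun Z : ℂ × ℂ => Z.2 / 4) Z := analyticAt_snd.div_const
  have h2 : AnalyticAt ℂ (fun Z : ℂ × ℂ => rootI * (Z.1 - 3) / 4) Z :=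
    (analyticAt_const.mul (analyticAt_fst.sub analyticAt_const)).div_const
  exact (h1.add h2).prod (h1.sub h2)

theorem analyticAt_norm_base :
    AnalyticAt ℂ (fun Z : ℂ × ℂ => Complex.sqrt (Z.1 ^ 2 + Z.2 ^ 2)) (3, 0) := by
  refine AnalyticAt.comp (g := Complex.sqrt) (f := fun Z : ℂ × ℂ => Z.1 ^ 2 + Z.2 ^ 2) ?_
    ((analyticAt_fst.pow 2).add (analyticAt_snd.pow 2))
  refine Complex.analyticAt_sqrt ?_
  left
  norm_num

theorem norm_base : Complex.sqrt ((3 : ℂ) ^ 2 + 0 ^ 2) = 3 := by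
  rw [zero_pow two_ne_zero, add_zero, Complex.sqrt_sq_of_re_pos (by norm_num)]

/-- The parabolic coordinates, combined into conjugate pairs. -/
noncomputable def pairFst (w : ℂ × ℂ) : ℂ :=
  3 / 4 * ((parabolicFst (planeOf w) - parabolicSnd (planeOf w)) +
    rootI * (parabolicFst (planeOf w) + parabolicSnd (planeOf w)))

noncomputable def pairSnd (w : ℂ × ℂ) : ℂ :=
  3 / 4 * ((parabolicFst (planeOf w) - parabolicSnd (planeOf w)) -
    rootI * (parabolicFst (planeOf w) + parabolicSnd (planeOf w)))

theorem analyticAt_parabolicFst : AnalyticAt ℂ parabolicFst (3, 0) :=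
  ((analyticAt_norm_base.add analyticAt_snd).sub analyticAt_const).div_const

theorem analyticAt_parabolicSnd : AnalyticAt ℂ parabolicSnd (3, 0) :=
  ((analyticAt_norm_base.sub analyticAt_snd).sub analyticAt_const).div_const

theorem parabolicFst_base : parabolicFst (3, 0) = 0 := by
  simp only [parabolicFst, norm_base]; norm_num

theorem parabolicSnd_base : parabolicSnd (3, 0) = 0 := by
  simp only [parabolicSnd, norm_base]; norm_num

theorem AnalyticAt.comp_planeOf {f : ℂ × ℂ → ℂ} (hf : AnalyticAt ℂ f (3, 0)) :
    AnalyticAt ℂ (fun w => f (planeOf w)) 0 := by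
  rw [← planeOf_zero] at hf
  exact hf.comp (analyticAt_planeOf 0)

theorem VanishesTo.comp_planeOf {f : ℂ × ℂ → ℂ} (hf : AnalyticAt ℂ f (3, 0)) (h0 : f (3, 0) = 0) :
    VanishesTo (fun w => f (planeOf w)) 1 :=
  .of_analyticAt hf.comp_planeOf (by rw [planeOf_zero, h0])

theorem analyticAt_pairFst : AnalyticAt ℂ pairFst 0 := by
  have h1 := analyticAt_parabolicFst.comp_planeOf
  have h2 := analyticAt_parabolicSnd.comp_planeOf
  exact analyticAt_const.mul ((h1.sub h2).add (analyticAt_const.mul (h1.add h2)))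

theorem analyticAt_pairSnd : AnalyticAt ℂ pairSnd 0 := by
  have h1 := analyticAt_parabolicFst.comp_planeOf
  have h2 := analyticAt_parabolicSnd.comp_planeOf
  exact analyticAt_const.mul ((h1.sub h2).sub (analyticAt_const.mul (h1.add h2)))

/-- The difference |Z| - Z₁ equals Z₂²/(|Z| + Z₁), which is of second order at (3, 0). Hence the
parabolic pair and the eigencoordinates have the same linear part. -/
theorem vanishesTo_norm_sub : VanishesTo (fun w : ℂ × ℂ =>
    Complex.sqrt ((planeOf w).1 ^ 2 + (planeOf w).2 ^ 2) - (planeOf w).1) 2 := by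
  have ha : AnalyticAt ℂ (fun w => Complex.sqrt ((planeOf w).1 ^ 2 + (planeOf w).2 ^ 2) +
      (planeOf w).1) 0 := by
    have := (analyticAt_norm_base.add (analyticAt_fst (𝕜 := ℂ) (p := ((3, 0) : ℂ × ℂ)))).comp_planeOf
    exact this
  have h0 : Complex.sqrt ((planeOf 0).1 ^ 2 + (planeOf 0).2 ^ 2) + (planeOf 0).1 = 6 := by
    rw [planeOf_zero]; simp only [norm_base]; norm_num
  have hne : ∀ᶠ w in 𝓝 (0 : ℂ × ℂ), Complex.sqrt ((planeOf w).1 ^ 2 + (planeOf w).2 ^ 2) +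
      (planeOf w).1 ≠ 0 :=
    ha.continuousAt.eventually_ne (by rw [h0]; norm_num)
  have hi : VanishesTo (fun w => (Complex.sqrt ((planeOf w).1 ^ 2 + (planeOf w).2 ^ 2) +
      (planeOf w).1)⁻¹) 0 :=
    .zero_of_continuousAt (ha.continuousAt.inv₀ (by rw [h0]; norm_num))
  have hs : VanishesTo (fun w => (planeOf w).2) 1 := .comp_planeOf analyticAt_snd rfl
  refine ((hs.mul hs).mul hi).congr_eventually ?_
  filter_upwards [hne] with w hw
  rw [eq_mul_inv_iff_mul_eq₀ hw]
  have := Complex.sqrt_sq' ((planeOf w).1 ^ 2 + (planeOf w).2 ^ 2)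
  linear_combination this

theorem pairFst_sub : VanishesTo (fun w => pairFst w - w.1) 2 := by
  refine (vanishesTo_norm_sub.const_mul (rootI / 4)).congr fun w => ?_
  have e := congrArg Prod.fst (coordOf_planeOf w)
  simp only [coordOf] at e
  rw [← e]
  simp only [pairFst, parabolicFst, parabolicSnd]
  ring

theorem pairSnd_sub : VanishesTo (fun w => pairSnd w - w.2) 2 := by
  refine (vanishesTo_norm_sub.const_mul (-rootI / 4)).congr fun w => ?_
  have e := congrArg Prod.snd (coordOf_planeOf w)
  simp only [coordOf] at e
  rw [← e]
  simp only [pairSnd, parabolicFst, parabolicSnd]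
  ring

/-- The limit of half of the return map in eigencoordinates. -/
noncomputable def halfCoord (w : ℂ × ℂ) : ℂ × ℂ := coordOf (halfLimit (planeOf w))

theorem planeOf_halfCoord (w : ℂ × ℂ) : planeOf (halfCoord w) = halfLimit (planeOf w) :=
  planeOf_coordOf _

theorem halfCoord_zero : halfCoord 0 = 0 := by
  rw [halfCoord, planeOf_zero, halfLimit_base]
  simp [coordOf]

theorem analyticAt_halfCoord : AnalyticAt ℂ halfCoord 0 := by
  have h := analyticAt_halfLimit
  rw [← planeOf_zero] at h
  exact AnalyticAt.comp (g := coordOf) (analyticAt_coordOf _) (h.comp (analyticAt_planeOf 0))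

theorem tendsto_planeOf : Tendsto planeOf (𝓝 0) (𝓝 (3, 0)) := by
  have := (analyticAt_planeOf 0).continuousAt.tendsto
  rwa [planeOf_zero] at this

/-! ### The recurrence for the parabolic coordinate -/

/-- The cubic part of the relation between three successive parabolic coordinates. -/
def cubicForm (p x y : ℂ) : ℂ := p ^ 3 + y ^ 3 - 3 * x * (p ^ 2 + y ^ 2) - 4 * x ^ 3

/-- Let x, y be the parabolic coordinates of the point and q the first one of its image. The slopes
1 + U and -(1 + V) at the two ends satisfy 1 + 2y = (1 + 2x)(1 + U)² and 1 + 2q = (1 + 2x)(1 + V)².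
Eliminating U and V from the phase relation leaves 6(q + y) + 4x + cubic = O(4). The absence of
quadratic terms is what makes the twist coefficient readable without a preliminary change of
variables. -/
theorem vanishesTo_recurrence : VanishesTo (fun w =>
    parabolicFst (halfLimit (planeOf w)) + parabolicSnd (planeOf w) +
      2 / 3 * parabolicFst (planeOf w) +
    cubicForm (-parabolicSnd (planeOf w) - 2 / 3 * parabolicFst (planeOf w))
      (parabolicFst (planeOf w)) (parabolicSnd (planeOf w)) / 6) 4 := by
  set x := fun w => parabolicFst (planeOf w)
  set y := fun w => parabolicSnd (planeOf w)
  set q := fun w => parabolicFst (halfLimit (planeOf w))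
  set U := fun w => (tangentCoord 0 (-planeOf w)).1 - 1 with hU
  set V := fun w => -(tangentCoord 0 (halfLimit (planeOf w))).1 - 1 with hV
  have aq : AnalyticAt ℂ (fun Z => parabolicFst (halfLimit Z)) (3, 0) := by
    have := analyticAt_parabolicFst
    rw [← halfLimit_base] at this
    exact this.comp analyticAt_halfLimit
  have x1 : VanishesTo x 1 := .comp_planeOf analyticAt_parabolicFst parabolicFst_base
  have y1 : VanishesTo y 1 := .comp_planeOf analyticAt_parabolicSnd parabolicSnd_base
  have q1 : VanishesTo q 1 := .comp_planeOf aq (by rw [halfLimit_base, parabolicFst_base])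
  have U1 : VanishesTo U 1 := by
    refine VanishesTo.comp_planeOf (f := fun Z => (tangentCoord 0 (-Z)).1 - 1)
      (analyticAt_tangentCoord_neg.sub analyticAt_const) ?_
    have : -((3, 0) : ℂ × ℂ) = (-3, 0) := by simp
    rw [this, tangentCoord_base.1, sub_self]
  have V1 : VanishesTo V 1 := by
    refine VanishesTo.comp_planeOf (f := fun Z => -(tangentCoord 0 (halfLimit Z)).1 - 1)
      (analyticAt_tangentCoord_halfLimit.neg.sub analyticAt_const) ?_
    rw [halfLimit_base, tangentCoord_base.2]
    ring
  have R := tendsto_planeOf.eventually eventually_halfLimit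
  have cont : ∀ {f : ℂ × ℂ → ℂ} {d : ℕ}, VanishesTo f 1 → VanishesTo (fun w => 1 + 2 * f w) 0 := by
    intro f d hf
    have h1 : VanishesTo (fun _ : ℂ × ℂ => (1 : ℂ)) 0 := .zero_of_continuousAt continuousAt_const
    exact h1.add ((hf.const_mul 2).mono (by norm_num))
  have hU2 := U1.mul U1
  have hV2 := V1.mul V1
  -- second order
  have T2 : VanishesTo (fun w => U w + V w + 8 / 3 * x w) 2 := by
    have hUV := x1.mul (U1.add V1)
    have k := (cont (d := 0) x1).mul ((((hU2.add hV2).const_mul 3).add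
      (((hU2.mul U1).add (hV2.mul V1)).mono (show 2 ≤ 1 + 1 + 1 by norm_num))))
    refine ((hUV.const_mul (-2)).add ((k.mono (by norm_num)).const_mul (-(1 / 6)))).congr_eventually ?_
    filter_upwards [R] with w hw
    obtain ⟨-, -, -, r4⟩ := hw
    simp only [slopeCubic] at r4
    simp only [x, hU, hV]
    linear_combination r4 / 6
  -- These are the quadratic and higher parts of y - x as a function of U and of q - x as a function
  -- of V.
  set r₁ := fun w => U w * U w * (1 / 2) + 2 * (x w * U w) + x w * (U w * U w) with hr₁
  set r₂ := fun w => V w * V w * (1 / 2) + 2 * (x w * V w) + x w * (V w * V w) with hr₂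
  have rem : ∀ {S : ℂ × ℂ → ℂ}, VanishesTo S 1 →
      VanishesTo (fun w => S w * S w * (1 / 2) + 2 * (x w * S w) + x w * (S w * S w)) 2 := by
    intro S hS
    have h1 := (hS.mul hS).const_mul (1 / 2)
    have h2 := (x1.mul hS).const_mul 2
    have h3 := (x1.mul (hS.mul hS)).mono (show 2 ≤ 1 + (1 + 1) by norm_num)
    exact ((h1.add h2).add h3).congr fun w => by ring
  have R1 := rem U1
  have R2 := rem V1
  have quad : ∀ {S r : ℂ × ℂ → ℂ}, VanishesTo S 1 → VanishesTo r 2 →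
      VanishesTo (fun w => r w * (3 * (x w + S w) ^ 2 + 3 * (x w + S w) * r w + r w * r w -
        6 * (x w * (x w + S w)) - 3 * (x w * r w))) 4 := by
    intro S r hS hr
    have hr1 := hr.mono one_le_two
    have s1 := x1.add hS
    have := hr.mul ((((((s1.mul s1).const_mul 3).add ((s1.mul hr1).const_mul 3)).add
      (hr1.mul hr1)).sub ((x1.mul s1).const_mul 6)).sub ((x1.mul hr1).const_mul 3))
    exact this.congr fun w => by ring
  have A : VanishesTo (fun w => 6 * (q w + y w) + 4 * x w + cubicForm (q w) (x w) (y w)) 4 := by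
    have k1 := (x1.mul ((hU2.mul U1).add (hV2.mul V1))).const_mul (-2)
    have k2 := quad U1 R1
    have k3 := quad V1 R2
    have k4 := ((x1.mul x1).mul T2).const_mul (-3)
    refine (((k1.add k2).add k3).add k4).congr_eventually ?_
    filter_upwards [R] with w hw
    obtain ⟨-, r2, r3, r4⟩ := hw
    simp only [slopeCubic] at r4
    have ey : y w = x w + U w + r₁ w := by
      simp only [hr₁, x, y, hU]
      linear_combination r2 / 2
    have eq' : q w = x w + V w + r₂ w := by
      simp only [hr₂, x, q, hV]
      linear_combination r3 / 2
    have r4' : (1 + 2 * x w) * (8 + 6 * (U w + V w) + 3 * (U w * U w + V w * V w) +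
        U w ^ 3 + V w ^ 3) = 8 := by
      simp only [x, hU, hV]
      linear_combination r4
    simp only [cubicForm]
    rw [ey, eq']
    simp only [hr₁, hr₂]
    linear_combination r4'
  -- The cubic form is evaluated at q, still unknown. Since q agrees with its linear part up to
  -- third order, inserting the linear part changes the form only by terms of degree at least 5.
  have B : VanishesTo (fun w => q w - (-y w - 2 / 3 * x w)) 3 := by
    have cub : VanishesTo (fun w => cubicForm (q w) (x w) (y w)) 3 := by
      have c1 := ((q1.pow 3).add (y1.pow 3)).sub ((x1.mul ((q1.pow 2).add (y1.pow 2))).const_mul 3)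
      exact (c1.sub ((x1.pow 3).const_mul 4)).congr fun w => by simp only [cubicForm]; ring
    refine (((A.mono (by norm_num)).sub cub).const_mul (1 / 6)).congr fun w => ?_
    ring
  have p1 : VanishesTo (fun w => -y w - 2 / 3 * x w) 1 :=
    ((y1.const_mul (-1)).sub (x1.const_mul (2 / 3))).congr fun w => by ring
  have D := B.mul ((((q1.mul q1).add (q1.mul p1)).add (p1.mul p1)).sub
    ((x1.mul (q1.add p1)).const_mul 3))
  refine ((A.const_mul (1 / 6)).sub ((D.mono (by norm_num)).const_mul (1 / 6))).congr fun w => ?_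
  simp only [cubicForm, x, y, q]
  ring

/-- The multiplier of the limit of half of the return map. -/
noncomputable def halfMult : ℂ := (-1 + 2 * rootI) / 3

noncomputable def halfMultConj : ℂ := (-1 - 2 * rootI) / 3

theorem halfMult_mul : halfMult * halfMultConj = 1 := by
  simp only [halfMult, halfMultConj]
  linear_combination (-4 / 9) * rootI_sq

/-- The coefficients of the cubic part of the limit of half of the return map. -/
noncomputable def halfCubic (j : ℕ) : ℂ := -(1 + rootI) / 8 / 729 *
  (if j = 0 then -32 + 80 * rootI else if j = 1 then -864 - 432 * rootI else
    if j = 2 then -864 + 432 * rootI else -32 - 80 * rootI)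

theorem cubicForm_pair (w : ℂ × ℂ) :
    -(1 + rootI) / 8 * cubicForm (-parabolicSnd (planeOf w) - 2 / 3 * parabolicFst (planeOf w))
      (parabolicFst (planeOf w)) (parabolicSnd (planeOf w)) =
    ∑ j ∈ Finset.range (3 + 1), halfCubic j * (pairFst w ^ j * pairSnd w ^ (3 - j)) := by
  have ex : parabolicFst (planeOf w) = (pairFst w + pairSnd w) / 3 -
      rootI / 6 * (pairFst w - pairSnd w) := by
    simp only [pairFst, pairSnd]
    linear_combination ((parabolicFst (planeOf w) + parabolicSnd (planeOf w)) / 4) * rootI_sq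
  have ey : parabolicSnd (planeOf w) = -(pairFst w + pairSnd w) / 3 -
      rootI / 6 * (pairFst w - pairSnd w) := by
    simp only [pairFst, pairSnd]
    linear_combination ((parabolicFst (planeOf w) + parabolicSnd (planeOf w)) / 4) * rootI_sq
  rw [ex, ey]
  generalize pairFst w = C
  generalize pairSnd w = D
  simp only [cubicForm, Finset.sum_range_succ, Finset.sum_range_zero, halfCubic]
  norm_num
  linear_combination (-(1 + rootI) / 8) * ((C - D) ^ 2 * (-96 * (C + D) + 64 * rootI * (C - D)) / 729)
    * rootI_sq

theorem pairFst_halfCoord : VanishesTo (fun w => pairFst (halfCoord w) - halfMult * pairFst w -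
    ∑ j ∈ Finset.range (3 + 1), halfCubic j * (pairFst w ^ j * pairSnd w ^ (3 - j))) 4 := by
  refine (vanishesTo_recurrence.const_mul (3 / 4 * (1 + rootI))).congr_eventually ?_
  filter_upwards [tendsto_planeOf.eventually eventually_halfLimit] with w hw
  rw [← cubicForm_pair]
  simp only [pairFst, planeOf_halfCoord, hw.1, halfMult]
  linear_combination (-(parabolicFst (planeOf w) + parabolicSnd (planeOf w)) / 2) * rootI_sq

theorem pairSnd_halfCoord : VanishesTo (fun w => pairSnd (halfCoord w) -
    halfMultConj * pairSnd w) 3 := by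
  have x1 : VanishesTo (fun w => parabolicFst (planeOf w)) 1 :=
    .comp_planeOf analyticAt_parabolicFst parabolicFst_base
  have y1 : VanishesTo (fun w => parabolicSnd (planeOf w)) 1 :=
    .comp_planeOf analyticAt_parabolicSnd parabolicSnd_base
  have p1 : VanishesTo (fun w => -parabolicSnd (planeOf w) - 2 / 3 * parabolicFst (planeOf w)) 1 :=
    ((y1.const_mul (-1)).sub (x1.const_mul (2 / 3))).congr fun w => by ring
  have cub : VanishesTo (fun w => cubicForm (-parabolicSnd (planeOf w) -
      2 / 3 * parabolicFst (planeOf w)) (parabolicFst (planeOf w)) (parabolicSnd (planeOf w))) 3 := by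
    have c1 := ((p1.pow 3).add (y1.pow 3)).sub ((x1.mul ((p1.pow 2).add (y1.pow 2))).const_mul 3)
    exact (c1.sub ((x1.pow 3).const_mul 4)).congr fun w => by simp only [cubicForm]; ring
  refine (((vanishesTo_recurrence.mono (by norm_num)).sub (cub.const_mul (1 / 6))).const_mul
    (3 / 4 * (1 - rootI))).congr_eventually ?_
  filter_upwards [tendsto_planeOf.eventually eventually_halfLimit] with w hw
  simp only [pairSnd, planeOf_halfCoord, hw.1, halfMultConj]
  linear_combination (-(parabolicFst (planeOf w) + parabolicSnd (planeOf w)) / 2) * rootI_sq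

theorem hasDiagonalPart_halfCoord : HasDiagonalPart halfCoord halfMult halfMultConj := by
  have h1 : VanishesTo halfCoord 1 := .of_analyticAt analyticAt_halfCoord halfCoord_zero
  have hc := analyticAt_halfCoord.continuousAt
  have p1 := HasDiagonalPart.vanishesTo_one_fst pairFst_sub
  have p2 := HasDiagonalPart.vanishesTo_one_snd pairSnd_sub
  refine ⟨hc, halfCoord_zero, h1, ?_, ?_⟩
  · have k1 := pairFst_sub.comp h1 hc halfCoord_zero
    have k2 := (pairFst_halfCoord.mono (show 2 ≤ 4 by norm_num)).add
      ((HasDiagonalPart.form_vanishesTo (d := 3) halfCubic p1 p2).mono (by norm_num))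
    refine ((k2.sub k1).add (pairFst_sub.const_mul halfMult)).congr fun w => ?_
    ring
  · have k1 := pairSnd_sub.comp h1 hc halfCoord_zero
    have k2 := pairSnd_halfCoord.mono (show 2 ≤ 3 by norm_num)
    refine ((k2.sub k1).add (pairSnd_sub.const_mul halfMultConj)).congr fun w => ?_
    ring

/-- The limit of the return map in eigencoordinates. -/
noncomputable def limitCoord (w : ℂ × ℂ) : ℂ × ℂ := coordOf (returnFamily (0, planeOf w))

theorem limitCoord_eq (w : ℂ × ℂ) : limitCoord w = halfCoord (halfCoord w) := by
  rw [limitCoord, returnFamily_zero, halfCoord, planeOf_halfCoord]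

theorem limitCoord_zero : limitCoord 0 = 0 := by
  rw [limitCoord_eq, halfCoord_zero, halfCoord_zero]

/-- For the square of the half return with multiplier μ, the resonant coefficient is that of the
half return times μ + μ²μ̄ = 2μ. Equating it with μ² iβ gives β = -4√2/9. The other cubic
coefficients are nonresonant and only need to exist. -/
theorem twistDefect_limitCoord : ∃ x₀ x₁ x₃ : ℂ, VanishesTo (fun w =>
    twistDefect limitCoord (halfMult ^ 2) ((-(4 * √2 / 9) : ℝ) : ℂ) pairFst pairSnd w -
      (x₀ * w.2 ^ 3 + x₁ * (w.1 * w.2 ^ 2) + x₃ * w.1 ^ 3)) 4 := by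
  have hd := hasDiagonalPart_halfCoord
  have hc' : VanishesTo (fun w => pairFst w - 1 * w.1) 2 := pairFst_sub.congr fun w => by ring
  have he' : VanishesTo (fun w => pairSnd w - 1 * w.2) 2 := pairSnd_sub.congr fun w => by ring
  have k1 := pairFst_halfCoord.comp hd.vanishesTo hd.continuousAt hd.map_zero
  have k2 := pairFst_halfCoord.const_mul halfMult
  have k3 := HasDiagonalPart.sum_form (d := 3) halfCubic (hd.comp_fst pairFst_sub)
    (hd.comp_snd pairSnd_sub)
  have k4 := (HasDiagonalPart.sum_form (d := 3) halfCubic hc' he').const_mul halfMult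
  have k5 := (VanishesTo.monomial_sub hc' he' 2 1).const_mul
    (halfMult ^ 2 * (Complex.I * ((-(4 * √2 / 9) : ℝ) : ℂ)))
  refine ⟨halfCubic 0 * (halfMult + halfMultConj ^ 3),
    halfCubic 1 * (halfMult + halfMult * halfMultConj ^ 2), halfCubic 3 * (halfMult + halfMult ^ 3),
    ((((k1.add k2).add k3).add k4).sub k5).congr fun w => ?_⟩
  -- This equality is the computation of the twist coefficient: `halfCubic 2` equals (2/27)(4 + √2
  -- i).
  have e : halfCubic 2 * (halfMult + halfMult ^ 2 * halfMultConj) =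
      halfMult ^ 2 * (Complex.I * ((-(4 * √2 / 9) : ℝ) : ℂ)) := by
    have e1 : halfMult ^ 2 * halfMultConj = halfMult := by
      linear_combination halfMult * halfMult_mul
    have e2 : Complex.I * ((-(4 * √2 / 9) : ℝ) : ℂ) = -(4 / 9) * rootI := by
      simp only [rootI]; push_cast; ring
    have e3 : halfCubic 2 = 2 / 27 * (4 + rootI) := by
      simp only [halfCubic]
      norm_num
      linear_combination (-(432 / 8 / 729 : ℂ)) * rootI_sq
    rw [e1, e2, e3]
    simp only [halfMult]
    have h3 : rootI ^ 3 = -2 * rootI := by linear_combination rootI * rootI_sq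
    ring_nf
    rw [h3, rootI_sq]
    ring
  generalize ((-(4 * √2 / 9) : ℝ) : ℂ) = β at e ⊢
  simp only [twistDefect, limitCoord_eq]
  simp only [Finset.sum_range_succ, Finset.sum_range_zero]
  norm_num
  linear_combination (w.1 ^ 2 * w.2) * e

/-! ### The fixed points -/

attribute [local irreducible] legFamily

theorem hasFDerivAt_halfFamily (l : ℕ) : ∃ A : ℂ × ℂ × ℂ →L[ℂ] ℂ × ℂ,
    HasFDerivAt (halfFamily l) A (0, (-3, 0)) ∧
    ∀ h x y : ℂ, A (h, x, y) = ((x / 3 - 2 / 3 * y + 5 / 3 * h - 4 * l * h),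
      (4 / 3 * x + y / 3 - h / 3 - 4 * l * h)) := by
  have a1 := (legData_first.analyticAt_legFamily l).differentiableAt.hasFDerivAt
  have a2 := (legData_second.analyticAt_legFamily l).differentiableAt.hasFDerivAt
  have h0 : legFamily 0 l (0, chart 0 (legStart 1)) = chart 0 (legStart 0) := by
    have := legData_first.legLimit_base
    rw [legFamily]
    simpa using this
  simp only [chart_legStart_one, chart_legStart_zero] at a1 a2 h0
  have hs : HasFDerivAt (fun p : ℂ × ℂ × ℂ => ((2 * p.1, 0) : ℂ × ℂ))
      (((2 : ℂ) • ContinuousLinearMap.fst ℂ ℂ (ℂ × ℂ)).prod 0) (0, (-3, 0)) :=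
    (hasFDerivAt_fst.const_mul (2 : ℂ)).prodMk (hasFDerivAt_const _ _)
  have hq : HasFDerivAt (fun p : ℂ × ℂ × ℂ => (p.1, legFamily 0 l p + (2 * p.1, 0))) _
      ((0 : ℂ), ((-3, 0) : ℂ × ℂ)) := hasFDerivAt_fst.prodMk (a1.add hs)
  have e : ((0 : ℂ), legFamily 0 l (0, (-3, 0)) + (2 * 0, 0)) = (0, (0, -(3 / 2))) := by
    rw [h0]; simp
  have a2' : HasFDerivAt (legFamily ((-1 : ℝ)) l) (fderiv ℂ (legFamily (-1) l) (0, (0, -(3 / 2))))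
      ((fun p : ℂ × ℂ × ℂ => (p.1, legFamily 0 l p + (2 * p.1, 0))) (0, (-3, 0))) := by
    simp only [e]
    exact a2
  refine ⟨_, HasFDerivAt.comp (g := legFamily (-1) l)
    (f := fun p : ℂ × ℂ × ℂ => (p.1, legFamily 0 l p + (2 * p.1, 0))) _ a2' hq, fun h x y => ?_⟩
  simp only [ContinuousLinearMap.comp_apply, ContinuousLinearMap.prod_apply,
    _root_.add_apply, ContinuousLinearMap.coe_fst', _root_.smul_apply,
    _root_.zero_apply, fderiv_legFamily_first, smul_eq_mul, Prod.mk_add_mk,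
    fderiv_legFamily_second]
  ext <;> simp only <;> ring

attribute [local irreducible] halfFamily

/-- In unscaled coordinates relative to (3n, 0), the leading order return is η ↦ A(1, η). Its fixed
point (-3/4, 1) is the source of the position (3n - 3/4, 1). -/
theorem hasFDerivAt_returnFamily : ∃ A : ℂ × ℂ × ℂ →L[ℂ] ℂ × ℂ,
    HasFDerivAt returnFamily A (0, (3, 0)) ∧ A (1, (-(3 / 4), 1)) = (-(3 / 4), 1) := by
  obtain ⟨A₁, h₁, e₁⟩ := hasFDerivAt_halfFamily 1
  obtain ⟨A₀, h₀, e₀⟩ := hasFDerivAt_halfFamily 0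
  have b := (hasAnalyticLimit_halfMap (l := 1) le_rfl).base
  have hs : HasFDerivAt (fun p : ℂ × ℂ × ℂ => ((2 * p.1, 0) : ℂ × ℂ))
      (((2 : ℂ) • ContinuousLinearMap.fst ℂ ℂ (ℂ × ℂ)).prod 0) (0, (3, 0)) :=
    (hasFDerivAt_fst.const_mul (2 : ℂ)).prodMk (hasFDerivAt_const _ _)
  have q1 : HasFDerivAt (fun p : ℂ × ℂ × ℂ => (p.1, ((2 * p.1, 0) : ℂ × ℂ) - p.2)) _
      ((0 : ℂ), ((3, 0) : ℂ × ℂ)) := hasFDerivAt_fst.prodMk (hs.sub hasFDerivAt_snd)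
  have h₁' : HasFDerivAt (halfFamily 1) A₁ ((fun p : ℂ × ℂ × ℂ =>
      (p.1, ((2 * p.1, 0) : ℂ × ℂ) - p.2)) ((0 : ℂ), ((3, 0) : ℂ × ℂ))) := by
    simpa using h₁
  have c1 := HasFDerivAt.comp (g := halfFamily 1)
    (f := fun p : ℂ × ℂ × ℂ => (p.1, ((2 * p.1, 0) : ℂ × ℂ) - p.2)) _ h₁' q1
  have q2 : HasFDerivAt (fun p : ℂ × ℂ × ℂ => (p.1, -halfFamily 1 (p.1, (2 * p.1, 0) - p.2))) _
      ((0 : ℂ), ((3, 0) : ℂ × ℂ)) := hasFDerivAt_fst.prodMk c1.neg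
  have h₀' : HasFDerivAt (halfFamily 0) A₀ ((fun p : ℂ × ℂ × ℂ =>
      (p.1, -halfFamily 1 (p.1, (2 * p.1, 0) - p.2))) ((0 : ℂ), ((3, 0) : ℂ × ℂ))) := by
    simpa [b] using h₀
  refine ⟨_, (HasFDerivAt.comp (g := halfFamily 0)
    (f := fun p : ℂ × ℂ × ℂ => (p.1, -halfFamily 1 (p.1, (2 * p.1, 0) - p.2))) _ h₀' q2).sub hs, ?_⟩
  simp only [ContinuousLinearMap.comp_apply, ContinuousLinearMap.prod_apply,
    _root_.sub_apply, _root_.neg_apply, ContinuousLinearMap.coe_fst',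
    ContinuousLinearMap.coe_snd', _root_.smul_apply, _root_.zero_apply,
    smul_eq_mul, Prod.mk_sub_mk, Prod.neg_mk, e₁, e₀]
  ext <;> simp only <;> norm_num

attribute [local irreducible] returnFamily scaledReturn

theorem HasDiagonalPart.hasFDerivAt {g : ℂ × ℂ → ℂ × ℂ} {l m : ℂ} (h : HasDiagonalPart g l m)
    (ha : AnalyticAt ℂ g 0) : HasFDerivAt g
      ((l • ContinuousLinearMap.fst ℂ ℂ ℂ).prod (m • ContinuousLinearMap.snd ℂ ℂ ℂ)) 0 := by
  have key : ∀ {f : ℂ × ℂ → ℂ} {L : ℂ × ℂ →L[ℂ] ℂ}, AnalyticAt ℂ f 0 →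
      VanishesTo (fun w => f w - L w) 2 → HasFDerivAt f L 0 := by
    intro f L hf hv
    have h1 := (hv.fderiv (hf.sub (L.analyticAt 0))).apply_zero
    have h2 : fderiv ℂ (fun w => f w - L w) 0 = fderiv ℂ f 0 - L := by
      rw [fderiv_fun_sub hf.differentiableAt L.differentiableAt, L.fderiv]
    have h3 : fderiv ℂ f 0 = L := sub_eq_zero.1 (h2 ▸ h1)
    rw [← h3]
    exact hf.differentiableAt.hasFDerivAt
  refine HasFDerivAt.prodMk (f₁ := fun w => (g w).1) (f₂ := fun w => (g w).2) (key ?_ ?_) (key ?_ ?_)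
  · exact AnalyticAt.comp (g := Prod.fst) analyticAt_fst ha
  · exact h.fst
  · exact AnalyticAt.comp (g := Prod.snd) analyticAt_snd ha
  · exact h.snd

theorem HasDiagonalPart.comp_self {g : ℂ × ℂ → ℂ × ℂ} {l m : ℂ} (h : HasDiagonalPart g l m) :
    HasDiagonalPart (fun w => g (g w)) (l ^ 2) (m ^ 2) where
  continuousAt := by
    have := h.continuousAt
    refine ContinuousAt.comp (f := g) ?_ this
    rwa [h.map_zero]
  map_zero := by rw [h.map_zero, h.map_zero]
  vanishesTo := h.vanishesTo.comp h.vanishesTo h.continuousAt h.map_zero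
  fst := ((h.fst.comp h.vanishesTo h.continuousAt h.map_zero).add (h.fst.const_mul l)).congr
    fun w => by ring
  snd := ((h.snd.comp h.vanishesTo h.continuousAt h.map_zero).add (h.snd.const_mul m)).congr
    fun w => by ring

theorem analyticAt_limitCoord : AnalyticAt ℂ limitCoord 0 := by
  have h := analyticAt_halfCoord
  have h2 := h
  rw [← halfCoord_zero] at h2
  have := h2.comp h
  refine this.congr (Eventually.of_forall fun w => ?_)
  rw [limitCoord_eq]
  rfl

/-- The derivative of the limit of the return map at its fixed point, in eigencoordinates. -/
noncomputable def limitLinear : ℂ × ℂ →L[ℂ] ℂ × ℂ :=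
  (halfMult ^ 2 • ContinuousLinearMap.fst ℂ ℂ ℂ).prod
    (halfMultConj ^ 2 • ContinuousLinearMap.snd ℂ ℂ ℂ)

theorem hasFDerivAt_limitCoord : HasFDerivAt limitCoord limitLinear 0 := by
  have h := hasDiagonalPart_halfCoord.comp_self
  have e : (fun w => halfCoord (halfCoord w)) = limitCoord := funext fun w => (limitCoord_eq w).symm
  rw [e] at h
  exact h.hasFDerivAt analyticAt_limitCoord

/-! ### The scaled return maps and their fixed points -/

/-- The scaled return maps in eigencoordinates. -/
noncomputable def coordReturn (n : ℕ) (w : ℂ × ℂ) : ℂ × ℂ := coordOf (scaledReturn n (planeOf w))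

theorem norm_coordOf_sub_le (Z Z' : ℂ × ℂ) : ‖coordOf Z - coordOf Z'‖ ≤ ‖Z - Z'‖ := by
  have hr : ‖rootI‖ ≤ 2 := by
    rw [rootI, norm_mul, Complex.norm_I, one_mul, Complex.norm_real, Real.norm_eq_abs,
      abs_of_nonneg (Real.sqrt_nonneg _), Real.sqrt_le_left (by norm_num)]
    norm_num
  have h1 : ‖Z.1 - Z'.1‖ ≤ ‖Z - Z'‖ := norm_fst_le (Z - Z')
  have h2 : ‖Z.2 - Z'.2‖ ≤ ‖Z - Z'‖ := norm_snd_le (Z - Z')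
  have h3 : ‖(Z.2 - Z'.2) / 4‖ ≤ ‖Z - Z'‖ / 4 := by
    rw [norm_div]; norm_num; linarith
  have h4 : ‖rootI * (Z.1 - Z'.1) / 4‖ ≤ 2 * ‖Z - Z'‖ / 4 := by
    rw [norm_div, norm_mul]; norm_num
    have := mul_le_mul hr h1 (norm_nonneg _) zero_le_two
    linarith
  rw [Prod.norm_def]
  refine max_le ?_ ?_
  · have : (coordOf Z - coordOf Z').1 = (Z.2 - Z'.2) / 4 + rootI * (Z.1 - Z'.1) / 4 := by
      simp only [coordOf, Prod.fst_sub]; ring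
    rw [this]
    linarith [norm_add_le ((Z.2 - Z'.2) / 4) (rootI * (Z.1 - Z'.1) / 4), norm_nonneg (Z - Z')]
  · have : (coordOf Z - coordOf Z').2 = (Z.2 - Z'.2) / 4 - rootI * (Z.1 - Z'.1) / 4 := by
      simp only [coordOf, Prod.snd_sub]; ring
    rw [this]
    linarith [norm_sub_le ((Z.2 - Z'.2) / 4) (rootI * (Z.1 - Z'.1) / 4), norm_nonneg (Z - Z')]

/-- Replacing the parameter 1/n by 0 in the analytic limit costs a Lipschitz constant times 1/n, on
top of the O(n⁻²) approximation. -/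
theorem closeTo_coordReturn : CloseTo coordReturn limitCoord := by
  obtain ⟨K, hK, hc⟩ := hasAnalyticLimit_scaledReturn.close
  obtain ⟨L, t, ht, hL⟩ := (hasAnalyticLimit_scaledReturn.analyticAt.contDiffAt (n := 1)).exists_lipschitzOnWith

  have T : Tendsto (fun p : ℕ × ℂ × ℂ => (p.1, planeOf p.2)) (atTop ×ˢ 𝓝 0)
      (atTop ×ˢ 𝓝 ((3, 0) : ℂ × ℂ)) :=
    tendsto_fst.prodMk (tendsto_planeOf.comp tendsto_snd)
  have inv : Tendsto (fun n : ℕ => (n : ℂ)⁻¹) atTop (𝓝 0) := tendsto_natCast_inv_complex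
  have T1 : Tendsto (fun p : ℕ × ℂ × ℂ => ((p.1 : ℂ)⁻¹, planeOf p.2)) (atTop ×ˢ 𝓝 0)
      (𝓝 ((0 : ℂ), ((3, 0) : ℂ × ℂ))) :=
    (inv.comp tendsto_fst).prodMk_nhds (tendsto_planeOf.comp tendsto_snd)
  have T2 : Tendsto (fun p : ℕ × ℂ × ℂ => ((0 : ℂ), planeOf p.2)) (atTop ×ˢ 𝓝 0)
      (𝓝 ((0 : ℂ), ((3, 0) : ℂ × ℂ))) :=
    tendsto_const_nhds.prodMk_nhds (tendsto_planeOf.comp tendsto_snd)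
  refine ⟨analyticAt_limitCoord, K + L, by positivity, ?_⟩
  filter_upwards [T.eventually hc, T1 ht, T2 ht,
    (eventually_ge_atTop 1).prod_inl (𝓝 (0 : ℂ × ℂ))] with p h1 h2 h3 h4
  refine ⟨(analyticAt_coordOf _).comp (h1.1.comp (analyticAt_planeOf _)),
    (norm_coordOf_sub_le _ _).trans ?_⟩
  have h5 := hL.norm_sub_le h2 h3
  have e : ‖(((p.1 : ℂ)⁻¹, planeOf p.2) : ℂ × ℂ × ℂ) - (0, planeOf p.2)‖ = (p.1 : ℝ)⁻¹ := by
    simp [Prod.norm_def]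
  rw [e] at h5
  have hn : (1 : ℝ) ≤ p.1 := by exact_mod_cast h4
  have h6 : K / (p.1 : ℝ) ^ 2 ≤ K / p.1 := by
    gcongr
    nlinarith
  have h7 := norm_sub_le_norm_sub_add_norm_sub (scaledReturn p.1 (planeOf p.2))
    (returnFamily ((p.1 : ℂ)⁻¹, planeOf p.2)) (returnFamily (0, planeOf p.2))
  have h8 := h1.2
  rw [add_div, div_eq_mul_inv (L : ℝ)]
  linarith

/-- A vector of the real plane in eigencoordinates. -/
noncomputable def realCoord (x : ℝ × ℝ) : ℂ × ℂ :=
  (x.2 / 4 + rootI * x.1 / 4, x.2 / 4 - rootI * x.1 / 4)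

theorem realCoord_add (x y : ℝ × ℝ) : realCoord (x + y) = realCoord x + realCoord y := by
  ext <;> simp [realCoord] <;> ring

theorem realCoord_sub (x y : ℝ × ℝ) : realCoord (x - y) = realCoord x - realCoord y := by
  ext <;> simp [realCoord] <;> ring

theorem realCoord_smul (c : ℝ) (x : ℝ × ℝ) : realCoord (c • x) = (c : ℂ) • realCoord x := by
  ext <;> simp [realCoord] <;> ring

theorem coordOf_complexify {n : ℕ} (hn : n ≠ 0) (z : ℝ × ℝ) :
    coordOf (complexify ((n : ℝ)⁻¹ • z)) = (n : ℂ)⁻¹ • realCoord (z - ((3 * n, 0) : ℝ × ℝ)) := by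
  have : (n : ℂ) ≠ 0 := by exact_mod_cast hn
  ext <;> simp [coordOf, complexify, realCoord] <;> field_simp

theorem planeOf_inv_smul (n : ℕ) (x : ℝ × ℝ) :
    planeOf ((n : ℂ)⁻¹ • realCoord x) = (3, 0) + (n : ℂ)⁻¹ • complexify x := by
  ext
  · simp only [planeOf, realCoord, complexify, Prod.smul_fst, Prod.smul_snd, Prod.fst_add,
      smul_eq_mul]
    linear_combination (-(n : ℂ)⁻¹ * x.1 / 2) * rootI_sq
  · simp only [planeOf, realCoord, complexify, Prod.smul_fst, Prod.smul_snd, Prod.snd_add,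
      smul_eq_mul]
    ring

theorem planeOf_smul_realCoord {n : ℕ} (hn : n ≠ 0) (z : ℝ × ℝ) :
    planeOf ((n : ℂ)⁻¹ • realCoord (z - ((3 * n, 0) : ℝ × ℝ))) = complexify ((n : ℝ)⁻¹ • z) := by
  rw [← coordOf_complexify hn, planeOf_coordOf]

/-- The linear part of the limit at (0, (3, 0)) fixes the direction of the centre, so the scaled
displacement is quadratic in 1/n; multiplication by n leaves O(1/n). -/
theorem eventually_coordReturn_centre : ∃ K > (0 : ℝ), ∀ᶠ n : ℕ in atTop,
    ‖(n : ℂ) • coordReturn n ((n : ℂ)⁻¹ • realCoord (-(3 / 4), 1)) - realCoord (-(3 / 4), 1)‖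
      ≤ K / n := by
  obtain ⟨K, hK, hc⟩ := hasAnalyticLimit_scaledReturn.close
  obtain ⟨A, hA, eA⟩ := hasFDerivAt_returnFamily
  set c : ℂ × ℂ := (-(3 / 4), 1)
  have hlin : HasFDerivAt (fun w : ℂ × ℂ => (w.1, ((3, 0) : ℂ × ℂ) + w.1 • c))
      ((ContinuousLinearMap.fst ℂ ℂ ℂ).prod ((ContinuousLinearMap.fst ℂ ℂ ℂ).smulRight c)) 0 :=
    hasFDerivAt_fst.prodMk ((hasFDerivAt_fst.smul_const c).const_add _)
  have han : AnalyticAt ℂ (fun w : ℂ × ℂ => (w.1, ((3, 0) : ℂ × ℂ) + w.1 • c)) 0 :=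
    analyticAt_fst.prod (analyticAt_const.add (analyticAt_fst.smul analyticAt_const))
  have e0 : (fun w : ℂ × ℂ => (w.1, ((3, 0) : ℂ × ℂ) + w.1 • c)) 0 = (0, (3, 0)) := by simp
  have V : VanishesTo (fun w : ℂ × ℂ => returnFamily (w.1, (3, 0) + w.1 • c) - (3, 0) - w.1 • c) 2 := by
    have hA' : HasFDerivAt returnFamily A
        ((fun w : ℂ × ℂ => (w.1, ((3, 0) : ℂ × ℂ) + w.1 • c)) 0) := by rwa [e0]
    have ha' : AnalyticAt ℂ returnFamily
        ((fun w : ℂ × ℂ => (w.1, ((3, 0) : ℂ × ℂ) + w.1 • c)) 0) := by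
      rw [e0]; exact hasAnalyticLimit_scaledReturn.analyticAt
    refine VanishesTo.two_of_hasFDerivAt ?_ ?_ ?_
    · exact ((AnalyticAt.comp (g := returnFamily)
        (f := fun w : ℂ × ℂ => (w.1, ((3, 0) : ℂ × ℂ) + w.1 • c)) ha' han).sub analyticAt_const).sub (analyticAt_fst.smul analyticAt_const)
    · have := hasAnalyticLimit_scaledReturn.base
      simp [this]
    · refine (((HasFDerivAt.comp (g := returnFamily)
        (f := fun w : ℂ × ℂ => (w.1, ((3, 0) : ℂ × ℂ) + w.1 • c)) _ hA' hlin).sub_const (3, 0)).sub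
        (hasFDerivAt_fst.smul_const c)).congr_fderiv ?_
      refine ContinuousLinearMap.ext fun w => ?_
      have : A (w.1, w.1 • c) = w.1 • c := by
        rw [show ((w.1, w.1 • c) : ℂ × ℂ × ℂ) = w.1 • (1, c) by simp, map_smul, eA]
      simp [this]
  obtain ⟨C, hC, hb⟩ := Asymptotics.IsBigO.exists_pos V
  have tinv : Tendsto (fun n : ℕ => ((n : ℂ)⁻¹, (0 : ℂ))) atTop (𝓝 0) :=
    tendsto_natCast_inv_complex.prodMk_nhds tendsto_const_nhds
  have T3 : Tendsto (fun n : ℕ => ((n, ((3, 0) : ℂ × ℂ) + (n : ℂ)⁻¹ • c) : ℕ × ℂ × ℂ)) atTop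
      (atTop ×ˢ 𝓝 (3, 0)) := by
    refine tendsto_id.prodMk ?_
    have := (tendsto_natCast_inv_complex.smul_const c).const_add ((3, 0) : ℂ × ℂ)
    simpa using this
  refine ⟨K + C, by positivity, ?_⟩
  filter_upwards [tinv.eventually hb.bound, T3.eventually hc, eventually_gt_atTop 0] with n h1 h2 h3
  have hn : (0 : ℝ) < n := by exact_mod_cast h3
  have hnc : (n : ℂ) ≠ 0 := by exact_mod_cast h3.ne'
  have ec : complexify (-(3 / 4), 1) = c := by
    simp [complexify, c]
  have e1 : planeOf ((n : ℂ)⁻¹ • realCoord (-(3 / 4), 1)) = (3, 0) + (n : ℂ)⁻¹ • c := by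
    rw [planeOf_inv_smul, ec]
  have e2 : realCoord (-(3 / 4), 1) = (n : ℂ) • coordOf ((3, 0) + (n : ℂ)⁻¹ • c) := by
    rw [← e1, coordOf_planeOf, smul_inv_smul₀ hnc]
  rw [coordReturn, e1, e2, ← smul_sub, norm_smul, Complex.norm_natCast]
  have h4 := norm_coordOf_sub_le (scaledReturn n ((3, 0) + (n : ℂ)⁻¹ • c)) ((3, 0) + (n : ℂ)⁻¹ • c)
  have h5 := norm_sub_le_norm_sub_add_norm_sub (scaledReturn n ((3, 0) + (n : ℂ)⁻¹ • c))
    (returnFamily ((n : ℂ)⁻¹, (3, 0) + (n : ℂ)⁻¹ • c)) ((3, 0) + (n : ℂ)⁻¹ • c)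
  have h6 := h2.2
  have h7 : ‖(((n : ℂ)⁻¹, (0 : ℂ)) : ℂ × ℂ)‖ = (n : ℝ)⁻¹ := by
    simp [Prod.norm_def]
  rw [h7, sub_sub, norm_pow, norm_inv, Real.norm_natCast] at h1
  calc (n : ℝ) * _ ≤ n * (K / (n : ℝ) ^ 2 + C * (n : ℝ)⁻¹ ^ 2) := by
        gcongr
        linarith
    _ = _ := by field_simp

/-- The return map of the outer billiard, in the plane. -/
noncomputable def planeReturn (n : ℕ) (z : ℝ × ℝ) : ℝ × ℝ :=
  (outerBilliard semiDisc)^[2 * (4 * n - 1)] z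

theorem eventually_planeReturn : ∀ᶠ n : ℕ in atTop, ∀ z : ℝ × ℝ, ‖z - centre n‖ ≤ 1 / 25 →
    (∀ x₀ : ℝ, 1 ≤ x₀ → Segment x₀ z (4 * n - 1) (planeReturn n z)) ∧
    coordReturn n ((n : ℂ)⁻¹ • realCoord (z - ((3 * n, 0) : ℝ × ℝ))) =
      (n : ℂ)⁻¹ • realCoord (planeReturn n z - ((3 * n, 0) : ℝ × ℝ)) ∧
    |(planeReturn n z).1 - ((centre n).1 - 7 / 9 * (z - centre n).1 - 4 / 9 * (z - centre n).2)|
      ≤ 1 / 100 ∧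
    |(planeReturn n z).2 - ((centre n).2 + 8 / 9 * (z - centre n).1 - 7 / 9 * (z - centre n).2)|
      ≤ 1 / 100 := by
  filter_upwards [eventually_return, eventually_gt_atTop 0] with n hn h0 z hz
  obtain ⟨z', h1, h2, h3, h4⟩ := hn z hz
  have e : planeReturn n z = z' := (h1 1 le_rfl).map
  rw [e]
  refine ⟨h1, ?_, h3, h4⟩
  rw [coordReturn, planeOf_smul_realCoord h0.ne', h2, coordOf_complexify h0.ne']

theorem norm_le_norm_realCoord (x : ℝ × ℝ) : ‖x‖ ≤ 4 * ‖realCoord x‖ := by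
  have h1 : ‖(realCoord x).1‖ ≤ ‖realCoord x‖ := norm_fst_le _
  have h2 : ‖(realCoord x).2‖ ≤ ‖realCoord x‖ := norm_snd_le _
  have e1 : ‖(x.2 : ℂ)‖ = 2 * ‖(realCoord x).1 + (realCoord x).2‖ := by
    have : (x.2 : ℂ) = 2 * ((realCoord x).1 + (realCoord x).2) := by simp only [realCoord]; ring
    rw [this, norm_mul]; simp
  have e2 : ‖(x.1 : ℂ)‖ = ‖rootI‖ * ‖(realCoord x).1 - (realCoord x).2‖ := by
    have : (x.1 : ℂ) = -rootI * ((realCoord x).1 - (realCoord x).2) := by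
      simp only [realCoord]
      linear_combination (x.1 / 2 : ℂ) * rootI_sq
    rw [this, norm_mul, norm_neg]
  have hr : ‖rootI‖ ≤ 2 := by
    rw [rootI, norm_mul, Complex.norm_I, one_mul, Complex.norm_real, Real.norm_eq_abs,
      abs_of_nonneg (Real.sqrt_nonneg _), Real.sqrt_le_left (by norm_num)]
    norm_num
  rw [Complex.norm_real] at e1 e2
  rw [Prod.norm_def, e1, e2]
  have h3 := norm_add_le (realCoord x).1 (realCoord x).2
  have h4 := norm_sub_le (realCoord x).1 (realCoord x).2
  refine max_le ?_ (by linarith)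
  calc _ ≤ 2 * ‖(realCoord x).1 - (realCoord x).2‖ := by gcongr
    _ ≤ _ := by linarith

theorem norm_realCoord_le (x : ℝ × ℝ) : ‖realCoord x‖ ≤ ‖x‖ := by
  have h := norm_coordOf_sub_le (complexify x) 0
  rw [sub_zero, norm_complexify] at h
  have e : coordOf (complexify x) - coordOf 0 = realCoord x := by
    ext <;> simp [coordOf, complexify, realCoord] <;> ring
  rwa [e] at h

/-- At distance O(1/n) from the origin the derivative of the scaled return differs from that of the
limit at its fixed point by O(1/n), and the mean value inequality applies to the convex ball. -/
theorem eventually_coordReturn_linear : ∃ K > (0 : ℝ), ∀ᶠ n : ℕ in atTop, ∀ a a' : ℂ × ℂ,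
    ‖a‖ ≤ 2 / n → ‖a'‖ ≤ 2 / n →
    ‖coordReturn n a - coordReturn n a' - limitLinear (a - a')‖ ≤ K / n * ‖a - a'‖ := by
  obtain ⟨K, hK, hc⟩ := closeTo_coordReturn.fderiv.close
  have V : VanishesTo (fun w => fderiv ℂ limitCoord w - limitLinear) 1 :=
    .of_analyticAt (analyticAt_limitCoord.fderiv.sub analyticAt_const)
      (by rw [hasFDerivAt_limitCoord.fderiv, sub_self])
  obtain ⟨C, hC, hb⟩ := Asymptotics.IsBigO.exists_pos V
  obtain ⟨r₁, hr₁, N, hN⟩ := (hc.and closeTo_coordReturn.eventually_analyticAt).exists_ball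
  obtain ⟨r₂, hr₂, h2⟩ := Metric.eventually_nhds_iff_ball.1 hb.bound
  have t : Tendsto (fun n : ℕ => 2 / (n : ℝ)) atTop (𝓝 0) :=
    tendsto_const_nhds.div_atTop tendsto_natCast_atTop_atTop
  refine ⟨K + C * 2, by positivity, ?_⟩
  filter_upwards [t.eventually_lt_const hr₁, t.eventually_lt_const hr₂, eventually_ge_atTop N]
    with n l1 l2 l3 a a' ha ha'
  have hs : ∀ w ∈ Metric.closedBall (0 : ℂ × ℂ) (2 / n), ‖w‖ ≤ 2 / n := fun w hw => by simpa using hw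
  refine (convex_closedBall (0 : ℂ × ℂ) (2 / n)).norm_image_sub_le_of_norm_hasFDerivWithin_le' (𝕜 := ℂ)
    (f' := fderiv ℂ (coordReturn n)) (fun w hw => ?_) (fun w hw => ?_)
    (by simpa using ha') (by simpa using ha)
  · exact (hN n l3 w ((hs w hw).trans_lt l1)).2.differentiableAt.hasFDerivAt.hasFDerivWithinAt
  · have k1 := (hN n l3 w ((hs w hw).trans_lt l1)).1.2
    have k2 := h2 w (by simpa using (hs w hw).trans_lt l2)
    rw [pow_one, norm_norm] at k2
    have k3 := norm_sub_le_norm_sub_add_norm_sub (fderiv ℂ (coordReturn n) w)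
      (fderiv ℂ limitCoord w) limitLinear
    have k4 : C * ‖w‖ ≤ C * (2 / n) := by gcongr; exact hs w hw
    rw [add_div, mul_div_assoc]
    linarith

/-- The linear map with the given matrix entries. -/
def matrixCLM (a b c d : ℝ) : ℝ × ℝ →L[ℝ] ℝ × ℝ :=
  (a • ContinuousLinearMap.fst ℝ ℝ ℝ + b • ContinuousLinearMap.snd ℝ ℝ ℝ).prod
    (c • ContinuousLinearMap.fst ℝ ℝ ℝ + d • ContinuousLinearMap.snd ℝ ℝ ℝ)

theorem matrixCLM_apply (a b c d : ℝ) (x : ℝ × ℝ) :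
    matrixCLM a b c d x = (a * x.1 + b * x.2, c * x.1 + d * x.2) := by
  simp [matrixCLM]

theorem halfMult_sq : halfMult ^ 2 = (-7 - 4 * rootI) / 9 := by
  simp only [halfMult]; linear_combination (4 / 9) * rootI_sq

theorem halfMultConj_sq : halfMultConj ^ 2 = (-7 + 4 * rootI) / 9 := by
  simp only [halfMultConj]; linear_combination (4 / 9) * rootI_sq

theorem limitLinear_realCoord (x : ℝ × ℝ) :
    limitLinear (realCoord x) = realCoord (matrixCLM (-7 / 9) (-4 / 9) (8 / 9) (-7 / 9) x) := by
  rw [matrixCLM_apply]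
  ext
  · simp [limitLinear, realCoord, halfMult_sq]
    linear_combination (-(x.1 : ℂ) / 9) * rootI_sq
  · simp [limitLinear, realCoord, halfMultConj_sq]
    linear_combination (-(x.1 : ℂ) / 9) * rootI_sq

theorem sub_natCast_centre (n : ℕ) (η : ℝ × ℝ) :
    centre n + η - ((3 * n, 0) : ℝ × ℝ) = (-(3 / 4), 1) + η := by
  ext <;> simp [centre] <;> ring

open Classical in
/-- The return maps have fixed points close to the points `centre n`. -/
theorem exists_fixedPoint : ∃ (p : ℕ → ℝ × ℝ) (M : ℝ), 0 < M ∧ ∀ᶠ n : ℕ in atTop,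
    ‖p n - centre n‖ ≤ M / n ∧ planeReturn n (p n) = p n := by
  obtain ⟨K, hK, hc⟩ := eventually_coordReturn_centre
  obtain ⟨L, hL, hl⟩ := eventually_coordReturn_linear
  have key : ∀ᶠ n : ℕ in atTop, ∃ q : ℝ × ℝ, ‖q - centre n‖ ≤ 8 * K / n ∧ planeReturn n q = q := by
    have t1 : Tendsto (fun n : ℕ => 8 * K / (n : ℝ)) atTop (𝓝 0) :=
      tendsto_const_nhds.div_atTop tendsto_natCast_atTop_atTop
    have t2 : Tendsto (fun n : ℕ => 4 * L / (n : ℝ)) atTop (𝓝 0) :=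
      tendsto_const_nhds.div_atTop tendsto_natCast_atTop_atTop
    filter_upwards [hc, hl, eventually_planeReturn, t1.eventually_lt_const
      (by norm_num : (0 : ℝ) < 1 / 50), t2.eventually_lt_const (by norm_num : (0 : ℝ) < 1 / 2),
      eventually_gt_atTop 0] with n h1 h2 h3 h4 h5 h6
    have hn : (0 : ℝ) < n := by exact_mod_cast h6
    have hnc : (n : ℂ) ≠ 0 := by exact_mod_cast h6.ne'
    set c : ℝ × ℝ := (-(3 / 4), 1) with hcdef
    obtain ⟨ψ, hψ⟩ : ∃ ψ : ℝ × ℝ → ℝ × ℝ, ∀ η, ψ η = planeReturn n (centre n + η) - centre n - η :=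
      ⟨_, fun _ => rfl⟩
    have ec : (c : ℝ × ℝ) = centre n - ((3 * n, 0) : ℝ × ℝ) := by
      have := sub_natCast_centre n 0
      rw [add_zero, add_zero] at this
      rw [this]
    have eψ : ∀ η : ℝ × ℝ, ‖η‖ ≤ 1 / 25 → realCoord (ψ η) =
        (n : ℂ) • coordReturn n ((n : ℂ)⁻¹ • realCoord (c + η)) - realCoord (c + η) := by
      intro η hη
      have k := (h3 (centre n + η) (by rwa [add_sub_cancel_left])).2.1
      rw [sub_natCast_centre] at k
      rw [k, smul_inv_smul₀ hnc, ← realCoord_sub]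
      congr 1
      rw [hψ, ec]
      abel
    have hb : ∀ η : ℝ × ℝ, ‖η‖ ≤ 1 / 25 → ‖(n : ℂ)⁻¹ • realCoord (c + η)‖ ≤ 2 / n := by
      intro η hη
      have hc1 : ‖c‖ ≤ 1 := by
        rw [hcdef, Prod.norm_def]; norm_num
      rw [norm_smul, norm_inv, Complex.norm_natCast, div_eq_inv_mul]
      gcongr
      exact (norm_realCoord_le _).trans ((norm_add_le _ _).trans (by linarith))
    -- The displacement ψ has linear part equal to that of the return minus the identity; it is
    -- invertible because 1 is not an eigenvalue of a nontrivial rotation.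
    have happ : ApproximatesLinearOn ψ (matrixCLM (-16 / 9) (-4 / 9) (8 / 9) (-16 / 9))
        (Metric.closedBall 0 (1 / 25)) (1 / 2) := by
      intro η hη η' hη'
      have hη1 : ‖η‖ ≤ 1 / 25 := by simpa using hη
      have hη2 : ‖η'‖ ≤ 1 / 25 := by simpa using hη'
      set a := (n : ℂ)⁻¹ • realCoord (c + η)
      set a' := (n : ℂ)⁻¹ • realCoord (c + η')
      have ha : a - a' = (n : ℂ)⁻¹ • realCoord (η - η') := by
        rw [← smul_sub, ← realCoord_sub, add_sub_add_left_eq_sub]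
      have e : realCoord (ψ η - ψ η' - matrixCLM (-16 / 9) (-4 / 9) (8 / 9) (-16 / 9) (η - η')) =
          (n : ℂ) • (coordReturn n a - coordReturn n a' - limitLinear (a - a')) := by
        have e1 : matrixCLM (-16 / 9) (-4 / 9) (8 / 9) (-16 / 9) (η - η') =
            matrixCLM (-7 / 9) (-4 / 9) (8 / 9) (-7 / 9) (η - η') - (η - η') := by
          rw [matrixCLM_apply, matrixCLM_apply]
          ext <;> simp <;> ring
        rw [e1, realCoord_sub, realCoord_sub, realCoord_sub, ← limitLinear_realCoord, eψ η hη1,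
          eψ η' hη2, ha, map_smul, smul_sub, smul_sub, smul_inv_smul₀ hnc]
        have e2 : realCoord (η - η') = realCoord (c + η) - realCoord (c + η') := by
          rw [← realCoord_sub, add_sub_add_left_eq_sub]
        rw [e2]
        abel
      refine (norm_le_norm_realCoord _).trans ?_
      rw [e, norm_smul, Complex.norm_natCast]
      have k := h2 a a' (hb η hη1) (hb η' hη2)
      have k2 : ‖a - a'‖ ≤ ‖η - η'‖ / n := by
        rw [ha, norm_smul, norm_inv, Complex.norm_natCast, div_eq_inv_mul]
        gcongr
        exact norm_realCoord_le _
      calc 4 * (n * _) ≤ 4 * (n * (L / n * (‖η - η'‖ / n))) := by gcongr; exact k.trans (by gcongr)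
        _ = 4 * L / n * ‖η - η'‖ := by field_simp
        _ ≤ _ := by
          push_cast
          gcongr
    -- The inverse matrix is explicit, with absolute row sums 5/8 and 3/4, so its norm for the
    -- maximum norm is at most 1.
    let inv : (matrixCLM (-16 / 9) (-4 / 9) (8 / 9) (-16 / 9)).NonlinearRightInverse :=
      { toFun := fun y => (-1 / 2 * y.1 + 1 / 8 * y.2, -1 / 4 * y.1 + -1 / 2 * y.2)
        nnnorm := 1
        bound' := by
          intro y
          have k1 : |y.1| ≤ ‖y‖ := norm_fst_le y
          have k2 : |y.2| ≤ ‖y‖ := norm_snd_le y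
          rw [NNReal.coe_one, one_mul, Prod.norm_def]
          rw [abs_le] at k1 k2
          refine max_le ?_ ?_ <;> rw [Real.norm_eq_abs, abs_le] <;> constructor <;> simp only <;>
            linarith
        right_inv' := by
          intro y
          rw [matrixCLM_apply]
          ext <;> simp only <;> ring }
    -- On the ball of radius 8K/n the displacement covers a ball of radius (1 - 1/2)(8K/n) = 4K/n
    -- about its value at the centre. That value has norm at most 4K/n, the factor 4 coming from
    -- `norm_le_norm_realCoord`, so zero is attained.
    have hsurj := happ.surjOn_closedBall_of_nonlinearRightInverse inv (ε := 8 * K / n) (b := 0)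
      (by positivity) (Metric.closedBall_subset_closedBall (by linarith))
    have h0 : (0 : ℝ × ℝ) ∈ Metric.closedBall (ψ 0) (((inv.nnnorm : ℝ)⁻¹ - (1 / 2 : NNReal)) *
        (8 * K / n)) := by
      rw [Metric.mem_closedBall, dist_eq_norm, zero_sub, norm_neg]
      refine (norm_le_norm_realCoord _).trans ?_
      rw [eψ 0 (by simp), add_zero]
      have : (((inv.nnnorm : ℝ)⁻¹ - (1 / 2 : NNReal)) * (8 * K / n)) = 4 * (K / n) := by
        have : (inv.nnnorm : ℝ) = 1 := rfl
        rw [this]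
        push_cast
        ring
      rw [this]
      gcongr
    obtain ⟨η, hη, hη0⟩ := hsurj h0
    refine ⟨centre n + η, by rw [add_sub_cancel_left]; simpa using hη, ?_⟩
    rw [hψ, sub_sub, sub_eq_zero] at hη0
    exact hη0
  refine ⟨fun n => if h : ∃ q : ℝ × ℝ, ‖q - centre n‖ ≤ 8 * K / n ∧ planeReturn n q = q then
    h.choose else 0, 8 * K, by positivity, ?_⟩
  filter_upwards [key] with n hn
  rw [dif_pos hn]
  exact hn.choose_spec

/-! ### The linear part of the return maps at their fixed points -/

/-- The eigencoordinates as a linear map. -/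
noncomputable def realCoordCLM : ℝ × ℝ →L[ℝ] ℂ × ℂ :=
  LinearMap.toContinuousLinearMap
    { toFun := realCoord
      map_add' := realCoord_add
      map_smul' := fun r x => by ext <;> simp [realCoord] <;> ring }

@[simp]
theorem realCoordCLM_apply (x : ℝ × ℝ) : realCoordCLM x = realCoord x := rfl

/-- The scaled eigencoordinates of a point of the plane. -/
noncomputable def shiftCoord (n : ℕ) (z : ℝ × ℝ) : ℂ × ℂ :=
  (n : ℂ)⁻¹ • realCoord (z - ((3 * n, 0) : ℝ × ℝ))

theorem shiftCoord_sub (n : ℕ) (z z' : ℝ × ℝ) :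
    shiftCoord n z - shiftCoord n z' = (n : ℂ)⁻¹ • realCoord (z - z') := by
  rw [shiftCoord, shiftCoord, ← smul_sub, ← realCoord_sub, sub_sub_sub_cancel_right]

theorem hasFDerivAt_shiftCoord (n : ℕ) (z : ℝ × ℝ) :
    HasFDerivAt (shiftCoord n) ((n : ℂ)⁻¹ • realCoordCLM) z := by
  have h := realCoordCLM.hasFDerivAt (x := z - ((3 * n, 0) : ℝ × ℝ))
  exact (h.comp z ((hasFDerivAt_id z).sub_const _)).const_smul ((n : ℂ)⁻¹)

theorem fderiv_realCoord {n : ℕ} (hn : n ≠ 0) {p : ℝ × ℝ} {D : ℂ × ℂ →L[ℂ] ℂ × ℂ}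
    {A : ℝ × ℝ →L[ℝ] ℝ × ℝ}
    (hc : ∀ᶠ z in 𝓝 p, coordReturn n (shiftCoord n z) = shiftCoord n (planeReturn n z))
    (hD : HasFDerivAt (coordReturn n) D (shiftCoord n p)) (hA : HasFDerivAt (planeReturn n) A p)
    (x : ℝ × ℝ) : D (realCoord x) = realCoord (A x) := by
  have h1 := (hD.restrictScalars ℝ).comp p (hasFDerivAt_shiftCoord n p)
  have h2 := (hasFDerivAt_shiftCoord n (planeReturn n p)).comp p hA
  have h3 := h1.unique (h2.congr_of_eventuallyEq hc)
  have h4 := congrArg (fun L : ℝ × ℝ →L[ℝ] ℂ × ℂ => L x) h3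
  simp only [ContinuousLinearMap.comp_apply, ContinuousLinearMap.coe_restrictScalars',
    _root_.smul_apply, realCoordCLM_apply, map_smul] at h4
  have : (n : ℂ)⁻¹ ≠ 0 := by simpa using hn
  exact smul_right_injective _ this h4

/-- D is the complexification of a real map, in coordinates that are conjugate to each other on real
vectors. Its matrix therefore has rows (a, b) and (b̄, ā), with the determinant and trace of the
real map. -/
theorem conj_entries {D : ℂ × ℂ →L[ℂ] ℂ × ℂ} {A : ℝ × ℝ →L[ℝ] ℝ × ℝ}
    (h : ∀ x, D (realCoord x) = realCoord (A x)) :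
    (D (1, 0)).2 = starRingEnd ℂ (D (0, 1)).1 ∧ (D (0, 1)).2 = starRingEnd ℂ (D (1, 0)).1 ∧
    (D (1, 0)).1 * (D (0, 1)).2 - (D (0, 1)).1 * (D (1, 0)).2 = A.det ∧
    (D (1, 0)).1 + (D (0, 1)).2 = ((A (1, 0)).1 + (A (0, 1)).2 : ℝ) := by
  obtain ⟨r, s, hrs⟩ : ∃ r s, A (1, 0) = (r, s) := ⟨_, _, rfl⟩
  obtain ⟨u, v, huv⟩ : ∃ u v, A (0, 1) = (u, v) := ⟨_, _, rfl⟩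
  have e1 : D (0, 1) + D (1, 0) = (v + rootI * u, v - rootI * u) := by
    have h1 := h ((4 : ℝ) • (0, 1))
    rw [map_smul, huv] at h1
    have h2 : realCoord ((4 : ℝ) • (0, 1)) = (0, 1) + (1, 0) := by ext <;> simp [realCoord]
    rw [h2, map_add] at h1
    rw [h1]
    ext <;> simp [realCoord] <;> ring
  have e2 : D (1, 0) - D (0, 1) = (r - rootI * s / 2, -r - rootI * s / 2) := by
    have h1 := h ((4 : ℝ) • (1, 0))
    rw [map_smul, hrs] at h1
    have h2 : realCoord ((4 : ℝ) • (1, 0)) = rootI • ((1, 0) - (0, 1)) := by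
      ext <;> simp [realCoord]
    rw [h2, map_smul, map_sub] at h1
    have h3 : D (1, 0) - D (0, 1) = (-rootI / 2) • rootI • (D (1, 0) - D (0, 1)) := by
      rw [smul_smul, show -rootI / 2 * rootI = 1 by linear_combination (-1 / 2) * rootI_sq, one_smul]
    rw [h3, h1]
    ext
    · simp [realCoord]; linear_combination (-(r : ℂ) / 2) * rootI_sq
    · simp [realCoord]; linear_combination ((r : ℂ) / 2) * rootI_sq
  have ea : D (1, 0) = ((v + rootI * u + r - rootI * s / 2) / 2, (v - rootI * u - r - rootI * s / 2) / 2) := by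
    have : D (1, 0) = (2 : ℂ)⁻¹ • ((D (0, 1) + D (1, 0)) + (D (1, 0) - D (0, 1))) := by
      rw [add_comm (D (0, 1)), add_add_sub_cancel, ← two_smul ℂ, smul_smul]; norm_num
    rw [this, e1, e2]
    ext <;> simp <;> ring
  have eb : D (0, 1) = ((v + rootI * u - r + rootI * s / 2) / 2, (v - rootI * u + r + rootI * s / 2) / 2) := by
    have : D (0, 1) = (D (0, 1) + D (1, 0)) - D (1, 0) := by rw [add_sub_cancel_right]
    rw [this, e1, ea]
    ext <;> simp <;> ring
  rw [clm_det_prod, ea, eb, hrs, huv]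
  refine ⟨?_, ?_, ?_, ?_⟩
  · simp [conj_rootI, map_ofNat]; ring
  · simp [conj_rootI, map_ofNat]; ring
  · push_cast; linear_combination ((u : ℂ) * s / 2) * rootI_sq
  · push_cast; ring

theorem exp_neg_arccos (s : ℝ) : Complex.exp (Complex.I * ((-arccos s : ℝ) : ℂ)) =
    (cos (arccos s) : ℝ) - Complex.I * (sin (arccos s) : ℝ) := by
  rw [mul_comm, Complex.exp_mul_I, ← Complex.ofReal_cos, ← Complex.ofReal_sin, cos_neg, sin_neg]
  push_cast
  ring

theorem exp_limit : Complex.exp (Complex.I * ((-arccos (-7 / 9) : ℝ) : ℂ)) = halfMult ^ 2 := by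
  rw [exp_neg_arccos, cos_arccos (by norm_num) (by norm_num), sin_arccos, halfMult_sq, rootI]
  have : √(1 - (-7 / 9) ^ 2) = 4 * √2 / 9 := by
    rw [Real.sqrt_eq_iff_mul_self_eq (by norm_num) (by positivity)]
    nlinarith [Real.sq_sqrt (zero_le_two : (0 : ℝ) ≤ 2)]
  rw [this]
  push_cast
  ring

/-- The change of coordinates that diagonalises the linear part. -/
noncomputable def diagCoord (q : ℂ) : ℂ × ℂ →L[ℂ] ℂ × ℂ :=
  (ContinuousLinearMap.fst ℂ ℂ ℂ + q • ContinuousLinearMap.snd ℂ ℂ ℂ).prod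
    (starRingEnd ℂ q • ContinuousLinearMap.fst ℂ ℂ ℂ + ContinuousLinearMap.snd ℂ ℂ ℂ)

theorem diagCoord_apply (q : ℂ) (w : ℂ × ℂ) :
    diagCoord q w = (w.1 + q * w.2, starRingEnd ℂ q * w.1 + w.2) := by simp [diagCoord]

/-- The inverse of `diagCoord q`. -/
noncomputable def diagCoordInv (q : ℂ) : ℂ × ℂ →L[ℂ] ℂ × ℂ :=
  (1 - q * starRingEnd ℂ q)⁻¹ •
    ((ContinuousLinearMap.fst ℂ ℂ ℂ - q • ContinuousLinearMap.snd ℂ ℂ ℂ).prod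
    (ContinuousLinearMap.snd ℂ ℂ ℂ - starRingEnd ℂ q • ContinuousLinearMap.fst ℂ ℂ ℂ))

theorem diagCoordInv_apply (q : ℂ) (w : ℂ × ℂ) :
    diagCoordInv q w = ((1 - q * starRingEnd ℂ q)⁻¹ * (w.1 - q * w.2),
      (1 - q * starRingEnd ℂ q)⁻¹ * (w.2 - starRingEnd ℂ q * w.1)) := by simp [diagCoordInv]

theorem diagCoord_diagCoordInv {q : ℂ} (hq : 1 - q * starRingEnd ℂ q ≠ 0) (w : ℂ × ℂ) :
    diagCoord q (diagCoordInv q w) = w := by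
  have h := inv_mul_cancel₀ hq
  rw [diagCoordInv_apply, diagCoord_apply]
  ext <;> simp only
  · linear_combination w.1 * h
  · linear_combination w.2 * h

theorem diagCoordInv_diagCoord {q : ℂ} (hq : 1 - q * starRingEnd ℂ q ≠ 0) (w : ℂ × ℂ) :
    diagCoordInv q (diagCoord q w) = w := by
  have h := inv_mul_cancel₀ hq
  rw [diagCoordInv_apply, diagCoord_apply]
  ext <;> simp only
  · linear_combination w.1 * h
  · linear_combination w.2 * h

theorem diagCoord_realCoord (q : ℂ) (x : ℝ × ℝ) :
    (diagCoord q (realCoord x)).2 = starRingEnd ℂ (diagCoord q (realCoord x)).1 := by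
  rw [diagCoord_apply]
  simp [realCoord, conj_rootI, map_ofNat]
  ring

/-- The row vector (1, q) is a left eigenvector, for the eigenvalue l, of the matrix with rows (a,
b) and (b̄, ā). It defines the first diagonalising coordinate; the second is its conjugate. -/
theorem eigenvector_relations {a b l q : ℂ} (hab : a * starRingEnd ℂ a - b * starRingEnd ℂ b = 1)
    (hl : l ^ 2 - (a + starRingEnd ℂ a) * l + 1 = 0) (hla : l - starRingEnd ℂ a ≠ 0)
    (hq : q = b / (l - starRingEnd ℂ a)) :
    a + q * starRingEnd ℂ b = l ∧ b + q * starRingEnd ℂ a = l * q := by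
  subst hq
  constructor
  · field_simp
    linear_combination -hab - hl
  · field_simp
    ring

/-- The scaled return map in diagonalising coordinates at the point `p`. -/
noncomputable def localReturn (n : ℕ) (p : ℝ × ℝ) (q : ℂ) (w : ℂ × ℂ) : ℂ × ℂ :=
  diagCoord q (coordReturn n (shiftCoord n p + diagCoordInv q w) - shiftCoord n p)

theorem hasDiagonalPart_localReturn {n : ℕ} {p : ℝ × ℝ} {q a b l : ℂ} {D : ℂ × ℂ →L[ℂ] ℂ × ℂ}
    (han : AnalyticAt ℂ (coordReturn n) (shiftCoord n p))
    (hfix : coordReturn n (shiftCoord n p) = shiftCoord n p)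
    (hD : HasFDerivAt (coordReturn n) D (shiftCoord n p))
    (hDe : ∀ w, D w = (a * w.1 + b * w.2, starRingEnd ℂ b * w.1 + starRingEnd ℂ a * w.2))
    (h1 : a + q * starRingEnd ℂ b = l) (h2 : b + q * starRingEnd ℂ a = l * q)
    (hq : 1 - q * starRingEnd ℂ q ≠ 0) :
    HasDiagonalPart (localReturn n p q) l (starRingEnd ℂ l) := by
  have hin : AnalyticAt ℂ (fun w => shiftCoord n p + diagCoordInv q w) 0 :=
    analyticAt_const.add ((diagCoordInv q).analyticAt 0)
  have hin0 : shiftCoord n p + diagCoordInv q 0 = shiftCoord n p := by simp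
  have han' : AnalyticAt ℂ (localReturn n p q) 0 := by
    have : AnalyticAt ℂ (coordReturn n) (shiftCoord n p + diagCoordInv q 0) := by rwa [hin0]
    exact ((diagCoord q).analyticAt _).comp
      ((AnalyticAt.comp (g := coordReturn n) (f := fun w => shiftCoord n p + diagCoordInv q w)
        this hin).sub analyticAt_const)
  have h0 : localReturn n p q 0 = 0 := by rw [localReturn, hin0, hfix, sub_self, map_zero]
  have hder : HasFDerivAt (localReturn n p q) ((diagCoord q).comp (D.comp (diagCoordInv q))) 0 := by
    have : HasFDerivAt (coordReturn n) D (shiftCoord n p + diagCoordInv q 0) := by rwa [hin0]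
    exact (diagCoord q).hasFDerivAt.comp 0 ((HasFDerivAt.comp (g := coordReturn n)
      (f := fun w => shiftCoord n p + diagCoordInv q w) 0 this
      ((diagCoordInv q).hasFDerivAt.const_add _)).sub_const _)
  have e : (diagCoord q).comp (D.comp (diagCoordInv q)) =
      (l • ContinuousLinearMap.fst ℂ ℂ ℂ).prod (starRingEnd ℂ l • ContinuousLinearMap.snd ℂ ℂ ℂ) := by
    have h1' := congrArg (starRingEnd ℂ) h1
    have h2' := congrArg (starRingEnd ℂ) h2
    simp only [map_add, map_mul, Complex.conj_conj] at h1' h2'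
    refine ContinuousLinearMap.ext fun w => ?_
    have hw := diagCoord_diagCoordInv hq w
    set u := diagCoordInv q w with hu
    simp only [ContinuousLinearMap.comp_apply, ← hu, hDe]
    rw [← hw]
    simp only [diagCoord_apply, ContinuousLinearMap.prod_apply, _root_.smul_apply,
      ContinuousLinearMap.coe_fst', ContinuousLinearMap.coe_snd', smul_eq_mul]
    ext <;> simp only
    · linear_combination u.1 * h1 + u.2 * h2
    · linear_combination u.2 * h1' + u.1 * h2'
  rw [e] at hder
  have hv : VanishesTo (fun w => localReturn n p q w -
      (l • ContinuousLinearMap.fst ℂ ℂ ℂ).prod (starRingEnd ℂ l • ContinuousLinearMap.snd ℂ ℂ ℂ) w)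
      2 := by
    refine .two_of_hasFDerivAt (han'.sub (ContinuousLinearMap.analyticAt _ _)) (by simp [h0]) ?_
    refine (hder.sub (ContinuousLinearMap.hasFDerivAt _)).congr_fderiv ?_
    rw [sub_self]
  refine ⟨han'.continuousAt, h0, .of_analyticAt han' h0, ?_, ?_⟩
  · refine Asymptotics.IsBigO.trans (Asymptotics.IsBigO.of_bound 1 (Eventually.of_forall fun w => ?_)) hv
    simpa using norm_fst_le (localReturn n p q w - (l * w.1, starRingEnd ℂ l * w.2))
  · refine Asymptotics.IsBigO.trans (Asymptotics.IsBigO.of_bound 1 (Eventually.of_forall fun w => ?_)) hv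
    simpa using norm_snd_le (localReturn n p q w - (l * w.1, starRingEnd ℂ l * w.2))

theorem eventually_areaPreserving : ∀ᶠ n : ℕ in atTop, ∀ z : ℝ × ℝ, ‖z - centre n‖ ≤ 1 / 25 →
    AreaPreservingAt (planeReturn n) z := by
  filter_upwards [eventually_planeReturn] with n hn z hz
  have h := ((hn z hz).1 1 le_rfl).regular
  exact AreaPreservingAt.iterate fun i hi => (h i hi).2

theorem norm_shiftCoord_le {n : ℕ} {z : ℝ × ℝ} (hn : 0 < n) (h : ‖z - centre n‖ ≤ 1) :
    ‖shiftCoord n z‖ ≤ 2 / n := by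
  have hn' : (0 : ℝ) < n := by exact_mod_cast hn
  have e := sub_natCast_centre n (z - centre n)
  rw [add_sub_cancel] at e
  rw [shiftCoord, e, norm_smul, norm_inv, Complex.norm_natCast, div_eq_inv_mul (2 : ℝ)]
  gcongr
  refine (norm_realCoord_le _).trans ((norm_add_le _ _).trans ?_)
  have : ‖((-(3 / 4), 1) : ℝ × ℝ)‖ ≤ 1 := by
    rw [Prod.norm_def]; norm_num
  linarith

theorem eventually_arccos_sub_le {s : ℕ → ℝ} {s₀ K : ℝ} (h1 : -1 < s₀) (h2 : s₀ < 1)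
    (h : ∀ᶠ n : ℕ in atTop, |s n - s₀| ≤ K / n) :
    ∃ K' > (0 : ℝ), ∀ᶠ n : ℕ in atTop, |arccos (s n) - arccos s₀| ≤ K' / n := by
  have hd : DifferentiableAt ℝ arccos s₀ := Real.differentiableAt_arccos.2 ⟨h1.ne', h2.ne⟩
  obtain ⟨C, hC, hb⟩ := hd.isBigO_sub.exists_pos
  have t0 : Tendsto (fun n : ℕ => K / (n : ℝ)) atTop (𝓝 0) :=
    tendsto_const_nhds.div_atTop tendsto_natCast_atTop_atTop
  have t : Tendsto s atTop (𝓝 s₀) := by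
    rw [tendsto_iff_norm_sub_tendsto_zero]
    exact squeeze_zero' (Eventually.of_forall fun n => norm_nonneg _) h t0
  refine ⟨C * (|K| + 1), by positivity, ?_⟩
  filter_upwards [h, t.eventually hb.bound] with n a b
  refine b.trans ?_
  rw [mul_div_assoc]
  refine mul_le_mul_of_nonneg_left (a.trans ?_) hC.le
  gcongr
  linarith [le_abs_self K]

theorem limitLinear_apply (w : ℂ × ℂ) :
    limitLinear w = (halfMult ^ 2 * w.1, halfMultConj ^ 2 * w.2) := by simp [limitLinear]

theorem conj_halfMult_sq : starRingEnd ℂ (halfMult ^ 2) = halfMultConj ^ 2 := by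
  rw [halfMult_sq, halfMultConj_sq]
  simp [conj_rootI, map_ofNat]

theorem closeTo_localReturn {p : ℕ → ℝ × ℝ} {q : ℕ → ℂ}
    (hp : CloseTo (fun n _ => shiftCoord n (p n)) (fun _ => 0))
    (hq : CloseTo (fun n _ => q n) (fun _ => 0)) :
    CloseTo (fun n => localReturn n (p n) (q n)) limitCoord := by
  have hq' : CloseTo (fun n _ => starRingEnd ℂ (q n)) (fun _ => 0) := by simpa using hq.conj
  have one : CloseTo (fun _ _ => (1 : ℂ)) (fun _ => 1) := .const analyticAt_const
  have hdet : CloseTo (fun n _ => (1 - q n * starRingEnd ℂ (q n))⁻¹) (fun _ => (1 - 0 * 0)⁻¹) :=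
    (one.sub (hq.mul hq')).inv (by simp)
  have hin : CloseTo (fun n w => shiftCoord n (p n) + diagCoordInv (q n) w)
      (fun w => 0 + ((1 - 0 * 0)⁻¹ * (w.1 - 0 * w.2), (1 - 0 * 0)⁻¹ * (w.2 - 0 * w.1))) := by
    simp only [diagCoordInv_apply]
    exact hp.add ((hdet.mul (CloseTo.id.fst.sub (hq.mul CloseTo.id.snd))).prod
      (hdet.mul (CloseTo.id.snd.sub (hq'.mul CloseTo.id.fst))))
  have hr := (closeTo_coordReturn.comp hin (by simp)).sub hp
  have h := (hr.fst.add (hq.mul hr.snd)).prod ((hq'.mul hr.fst).add hr.snd)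
  simp only [zero_mul, sub_zero, inv_one, one_mul, Prod.mk.eta, zero_add, add_zero] at h
  exact h.congr (Eventually.of_forall fun x => by simp only [localReturn, diagCoord_apply])

/-- Area preservation gives |a|² - |b|² = 1, so the eigenvalues are the roots of l² - 2(Re a)l + 1.
As Re a tends to -7/9, they lie on the unit circle. The angle -arccos(Re a) is the branch whose
limit matches `halfMult ^ 2`. -/
theorem exists_linearisation : ∃ (p : ℕ → ℝ × ℝ) (α : ℕ → ℝ) (q : ℕ → ℂ) (M : ℝ), 0 < M ∧
    (∀ᶠ n : ℕ in atTop, ‖p n - centre n‖ ≤ M / n) ∧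
    (∀ᶠ n : ℕ in atTop, planeReturn n (p n) = p n) ∧
    (∀ᶠ n : ℕ in atTop, |α n - -arccos (-7 / 9)| ≤ M / n) ∧
    (∀ᶠ n : ℕ in atTop, ‖q n‖ ≤ M / n) ∧
    (∀ᶠ n : ℕ in atTop, ∃ A : ℝ × ℝ →L[ℝ] ℝ × ℝ, HasFDerivAt (planeReturn n) A (p n) ∧
      A.det = 1 ∧ |(A (1, 0)).1 + (A (0, 1)).2| < 2) ∧
    (∀ᶠ n : ℕ in atTop, HasDiagonalPart (localReturn n (p n) (q n))
      (Complex.exp (Complex.I * α n)) (starRingEnd ℂ (Complex.exp (Complex.I * α n)))) ∧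
    CloseTo (fun n => localReturn n (p n) (q n)) limitCoord := by
  obtain ⟨p, M, hM, hp⟩ := exists_fixedPoint
  have hpc : ∀ᶠ n : ℕ in atTop, ‖p n - centre n‖ < 1 / 25 := by
    have t : Tendsto (fun n : ℕ => M / (n : ℝ)) atTop (𝓝 0) :=
      tendsto_const_nhds.div_atTop tendsto_natCast_atTop_atTop
    filter_upwards [hp, t.eventually_lt_const (by norm_num : (0 : ℝ) < 1 / 25)] with n h1 h2
    exact h1.1.trans_lt h2
  have cp : CloseTo (fun n _ => shiftCoord n (p n)) (fun _ => 0) := by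
    refine CloseTo.of_seq (K := 2) ?_
    filter_upwards [hpc, eventually_gt_atTop 0] with n h1 h2
    rw [sub_zero]
    exact norm_shiftCoord_le h2 (h1.le.trans (by norm_num))
  have hfix : ∀ᶠ n : ℕ in atTop, coordReturn n (shiftCoord n (p n)) = shiftCoord n (p n) := by
    filter_upwards [hp, hpc, eventually_planeReturn] with n h1 h2 h3
    have := (h3 (p n) h2.le).2.1
    rw [h1.2] at this
    exact this
  have han : ∀ᶠ n : ℕ in atTop, AnalyticAt ℂ (coordReturn n) (shiftCoord n (p n)) := by
    have t : Tendsto (fun n : ℕ => (n, shiftCoord n (p n))) atTop (atTop ×ˢ 𝓝 0) :=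
      tendsto_id.prodMk cp.tendsto_zero
    exact t.eventually closeTo_coordReturn.eventually_analyticAt
  set D : ℕ → ℂ × ℂ →L[ℂ] ℂ × ℂ := fun n => fderiv ℂ (coordReturn n) (shiftCoord n (p n)) with hDdef
  have hD : ∀ᶠ n : ℕ in atTop, HasFDerivAt (coordReturn n) (D n) (shiftCoord n (p n)) :=
    han.mono fun n h => h.differentiableAt.hasFDerivAt
  have cD : CloseTo (fun n _ => D n) (fun _ => limitLinear) := by
    have := closeTo_coordReturn.fderiv.comp cp rfl
    rwa [hasFDerivAt_limitCoord.fderiv] at this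
  set a : ℕ → ℂ := fun n => (D n (1, 0)).1
  set b : ℕ → ℂ := fun n => (D n (0, 1)).1
  have ca : CloseTo (fun n _ => a n) (fun _ => halfMult ^ 2) := by
    have := (cD.clm (ContinuousLinearMap.apply ℂ (ℂ × ℂ) ((1 : ℂ), (0 : ℂ)))).fst
    simpa [limitLinear_apply] using this
  have cb : CloseTo (fun n _ => b n) (fun _ => 0) := by
    have := (cD.clm (ContinuousLinearMap.apply ℂ (ℂ × ℂ) ((0 : ℂ), (1 : ℂ)))).fst
    simpa [limitLinear_apply] using this
  have hre : (halfMult ^ 2).re = -7 / 9 := by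
    rw [halfMult_sq, rootI]
    simp
  obtain ⟨K₁, -, ha1⟩ := ca.eventually_norm_le
  have hs : ∀ᶠ n : ℕ in atTop, |(a n).re - -7 / 9| ≤ K₁ / n := by
    filter_upwards [ha1] with n h
    rw [← hre, ← Complex.sub_re]
    exact (Complex.abs_re_le_norm _).trans h
  have hs1 : ∀ᶠ n : ℕ in atTop, |(a n).re| < 1 := by
    have t : Tendsto (fun n => |(a n).re|) atTop (𝓝 |(halfMult ^ 2).re|) :=
      ((Complex.continuous_re.tendsto _).comp ca.tendsto_zero).abs
    refine t.eventually_lt_const ?_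
    rw [hre, abs_lt]; norm_num
  obtain ⟨K₂, hK₂, hα⟩ := eventually_arccos_sub_le (by norm_num) (by norm_num) hs
  set α : ℕ → ℝ := fun n => -arccos (a n).re
  have hα' : ∀ᶠ n : ℕ in atTop, |α n - -arccos (-7 / 9)| ≤ K₂ / n := by
    filter_upwards [hα] with n h
    rwa [← neg_sub', abs_neg]
  set l : ℕ → ℂ := fun n => Complex.exp (Complex.I * α n)
  have cl : CloseTo (fun n _ => l n) (fun _ => halfMult ^ 2) := by
    have c1 : CloseTo (fun n _ => (α n : ℂ)) (fun _ => ((-arccos (-7 / 9) : ℝ) : ℂ)) := by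
      refine CloseTo.of_seq (K := K₂) ?_
      filter_upwards [hα'] with n h
      rwa [← Complex.ofReal_sub, Complex.norm_real]
    have := CloseTo.map (Φ := fun z => Complex.exp (Complex.I * z)) (by fun_prop) c1
    rwa [exp_limit] at this
  -- The two limit eigenvalues are distinct, so q = b/(l - ā) is well defined for large n and tends
  -- to 0 with b.
  have hne : halfMult ^ 2 - starRingEnd ℂ (halfMult ^ 2) ≠ 0 := by
    rw [conj_halfMult_sq, halfMult_sq, halfMultConj_sq]
    intro h
    have h2 : rootI = 0 := by linear_combination (-9 / 8) * h
    have := rootI_sq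
    rw [h2] at this
    norm_num at this
  set q : ℕ → ℂ := fun n => b n / (l n - starRingEnd ℂ (a n))
  have cq : CloseTo (fun n _ => q n) (fun _ => 0) := by
    have := cb.div (cl.sub ca.conj) hne
    simpa using this
  obtain ⟨K₃, hK₃, hq⟩ := cq.eventually_norm_le
  have hq1 : ∀ᶠ n : ℕ in atTop, ‖q n‖ < 1 := by
    have := cq.tendsto_zero.norm
    exact this.eventually_lt_const (by simp)
  have hla : ∀ᶠ n : ℕ in atTop, l n - starRingEnd ℂ (a n) ≠ 0 :=
    (cl.sub ca.conj).tendsto_zero.eventually_ne hne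
  have hA : ∀ᶠ n : ℕ in atTop, ∃ A : ℝ × ℝ →L[ℝ] ℝ × ℝ, HasFDerivAt (planeReturn n) A (p n) ∧
      A.det = 1 ∧ ∀ x, D n (realCoord x) = realCoord (A x) := by
    filter_upwards [eventually_areaPreserving, hpc, hD, eventually_planeReturn,
      eventually_gt_atTop 0] with n h1 h2 h3 h4 h5
    obtain ⟨A, hA, hdet⟩ := h1 (p n) h2.le
    refine ⟨A, hA, hdet, fderiv_realCoord h5.ne' ?_ h3 hA⟩
    have : ∀ᶠ z in 𝓝 (p n), ‖z - centre n‖ < 1 / 25 :=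
      ((continuous_id.sub continuous_const).norm.tendsto _).eventually_lt_const h2
    filter_upwards [this] with z hz
    exact (h4 z hz.le).2.1
  have M0 : ∀ K ≤ M + K₂ + K₃, ∀ n : ℕ, K / (n : ℝ) ≤ (M + K₂ + K₃) / n := fun K hK n => by gcongr
  refine ⟨p, α, q, M + K₂ + K₃, by positivity,
    hp.mono fun n h => h.1.trans (M0 _ (by linarith) n), hp.mono fun n h => h.2,
    hα'.mono fun n h => h.trans (M0 _ (by linarith) n), ?_, ?_, ?_, closeTo_localReturn cp cq⟩
  · exact hq.mono fun n h => (by simpa using h : ‖q n‖ ≤ K₃ / n).trans (M0 _ (by linarith) n)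
  · filter_upwards [hA, hs1] with n ⟨A, h1, h2, h3⟩ h4
    refine ⟨A, h1, h2, ?_⟩
    obtain ⟨-, e1, -, e2⟩ := conj_entries h3
    rw [e1, Complex.add_conj, Complex.ofReal_inj] at e2
    rw [← e2, abs_mul, abs_two]
    linarith
  · filter_upwards [hA, hs1, hq1, hla, han, hfix, hD] with n ⟨A, h1, h2, h3⟩ h4 h5 h6 h7 h8 h9
    obtain ⟨e1, e2, e3, -⟩ := conj_entries h3
    have hab : a n * starRingEnd ℂ (a n) - b n * starRingEnd ℂ (b n) = 1 := by
      rw [e1, e2, h2] at e3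
      exact_mod_cast e3
    have hl : l n ^ 2 - (a n + starRingEnd ℂ (a n)) * l n + 1 = 0 := by
      have f1 : l n = (cos (arccos (a n).re) : ℝ) - Complex.I * (sin (arccos (a n).re) : ℝ) :=
        exp_neg_arccos _
      have f2 : cos (arccos (a n).re) = (a n).re :=
        cos_arccos (by linarith [(abs_lt.1 h4).1]) (abs_lt.1 h4).2.le
      have f3 : ((cos (arccos (a n).re) : ℝ) : ℂ) ^ 2 + ((sin (arccos (a n).re) : ℝ) : ℂ) ^ 2 = 1 := by
        exact_mod_cast cos_sq_add_sin_sq (arccos (a n).re)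
      rw [Complex.add_conj, ← f2, f1]
      push_cast
      push_cast at f3
      linear_combination -f3 + Complex.sin (arccos (a n).re) ^ 2 * Complex.I_sq
    obtain ⟨g1, g2⟩ := eigenvector_relations hab hl h6 rfl
    refine hasDiagonalPart_localReturn h7 h8 h9 (fun w => ?_) g1 g2 ?_
    · have : w = w.1 • ((1, 0) : ℂ × ℂ) + w.2 • ((0, 1) : ℂ × ℂ) := by ext <;> simp
      rw [this, map_add, map_smul, map_smul]
      ext
      · simp [a, b]; ring
      · simp [a, b, e1, e2]; ring
    · intro h0
      rw [Complex.mul_conj, Complex.normSq_eq_norm_sq] at h0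
      have h0' : (1 : ℝ) - ‖q n‖ ^ 2 = 0 := by exact_mod_cast h0
      nlinarith [norm_nonneg (q n)]

/-! ### Area preserving maps do not contract -/

-- If N decreased strictly off p, a compact sublevel set D = {N ≤ r} would be mapped into {N ≤ s}
-- with s < r. The nonempty open set {s < N < r} in D would then be disjoint from the image of D,
-- although D and its image have equal measure.
open MeasureTheory in
theorem not_contracting {e : OpenPartialHomeomorph (ℝ × ℝ) (ℝ × ℝ)} {p : ℝ × ℝ} {N : ℝ × ℝ → ℝ}
    {m : ℝ} (hp : p ∈ e.source) (hfix : e p = p) (hm : 0 < m)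
    (harea : ∀ᶠ z in 𝓝 p, AreaPreservingAt e z) (hN : ∀ᶠ z in 𝓝 p, ContinuousAt N z)
    (hN0 : N p = 0) (hlow : ∀ᶠ z in 𝓝 p, m * ‖z - p‖ ≤ N z) :
    ¬ ∀ᶠ z in 𝓝 p, z ≠ p → N (e z) < N z := by
  intro hcontr
  obtain ⟨r₀, hr₀, hb₀⟩ := Metric.nhds_basis_closedBall.eventually_iff.1
    (harea.and (hN.and (hlow.and (hcontr.and (e.open_source.mem_nhds hp)))))
  have hce : ContinuousAt e p := e.continuousAt hp
  have hpre : ∀ᶠ z in 𝓝 p, e z ∈ Metric.closedBall p r₀ := by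
    have : Metric.closedBall p r₀ ∈ 𝓝 (e p) := by
      rw [hfix]; exact Metric.closedBall_mem_nhds _ hr₀
    exact hce this
  obtain ⟨r₁', hr₁', hb₁'⟩ := Metric.nhds_basis_closedBall.eventually_iff.1 hpre
  set r₁ := min r₀ r₁' with hr₁def
  have hr₁ : 0 < r₁ := lt_min hr₀ hr₁'
  have hb : ∀ z ∈ Metric.closedBall p r₁, (AreaPreservingAt e z ∧ ContinuousAt N z ∧
      m * ‖z - p‖ ≤ N z ∧ (z ≠ p → N (e z) < N z) ∧ z ∈ e.source) ∧
      e z ∈ Metric.closedBall p r₀ := fun z hz =>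
    ⟨hb₀ (Metric.closedBall_subset_closedBall (min_le_left _ _) hz),
      hb₁' (Metric.closedBall_subset_closedBall (min_le_right _ _) hz)⟩
  -- With this level, N ≤ r forces ‖z - p‖ ≤ r₁/2, so the sublevel set stays inside the ball where
  -- all hypotheses hold.
  set r := m * r₁ / 2 with hrdef
  have hr : 0 < r := by positivity
  set D := Metric.closedBall p r₁ ∩ N ⁻¹' Iic r with hD
  have hNc : ContinuousOn N (Metric.closedBall p r₁) := fun z hz =>
    (hb z hz).1.2.1.continuousWithinAt
  have hDc : IsClosed D := hNc.preimage_isClosed_of_isClosed Metric.isClosed_closedBall isClosed_Iic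
  have hDk : IsCompact D := (isCompact_closedBall p r₁).of_isClosed_subset hDc inter_subset_left
  have hpD : p ∈ D := ⟨Metric.mem_closedBall_self hr₁.le, by simp [hN0, hr.le]⟩
  have hle : ∀ z ∈ D, N (e z) < r := by
    intro z hz
    rcases eq_or_ne z p with rfl | hne
    · rw [hfix, hN0]; exact hr
    · exact ((hb z hz.1).1.2.2.2.1 hne).trans_le hz.2
  have hmaps : ∀ z ∈ D, e z ∈ Metric.ball p r₁ := by
    intro z hz
    have h1 := (hb₀ (hb z hz.1).2).2.2.1
    have h2 := hle z hz
    rw [mem_ball_iff_norm]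
    have h3 : m * ‖e z - p‖ < m * r₁ := by nlinarith
    exact lt_of_mul_lt_mul_left h3 hm.le
  have hec : ContinuousOn e D := fun z hz => (e.continuousAt (hb z hz.1).1.2.2.2.2).continuousWithinAt
  have hNe : ContinuousOn (fun z => N (e z)) D := hNc.comp hec fun z hz =>
    Metric.ball_subset_closedBall (hmaps z hz)
  -- Compactness turns the pointwise decrease into a uniform gap between the levels s and r.
  obtain ⟨z₀, hz₀, hmax⟩ := hDk.exists_isMaxOn ⟨p, hpD⟩ hNe
  set s := N (e z₀)
  have hsr : s < r := hle z₀ hz₀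
  have hs0 : 0 ≤ s := by
    have : N (e p) ≤ s := hmax hpD
    rwa [hfix, hN0] at this
  -- a point on which `N` takes a value between the two levels
  obtain ⟨y, hy, hys⟩ : ∃ y ∈ Metric.closedBall p r₁, N y = (s + r) / 2 := by
    have hq : p + (r₁, 0) ∈ Metric.closedBall p r₁ := by
      simp [Prod.norm_def, abs_of_pos hr₁, hr₁.le]
    have h1 := (hb _ hq).1.2.2.1
    have h2 : ‖p + (r₁, 0) - p‖ = r₁ := by simp [Prod.norm_def, abs_of_pos hr₁, hr₁.le]
    rw [h2] at h1
    have := (convex_closedBall p r₁).isPreconnected.intermediate_value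
      (Metric.mem_closedBall_self hr₁.le) hq hNc
    rw [hN0] at this
    obtain ⟨y, hy, e⟩ := this (⟨by linarith, by nlinarith⟩ : (s + r) / 2 ∈ Icc 0 _)
    exact ⟨y, hy, e⟩
  have hyb : y ∈ Metric.ball p r₁ := by
    have h1 := (hb y hy).1.2.2.1
    rw [mem_ball_iff_norm]
    have h3 : m * ‖y - p‖ < m * r₁ := by rw [hys] at h1; nlinarith
    exact lt_of_mul_lt_mul_left h3 hm.le
  set O := Metric.ball p r₁ ∩ N ⁻¹' Ioo s r
  have hO : IsOpen O :=
    (hNc.mono Metric.ball_subset_closedBall).isOpen_inter_preimage Metric.isOpen_ball isOpen_Ioo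
  have hOne : O.Nonempty := ⟨y, hyb, by
    simp only [mem_preimage, hys, mem_Ioo]
    constructor <;> linarith⟩
  have hdisj : Disjoint (e '' D) O := by
    rw [Set.disjoint_left]
    rintro _ ⟨z, hz, rfl⟩ ⟨-, h⟩
    exact absurd (hmax hz) (not_le.2 h.1)
  have hsub : e '' D ∪ O ⊆ D := by
    rintro z (⟨z, hz, rfl⟩ | ⟨h1, h2⟩)
    · exact ⟨Metric.ball_subset_closedBall (hmaps z hz), (hle z hz).le⟩
    · exact ⟨Metric.ball_subset_closedBall h1, h2.2.le⟩
  have hvol : volume (e '' D) = volume D := by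
    choose! A hA hdet using fun z (hz : z ∈ D) => (hb z hz.1).1.1
    have := lintegral_abs_det_fderiv_eq_addHaar_image volume hDc.measurableSet
      (fun z hz => (hA z hz).hasFDerivWithinAt)
      (e.injOn.mono fun z hz => (hb z hz.1).1.2.2.2.2)
    rw [← this, setLIntegral_congr_fun hDc.measurableSet (g := fun _ => 1)]
    · simp
    · intro z hz
      simp [hdet z hz]
  have h1 := measure_mono (μ := volume) hsub
  rw [measure_union hdisj hO.measurableSet, hvol] at h1
  have h2 := hO.measure_pos volume hOne
  have h3 : volume D ≠ ⊤ := hDk.measure_lt_top.ne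
  exact absurd h1 (not_le.2 (ENNReal.lt_add_right h3 h2.ne'))

/-! ### Reality of the twist coefficient -/

theorem AreaPreservingAt.symm {e : OpenPartialHomeomorph (ℝ × ℝ) (ℝ × ℝ)} {z : ℝ × ℝ}
    (hz : z ∈ e.target) (h : AreaPreservingAt e (e.symm z)) : AreaPreservingAt e.symm z := by
  obtain ⟨A, hA, hd⟩ := h
  have hd' : A.det ≠ 0 := by rw [hd]; exact one_ne_zero
  set B := A.toContinuousLinearEquivOfDetNeZero hd'
  have hB : (B : ℝ × ℝ →L[ℝ] ℝ × ℝ) = A := ContinuousLinearMap.coe_toContinuousLinearEquivOfDetNeZero _ _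
  rw [← hB] at hA
  refine ⟨_, e.hasFDerivAt_symm hz hA, ?_⟩
  have h1 := B.det_coe_symm
  rw [hB, hd, inv_one] at h1
  exact h1

/-- From |1 + iβt|² = 1 - 2t Im β + t²|β|², the linear term dominates for small t ≥ 0. This gives
contraction when Im β > 0; `one_sub_le_norm` gives expansion when Im β < 0. -/
theorem norm_le_one_sub {β : ℂ} {t : ℝ} (ht : 0 ≤ t) (h : ‖β‖ ^ 2 * t ≤ β.im)
    (h1 : β.im * t ≤ 1) : ‖1 + Complex.I * β * t‖ ≤ 1 - β.im * t / 2 := by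
  refine abs_le_of_sq_le_sq' ?_ (by linarith) |>.2
  rw [← Complex.normSq_eq_norm_sq, Complex.normSq_apply] at *
  simp
  nlinarith [mul_nonneg ht (sub_nonneg.2 h), mul_nonneg ht ht, sq_nonneg (β.im * t)]

theorem one_sub_le_norm (β : ℂ) (t : ℝ) : 1 - β.im * t ≤ ‖1 + Complex.I * β * t‖ := by
  have : (1 + Complex.I * β * t).re = 1 - β.im * t := by simp; ring
  rw [← this]
  exact Complex.re_le_norm _

/-- The twist coefficient of an area preserving map is real. -/
theorem im_twist_eq_zero {f : ℝ × ℝ → ℝ × ℝ} {p : ℝ × ℝ} {N : ℝ × ℝ → ℝ} {m C : ℝ} {β : ℂ}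
    (hf : ContDiffAt ℝ 1 f p) (hfix : f p = p) (hm : 0 < m)
    (harea : ∀ᶠ z in 𝓝 p, AreaPreservingAt f z) (hN : ∀ᶠ z in 𝓝 p, ContinuousAt N z)
    (hN0 : N p = 0) (hlow : ∀ᶠ z in 𝓝 p, m * ‖z - p‖ ≤ N z)
    (htwist : ∀ᶠ z in 𝓝 p, |N (f z) - N z * ‖1 + Complex.I * β * ((N z ^ 2 : ℝ) : ℂ)‖| ≤
      C * N z ^ 5) : β.im = 0 := by
  obtain ⟨A, hA, hd⟩ := harea.self_of_nhds
  have hd' : A.det ≠ 0 := by rw [hd]; exact one_ne_zero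
  set B := A.toContinuousLinearEquivOfDetNeZero hd'
  have hB : (B : ℝ × ℝ →L[ℝ] ℝ × ℝ) = A := ContinuousLinearMap.coe_toContinuousLinearEquivOfDetNeZero _ _
  have hs : HasStrictFDerivAt f (B : ℝ × ℝ →L[ℝ] ℝ × ℝ) p := by
    rw [hB]; exact hf.hasStrictFDerivAt' hA one_ne_zero
  set e := hs.toOpenPartialHomeomorph f with he
  have hef : (e : ℝ × ℝ → ℝ × ℝ) = f := hs.toOpenPartialHomeomorph_coe
  have hp : p ∈ e.source := hs.mem_toOpenPartialHomeomorph_source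
  have hpt : p ∈ e.target := by
    have := e.map_source hp
    rwa [hef, hfix] at this
  have hsym : e.symm p = p := by
    have := e.left_inv hp
    rwa [hef, hfix] at this
  have tN : Tendsto N (𝓝 p) (𝓝 0) := by
    have := hN.self_of_nhds.tendsto
    rwa [hN0] at this
  have small : ∀ c : ℝ, ∀ ε > (0 : ℝ), ∀ᶠ z in 𝓝 p, c * N z ^ 2 < ε := fun c ε hε => by
    have : Tendsto (fun z => c * N z ^ 2) (𝓝 p) (𝓝 (c * 0 ^ 2)) := (tN.pow 2).const_mul c
    exact this.eventually_lt_const (by simpa using hε)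
  have pos : ∀ᶠ z in 𝓝 p, z ≠ p → 0 < N z := by
    filter_upwards [hlow] with z hz hne
    exact (mul_pos hm (norm_pos_iff.2 (sub_ne_zero.2 hne))).trans_le hz
  -- For negative imaginary part N grows under f, so the inverse contracts; for positive imaginary
  -- part f itself does. In both cases the error C N⁵ is absorbed by the cubic term in N.
  rcases lt_trichotomy β.im 0 with hneg | h0 | hpos
  · exfalso
    have hexp : ∀ᶠ z in 𝓝 p, z ≠ p → N z < N (f z) := by
      filter_upwards [htwist, pos, small C (-β.im) (by linarith)] with z h1 h2 h3 hne
      have h4 := one_sub_le_norm β (N z ^ 2)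
      have h5 := (abs_le.1 h1).1
      have h6 := h2 hne
      have h7 : N z * (1 - β.im * N z ^ 2) ≤ N z * ‖1 + Complex.I * β * ((N z ^ 2 : ℝ) : ℂ)‖ := by
        gcongr
      have h8 : 0 < N z ^ 3 * (-β.im - C * N z ^ 2) := by
        have : 0 < -β.im - C * N z ^ 2 := by linarith
        positivity
      nlinarith
    have tsym : Tendsto e.symm (𝓝 p) (𝓝 p) := by
      have := (e.continuousAt_symm hpt).tendsto
      rwa [hsym] at this
    have htgt : ∀ᶠ z in 𝓝 p, z ∈ e.target := e.open_target.mem_nhds hpt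
    refine not_contracting (e := e.symm) (p := p) (N := N) hpt hsym hm ?_ hN hN0 hlow ?_
    · filter_upwards [tsym.eventually harea, htgt] with z h1 h2
      exact AreaPreservingAt.symm h2 (by rwa [hef])
    · filter_upwards [tsym.eventually hexp, htgt] with z h1 h2 hne
      have h3 : f (e.symm z) = z := by rw [← hef]; exact e.right_inv h2
      rw [h3] at h1
      refine h1 fun h => hne ?_
      rw [← h3, h, hfix]
  · exact h0
  · exfalso
    refine not_contracting (e := e) (p := p) (N := N) hp (by rw [hef]; exact hfix) hm
      (by rwa [hef]) hN hN0 hlow ?_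
    rw [hef]
    filter_upwards [htwist, pos, small C (β.im / 2) (by linarith), small (‖β‖ ^ 2) β.im hpos,
      small β.im 1 one_pos] with z h1 h2 h3 h4 h5 hne
    have h6 := norm_le_one_sub (β := β) (sq_nonneg (N z)) h4.le h5.le
    have h7 := (abs_le.1 h1).2
    have h8 := h2 hne
    have h9 : N z * ‖1 + Complex.I * β * ((N z ^ 2 : ℝ) : ℂ)‖ ≤ N z * (1 - β.im * N z ^ 2 / 2) := by
      gcongr
    have h10 : 0 < N z ^ 3 * (β.im / 2 - C * N z ^ 2) := by
      have : 0 < β.im / 2 - C * N z ^ 2 := by linarith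
      positivity
    nlinarith

/-! ### The real form of the return maps and the twist coefficient -/

theorem realPart_bound {w u : ℂ × ℂ} {q : ℂ} (hq : ‖q‖ ≤ 1 / 2) (h : w = diagCoord q u) :
    ‖u‖ ≤ 2 * ‖w‖ := by
  have e : u - w = (-(q * u.2), -(starRingEnd ℂ q * u.1)) := by
    rw [h, diagCoord_apply]; ext <;> simp
  have h1 : ‖u - w‖ ≤ 1 / 2 * ‖u‖ := by
    rw [e, Prod.norm_def]
    refine max_le ?_ ?_
    · rw [norm_neg, norm_mul]; gcongr; exact norm_snd_le u
    · rw [norm_neg, norm_mul, RCLike.norm_conj]; gcongr; exact norm_fst_le u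
  have h2 := norm_sub_norm_le u w
  linarith

/-- The real coordinates of a point given in eigencoordinates. -/
noncomputable def realPlane : ℂ × ℂ →L[ℝ] ℝ × ℝ :=
  (Complex.reCLM.comp (((-rootI) • (ContinuousLinearMap.fst ℂ ℂ ℂ -
    ContinuousLinearMap.snd ℂ ℂ ℂ)).restrictScalars ℝ)).prod
  (Complex.reCLM.comp (((2 : ℂ) • (ContinuousLinearMap.fst ℂ ℂ ℂ +
    ContinuousLinearMap.snd ℂ ℂ ℂ)).restrictScalars ℝ))

theorem realPlane_realCoord (x : ℝ × ℝ) : realPlane (realCoord x) = x := by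
  have h1 : -rootI * ((x.2 / 4 + rootI * x.1 / 4) - (x.2 / 4 - rootI * x.1 / 4)) = (x.1 : ℂ) := by
    linear_combination (-(x.1 : ℂ) / 2) * rootI_sq
  have h2 : 2 * ((x.2 / 4 + rootI * x.1 / 4) + (x.2 / 4 - rootI * x.1 / 4)) = (x.2 : ℂ) := by ring
  ext
  · have := congrArg Complex.re h1
    simpa [realPlane, realCoord] using this
  · have : rootI.re = 0 := by simp [rootI]
    simp [realPlane, realCoord, this]
    ring

theorem contDiff_shiftCoord (n : ℕ) : ContDiff ℝ ∞ (shiftCoord n) :=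
  (realCoordCLM.contDiff.comp (contDiff_id.sub contDiff_const)).const_smul ((n : ℂ)⁻¹)

theorem eventually_contDiffAt_planeReturn : ∀ᶠ n : ℕ in atTop, ∀ z : ℝ × ℝ,
    ‖z - centre n‖ < 1 / 25 → ContDiffAt ℝ ∞ (planeReturn n) z := by
  obtain ⟨r, hr, N, hN⟩ := closeTo_coordReturn.eventually_analyticAt.exists_ball
  have t : Tendsto (fun n : ℕ => 2 / (n : ℝ)) atTop (𝓝 0) :=
    tendsto_const_nhds.div_atTop tendsto_natCast_atTop_atTop
  filter_upwards [eventually_planeReturn, eventually_gt_atTop 0, eventually_ge_atTop N,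
    t.eventually_lt_const hr] with n h1 h2 h3 h4 z hz
  have hnc : (n : ℂ) ≠ 0 := by exact_mod_cast h2.ne'
  have ha : AnalyticAt ℂ (coordReturn n) (shiftCoord n z) :=
    hN n h3 _ ((norm_shiftCoord_le h2 (hz.le.trans (by norm_num))).trans_lt h4)
  have hc : ContDiffAt ℝ ∞ (fun z => realPlane ((n : ℂ) • coordReturn n (shiftCoord n z)) +
      ((3 * n, 0) : ℝ × ℝ)) z := by
    have h5 : ContDiffAt ℝ ∞ (coordReturn n) (shiftCoord n z) := ha.contDiffAt.restrict_scalars ℝ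
    have h6 : ContDiffAt ℝ ∞ (fun z => coordReturn n (shiftCoord n z)) z :=
      h5.comp z (contDiff_shiftCoord n).contDiffAt
    exact (realPlane.contDiff.contDiffAt.comp z (h6.const_smul (n : ℂ))).add contDiffAt_const
  refine hc.congr_of_eventuallyEq ?_
  have : ∀ᶠ z' in 𝓝 z, ‖z' - centre n‖ < 1 / 25 :=
    ((continuous_id.sub continuous_const).norm.tendsto _).eventually_lt_const hz
  filter_upwards [this] with z' hz'
  have h7 := (h1 z' hz'.le).2.1
  rw [shiftCoord, h7, smul_inv_smul₀ hnc, realPlane_realCoord, sub_add_cancel]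

/-- The diagonalising coordinates, scaled, as a function on the plane. -/
noncomputable def pointCoord (n : ℕ) (q : ℂ) : ℝ × ℝ →L[ℝ] ℂ × ℂ :=
  ((diagCoord q).restrictScalars ℝ).comp ((n : ℂ)⁻¹ • realCoordCLM)

theorem pointCoord_apply (n : ℕ) (q : ℂ) (y : ℝ × ℝ) :
    pointCoord n q y = diagCoord q ((n : ℂ)⁻¹ • realCoord y) := rfl

theorem pointCoord_snd (n : ℕ) (q : ℂ) (y : ℝ × ℝ) :
    (pointCoord n q y).2 = starRingEnd ℂ (pointCoord n q y).1 := by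
  have : (n : ℂ)⁻¹ • realCoord y = realCoord ((n : ℝ)⁻¹ • y) := by
    rw [realCoord_smul]; simp
  rw [pointCoord_apply, this, diagCoord_realCoord]

theorem pointCoord_eq (n : ℕ) (q : ℂ) (y : ℝ × ℝ) :
    pointCoord n q y = ((pointCoord n q y).1, starRingEnd ℂ (pointCoord n q y).1) :=
  Prod.ext rfl (pointCoord_snd n q y)

theorem norm_pointCoord (n : ℕ) (q : ℂ) (y : ℝ × ℝ) :
    ‖pointCoord n q y‖ = ‖(pointCoord n q y).1‖ := by
  rw [Prod.norm_def, pointCoord_snd, RCLike.norm_conj, max_self]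

theorem norm_le_pointCoord {n : ℕ} (hn : 0 < n) {q : ℂ} (hq : ‖q‖ ≤ 1 / 2) (y : ℝ × ℝ) :
    ‖y‖ ≤ 8 * n * ‖pointCoord n q y‖ := by
  have h1 := realPart_bound hq (pointCoord_apply n q y)
  rw [norm_smul, norm_inv, Complex.norm_natCast] at h1
  have hn' : (0 : ℝ) < n := by exact_mod_cast hn
  rw [inv_mul_le_iff₀ hn'] at h1
  have := norm_le_norm_realCoord y
  linarith

theorem localReturn_pointCoord {n : ℕ} {p z : ℝ × ℝ} {q : ℂ} (hq : ‖q‖ < 1)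
    (h : coordReturn n (shiftCoord n z) = shiftCoord n (planeReturn n z)) :
    localReturn n p q (pointCoord n q (z - p)) = pointCoord n q (planeReturn n z - p) := by
  have hq' : 1 - q * starRingEnd ℂ q ≠ 0 := by
    intro h0
    rw [Complex.mul_conj, Complex.normSq_eq_norm_sq] at h0
    have h0' : (1 : ℝ) - ‖q‖ ^ 2 = 0 := by exact_mod_cast h0
    nlinarith [norm_nonneg q]
  rw [localReturn, pointCoord_apply, diagCoordInv_diagCoord hq', ← shiftCoord_sub, add_sub_cancel, h,
    shiftCoord_sub, pointCoord_apply]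

theorem pairSnd_conj (z : ℂ) :
    pairSnd (z, starRingEnd ℂ z) = starRingEnd ℂ (pairFst (z, starRingEnd ℂ z)) := by
  have e : planeOf (z, starRingEnd ℂ z) = (((3 + 2 * √2 * z.im : ℝ) : ℂ), ((4 * z.re : ℝ) : ℂ)) := by
    have h1 : z - starRingEnd ℂ z = 2 * Complex.I * z.im := by
      rw [Complex.sub_conj]; push_cast; ring
    have h2 : z + starRingEnd ℂ z = 2 * z.re := by rw [Complex.add_conj]; push_cast; ring
    rw [planeOf]
    simp only [h1, h2, rootI]
    ext
    · push_cast; linear_combination (-2 * (√2 : ℝ) * z.im : ℂ) * Complex.I_sq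
    · push_cast; ring
  have hs : ∀ r : ℝ, 0 ≤ r → ∃ s : ℝ, Complex.sqrt (r : ℂ) = s := by
    intro r hr
    rcases hr.eq_or_lt with rfl | h
    · exact ⟨0, by simp⟩
    · exact ⟨_, Complex.sqrt_ofReal h⟩
  obtain ⟨s, hs⟩ := hs ((3 + 2 * √2 * z.im) ^ 2 + (4 * z.re) ^ 2) (by positivity)
  rw [Complex.ofReal_add, Complex.ofReal_pow, Complex.ofReal_pow] at hs
  simp only [pairSnd, pairFst, parabolicFst, parabolicSnd, e, hs]
  simp [conj_rootI, map_ofNat]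
  ring

theorem conjugatePair_pair :
    ConjugatePair (fun _ => pairFst) (fun _ => pairSnd) pairFst pairSnd where
  close_fst := .const analyticAt_pairFst
  close_snd := .const analyticAt_pairSnd
  lin_fst := Eventually.of_forall fun _ => pairFst_sub
  lin_snd := Eventually.of_forall fun _ => pairSnd_sub
  limit_fst := pairFst_sub
  limit_snd := pairSnd_sub
  real := Eventually.of_forall fun p => pairSnd_conj p.2

theorem add_mul_rootI_ne_one {a b : ℝ} (hb : b ≠ 0) : (a : ℂ) + b * rootI ≠ 1 := by
  intro h
  have := congrArg Complex.im h
  simp [rootI, hb] at this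

/-- Each of the five powers is a + b√2 i with explicit rational a and b ≠ 0, so none of them is
real. -/
theorem halfMult_sq_pow_ne_one {k : ℕ} (h1 : 1 ≤ k) (h5 : k ≤ 5) : (halfMult ^ 2) ^ k ≠ 1 := by
  have key : ∀ a b : ℝ, b ≠ 0 → (halfMult ^ 2) ^ k = a + b * rootI → (halfMult ^ 2) ^ k ≠ 1 :=
    fun a b hb h => h ▸ add_mul_rootI_ne_one hb
  rw [halfMult_sq] at *
  have r3 : rootI ^ 3 = -2 * rootI := by linear_combination rootI * rootI_sq
  have r4 : rootI ^ 4 = 4 := by linear_combination (rootI ^ 2 - 2) * rootI_sq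
  have r5 : rootI ^ 5 = 4 * rootI := by linear_combination rootI * r4
  interval_cases k
  · exact key (-7 / 9) (-4 / 9) (by norm_num) (by push_cast; ring)
  · exact key (17 / 81) (56 / 81) (by norm_num) (by ring_nf; rw [rootI_sq]; push_cast; ring)
  · exact key (329 / 729) (-460 / 729) (by norm_num)
      (by ring_nf; rw [rootI_sq, r3]; push_cast; ring)
  · exact key (-5983 / 6561) (1904 / 6561) (by norm_num)
      (by ring_nf; rw [rootI_sq, r3, r4]; push_cast; ring)
  · exact key (57113 / 59049) (10604 / 59049) (by norm_num)
      (by ring_nf; rw [rootI_sq, r3, r4, r5]; push_cast; ring)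

theorem CloseTo.of_real_seq {a : ℕ → ℝ} {a₀ K : ℝ} (h : ∀ᶠ n : ℕ in atTop, |a n - a₀| ≤ K / n) :
    CloseTo (fun n _ => (a n : ℂ)) (fun _ => (a₀ : ℂ)) :=
  CloseTo.of_seq (K := K) (h.mono fun n h => by rwa [← Complex.ofReal_sub, Complex.norm_real])

theorem tendsto_const_div_natCast (M : ℝ) : Tendsto (fun n : ℕ => M / (n : ℝ)) atTop (𝓝 0) :=
  tendsto_const_nhds.div_atTop tendsto_natCast_atTop_atTop

/-- The coordinates `c n` bring the return map at `p n` to the normal form with angle `α n` and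
twist coefficient `β n`. -/
structure NormalForm (p : ℕ → ℝ × ℝ) (α β : ℕ → ℝ) (q : ℕ → ℂ) (c e : ℕ → ℂ × ℂ → ℂ)
    (c' e' : ℂ × ℂ → ℂ) (M : ℝ) : Prop where
  pos : 0 < M
  near : ∀ᶠ n : ℕ in atTop, ‖p n - centre n‖ ≤ M / n
  fixed : ∀ᶠ n : ℕ in atTop, planeReturn n (p n) = p n
  angle : ∀ᶠ n : ℕ in atTop, |α n - -arccos (-7 / 9)| ≤ M / n
  norm_le : ∀ᶠ n : ℕ in atTop, ‖q n‖ ≤ M / n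
  linear : ∀ᶠ n : ℕ in atTop, ∃ A : ℝ × ℝ →L[ℝ] ℝ × ℝ, HasFDerivAt (planeReturn n) A (p n) ∧
    A.det = 1 ∧ |(A (1, 0)).1 + (A (0, 1)).2| < 2
  close_return : CloseTo (fun n => localReturn n (p n) (q n)) limitCoord
  pair : ConjugatePair c e c' e'
  twist : CloseTo (fun n _ => (β n : ℂ)) (fun _ => ((-(4 * √2 / 9) : ℝ) : ℂ))
  defect : ∀ᶠ n : ℕ in atTop, VanishesTo (twistDefect (localReturn n (p n) (q n))
    (Complex.exp (Complex.I * α n)) (β n) (c n) (e n)) 5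

theorem norm_exp_I_mul (x : ℝ) : ‖Complex.exp (Complex.I * x)‖ = 1 := by
  rw [mul_comm]; exact Complex.norm_exp_ofReal_mul_I x

/-- The twist coefficient at the fixed point is real. -/
theorem im_eq_zero_of_twistDefect {n : ℕ} (hn : 0 < n) {p : ℝ × ℝ} {q l β : ℂ}
    {c e : ℂ × ℂ → ℂ} (hq : ‖q‖ ≤ 1 / 2) (hl : ‖l‖ = 1)
    (hf : ContDiffAt ℝ ∞ (planeReturn n) p) (hfix : planeReturn n p = p)
    (harea : ∀ᶠ z in 𝓝 p, AreaPreservingAt (planeReturn n) z)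
    (hconj : ∀ᶠ z in 𝓝 p, coordReturn n (shiftCoord n z) = shiftCoord n (planeReturn n z))
    (hc : AnalyticAt ℂ c 0) (hlin : VanishesTo (fun w => c w - w.1) 2)
    (hreal : ∀ᶠ z in 𝓝 (0 : ℂ), e (z, starRingEnd ℂ z) = starRingEnd ℂ (c (z, starRingEnd ℂ z)))
    (hdef : VanishesTo (twistDefect (localReturn n p q) l β c e) 5) : β.im = 0 := by
  have hn' : (0 : ℝ) < n := by exact_mod_cast hn
  set W : ℝ × ℝ → ℂ × ℂ := fun z => pointCoord n q (z - p) with hW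
  have hWc : Continuous W := by fun_prop
  have hW0 : W p = 0 := by simp [hW]
  have tW : Tendsto W (𝓝 p) (𝓝 0) := by simpa [hW0] using hWc.tendsto p
  have tW1 : Tendsto (fun z => (W z).1) (𝓝 p) (𝓝 0) := by
    have := (continuous_fst.tendsto (0 : ℂ × ℂ)).comp tW
    exact this
  obtain ⟨C₁, hC₁, hb₁⟩ := Asymptotics.IsBigO.exists_pos hlin
  obtain ⟨C₂, hC₂, hb₂⟩ := Asymptotics.IsBigO.exists_pos hdef
  have hc0 : c 0 = 0 := by simpa using hlin.apply_zero
  -- On the real plane ‖W‖ is the modulus of its first entry, and c agrees with that entry to second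
  -- order. So |c| is comparable to the distance from p and can serve as N.
  have hhalf : ∀ᶠ z in 𝓝 p, ‖W z‖ ≤ 2 * ‖c (W z)‖ := by
    have h0 : ∀ᶠ z in 𝓝 p, C₁ * ‖W z‖ < 1 / 2 := by
      have := (tW.norm.const_mul C₁)
      exact this.eventually_lt_const (by simp)
    filter_upwards [tW.eventually hb₁.bound, h0] with z h1 h2
    rw [norm_pow, norm_norm] at h1
    have h3 : ‖W z‖ = ‖(W z).1‖ := norm_pointCoord _ _ _
    have h4 := norm_sub_norm_le (W z).1 (c (W z))
    rw [norm_sub_rev] at h4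
    nlinarith [norm_nonneg (W z)]
  refine im_twist_eq_zero (f := planeReturn n) (p := p) (N := fun z => ‖c (W z)‖)
    (m := (16 * n)⁻¹) (C := C₂ * 2 ^ 5) (hf.of_le (by norm_cast)) hfix (by positivity) harea ?_
    (by simp [hW0, hc0]) ?_ ?_
  · filter_upwards [tW.eventually hc.eventually_analyticAt] with z hz
    exact (ContinuousAt.comp (g := c) hz.continuousAt hWc.continuousAt).norm
  · filter_upwards [hhalf] with z hz
    have := norm_le_pointCoord hn hq (z - p)
    rw [inv_mul_le_iff₀ (by positivity)]
    have h2 : 8 * n * ‖W z‖ ≤ 8 * n * (2 * ‖c (W z)‖) := by gcongr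
    change ‖z - p‖ ≤ 8 * n * ‖W z‖ at this
    linarith
  · filter_upwards [hhalf, tW.eventually hb₂.bound, hconj, tW1.eventually hreal] with z h1 h2 h3 h4
    have e1 : W (planeReturn n z) = localReturn n p q (W z) :=
      (localReturn_pointCoord (lt_of_le_of_lt hq (by norm_num)) h3).symm
    have e2 : W z = ((W z).1, starRingEnd ℂ (W z).1) := pointCoord_eq _ _ _
    rw [← e2] at h4
    -- On the real plane e is the conjugate of c, so the twist factor depends only on N = |c|.
    have e3 : c (W z) * e (W z) = ((‖c (W z)‖ ^ 2 : ℝ) : ℂ) := by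
      rw [h4, Complex.mul_conj, Complex.normSq_eq_norm_sq]
    rw [twistDefect, e3, norm_pow, norm_norm] at h2
    simp only [e1]
    have h5 := abs_norm_sub_norm_le (c (localReturn n p q (W z)))
      (l * c (W z) * (1 + Complex.I * β * ((‖c (W z)‖ ^ 2 : ℝ) : ℂ)))
    rw [norm_mul, norm_mul, hl, one_mul] at h5
    refine (h5.trans h2).trans ?_
    rw [mul_assoc, ← mul_pow]
    gcongr

theorem exists_normalForm : ∃ (p : ℕ → ℝ × ℝ) (α β : ℕ → ℝ) (q : ℕ → ℂ) (c e : ℕ → ℂ × ℂ → ℂ)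
    (c' e' : ℂ × ℂ → ℂ) (M : ℝ), NormalForm p α β q c e c' e' M := by
  obtain ⟨p, α, q, M, hM, hp, hfix, hα, hq, hA, hdiag, hclose⟩ := exists_linearisation
  have hl : CloseTo (fun n _ => Complex.exp (Complex.I * α n)) (fun _ => halfMult ^ 2) := by
    have := CloseTo.map (Φ := fun z => Complex.exp (Complex.I * z)) (by fun_prop)
      (CloseTo.of_real_seq hα)
    rwa [exp_limit] at this
  have hm := hl.conj
  rw [conj_halfMult_sq] at hm
  obtain ⟨x₀, x₁, x₃, hx⟩ := twistDefect_limitCoord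
  obtain ⟨c, e, c', e', β, hpair, hβ, hdef⟩ := ConjugatePair.exists_normalForm hclose hl hm hdiag
    limitCoord_zero (by rw [← mul_pow, halfMult_mul, one_pow])
    (fun k h1 h5 => halfMult_sq_pow_ne_one h1 h5) conjugatePair_pair hx
  have hreal : ∀ᶠ n in atTop, ((β n).re : ℂ) = β n := by
    filter_upwards [hpair.close_fst.eventually_analyticAt_zero, hpair.lin_fst, hpair.real.curry, hdef,
      hp, hfix, hq, eventually_areaPreserving, eventually_planeReturn, eventually_gt_atTop 0,
      (tendsto_const_div_natCast M).eventually_lt_const (by norm_num : (0 : ℝ) < 1 / 25),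
      eventually_contDiffAt_planeReturn] with n h1 h2 h3 h4 h5 h6 h7 h8 h9 h10 h11 h12
    have near : ∀ᶠ z in 𝓝 (p n), ‖z - centre n‖ < 1 / 25 :=
      ((continuous_id.sub continuous_const).norm.tendsto _).eventually_lt_const (h5.trans_lt h11)
    have : (β n).im = 0 := im_eq_zero_of_twistDefect h10 (by linarith) (norm_exp_I_mul _)
      (h12 _ (h5.trans_lt h11)) h6 (near.mono fun z hz => h8 z hz.le)
      (near.mono fun z hz => (h9 z hz.le).2.1) h1 h2 h3 h4
    exact Complex.ext rfl (by simp [this])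
  refine ⟨p, α, fun n => (β n).re, q, c, e, c', e', M, hM, hp, hfix, hα, hq, hA, hclose, hpair,
    ?_, ?_⟩
  · exact hβ.congr ((hreal.prod_inl _).mono fun x h => h)
  · filter_upwards [hdef, hreal] with n h1 h2
    rwa [h2]

/-! ### Scaled maps of the plane and their derivatives -/

/-- A complex number as a point of the plane. -/
noncomputable def toPlane : ℂ →L[ℝ] ℝ × ℝ := Complex.reCLM.prod Complex.imCLM

@[simp]
theorem toPlane_apply (z : ℂ) : toPlane z = (z.re, z.im) := rfl

theorem norm_toPlane_le : ‖toPlane‖ ≤ 1 := by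
  refine ContinuousLinearMap.opNorm_le_bound _ zero_le_one fun z => ?_
  rw [toPlane_apply, one_mul, Prod.norm_def]
  exact max_le (Complex.abs_re_le_norm z) (Complex.abs_im_le_norm z)

/-- The restriction of `f` to a real plane, at the scale `1 / n`. -/
noncomputable def scaledMap (n : ℕ) (f : ℂ × ℂ → ℂ) (W : ℝ × ℝ →L[ℝ] ℂ × ℂ) (y : ℝ × ℝ) : ℝ × ℝ :=
  toPlane ((n : ℂ) * f ((n : ℂ)⁻¹ • W y))

theorem norm_iteratedFDeriv_clm_comp_le {f : ℂ × ℂ → ℂ} {r : ℝ} (hf : ∀ w : ℂ × ℂ, ‖w‖ < r → AnalyticAt ℂ f w)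
    (T : ℂ →L[ℝ] ℝ × ℝ) (L : ℝ × ℝ →L[ℝ] ℂ × ℂ) {y : ℝ × ℝ} (hy : ‖L y‖ < r) :
    ContDiffAt ℝ ∞ (fun y => T (f (L y))) y ∧
    ∀ k : ℕ, ‖iteratedFDeriv ℝ k (fun y => T (f (L y))) y‖ ≤
      ‖T‖ * (‖iteratedFDeriv ℂ k f (L y)‖ * ‖L‖ ^ k) := by
  have hfR : ∀ w : ℂ × ℂ, ‖w‖ < r → ContDiffAt ℝ ∞ f w := fun w hw =>
    (hf w hw).contDiffAt.restrict_scalars ℝ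
  have hfL : ContDiffAt ℝ ∞ (fun y => f (L y)) y := (hfR _ hy).comp y L.contDiff.contDiffAt
  refine ⟨T.contDiff.contDiffAt.comp y hfL, fun k => ?_⟩
  have h1 := T.norm_iteratedFDeriv_comp_left (f := fun y => f (L y)) (n := k) hfL (by exact_mod_cast le_top)
  refine h1.trans (mul_le_mul_of_nonneg_left ?_ (norm_nonneg _))
  set s := Metric.ball (0 : ℂ × ℂ) r with hs
  have hs' : ∀ w ∈ s, ‖w‖ < r := fun w hw => by simpa [hs] using hw
  have hys : L y ∈ s := by simpa [hs] using hy
  have hso : IsOpen s := Metric.isOpen_ball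
  have hpo : IsOpen (L ⁻¹' s) := hso.preimage L.continuous
  have h2 := L.iteratedFDerivWithin_comp_right (f := f) (s := s) (n := ∞)
    (fun w hw => (hfR w (hs' w hw)).contDiffWithinAt) hso.uniqueDiffOn hpo.uniqueDiffOn hys (i := k)
    (by exact_mod_cast le_top)
  rw [iteratedFDerivWithin_of_isOpen k hpo hys, iteratedFDerivWithin_of_isOpen k hso hys] at h2
  have h3 : iteratedFDeriv ℝ k (fun y => f (L y)) y = _ := h2
  rw [h3]
  refine (ContinuousMultilinearMap.norm_compContinuousLinearMap_le _ _).trans ?_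
  rw [Finset.prod_const, Finset.card_univ, Fintype.card_fin]
  have h4 := ContDiffAt.restrictScalars_iteratedFDeriv (𝕜 := ℝ) (n := k)
    ((hf _ hy).contDiffAt (n := k))
  rw [← h4, Function.comp_apply, ContinuousMultilinearMap.norm_restrictScalars]

theorem exists_forall_le_five {P : ℕ → ℝ → ℕ → Prop} (hmono : ∀ k K K' n, K ≤ K' → P k K n → P k K' n)
    (h : ∀ k ≤ 5, ∃ K > (0 : ℝ), ∀ᶠ n in atTop, P k K n) :
    ∃ K > (0 : ℝ), ∀ᶠ n in atTop, ∀ k ≤ 5, P k K n := by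
  choose! K hK hP using h
  refine ⟨∑ k ∈ Finset.range 6, K k, Finset.sum_pos (fun k hk => hK k ?_) ⟨0, by simp⟩, ?_⟩
  · have := Finset.mem_range.1 hk; omega
  · have : ∀ᶠ n in atTop, ∀ k ∈ Finset.range 6, P k (K k) n := by
      rw [Filter.eventually_all_finset]
      exact fun k hk => hP k (by have := Finset.mem_range.1 hk; omega)
    filter_upwards [this] with n hn k hk
    have hk' : k ∈ Finset.range 6 := Finset.mem_range.2 (by omega)
    refine hmono _ _ _ _ (Finset.single_le_sum (f := K) (fun i hi => ?_) hk') (hn k hk')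
    exact (hK i (by have := Finset.mem_range.1 hi; omega)).le

/-- On ‖w‖ ≤ 2/n the k-th derivative is O(n^(k-d)) when k ≤ d, and each derivative in the scaled
variable brings a factor of order 1/n. For k > d boundedness alone is enough. -/
theorem CloseTo.eventually_iteratedFDeriv_le {f : ℕ → ℂ × ℂ → ℂ} {F : ℂ × ℂ → ℂ} {d : ℕ}
    (h : CloseTo f F) (hd : ∀ᶠ n in atTop, VanishesTo (f n) d) (k : ℕ) :
    ∃ K > (0 : ℝ), ∀ᶠ n : ℕ in atTop, ∀ w : ℂ × ℂ, ‖w‖ ≤ 2 / n →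
      ‖_root_.iteratedFDeriv ℂ k (f n) w‖ * (2 / (n : ℝ)) ^ k ≤ K / (n : ℝ) ^ d := by
  have key : ∃ K > (0 : ℝ), ∀ᶠ p : ℕ × ℂ × ℂ in atTop ×ˢ 𝓝 0,
      ‖_root_.iteratedFDeriv ℂ k (f p.1) p.2‖ ≤ K * ‖p.2‖ ^ (d - k) := by
    rcases le_total k d with hk | hk
    · exact h.norm_iteratedFDeriv_le hd hk
    · obtain ⟨B, hB, hb⟩ := (h.iteratedFDeriv k).eventually_bounded
      refine ⟨B, hB, hb.mono fun p hp => ?_⟩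
      rw [Nat.sub_eq_zero_of_le hk, pow_zero, mul_one]
      exact hp
  obtain ⟨K, hK, hb⟩ := key
  obtain ⟨r, hr, N, hN⟩ := hb.exists_ball
  refine ⟨K * 2 ^ (d - k + k), by positivity, ?_⟩
  filter_upwards [eventually_ge_atTop N, (tendsto_const_div_natCast 2).eventually_lt_const hr,
    eventually_gt_atTop 0] with n h1 h2 h3 w hw
  have hn : (1 : ℝ) ≤ n := by exact_mod_cast h3
  have h4 := hN n h1 w (hw.trans_lt h2)
  calc _ ≤ (K * (2 / (n : ℝ)) ^ (d - k)) * (2 / (n : ℝ)) ^ k := by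
        refine mul_le_mul_of_nonneg_right (h4.trans ?_) (by positivity)
        gcongr
    _ = K * 2 ^ (d - k + k) / (n : ℝ) ^ (d - k + k) := by rw [mul_assoc, ← pow_add, div_pow]; ring
    _ ≤ _ := by
        gcongr
        omega

/-- If the maps `f n` vanish to order `d` at the origin, then the scaled maps and their derivatives
are of size `n / n ^ d`. -/
theorem CloseTo.scaledMap {f : ℕ → ℂ × ℂ → ℂ} {F : ℂ × ℂ → ℂ} {d : ℕ}
    (h : CloseTo f F) (hd : ∀ᶠ n in atTop, VanishesTo (f n) d) :
    ∃ K > (0 : ℝ), ∀ᶠ n : ℕ in atTop, ∀ k ≤ 5, ∀ W : ℝ × ℝ →L[ℝ] ℂ × ℂ, ‖W‖ ≤ 2 → ∀ y, ‖y‖ ≤ 1 →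
      ContDiffAt ℝ ∞ (_root_.scaledMap n (f n) W) y ∧
      ‖_root_.iteratedFDeriv ℝ k (_root_.scaledMap n (f n) W) y‖ ≤ K * n / (n : ℝ) ^ d := by
  refine exists_forall_le_five (P := fun k K n => ∀ W : ℝ × ℝ →L[ℝ] ℂ × ℂ, ‖W‖ ≤ 2 → ∀ y, ‖y‖ ≤ 1 →
      ContDiffAt ℝ ∞ (_root_.scaledMap n (f n) W) y ∧
      ‖_root_.iteratedFDeriv ℝ k (_root_.scaledMap n (f n) W) y‖ ≤ K * n / (n : ℝ) ^ d) ?_ ?_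
  · intro k K K' n hK hP W hW y hy
    refine ⟨(hP W hW y hy).1, (hP W hW y hy).2.trans ?_⟩
    gcongr
  · intro k hk
    obtain ⟨K, hK, hb⟩ := h.eventually_iteratedFDeriv_le hd k
    obtain ⟨r, hr, N, hN⟩ := h.eventually_analyticAt.exists_ball
    refine ⟨K, hK, ?_⟩
    filter_upwards [hb, eventually_ge_atTop N, (tendsto_const_div_natCast 2).eventually_lt_const hr,
      eventually_gt_atTop 0] with n h1 h2 h3 h4 W hW y hy
    have hn : (0 : ℝ) < n := by exact_mod_cast h4
    set L : ℝ × ℝ →L[ℝ] ℂ × ℂ := (n : ℂ)⁻¹ • W with hL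
    set T : ℂ →L[ℝ] ℝ × ℝ := (n : ℝ) • toPlane with hT
    have hLn : ‖L‖ ≤ 2 / n := by
      rw [hL, norm_smul, norm_inv, Complex.norm_natCast, div_eq_inv_mul]
      gcongr
    have hLy : ‖L y‖ ≤ 2 / n := by
      refine (L.le_opNorm y).trans ?_
      calc ‖L‖ * ‖y‖ ≤ 2 / n * 1 := by gcongr
        _ = _ := mul_one _
    have hTn : ‖T‖ ≤ n := by
      rw [hT, norm_smul, Real.norm_natCast]
      calc (n : ℝ) * ‖toPlane‖ ≤ n * 1 := by gcongr; exact norm_toPlane_le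
        _ = _ := mul_one _
    have e : _root_.scaledMap n (f n) W = fun y => T (f n (L y)) := by
      funext y
      have : (n : ℂ) * f n ((n : ℂ)⁻¹ • W y) = (n : ℝ) • f n ((n : ℂ)⁻¹ • W y) := by
        rw [Complex.real_smul]; simp
      rw [_root_.scaledMap, this, map_smul]
      rfl
    obtain ⟨h5, h6⟩ := norm_iteratedFDeriv_clm_comp_le (f := f n) (fun w hw => hN n h2 w hw) T L (hLy.trans_lt h3)
    rw [e]
    refine ⟨h5, (h6 k).trans ?_⟩
    calc _ ≤ (n : ℝ) * (‖_root_.iteratedFDeriv ℂ k (f n) (L y)‖ * (2 / (n : ℝ)) ^ k) := by gcongr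
      _ ≤ (n : ℝ) * (K / (n : ℝ) ^ d) := by gcongr; exact h1 _ hLy
      _ = _ := by ring

/-! ### The parallelograms -/

theorem convexHull_parallelogram {E : Type*} [AddCommGroup E] [Module ℝ E] (a b : E) {u v : ℝ}
    (h : |u| + |v| ≤ 1) : u • a + v • b ∈ convexHull ℝ {a, b, -a, -b} := by
  set S := convexHull ℝ {a, b, -a, -b}
  have hS : Convex ℝ S := convex_convexHull ℝ _
  have mem : ∀ x ∈ ({a, b, -a, -b} : Set E), x ∈ S := fun x hx => subset_convexHull ℝ _ hx
  have ha : a ∈ S := mem _ (by simp)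
  have hb : b ∈ S := mem _ (by simp)
  have ha' : -a ∈ S := mem _ (by simp)
  have hb' : -b ∈ S := mem _ (by simp)
  have h0 : (0 : E) ∈ S := by
    have := hS ha ha' (by norm_num : (0 : ℝ) ≤ 1 / 2) (by norm_num : (0 : ℝ) ≤ 1 / 2) (by norm_num)
    simpa using this
  have sgn : ∀ (x : E) (r : ℝ), x ∈ S → -x ∈ S → ∃ y ∈ S, r • x = |r| • y := by
    intro x r hx hx'
    rcases le_total 0 r with hr | hr
    · exact ⟨x, hx, by rw [abs_of_nonneg hr]⟩
    · exact ⟨-x, hx', by rw [abs_of_nonpos hr, smul_neg, neg_smul, neg_neg]⟩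
  obtain ⟨y, hy, ey⟩ := sgn a u ha ha'
  obtain ⟨z, hz, ez⟩ := sgn b v hb hb'
  rw [ey, ez]
  have := hS.sum_mem (t := Finset.univ) (w := ![|u|, |v|, 1 - |u| - |v|]) (z := ![y, z, 0]) ?_ ?_ ?_
  · simpa [Fin.sum_univ_three] using this
  · intro i _
    fin_cases i <;> simp
    linarith
  · simp [Fin.sum_univ_three]
  · intro i _
    fin_cases i <;> simp [hy, hz, h0]

theorem mem_parallelogram_of_convexHull {E : Type*} [AddCommGroup E] [Module ℝ E] {a b x : E}
    (h : x ∈ convexHull ℝ {a, b, -a, -b}) : ∃ u v : ℝ, |u| + |v| ≤ 1 ∧ x = u • a + v • b := by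
  have hconv : Convex ℝ {x : E | ∃ u v : ℝ, |u| + |v| ≤ 1 ∧ x = u • a + v • b} := by
    rintro _ ⟨u, v, h, rfl⟩ _ ⟨u', v', h', rfl⟩ s t hs ht hst
    refine ⟨s * u + t * u', s * v + t * v', ?_, by module⟩
    have h1 := abs_add_le (s * u) (t * u')
    have h2 := abs_add_le (s * v) (t * v')
    rw [abs_mul, abs_mul, abs_of_nonneg hs, abs_of_nonneg ht] at h1 h2
    nlinarith
  refine convexHull_min ?_ hconv h
  rintro y (rfl | rfl | rfl | rfl)
  · exact ⟨1, 0, by simp, by simp⟩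
  · exact ⟨0, 1, by simp, by simp⟩
  · exact ⟨-1, 0, by simp, by simp⟩
  · exact ⟨0, -1, by simp, by simp⟩

theorem parR_eq : parR = convexHull ℝ {((0, 3 / 512) : ℝ × ℝ), (3 / 256, -3 / 512),
    -(0, 3 / 512), -(3 / 256, -3 / 512)} := by
  rw [parR]
  congr 4 <;> norm_num

theorem parE_eq : parE = convexHull ℝ {((1 / 1024, 0) : ℝ × ℝ), (-1 / 1024, √2 / 512),
    -(1 / 1024, 0), -(-1 / 1024, √2 / 512)} := by
  rw [parE]
  congr 4
  · norm_num
  · simp; constructor <;> ring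

/-- The linear part of the conjugacy. -/
noncomputable def planeEquiv : (ℝ × ℝ) ≃L[ℝ] ℝ × ℝ :=
  ContinuousLinearEquiv.equivOfInverse (matrixCLM 0 (1 / 4) (√2 / 4) 0)
    (matrixCLM 0 (2 * √2) 4 0)
    (fun x => by
      have := Real.mul_self_sqrt (zero_le_two : (0 : ℝ) ≤ 2)
      rw [matrixCLM_apply, matrixCLM_apply]
      ext <;> simp only
      · linear_combination (x.1 / 2) * this
      · ring)
    (fun x => by
      have := Real.mul_self_sqrt (zero_le_two : (0 : ℝ) ≤ 2)
      rw [matrixCLM_apply, matrixCLM_apply]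
      ext <;> simp only
      · ring
      · linear_combination (x.2 / 2) * this)

theorem planeEquiv_apply (x : ℝ × ℝ) : planeEquiv x = (x.2 / 4, √2 * x.1 / 4) := by
  have : planeEquiv x = matrixCLM 0 (1 / 4) (√2 / 4) 0 x := rfl
  rw [this, matrixCLM_apply]
  ext <;> simp only <;> ring

theorem planeEquiv_symm_apply (x : ℝ × ℝ) : planeEquiv.symm x = (2 * √2 * x.2, 4 * x.1) := by
  have : planeEquiv.symm x = matrixCLM 0 (2 * √2) 4 0 x := rfl
  rw [this, matrixCLM_apply]
  ext <;> simp only <;> ring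

theorem norm_planeEquiv_symm_le (x : ℝ × ℝ) : ‖planeEquiv.symm x‖ ≤ 4 * ‖x‖ := by
  rw [planeEquiv_symm_apply, Prod.norm_def]
  have h1 : ‖x.1‖ ≤ ‖x‖ := norm_fst_le x
  have h2 : ‖x.2‖ ≤ ‖x‖ := norm_snd_le x
  have h3 : √2 ≤ 2 := by rw [Real.sqrt_le_left (by norm_num)]; norm_num
  refine max_le ?_ ?_
  · rw [norm_mul, norm_mul, Real.norm_of_nonneg zero_le_two, Real.norm_of_nonneg (Real.sqrt_nonneg 2)]
    nlinarith [norm_nonneg x.2, Real.sqrt_nonneg 2]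
  · rw [norm_mul]; norm_num; exact h1

theorem affinePart_eq (n : ℕ) (z : ℝ × ℝ) : affinePart n z = planeEquiv (z - centre n) := by
  rw [affinePart, planeEquiv_apply]
  ext <;> simp [centre] <;> ring

theorem toPlane_realCoord (x : ℝ × ℝ) : toPlane (realCoord x).1 = planeEquiv x := by
  rw [planeEquiv_apply, toPlane_apply]
  ext <;> simp [realCoord, rootI]

/-- Points close to the preimage of `parE` under the linear part of the conjugacy lie in `parR`. -/
theorem mem_parR_of_near {ξ δ : ℝ × ℝ} (hξ : ξ ∈ parE) (hδ : ‖δ‖ ≤ 1 / 1024) :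
    planeEquiv.symm ξ + δ ∈ parR := by
  rw [parE_eq] at hξ
  obtain ⟨u, v, h, rfl⟩ := mem_parallelogram_of_convexHull hξ
  have d1 : |δ.1| ≤ 1 / 1024 := (norm_fst_le δ).trans hδ
  have d2 : |δ.2| ≤ 1 / 1024 := (norm_snd_le δ).trans hδ
  -- The linear part takes `parE` back to `parR` shrunk by the factor 2/3. A shift δ of norm at most
  -- 1/1024 adds at most (512 + 256 + 256)/(3 · 1024) = 1/3, exactly the room left.
  have e : planeEquiv.symm (u • (1 / 1024, 0) + v • (-1 / 1024, √2 / 512)) + δ =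
      (2 / 3 * u + (512 / 3 * δ.2 + 256 / 3 * δ.1)) • ((0, 3 / 512) : ℝ × ℝ) +
      (2 / 3 * v + 256 / 3 * δ.1) • (3 / 256, -3 / 512) := by
    have := Real.mul_self_sqrt (zero_le_two : (0 : ℝ) ≤ 2)
    rw [planeEquiv_symm_apply]
    ext
    · simp; linear_combination (v / 256) * this
    · simp; ring
  rw [e, parR_eq]
  refine convexHull_parallelogram _ _ ?_
  have h1 := abs_add_le (2 / 3 * u) (512 / 3 * δ.2 + 256 / 3 * δ.1)
  have h2 := abs_add_le (512 / 3 * δ.2) (256 / 3 * δ.1)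
  have h3 := abs_add_le (2 / 3 * v) (256 / 3 * δ.1)
  rw [abs_mul] at h1 h3
  rw [abs_mul, abs_mul] at h2
  rw [abs_mul (256 / 3)] at h3
  norm_num at h1 h2 h3
  linarith

theorem abs_le_of_mem_parR {x : ℝ × ℝ} (h : x ∈ parR) : |x.1| ≤ 3 / 256 ∧ |x.2| ≤ 3 / 512 := by
  rw [parR_eq] at h
  obtain ⟨u, v, h, rfl⟩ := mem_parallelogram_of_convexHull h
  have h1 := abs_sub u v
  have h2 := abs_nonneg u
  simp only [Prod.smul_mk, smul_eq_mul, Prod.mk_add_mk]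
  constructor
  · rw [mul_zero, zero_add, abs_mul]; norm_num; linarith
  · rw [show u * (3 / 512) + v * (-3 / 512) = 3 / 512 * (u - v) by ring, abs_mul]; norm_num; linarith

theorem norm_le_of_mem_parE {x : ℝ × ℝ} (h : x ∈ parE) : ‖x‖ ≤ 1 := by
  rw [parE_eq] at h
  obtain ⟨u, v, h, rfl⟩ := mem_parallelogram_of_convexHull h
  have h2 := abs_nonneg u
  have h4 := abs_nonneg v
  have h3 : √2 ≤ 2 := by rw [Real.sqrt_le_left (by norm_num)]; norm_num
  simp only [Prod.smul_mk, smul_eq_mul, Prod.mk_add_mk, Prod.norm_def]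
  refine max_le ?_ ?_
  · have h1 := abs_sub u v
    rw [show u * (1 / 1024) + v * (-1 / 1024) = 1 / 1024 * (u - v) by ring, norm_mul]
    norm_num
    linarith
  · rw [mul_zero, zero_add, norm_mul, Real.norm_of_nonneg (show 0 ≤ √2 / 512 by positivity), Real.norm_eq_abs]
    nlinarith [Real.sqrt_nonneg 2]

theorem zero_mem_parE : (0 : ℝ × ℝ) ∈ parE := by
  rw [parE_eq]
  have := convexHull_parallelogram ((1 / 1024, 0) : ℝ × ℝ) (-1 / 1024, √2 / 512) (u := 0) (v := 0)
    (by simp)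
  simpa using this

theorem uniqueDiffOn_parE : UniqueDiffOn ℝ parE := by
  refine uniqueDiffOn_convex (convex_convexHull ℝ _) ?_
  refine ⟨0, mem_interior_iff_mem_nhds.2 ?_⟩
  have h : Metric.ball (0 : ℝ × ℝ) (1 / 4096) ∈ 𝓝 (0 : ℝ × ℝ) := Metric.ball_mem_nhds _ (by norm_num)
  refine Filter.mem_of_superset h fun x hx => ?_
  have hx' : ‖x‖ < 1 / 4096 := by simpa using hx
  have d1 : |x.1| ≤ 1 / 4096 := (norm_fst_le x).trans hx'.le
  have d2 : |x.2| ≤ 1 / 4096 := (norm_snd_le x).trans hx'.le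
  have h2 := Real.mul_self_sqrt (zero_le_two : (0 : ℝ) ≤ 2)
  have h3 : √2 ≤ 3 / 2 := by rw [Real.sqrt_le_left (by norm_num)]; norm_num
  have e : x = (1024 * x.1 + 256 * √2 * x.2) • ((1 / 1024, 0) : ℝ × ℝ) +
      (256 * √2 * x.2) • (-1 / 1024, √2 / 512) := by
    ext
    · simp; ring
    · simp; linear_combination (-x.2 / 2) * h2
  change x ∈ parE
  rw [parE_eq, e]
  refine convexHull_parallelogram _ _ ?_
  have h4 := abs_add_le (1024 * x.1) (256 * √2 * x.2)
  have h5 : |256 * √2 * x.2| ≤ 3 / 32 := by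
    rw [abs_mul, abs_of_nonneg (by positivity)]
    nlinarith [abs_nonneg x.2, Real.sqrt_nonneg 2]
  rw [abs_mul 1024, abs_of_nonneg (by norm_num : (0 : ℝ) ≤ 1024)] at h4
  linarith

theorem mem_parRn {n : ℕ} {z : ℝ × ℝ} : z ∈ parRn n ↔ z - centre n ∈ parR := by
  rw [parRn, mem_image]
  constructor
  · rintro ⟨x, hx, rfl⟩
    have : ((3 * n - 3 / 4, 1) : ℝ × ℝ) = centre n := rfl
    rwa [this, add_sub_cancel_left]
  · intro h
    exact ⟨_, h, by rw [show ((3 * n - 3 / 4, 1) : ℝ × ℝ) = centre n from rfl, add_sub_cancel]⟩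

theorem parRn_mem_nhds {n : ℕ} {p : ℝ × ℝ} (hp : ‖p - centre n‖ < 1 / 1024) : parRn n ∈ 𝓝 p := by
  have : ∀ᶠ z in 𝓝 p, ‖z - centre n‖ < 1 / 1024 :=
    ((continuous_id.sub continuous_const).norm.tendsto _).eventually_lt_const hp
  filter_upwards [this] with z hz
  rw [mem_parRn]
  have := mem_parR_of_near zero_mem_parE hz.le
  rwa [map_zero, zero_add] at this

theorem norm_le_of_mem_parRn {n : ℕ} {z : ℝ × ℝ} (h : z ∈ parRn n) : ‖z - centre n‖ ≤ 3 / 256 := by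
  have h1 := abs_le_of_mem_parR (mem_parRn.1 h)
  rw [Prod.norm_def]
  exact max_le h1.1 (h1.2.trans (by norm_num))

/-! ### The conjugating charts -/

theorem norm_iteratedFDeriv_affine_le (B : ℝ × ℝ →L[ℝ] ℝ × ℝ) (p v z : ℝ × ℝ) (k : ℕ) :
    ‖iteratedFDeriv ℝ k (fun z => B (z - p) + v) z‖ ≤ ‖B‖ * ‖z - p‖ + ‖v‖ + ‖B‖ := by
  have hd : fderiv ℝ (fun z => B (z - p) + v) = fun _ => B := by
    funext z
    exact ((B.hasFDerivAt.comp z ((hasFDerivAt_id z).sub_const p)).add_const v).fderiv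
  match k with
  | 0 =>
    rw [norm_iteratedFDeriv_zero]
    linarith [norm_add_le (B (z - p)) v, B.le_opNorm (z - p), norm_nonneg B]
  | 1 =>
    rw [norm_iteratedFDeriv_one, hd]
    have : 0 ≤ ‖B‖ * ‖z - p‖ := by positivity
    linarith [norm_nonneg v]
  | k + 2 =>
    rw [← norm_iteratedFDeriv_fderiv, hd, iteratedFDeriv_const_of_ne (Nat.succ_ne_zero k)]
    simp only [Pi.zero_apply, norm_zero]
    positivity

/-- The diagonalising coordinates as a linear map on the plane. -/
noncomputable def diagPlane (q : ℂ) : ℝ × ℝ →L[ℝ] ℂ × ℂ :=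
  ((diagCoord q).restrictScalars ℝ).comp realCoordCLM

theorem diagPlane_apply (q : ℂ) (y : ℝ × ℝ) : diagPlane q y = diagCoord q (realCoord y) := rfl

theorem norm_diagPlane_le {q : ℂ} (hq : ‖q‖ ≤ 1 / 2) : ‖diagPlane q‖ ≤ 2 := by
  refine ContinuousLinearMap.opNorm_le_bound _ zero_le_two fun y => ?_
  rw [diagPlane_apply, diagCoord_apply, Prod.norm_def]
  have h0 := norm_realCoord_le y
  have h1 : ‖(realCoord y).1‖ ≤ ‖y‖ := (norm_fst_le _).trans h0
  have h2 : ‖(realCoord y).2‖ ≤ ‖y‖ := (norm_snd_le _).trans h0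
  refine max_le ?_ ?_
  · refine (norm_add_le _ _).trans ?_
    rw [norm_mul]
    nlinarith [norm_nonneg (realCoord y).2, norm_nonneg q]
  · refine (norm_add_le _ _).trans ?_
    rw [norm_mul, RCLike.norm_conj]
    nlinarith [norm_nonneg (realCoord y).1, norm_nonneg q]

theorem pointCoord_eq_smul (n : ℕ) (q : ℂ) (y : ℝ × ℝ) :
    pointCoord n q y = (n : ℂ)⁻¹ • diagPlane q y := by
  rw [pointCoord_apply, map_smul, diagPlane_apply]

/-- The conjugating map. -/
noncomputable def chartMap (n : ℕ) (p : ℝ × ℝ) (q : ℂ) (c : ℂ × ℂ → ℂ) (z : ℝ × ℝ) : ℝ × ℝ :=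
  scaledMap n c (diagPlane q) (z - p)

theorem chartMap_eq (n : ℕ) (p : ℝ × ℝ) (q : ℂ) (c : ℂ × ℂ → ℂ) (z : ℝ × ℝ) :
    chartMap n p q c z = toPlane (n * c (pointCoord n q (z - p))) := by
  rw [pointCoord_eq_smul]; rfl

/-- The linear error of the conjugating map. -/
noncomputable def conjTerm (q : ℂ) : ℝ × ℝ →L[ℝ] ℝ × ℝ :=
  toPlane.comp ((q • (ContinuousLinearMap.snd ℂ ℂ ℂ)).restrictScalars ℝ |>.comp realCoordCLM)

theorem norm_conjTerm_le (q : ℂ) : ‖conjTerm q‖ ≤ ‖q‖ := by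
  refine ContinuousLinearMap.opNorm_le_bound _ (norm_nonneg _) fun y => ?_
  have e : conjTerm q y = toPlane (q * (realCoord y).2) := rfl
  have h1 := toPlane.le_opNorm (q * (realCoord y).2)
  rw [e]
  refine h1.trans ?_
  rw [norm_mul]
  have h2 : ‖(realCoord y).2‖ ≤ ‖y‖ := (norm_snd_le _).trans (norm_realCoord_le y)
  calc ‖toPlane‖ * (‖q‖ * ‖(realCoord y).2‖) ≤ 1 * (‖q‖ * ‖y‖) := by
        gcongr; exact norm_toPlane_le
    _ = _ := one_mul _

/-- The deviation has three sources: the nonlinear part of c, which vanishes to second order and so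
is O(1/n) after scaling; the diagonalising constant q; and the offset of p from the centre. The last
two are O(1/n) as well. -/
theorem chartMap_sub_affinePart {n : ℕ} (hn : n ≠ 0) (p : ℝ × ℝ) (q : ℂ) (c : ℂ × ℂ → ℂ) (z : ℝ × ℝ) :
    chartMap n p q c z - affinePart n z =
      scaledMap n (fun w => c w - w.1) (diagPlane q) (z - p) +
      (conjTerm q (z - p) + planeEquiv (centre n - p)) := by
  have hnc : (n : ℂ) ≠ 0 := by exact_mod_cast hn
  have e1 : toPlane (n * ((n : ℂ)⁻¹ • diagPlane q (z - p)).1) =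
      planeEquiv (z - p) + conjTerm q (z - p) := by
    have : (n : ℂ) * ((n : ℂ)⁻¹ • diagPlane q (z - p)).1 =
        (realCoord (z - p)).1 + q * (realCoord (z - p)).2 := by
      rw [diagPlane_apply, diagCoord_apply, Prod.smul_fst, smul_eq_mul, mul_inv_cancel_left₀ hnc]
    rw [this, map_add, toPlane_realCoord]
    rfl
  have e2 : planeEquiv (z - centre n) = planeEquiv (z - p) - planeEquiv (centre n - p) := by
    rw [← map_sub]; congr 1; abel
  rw [chartMap, scaledMap, scaledMap, mul_sub, map_sub toPlane, e1, affinePart_eq, e2]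
  abel

namespace NormalForm

variable {p : ℕ → ℝ × ℝ} {α β : ℕ → ℝ} {q : ℕ → ℂ} {c e : ℕ → ℂ × ℂ → ℂ} {c' e' : ℂ × ℂ → ℂ} {M : ℝ}

theorem eventually_near (h : NormalForm p α β q c e c' e' M) {ε : ℝ} (hε : 0 < ε) :
    ∀ᶠ n : ℕ in atTop, ‖p n - centre n‖ < ε ∧ ‖q n‖ < ε := by
  filter_upwards [h.near, h.norm_le, (tendsto_const_div_natCast M).eventually_lt_const hε]
    with n h1 h2 h3
  exact ⟨h1.trans_lt h3, h2.trans_lt h3⟩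

theorem eventually_chartMap (h : NormalForm p α β q c e c' e' M) : ∃ K > (0 : ℝ),
    ∀ᶠ n : ℕ in atTop, ∀ z : ℝ × ℝ, ‖z - centre n‖ < 1 / 30 →
      ContDiffAt ℝ ∞ (chartMap n (p n) (q n) (c n)) z ∧
      ContDiffAt ℝ ∞ (fun z => chartMap n (p n) (q n) (c n) z - affinePart n z) z ∧
      ∀ k ≤ 5, ‖iteratedFDeriv ℝ k (fun z => chartMap n (p n) (q n) (c n) z - affinePart n z) z‖
        ≤ K / n := by
  have hf : CloseTo (fun n w => c n w - w.1) (fun w => c' w - w.1) := h.pair.close_fst.sub CloseTo.id.fst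
  obtain ⟨K, hK, hb⟩ := hf.scaledMap h.pair.lin_fst
  have hM := h.pos
  refine ⟨K + 3 * M, by positivity, ?_⟩
  filter_upwards [hb, h.eventually_near (ε := 1 / 100) (by norm_num), h.near, h.norm_le,
    eventually_gt_atTop 0] with n h1 h2 h3 h4 h5 z hz
  have hn : (0 : ℝ) < n := by exact_mod_cast h5
  have hzp : ‖z - p n‖ ≤ 1 := by
    have := norm_sub_le_norm_sub_add_norm_sub z (centre n) (p n)
    rw [norm_sub_rev (centre n)] at this
    linarith [h2.1]
  have hW := norm_diagPlane_le (q := q n) (by linarith [h2.2])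
  have e : (fun z => chartMap n (p n) (q n) (c n) z - affinePart n z) = fun z =>
      scaledMap n (fun w => c n w - w.1) (diagPlane (q n)) (z - p n) +
      (conjTerm (q n) (z - p n) + planeEquiv (centre n - p n)) :=
    funext fun z => chartMap_sub_affinePart h5.ne' _ _ _ _
  have hs : ContDiffAt ℝ ∞ (fun z => scaledMap n (fun w => c n w - w.1) (diagPlane (q n)) (z - p n)) z :=
    ContDiffAt.comp z (g := scaledMap n (fun w => c n w - w.1) (diagPlane (q n)))
      (h1 0 (by norm_num) _ hW _ hzp).1 (contDiffAt_id.sub contDiffAt_const)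
  have ha : ContDiffAt ℝ ∞ (fun z => conjTerm (q n) (z - p n) + planeEquiv (centre n - p n)) z :=
    ((conjTerm (q n)).contDiff.contDiffAt.comp z (contDiffAt_id.sub contDiffAt_const)).add
      contDiffAt_const
  have hd : ContDiffAt ℝ ∞ (fun z => chartMap n (p n) (q n) (c n) z - affinePart n z) z := by
    rw [e]; exact hs.add ha
  have haff : ContDiffAt ℝ ∞ (affinePart n) z := by
    have : affinePart n = fun z => planeEquiv (z - centre n) := funext fun z => affinePart_eq n z
    rw [this]
    exact planeEquiv.contDiff.contDiffAt.comp z (contDiffAt_id.sub contDiffAt_const)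
  refine ⟨?_, hd, fun k hk => ?_⟩
  · have := hd.add haff
    simpa using this
  · have hk' : ((k : ℕ) : WithTop ℕ∞) ≤ ∞ := by exact_mod_cast le_top
    rw [e, fun_iteratedFDeriv_add_apply (hs.of_le hk') (ha.of_le hk')]
    refine (norm_add_le _ _).trans ?_
    have b1 : ‖iteratedFDeriv ℝ k (fun z => scaledMap n (fun w => c n w - w.1) (diagPlane (q n))
        (z - p n)) z‖ ≤ K / n := by
      rw [iteratedFDeriv_comp_sub (f := scaledMap n (fun w => c n w - w.1) (diagPlane (q n)))]
      refine (h1 k hk _ hW _ hzp).2.trans (le_of_eq ?_)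
      field_simp
    have b2 := norm_iteratedFDeriv_affine_le (conjTerm (q n)) (p n) (planeEquiv (centre n - p n)) z k
    have b3 := (norm_conjTerm_le (q n)).trans h4
    have b4 : ‖planeEquiv (centre n - p n)‖ ≤ M / n := by
      rw [← toPlane_realCoord]
      refine (toPlane.le_opNorm _).trans ?_
      have := (norm_fst_le (realCoord (centre n - p n))).trans (norm_realCoord_le _)
      rw [norm_sub_rev] at this
      calc _ ≤ 1 * (M / n) := by gcongr; exacts [norm_toPlane_le, this.trans h3]
        _ = _ := one_mul _
    have b5 : ‖conjTerm (q n)‖ * ‖z - p n‖ ≤ M / n * 1 := by gcongr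
    rw [add_div, mul_div_assoc]
    linarith

/-- The chart is O(1/n)-close in C⁵, in particular in C¹, to an affine map whose linear part has
inverse of norm at most 4. A deviation with Lipschitz constant 1/8 < 1/4 keeps it injective on the
whole ball and open with quantitative bounds. -/
theorem exists_chart (h : NormalForm p α β q c e c' e' M) : ∃ K > (0 : ℝ),
    ∀ᶠ n : ℕ in atTop, ∃ C : OpenPartialHomeomorph (ℝ × ℝ) (ℝ × ℝ),
      C.source = Metric.ball (centre n) (1 / 30) ∧
      (C : ℝ × ℝ → ℝ × ℝ) = chartMap n (p n) (q n) (c n) ∧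
      ContDiffOn ℝ ∞ C C.source ∧ ContDiffOn ℝ ∞ C.symm C.target ∧
      C5BoundOn (fun z => C z - affinePart n z) C.source (K / n) ∧ parE ⊆ C '' parRn n := by
  obtain ⟨K, hK, hb⟩ := h.eventually_chartMap
  refine ⟨K, hK, ?_⟩
  filter_upwards [hb, (tendsto_const_div_natCast K).eventually_lt_const
      (by norm_num : (0 : ℝ) < 1 / 8), (tendsto_const_div_natCast (8 * K)).eventually_lt_const
      (by norm_num : (0 : ℝ) < 1 / 1024), eventually_gt_atTop 0] with n h1 h2 h3 h4
  have hn : (0 : ℝ) < n := by exact_mod_cast h4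
  set f := chartMap n (p n) (q n) (c n) with hf
  set s := Metric.ball (centre n) (1 / 30) with hs
  have hs' : ∀ z ∈ s, ‖z - centre n‖ < 1 / 30 := fun z hz => by rwa [← mem_ball_iff_norm]
  have hso : IsOpen s := Metric.isOpen_ball
  have happ : ApproximatesLinearOn f (planeEquiv : ℝ × ℝ →L[ℝ] ℝ × ℝ) s (1 / 8) := by
    intro z hz z' hz'
    have := (convex_ball (centre n) (1 / 30)).norm_image_sub_le_of_norm_fderiv_le (𝕜 := ℝ)
      (f := fun z => f z - affinePart n z) (C := 1 / 8)
      (fun w hw => (h1 w (hs' w hw)).2.1.differentiableAt (by simp))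
      (fun w hw => by
        have := (h1 w (hs' w hw)).2.2 1 (by norm_num)
        rw [norm_iteratedFDeriv_one] at this
        exact this.trans h2.le) hz' hz
    have e : f z - f z' - (planeEquiv : ℝ × ℝ →L[ℝ] ℝ × ℝ) (z - z') =
        (f z - affinePart n z) - (f z' - affinePart n z') := by
      rw [affinePart_eq, affinePart_eq, sub_sub_sub_comm, ← map_sub, sub_sub_sub_cancel_right]
      rfl
    rw [e]
    refine this.trans (le_of_eq ?_)
    norm_num
  have hN : ‖(planeEquiv.symm : ℝ × ℝ →L[ℝ] ℝ × ℝ)‖₊ ≤ 4 := by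
    rw [← NNReal.coe_le_coe]
    exact ContinuousLinearMap.opNorm_le_bound _ (by norm_num) norm_planeEquiv_symm_le
  have hc : (1 / 8 : NNReal) < ‖(planeEquiv.symm : ℝ × ℝ →L[ℝ] ℝ × ℝ)‖₊⁻¹ := by
    have hpos := planeEquiv.nnnorm_symm_pos
    calc (1 / 8 : NNReal) < 4⁻¹ := by rw [one_div]; gcongr; norm_num
      _ ≤ _ := by gcongr
  set C := happ.toOpenPartialHomeomorph f s (Or.inr hc) hso
  have hCs : C.source = s := rfl
  have hCf : (C : ℝ × ℝ → ℝ × ℝ) = f := rfl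
  have hlow : ∀ x, ‖x‖ ≤ 4 * ‖planeEquiv x‖ := fun x => by
    have := norm_planeEquiv_symm_le (planeEquiv x)
    rwa [ContinuousLinearEquiv.symm_apply_apply] at this
  refine ⟨C, hCs, hCf, ?_, ?_, ?_, ?_⟩
  · exact fun z hz => (h1 z (hs' z hz)).1.contDiffWithinAt
  · intro w hw
    have hz := C.map_target hw
    set z := C.symm w
    have hfz := (h1 z (hs' z hz)).1
    -- A vector killed by the derivative satisfies ‖x‖ ≤ 4 · ‖x‖/8, hence is zero. Invertibility
    -- makes the inverse chart smooth.
    have hinj : Function.Injective (fderiv ℝ f z) := by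
      rw [injective_iff_map_eq_zero]
      intro x hx
      have hg := ((h1 z (hs' z hz)).2.1.differentiableAt (by simp)).hasFDerivAt
      have ha : HasFDerivAt (affinePart n) (planeEquiv : ℝ × ℝ →L[ℝ] ℝ × ℝ) z := by
        have : affinePart n = fun z => planeEquiv (z - centre n) := funext fun z => affinePart_eq n z
        rw [this]
        exact planeEquiv.hasFDerivAt.comp z ((hasFDerivAt_id z).sub_const (centre n))
      have hfd := (hg.add ha).fderiv
      have ef : (fun z => f z - affinePart n z) + affinePart n = f := by funext z; simp
      rw [ef] at hfd
      have hb1 := (h1 z (hs' z hz)).2.2 1 (by norm_num)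
      rw [norm_iteratedFDeriv_one] at hb1
      set G := fderiv ℝ (fun z => f z - affinePart n z) z
      rw [hfd] at hx
      have hx' : planeEquiv x = -G x := by
        rw [eq_neg_iff_add_eq_zero, add_comm]; exact hx
      have h6 := hlow x
      rw [hx', norm_neg] at h6
      have h7 := G.le_opNorm x
      have h8 : ‖G‖ * ‖x‖ ≤ 1 / 8 * ‖x‖ := by gcongr; linarith
      exact norm_le_zero_iff.1 (by linarith)
    set D := (LinearEquiv.ofInjectiveEndo (fderiv ℝ f z : ℝ × ℝ →ₗ[ℝ] ℝ × ℝ) hinj).toContinuousLinearEquiv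
    have hD : (D : ℝ × ℝ →L[ℝ] ℝ × ℝ) = fderiv ℝ f z := by
      ext <;> rfl
    refine (C.contDiffAt_symm (f₀' := D) hw ?_ hfz).contDiffWithinAt
    rw [hD, hCf]
    exact (hfz.differentiableAt (by simp)).hasFDerivAt
  · refine ⟨fun z hz => ((h1 z (hs' z hz)).2.1.of_le ?_).contDiffWithinAt, fun k hk z hz => ?_⟩
    · exact WithTop.coe_le_coe.2 le_top
    · have hz' : z ∈ s := hz
      rw [hCs, iteratedFDerivWithin_of_isOpen k hso hz']
      exact (h1 z (hs' z hz)).2.2 k hk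
  · intro ξ hξ
    set b := centre n + planeEquiv.symm ξ with hbdef
    have hbR : b ∈ parRn n := by
      rw [mem_parRn, hbdef, add_sub_cancel_left]
      simpa using mem_parR_of_near hξ (δ := 0) (by simp)
    have hbn := norm_le_of_mem_parRn hbR
    let inv : (planeEquiv : ℝ × ℝ →L[ℝ] ℝ × ℝ).NonlinearRightInverse :=
      { toFun := planeEquiv.symm
        nnnorm := 4
        bound' := fun y => norm_planeEquiv_symm_le y
        right_inv' := fun y => planeEquiv.apply_symm_apply y }
    -- The ball of radius 8K/n about the affine preimage b of ξ covers a ball of radius (1/4 -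
    -- 1/8)(8K/n) = K/n about f b, which contains ξ. The preimage found differs from b by less than
    -- 1/1024, so it lies in `parRn n`.
    have hsurj := happ.surjOn_closedBall_of_nonlinearRightInverse inv (ε := 8 * K / n) (b := b)
      (by positivity) (fun z hz => by
        rw [mem_closedBall_iff_norm] at hz
        rw [hs, mem_ball_iff_norm]
        have := norm_sub_le_norm_sub_add_norm_sub z b (centre n)
        linarith)
    have hmem : ξ ∈ Metric.closedBall (f b) (((inv.nnnorm : ℝ)⁻¹ - (1 / 8 : NNReal)) * (8 * K / n)) := by
      rw [mem_closedBall_iff_norm, norm_sub_rev]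
      have e1 : (((inv.nnnorm : ℝ)⁻¹ - (1 / 8 : NNReal)) * (8 * K / n)) = K / n := by
        have : (inv.nnnorm : ℝ) = 4 := rfl
        rw [this]
        push_cast
        ring
      have e2 : affinePart n b = ξ := by
        rw [affinePart_eq, hbdef, add_sub_cancel_left, ContinuousLinearEquiv.apply_symm_apply]
      have h5 := (h1 b (by linarith)).2.2 0 (by norm_num)
      rw [norm_iteratedFDeriv_zero, e2] at h5
      rw [e1]
      exact h5
    obtain ⟨z, hz, hfz⟩ := hsurj hmem
    refine ⟨z, ?_, by rw [hCf]; exact hfz⟩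
    rw [mem_closedBall_iff_norm] at hz
    rw [mem_parRn]
    have := mem_parR_of_near hξ (δ := z - b) (hz.trans h3.le)
    rw [hbdef] at this
    convert this using 1
    abel

end NormalForm

/-! ### The return map in the conjugating charts -/

/-- A point of the plane as a pair of conjugate complex numbers. -/
noncomputable def conjPlane : ℝ × ℝ →L[ℝ] ℂ × ℂ :=
  LinearMap.toContinuousLinearMap
    { toFun := fun y => (y.1 + y.2 * Complex.I, y.1 - y.2 * Complex.I)
      map_add' := fun x y => by ext <;> simp <;> ring
      map_smul' := fun r x => by ext <;> simp <;> ring }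

theorem conjPlane_apply (y : ℝ × ℝ) :
    conjPlane y = (y.1 + y.2 * Complex.I, y.1 - y.2 * Complex.I) := rfl

theorem norm_conjPlane_le : ‖conjPlane‖ ≤ 2 := by
  refine ContinuousLinearMap.opNorm_le_bound _ zero_le_two fun y => ?_
  have h1 : |y.1| ≤ ‖y‖ := norm_fst_le y
  have h2 : |y.2| ≤ ‖y‖ := norm_snd_le y
  rw [conjPlane_apply, Prod.norm_def]
  refine max_le ((norm_add_le _ _).trans ?_) ((norm_sub_le _ _).trans ?_) <;>
  · rw [norm_mul, Complex.norm_I, mul_one, Complex.norm_real, Complex.norm_real, Real.norm_eq_abs,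
      Real.norm_eq_abs]
    linarith

theorem twistMap_eq (a b : ℝ) (y : ℝ × ℝ) : twistMap a b y =
    toPlane ((y.1 + y.2 * Complex.I) *
      Complex.exp (Complex.I * ((a + b * (y.1 ^ 2 + y.2 ^ 2) : ℝ) : ℂ))) := by
  rw [twistMap]
  generalize a + b * (y.1 ^ 2 + y.2 ^ 2) = t
  rw [mul_comm Complex.I, Complex.exp_mul_I, ← Complex.ofReal_cos, ← Complex.ofReal_sin, toPlane_apply]
  ext <;> simp [-Complex.ofReal_cos, -Complex.ofReal_sin]

theorem VanishesTo.prod {f g : ℂ × ℂ → ℂ} {d : ℕ} (h : VanishesTo f d) (h' : VanishesTo g d) :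
    VanishesTo (fun w => (f w, g w)) d :=
  Asymptotics.IsBigO.prod_left h h'

/-- The defect is built with 1 + iβce, whereas `twistMap` rotates by an angle. The two factors
differ by the square of the order 2 quantity w₁w₂; with the prefactor w₁ this is order 5. -/
theorem vanishesTo_exp_sub (b : ℂ) : VanishesTo (fun w : ℂ × ℂ =>
    w.1 * (1 + Complex.I * b * (w.1 * w.2) - Complex.exp (Complex.I * b * (w.1 * w.2)))) 5 := by
  have h1 : VanishesTo (fun w : ℂ × ℂ => w.1) 1 := (VanishesTo.coord_fst 1).congr fun w => by ring
  have h2 : VanishesTo (fun w : ℂ × ℂ => w.2) 1 := (VanishesTo.coord_snd 1).congr fun w => by ring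
  have hx : VanishesTo (fun w : ℂ × ℂ => (Complex.I * b * (w.1 * w.2)) ^ 2) 4 :=
    (((h1.mul h2).const_mul (Complex.I * b)).mul ((h1.mul h2).const_mul (Complex.I * b))).congr
      fun w => by ring
  refine h1.mul (e := 4) (Asymptotics.IsBigO.trans (Asymptotics.IsBigO.of_bound 1 ?_) hx)
  have hc : Continuous fun w : ℂ × ℂ => ‖Complex.I * b * (w.1 * w.2)‖ := by fun_prop
  have : ∀ᶠ w in 𝓝 (0 : ℂ × ℂ), ‖Complex.I * b * (w.1 * w.2)‖ < 1 :=
    (hc.tendsto 0).eventually_lt_const (by simp)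
  filter_upwards [this] with w hw
  have := Complex.norm_exp_sub_one_sub_id_le hw.le
  rw [norm_sub_rev, ← sub_sub, norm_pow, one_mul]
  exact this

theorem scaledMap_jet {f : ℂ × ℂ → ℂ} (hf : AnalyticAt ℂ f 0) (hv : VanishesTo f 5) (n : ℕ)
    (W : ℝ × ℝ →L[ℝ] ℂ × ℂ) {k : ℕ} (hk : k ≤ 4) : iteratedFDeriv ℝ k (scaledMap n f W) 0 = 0 := by
  obtain ⟨r, hr, hb⟩ := Metric.eventually_nhds_iff_ball.1 hf.eventually_analyticAt
  obtain ⟨-, h2⟩ := norm_iteratedFDeriv_clm_comp_le (f := f) (r := r)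
    (fun w hw => hb w (by simpa using hw)) ((n : ℝ) • toPlane) ((n : ℂ)⁻¹ • W) (y := 0) (by simpa using hr)
  have e : scaledMap n f W = fun y => ((n : ℝ) • toPlane) (f (((n : ℂ)⁻¹ • W) y)) := by
    funext y
    have : (n : ℂ) * f ((n : ℂ)⁻¹ • W y) = (n : ℝ) • f ((n : ℂ)⁻¹ • W y) := by
      rw [Complex.real_smul]; simp
    rw [scaledMap, this, map_smul]
    rfl
  have h0 : iteratedFDeriv ℂ k f 0 = 0 := by
    have : VanishesTo f ((4 - k + 1) + k) := by
      rwa [show 4 - k + 1 + k = 5 by omega]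
    exact (VanishesTo.iteratedFDeriv hf k this).apply_zero
  have h3 := h2 k
  rw [map_zero, h0, norm_zero, zero_mul, mul_zero] at h3
  rw [e]
  exact norm_le_zero_iff.1 h3

namespace NormalForm

variable {p : ℕ → ℝ × ℝ} {α β : ℕ → ℝ} {q : ℕ → ℂ} {c e : ℕ → ℂ × ℂ → ℂ} {c' e' : ℂ × ℂ → ℂ} {M : ℝ}

/-- The pair (c, e) is close to the identity and has a uniform analytic inverse κ. In the
coordinates (c, e) the error is the defect composed with κ plus the correction from replacing 1 +
iβce by an exponential, so it vanishes to order 5 and converges. -/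
theorem exists_error (h : NormalForm p α β q c e c' e' M) :
    ∃ (E : ℕ → ℂ × ℂ → ℂ) (E' : ℂ × ℂ → ℂ), CloseTo E E' ∧ (∀ᶠ n in atTop, VanishesTo (E n) 5) ∧
    ∀ᶠ n : ℕ in atTop, ∀ z y : ℝ × ℝ, ‖z - centre n‖ ≤ 1 / 50 → ‖y‖ ≤ 1 →
      chartMap n (p n) (q n) (c n) z = y →
      chartMap n (p n) (q n) (c n) (planeReturn n z) - twistMap (α n) (β n / (n : ℝ) ^ 2) y =
        scaledMap n (E n) conjPlane y := by
  have hpair := h.pair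
  obtain ⟨κ, κ', hκ, hκ0, hr, hl⟩ := CloseTo.exists_inverse (hpair.close_fst.prod hpair.close_snd)
    (by
      filter_upwards [hpair.lin_fst, hpair.lin_snd] with n h1 h2
      exact (h1.prod h2).congr fun w => rfl)
    ((hpair.limit_fst.prod hpair.limit_snd).congr fun w => rfl)
  have hκ'0 : κ' 0 = 0 := by
    have h1 := hκ.tendsto_zero
    have h2 : Tendsto (fun n => κ n 0) atTop (𝓝 0) :=
      tendsto_const_nhds.congr' (hκ0.mono fun n hn => hn.symm)
    exact tendsto_nhds_unique h1 h2
  have hlam : CloseTo (fun n _ => Complex.exp (Complex.I * α n))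
      (fun _ => Complex.exp (Complex.I * ((-arccos (-7 / 9) : ℝ) : ℂ))) :=
    CloseTo.map (Φ := fun z => Complex.exp (Complex.I * z)) (by fun_prop) (CloseTo.of_real_seq h.angle)
  have hI : CloseTo (fun _ _ => Complex.I) (fun _ => Complex.I) := .const analyticAt_const
  have hexp := CloseTo.map (Φ := Complex.exp) (by fun_prop)
    ((hI.mul h.twist).mul (CloseTo.id.fst.mul CloseTo.id.snd))
  have hE := ((hpair.close_fst.comp (h.close_return.comp hκ hκ'0)
    (by rw [hκ'0]; exact limitCoord_zero)).sub ((hlam.mul CloseTo.id.fst).mul hexp))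
  refine ⟨_, _, hE, ?_, ?_⟩
  · filter_upwards [h.defect, hκ0, hκ.eventually_analyticAt_zero, hr.curry] with n h1 h2 h3 h4
    have hv : VanishesTo (κ n) 1 := .of_analyticAt h3 h2
    refine VanishesTo.congr_eventually ((h1.comp hv h3.continuousAt h2).add
      ((vanishesTo_exp_sub (β n)).const_mul (Complex.exp (Complex.I * α n)))) ?_
    filter_upwards [h4] with w hw
    have e1 : c n (κ n w) = w.1 := congrArg Prod.fst hw
    have e2 : e n (κ n w) = w.2 := congrArg Prod.snd hw
    rw [twistDefect, e1, e2]
    ring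
  · obtain ⟨r₁, hr₁, N₁, hN₁⟩ := hl.exists_ball
    have hreal : ∃ r > (0 : ℝ), ∃ N : ℕ, ∀ n ≥ N, ∀ z : ℂ, ‖z‖ < r →
        e n (z, starRingEnd ℂ z) = starRingEnd ℂ (c n (z, starRingEnd ℂ z)) := by
      obtain ⟨A, hA, B, hB, hAB⟩ := Filter.eventually_prod_iff.1 hpair.real
      obtain ⟨N, hN⟩ := eventually_atTop.1 hA
      obtain ⟨r, hr, hB'⟩ := Metric.eventually_nhds_iff_ball.1 hB
      exact ⟨r, hr, N, fun n hn z hz => hAB (hN n hn) (hB' z (by simpa using hz))⟩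
    obtain ⟨r₂, hr₂, N₂, hN₂⟩ := hreal
    filter_upwards [h.eventually_near (ε := 1 / 100) (by norm_num), eventually_planeReturn,
      eventually_ge_atTop N₁, eventually_ge_atTop N₂, eventually_gt_atTop 0,
      (tendsto_const_div_natCast 2).eventually_lt_const hr₁,
      (tendsto_const_div_natCast 2).eventually_lt_const hr₂] with n a1 a2 a3 a4 a5 a6 a7 z y hz hy hzy
    have hn : (0 : ℝ) < n := by exact_mod_cast a5
    have hnc : (n : ℂ) ≠ 0 := by exact_mod_cast a5.ne'
    have hzp : ‖z - p n‖ ≤ 1 := by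
      have := norm_sub_le_norm_sub_add_norm_sub z (centre n) (p n)
      rw [norm_sub_rev (centre n)] at this
      linarith [a1.1]
    set V := pointCoord n (q n) (z - p n) with hV
    have hVn : ‖V‖ ≤ 2 / n := by
      rw [hV, pointCoord_eq_smul, norm_smul, norm_inv, Complex.norm_natCast, div_eq_inv_mul]
      gcongr
      refine ((diagPlane (q n)).le_opNorm _).trans ?_
      have := norm_diagPlane_le (q := q n) (by linarith [a1.2])
      calc ‖diagPlane (q n)‖ * ‖z - p n‖ ≤ 2 * 1 := by gcongr
        _ = 2 := mul_one 2
    have hV2 : V = (V.1, starRingEnd ℂ V.1) := pointCoord_eq _ _ _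
    have hcV : (n : ℂ) * c n V = y.1 + y.2 * Complex.I := by
      rw [chartMap_eq, toPlane_apply] at hzy
      rw [← hzy]
      exact (Complex.re_add_im _).symm
    have heV : (n : ℂ) * e n V = y.1 - y.2 * Complex.I := by
      have h1 := hN₂ n a4 V.1 (((norm_fst_le V).trans hVn).trans_lt a7)
      rw [← hV2] at h1
      have h2 := congrArg (starRingEnd ℂ) hcV
      rw [map_mul, Complex.conj_natCast, ← h1] at h2
      rw [h2]
      simp [sub_eq_add_neg]
    have hχ : (c n V, e n V) = (n : ℂ)⁻¹ • conjPlane y := by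
      rw [conjPlane_apply, ← hcV, ← heV]
      ext <;> simp [hnc]
    have hκV : κ n ((n : ℂ)⁻¹ • conjPlane y) = V := by
      rw [← hχ]
      exact hN₁ n a3 V (hVn.trans_lt a6)
    have hret : localReturn n (p n) (q n) V = pointCoord n (q n) (planeReturn n z - p n) :=
      localReturn_pointCoord (a1.2.trans (by norm_num)) (a2 z (hz.trans (by norm_num))).2.1
    -- The coordinates of size 1 are n times the analytic ones, so w₁w₂ = |y|²/n²; this is where the
    -- twist coefficient β/n² comes from.
    have hsq : ((n : ℂ)⁻¹ • conjPlane y).1 * ((n : ℂ)⁻¹ • conjPlane y).2 =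
        (((y.1 ^ 2 + y.2 ^ 2) / (n : ℝ) ^ 2 : ℝ) : ℂ) := by
      rw [conjPlane_apply]
      simp only [Prod.smul_mk, smul_eq_mul]
      push_cast
      field_simp
      linear_combination (-(y.2 : ℂ) ^ 2) * Complex.I_sq
    have harg : Complex.exp (Complex.I * ((α n + β n / (n : ℝ) ^ 2 * (y.1 ^ 2 + y.2 ^ 2) : ℝ) : ℂ)) =
        Complex.exp (Complex.I * α n) * Complex.exp (Complex.I * β n *
          (((y.1 ^ 2 + y.2 ^ 2) / (n : ℝ) ^ 2 : ℝ) : ℂ)) := by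
      rw [← Complex.exp_add]
      congr 1
      push_cast
      ring
    have hfst : (n : ℂ) * ((n : ℂ)⁻¹ • conjPlane y).1 = y.1 + y.2 * Complex.I := by
      rw [Prod.smul_fst, smul_eq_mul, mul_inv_cancel_left₀ hnc, conjPlane_apply]
    rw [scaledMap, hκV, hret, hsq, chartMap_eq, twistMap_eq, harg, ← map_sub, ← hfst]
    congr 1
    ring

end NormalForm

/-! ### Ellipticity -/

theorem norm_eq_one_of_quadratic {ν : ℂ} {t : ℝ} (ht : |t| < 2) (h : ν ^ 2 - t * ν + 1 = 0) :
    ‖ν‖ = 1 ∧ ν.im ≠ 0 := by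
  have him : ν.im ≠ 0 := by
    intro h0
    have e : ν = (ν.re : ℂ) := Complex.ext rfl (by simp [h0])
    rw [e] at h
    have h' : ν.re ^ 2 - t * ν.re + 1 = 0 := by exact_mod_cast h
    have := sq_lt_sq' (abs_lt.1 ht).1 (abs_lt.1 ht).2
    nlinarith [sq_nonneg (ν.re - t / 2)]
  refine ⟨?_, him⟩
  have hc := congrArg (starRingEnd ℂ) h
  simp only [map_add, map_sub, map_pow, map_mul, Complex.conj_ofReal, map_one, map_zero] at hc
  have hne : ν - starRingEnd ℂ ν ≠ 0 := by
    rw [Complex.sub_conj]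
    simp [him]
  have h1 : (ν - starRingEnd ℂ ν) * (ν + starRingEnd ℂ ν - t) = 0 := by linear_combination h - hc
  have h2 := (mul_eq_zero.1 h1).resolve_left hne
  have h3 : ν * starRingEnd ℂ ν = 1 := by linear_combination ν * h2 - h
  rw [Complex.mul_conj, Complex.normSq_eq_norm_sq] at h3
  have h4 : ‖ν‖ ^ 2 = 1 := by exact_mod_cast h3
  exact (pow_eq_one_iff_of_nonneg (norm_nonneg ν) two_ne_zero).1 h4

/-- If μ is an eigenvalue of B, then μ^m is one of B^m, a real matrix of determinant 1 and |trace| <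
2. So μ^m has modulus 1 and is not real, and a real μ would have a real power. -/
theorem norm_eq_one_of_charpoly {B : (ℝ × ℝ) →L[ℝ] (ℝ × ℝ)} {m : ℕ} (hm : m ≠ 0)
    (hdet : (B ^ m).det = 1) (htr : |((B ^ m) (1, 0)).1 + ((B ^ m) (0, 1)).2| < 2) {μ : ℂ}
    (hμ : Polynomial.aeval μ (B : (ℝ × ℝ) →ₗ[ℝ] (ℝ × ℝ)).charpoly = 0) : ‖μ‖ = 1 ∧ μ.im ≠ 0 := by
  set b := Module.Basis.finTwoProd ℝ
  set N := LinearMap.toMatrix b b (B : (ℝ × ℝ) →ₗ[ℝ] (ℝ × ℝ)) with hN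
  set Nc := N.map (algebraMap ℝ ℂ) with hNc
  have h1 : μ ∈ spectrum ℂ Nc := by
    rw [Matrix.mem_spectrum_iff_isRoot_charpoly, Polynomial.IsRoot, hNc, Matrix.charpoly_map,
      Polynomial.eval_map_algebraMap, hN, LinearMap.charpoly_toMatrix]
    exact hμ
  have h2 : μ ^ m ∈ spectrum ℂ (Nc ^ m) := spectrum.pow_mem_pow Nc m h1
  have e1 : Nc ^ m = (LinearMap.toMatrix b b ((B ^ m : (ℝ × ℝ) →L[ℝ] (ℝ × ℝ)) :
      (ℝ × ℝ) →ₗ[ℝ] (ℝ × ℝ))).map (algebraMap ℝ ℂ) := by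
    have : ((B ^ m : (ℝ × ℝ) →L[ℝ] (ℝ × ℝ)) : (ℝ × ℝ) →ₗ[ℝ] (ℝ × ℝ)) =
        (B : (ℝ × ℝ) →ₗ[ℝ] (ℝ × ℝ)) ^ m := by
      ext <;> simp
    rw [this, ← LinearMap.toMatrix_pow, ← hN, hNc, Matrix.map_pow]
  have e2 : (LinearMap.toMatrix b b ((B ^ m : (ℝ × ℝ) →L[ℝ] (ℝ × ℝ)) :
      (ℝ × ℝ) →ₗ[ℝ] (ℝ × ℝ))).charpoly = Polynomial.X ^ 2 -
      Polynomial.C (((B ^ m) (1, 0)).1 + ((B ^ m) (0, 1)).2) * Polynomial.X + Polynomial.C 1 := by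
    have d : (LinearMap.toMatrix b b ((B ^ m : (ℝ × ℝ) →L[ℝ] (ℝ × ℝ)) :
        (ℝ × ℝ) →ₗ[ℝ] (ℝ × ℝ))).det = 1 := by
      rw [LinearMap.det_toMatrix]; exact hdet
    rw [Matrix.charpoly_fin_two, d, Matrix.trace_fin_two]
    simp [LinearMap.toMatrix_apply, b, Module.End.pow_apply]
  rw [e1, Matrix.mem_spectrum_iff_isRoot_charpoly, Polynomial.IsRoot, Matrix.charpoly_map, e2] at h2
  have h3 : (μ ^ m) ^ 2 - ((((B ^ m) (1, 0)).1 + ((B ^ m) (0, 1)).2 : ℝ) : ℂ) * μ ^ m + 1 = 0 := by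
    simpa using h2
  obtain ⟨h4, h5⟩ := norm_eq_one_of_quadratic htr h3
  rw [norm_pow] at h4
  refine ⟨(pow_eq_one_iff_of_nonneg (norm_nonneg μ) hm).1 h4, fun h0 => h5 ?_⟩
  have e : μ = (μ.re : ℂ) := Complex.ext rfl (by simp [h0])
  rw [e, ← Complex.ofReal_pow, Complex.ofReal_im]

/-- The length k of the known return need not be the minimal period q. With k = qm, the derivative
of the k-th iterate is the m-th power of that of the q-th, and ellipticity descends. -/
theorem isEllipticPeriodicPoint_of_iterate {z : ℝ × ℝ} {k : ℕ} (hk : 0 < k)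
    (hz : (outerBilliard semiDisc)^[k] z = z)
    (hreg : ∀ i < k, IsRegularPoint ((outerBilliard semiDisc)^[i] z)) {A : (ℝ × ℝ) →L[ℝ] (ℝ × ℝ)}
    (hA : HasFDerivAt ((outerBilliard semiDisc)^[k]) A z) (hdet : A.det = 1)
    (htr : |(A (1, 0)).1 + (A (0, 1)).2| < 2) :
    IsEllipticPeriodicPoint (outerDomain semiDisc) (outerBilliard semiDisc) z := by
  set T := outerBilliard semiDisc
  have hper : Function.IsPeriodicPt T k z := hz
  obtain ⟨m, hm⟩ := hper.minimalPeriod_dvd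
  set q := Function.minimalPeriod T z with hq
  have hq0 : 0 < q := hper.minimalPeriod_pos hk
  have hm0 : m ≠ 0 := by
    rintro rfl
    omega
  have hqk : q ≤ k := Nat.le_of_dvd hk ⟨m, hm⟩
  obtain ⟨B, hB, -⟩ := AreaPreservingAt.iterate (f := T) (z := z) (k := q)
    fun i hi => (hreg i (hi.trans_le hqk)).2
  have hBA : B ^ m = A := by
    have h1 := hB.iterate (Function.isPeriodicPt_minimalPeriod T z) m
    rw [← Function.iterate_mul, ← hm] at h1
    exact h1.unique hA
  refine ⟨fun i => ?_, ⟨k, hk, hper⟩, hB.differentiableAt, fun μ hμ => ?_⟩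
  · rw [← hper.iterate_mod_apply i]
    exact (hreg _ (Nat.mod_lt _ hk)).1
  · rw [hB.fderiv] at hμ
    exact norm_eq_one_of_charpoly hm0 (by rwa [hBA]) (by rwa [hBA]) hμ

/-! ### The normal form of the first return map -/

theorem eventually_firstReturn {x₀ : ℝ} (hx₀ : 1 ≤ x₀) : ∀ᶠ n : ℕ in atTop, ∀ z ∈ parRn n,
    z ∈ returnDomain x₀ ∧ firstReturn x₀ z = planeReturn n z ∧
    planeReturn n z ∈ Metric.ball (centre n) (1 / 30) := by
  -- The lower bound on n moves the ball about the centre to the right of x = x₀.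
  filter_upwards [eventually_planeReturn, eventually_ge_atTop (⌈x₀⌉₊ + 2)] with n h1 h2 z hz
  have hn : x₀ + 2 ≤ (n : ℝ) := by
    have h3 : ((⌈x₀⌉₊ + 2 : ℕ) : ℝ) ≤ n := by exact_mod_cast h2
    push_cast at h3
    linarith [Nat.le_ceil x₀]
  have hsec : ∀ w : ℝ × ℝ, ‖w - centre n‖ < 1 / 30 → w ∈ sectionRegion x₀ := by
    intro w hw
    have d1 := abs_lt.1 ((norm_fst_le (w - centre n)).trans_lt hw : |(w - centre n).1| < 1 / 30)
    have d2 := abs_lt.1 ((norm_snd_le (w - centre n)).trans_lt hw : |(w - centre n).2| < 1 / 30)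
    simp only [Prod.fst_sub, Prod.snd_sub, centre] at d1 d2
    exact mem_sectionRegion (by linarith [d1.1]) (by linarith [d1.1]) (by linarith [d2.1])
      (by linarith [d2.2])
  have hzn := norm_le_of_mem_parRn hz
  obtain ⟨hseg, -, b1, b2⟩ := h1 z (hzn.trans (by norm_num))
  -- Points of `parRn n` are within 3/256 and 3/512 of the centre in the two coordinates. The affine
  -- approximation with error 1/100 then keeps the image within 1/30, inside the domain of the
  -- chart.
  have hball : ‖planeReturn n z - centre n‖ < 1 / 30 := by
    have d := abs_le_of_mem_parR (mem_parRn.1 hz)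
    rw [abs_le] at b1 b2 d
    obtain ⟨d1, d2⟩ := d
    rw [abs_le] at d2
    rw [Prod.norm_def, max_lt_iff, Real.norm_eq_abs, Real.norm_eq_abs, abs_lt, abs_lt]
    simp only [Prod.fst_sub, Prod.snd_sub] at *
    constructor <;> constructor <;> linarith [b1.1, b1.2, b2.1, b2.2, d1.1, d1.2, d2.1, d2.2]
  have hk : 0 < 4 * n - 1 := by
    have : 2 ≤ n := by omega
    omega
  have hmem := hsec _ hball
  exact ⟨⟨hsec z (hzn.trans_lt (by norm_num)), _, (hseg x₀ hx₀).isFirstReturnTime hk hmem⟩,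
    (hseg x₀ hx₀).firstReturn_eq hk hmem, by rwa [mem_ball_iff_norm]⟩

namespace NormalForm

variable {p : ℕ → ℝ × ℝ} {α β : ℕ → ℝ} {q : ℕ → ℂ} {c e : ℕ → ℂ × ℂ → ℂ} {c' e' : ℂ × ℂ → ℂ} {M : ℝ}

theorem eventually_elliptic (h : NormalForm p α β q c e c' e' M) : ∀ᶠ n : ℕ in atTop,
    IsEllipticPeriodicPoint (outerDomain semiDisc) (outerBilliard semiDisc) (p n) := by
  filter_upwards [h.linear, h.fixed, eventually_planeReturn,
    h.eventually_near (ε := 1 / 25) (by norm_num), eventually_gt_atTop 0] with n ⟨A, h1, h2, h3⟩ h4 h5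
    h6 h7
  exact isEllipticPeriodicPoint_of_iterate (by omega) h4 ((h5 (p n) h6.1.le).1 1 le_rfl).regular h1 h2 h3

theorem eventually_twist (h : NormalForm p α β q c e c' e' M) :
    ∀ᶠ n : ℕ in atTop, 1 / 2 / (n : ℝ) ^ 2 ≤ |β n / (n : ℝ) ^ 2| := by
  have h1 := h.twist.tendsto_zero.norm
  have h2 : (1 / 2 : ℝ) < ‖((-(4 * √2 / 9) : ℝ) : ℂ)‖ := by
    rw [Complex.norm_real, norm_neg, Real.norm_of_nonneg (by positivity)]
    have : (6 / 5 : ℝ) ≤ √2 := Real.le_sqrt_of_sq_le (by norm_num)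
    linarith
  filter_upwards [h1.eventually_const_lt h2] with n hn
  rw [Complex.norm_real, Real.norm_eq_abs] at hn
  rw [abs_div, abs_of_nonneg (by positivity : (0 : ℝ) ≤ (n : ℝ) ^ 2)]
  gcongr

end NormalForm

theorem C5BoundOn.mono {f : ℝ × ℝ → ℝ × ℝ} {S : Set (ℝ × ℝ)} {B B' : ℝ} (h : C5BoundOn f S B)
    (hB : B ≤ B') : C5BoundOn f S B' :=
  ⟨h.1, fun k hk z hz => (h.2 k hk z hz).trans hB⟩

theorem c5BoundOn_of_eqOn {f g : ℝ × ℝ → ℝ × ℝ} {S : Set (ℝ × ℝ)} {B : ℝ} (hS : UniqueDiffOn ℝ S)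
    (he : EqOn f g S) (hg : ∀ z ∈ S, ContDiffAt ℝ ∞ g z)
    (hb : ∀ k ≤ 5, ∀ z ∈ S, ‖iteratedFDeriv ℝ k g z‖ ≤ B) : C5BoundOn f S B := by
  refine ⟨fun z hz => ((hg z hz).of_le ?_).contDiffWithinAt.congr he (he hz), fun k hk z hz => ?_⟩
  · exact WithTop.coe_le_coe.2 le_top
  · rw [iteratedFDerivWithin_congr he hz,
      iteratedFDerivWithin_eq_iteratedFDeriv hS ((hg z hz).of_le (by exact_mod_cast le_top)) hz]
    exact hb k hk z hz

theorem jetVanishesOn_of_eqOn {f g : ℝ × ℝ → ℝ × ℝ} {S : Set (ℝ × ℝ)} {l : ℕ} (hS : UniqueDiffOn ℝ S)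
    (he : EqOn f g S) (h0 : 0 ∈ S) (hg : ContDiffAt ℝ ∞ g 0)
    (hb : ∀ k ≤ l, iteratedFDeriv ℝ k g 0 = 0) : JetVanishesOn f S l := by
  intro k hk
  rw [iteratedFDerivWithin_congr he h0,
    iteratedFDerivWithin_eq_iteratedFDeriv hS (hg.of_le (by exact_mod_cast le_top)) h0]
  exact hb k hk

theorem propositionA :
    ∃ X : ℝ, ∀ x₀ : ℝ, X ≤ x₀ →
      ∃ (N : ℕ) (M c : ℝ) (p : ℕ → ℝ × ℝ)
        (C : ℕ → OpenPartialHomeomorph (ℝ × ℝ) (ℝ × ℝ)) (α α₂ : ℕ → ℝ),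
        0 < N ∧ 0 < c ∧ ∀ n : ℕ, N ≤ n →
          -- the elliptic periodic points
          IsEllipticPeriodicPoint (outerDomain semiDisc) (outerBilliard semiDisc) (p n) ∧
          |(p n).1 - (3 * n - 3 / 4)| ≤ M / n ∧
          |(p n).2 - 1| ≤ M / n ∧
          parRn n ∈ 𝓝 (p n) ∧
          -- the conjugacy
          ContDiffOn ℝ ∞ (C n) (C n).source ∧
          ContDiffOn ℝ ∞ (C n).symm (C n).target ∧
          parRn n ⊆ (C n).source ∧
          parE ⊆ C n '' parRn n ∧
          C n (p n) = 0 ∧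
          C5BoundOn (fun z => C n z - affinePart n z) (C n).source (M / n) ∧
          -- the conjugated first return map
          (∀ q ∈ parE, (C n).symm q ∈ returnDomain x₀ ∧
            firstReturn x₀ ((C n).symm q) ∈ (C n).source) ∧
          C5BoundOn
            (fun q => C n (firstReturn x₀ ((C n).symm q)) - twistMap (α n) (α₂ n) q)
            parE (M / (n : ℝ) ^ 3) ∧
          JetVanishesOn
            (fun q => C n (firstReturn x₀ ((C n).symm q)) - twistMap (α n) (α₂ n) q)
            parE 4 ∧
          -- the rotation angle and the twist coefficient
          |α n - -arccos (-7 / 9)| ≤ M / n ∧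
          c / (n : ℝ) ^ 2 ≤ |α₂ n| := by
  obtain ⟨p, α, β, q, c, e, c', e', M, h⟩ := exists_normalForm
  obtain ⟨K₁, hK₁, hchart⟩ := h.exists_chart
  obtain ⟨E, E', hE, hE5, herr⟩ := h.exists_error
  obtain ⟨K₂, hK₂, hscale⟩ := hE.scaledMap hE5
  obtain ⟨C, hC⟩ := hchart.choice
  have hM := h.pos
  -- The itinerary needs only x₀ ≥ 1: the second and third legs stay to the left of x = 1.
  refine ⟨1, fun x₀ hx₀ => ?_⟩
  suffices key : ∀ᶠ n : ℕ in atTop, _ by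
    obtain ⟨N, hN⟩ := eventually_atTop.1 key
    exact ⟨max N 1, M + K₁ + K₂, 1 / 2, p, C, α, fun n => β n / (n : ℝ) ^ 2, by positivity,
      by norm_num, fun n hn => hN n ((le_max_left _ _).trans hn)⟩
  filter_upwards [hC, h.eventually_elliptic, h.eventually_twist, h.near, h.angle, h.pair.lin_fst,
    h.eventually_near (ε := 1 / 1024) (by norm_num), eventually_firstReturn hx₀, herr, hscale, hE5,
    hE.eventually_analyticAt_zero, eventually_ge_atTop 1]
    with n ⟨c1, c2, c3, c4, c5, c6⟩ h1 h2 h3 h4 h5 h6 h7 h8 h9 h10 h11 h12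
  have hn : (1 : ℝ) ≤ n := by exact_mod_cast h12
  have le : ∀ K ≤ M + K₁ + K₂, K / (n : ℝ) ≤ (M + K₁ + K₂) / n := fun K hK => by gcongr
  have hsub : parRn n ⊆ (C n).source := by
    intro z hz
    rw [c1, mem_ball_iff_norm]
    exact (norm_le_of_mem_parRn hz).trans_lt (by norm_num)
  have hsymm : ∀ y ∈ parE, (C n).symm y ∈ parRn n ∧ C n ((C n).symm y) = y := by
    intro y hy
    obtain ⟨z, hz, rfl⟩ := c6 hy
    rw [(C n).left_inv (hsub hz)]
    exact ⟨hz, rfl⟩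
  have heq : EqOn (fun y => C n (firstReturn x₀ ((C n).symm y)) -
      twistMap (α n) (β n / (n : ℝ) ^ 2) y) (scaledMap n (E n) conjPlane) parE := by
    intro y hy
    obtain ⟨hz, hCz⟩ := hsymm y hy
    simp only
    rw [(h7 _ hz).2.1, c2]
    exact h8 _ y ((norm_le_of_mem_parRn hz).trans (by norm_num)) (norm_le_of_mem_parE hy)
      (by rw [← c2]; exact hCz)
  have hdiff : ∀ y ∈ parE, ContDiffAt ℝ ∞ (scaledMap n (E n) conjPlane) y := fun y hy =>
    (h9 0 (by norm_num) _ norm_conjPlane_le y (norm_le_of_mem_parE hy)).1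
  refine ⟨h1, ?_, ?_, parRn_mem_nhds h6.1, c3, c4, hsub, c6, ?_, c5.mono (le _ (by linarith)), ?_, ?_,
    ?_, h4.trans (le _ (by linarith)), h2⟩
  · exact (norm_fst_le (p n - centre n)).trans (h3.trans (le _ (by linarith)))
  · exact (norm_snd_le (p n - centre n)).trans (h3.trans (le _ (by linarith)))
  · have : c n 0 = 0 := by simpa using h5.apply_zero
    rw [c2, chartMap_eq, sub_self, map_zero, this, mul_zero, map_zero]
  · intro y hy
    obtain ⟨hz, -⟩ := hsymm y hy
    refine ⟨(h7 _ hz).1, ?_⟩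
    rw [(h7 _ hz).2.1, c1]
    exact (h7 _ hz).2.2
  -- The scaled remainder is n · n⁻⁵ = n⁻⁴, which is weakened to n⁻³.
  · refine (c5BoundOn_of_eqOn uniqueDiffOn_parE heq hdiff (B := K₂ * n / (n : ℝ) ^ 5) fun k hk y hy =>
      (h9 k hk _ norm_conjPlane_le y (norm_le_of_mem_parE hy)).2).mono ?_
    rw [div_le_div_iff₀ (by positivity) (by positivity)]
    have : K₂ * n * (n : ℝ) ^ 3 ≤ (M + K₁ + K₂) * (n : ℝ) * (n : ℝ) ^ 4 := by
      gcongr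
      · linarith
      · norm_num
    calc _ ≤ _ := this
      _ = _ := by ring
  · exact jetVanishesOn_of_eqOn uniqueDiffOn_parE heq zero_mem_parE (hdiff 0 zero_mem_parE)
      fun k hk => scaledMap_jet h11 h10 n _ hk
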